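/- **Setting.** For $z=(t,x)\in\mathbb{R}^2$ write $\|z\|=\sqrt{|t|}+|x|$. Let $0<C\le\frac1{16}$, $r>2$, and let $K:\mathbb{R}^2\setminus\{0\}\to\mathbb{R}$ be a truncated heat kernel: $K$ is smooth away from $0$, supported in $\{\|z\|\le C\}$, vanishes for $t\le 0$, is even in $x$, equals $\mathbf 1_{t>0}(4\pi t)^{-1/2}e^{-x^2/4t}$ for $\|z\|\le C/2$, and satisfies $\iint K(t,x)\,t^{k_0}x^{k_1}\,dt\,dx=0$ whenever $2k_0+k_1\le r$. Let $\rho:\mathbb{R}^2\to\mathbb{R}$ be smooth, compactly supported, nonnegative, even in $x$, with $\int\rho=1$, and let $\rho_\epsilon(t,x)=\epsilon^{-3}\rho(\epsilon^{-2}t,\epsilon^{-1}x)$. Let $0\le\gamma<\frac14$. Write $K'=\partial_xK$, $K'_\epsilon=K'*\rho_\epsilon$ (space-time convolution), $\partial_x^\gamma$ for the Fourier multiplier $(2\pi|\xi|)^\gamma$ in the variable $x\in\mathbb{R}$, and $(\pi f)(t,x)=\sum_{n\in\mathbb{Z}}f(t,x+n)$. **Constants.** Consider symbols built from a noise $\Xi$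 by the (commutative) products $\mathcal I'(\tau_1)\mathcal I'(\tau_2)$, and let $\|\tau\|$ be the number of noises in $\tau$. To $\mathcal I'(\tau)$ and to $\tau=\mathcal I'(\tau_1)\mathcal I'(\tau_2)$ attach the kernels $$\mathcal W_{\mathcal I'(\Xi)}(z;w)=\pi\partial_x^\gamma K'_\epsilon(z-w),\qquad \mathcal W_{\mathcal I'(\tau)}(z;w)=\int_{\mathbb{R}^2}K'(z-u)\,\mathcal W_\tau(u;w)\,du\quad(\tau\ne\Xi),$$ $$\mathcal W_{\tau}(z;w_1,\dots,w_{\|\tau\|})=\mathcal W_{\mathcal I'(\tau_1)}(z;w_1,\dots,w_{\|\tau_1\|})\,\mathcal W_{\mathcal I'(\tau_2)}(z;w_{\|\tau_1\|+1},\dots,w_{\|\tau\|}),$$ and let $$C_\tau^{(\epsilon)}=\sum_{P}\int_{(\mathbb{R}\times[0,1))^{\|\tau\|/2}}\mathcal W_\tau(0;w)\big|_{w_i=w_j\text{ for }\{i,j\}\in P},$$ where $P$ runs over all perfect matchings of $\{1,\dots,\|\tau\|\}$ and one integrates over one variable per pair. Set $V=\mathcal I'(\Xi)^2$, $W=\mathcal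 I'(\Xi)\mathcal I'(V)$, $B=\mathcal I'(V)^2$, $WV=\mathcal I'(\Xi)\mathcal I'(W)$. The six symbols with $\|\tau\|=6$ are $$\mathcal I'(W)^2,\quad \mathcal I'(V)\mathcal I'(B),\quad \mathcal I'(V)\mathcal I'(WV),\quad \mathcal I'(\Xi)\mathcal I'(\mathcal I'(V)\mathcal I'(W)),\quad \mathcal I'(\Xi)\mathcal I'(\mathcal I'(\Xi)\mathcal I'(B)),\quad \mathcal I'(\Xi)\mathcal I'(\mathcal I'(\Xi)\mathcal I'(WV)).$$ **Claim.** There are constants $c,c',\epsilon_0>0$ depending only on $K,\rho,\gamma$ (and, in (3), also on $\kappa$) such that: 1. $C_V^{(\epsilon)}\le c\,\epsilon^{-1-2\gamma}$ for all $\epsilon\in(0,1]$, and $C_V^{(\epsilon)}\ge c'\epsilon^{-1-2\gamma}$ for all $\epsilon\in(0,\epsilon_0]$; 2. if $\gamma>0$, then $|C_B^{(\epsilon)}|\le c\,\epsilon^{-4\gamma}$ and $|C_{WV}^{(\epsilon)}|\le c\,\epsilon^{-4\gamma}$ for all $\epsilon\in(0,1]$; 3. if $\gamma\ge\frac16$,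 then for every $\kappa>0$ and each of the six symbols $\tau$ with $\|\tau\|=6$, $|C_\tau^{(\epsilon)}|\le c\,\epsilon^{1-6\gamma-\kappa}$ for all $\epsilon\in(0,1]$. -/

import Mathlib

open MeasureTheory
open scoped FourierTransform ContDiff

namespace FracKPZ

/-- The parabolic size `√|t| + |x|` of a space-time point `z = (t, x)`. -/
noncomputable def parNorm (z : ℝ × ℝ) : ℝ := √|z.1| + |z.2|

/-- The heat kernel `(4πt)^{-1/2} exp(-x²/(4t))` for `t > 0`, extended by `0` to `t ≤ 0`. -/
noncomputable def heatKernel (z : ℝ × ℝ) : ℝ :=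
  if 0 < z.1 then (√(4 * Real.pi * z.1))⁻¹ * Real.exp (-z.2 ^ 2 / (4 * z.1)) else 0

/-- `K` is a truncation of the heat kernel: smooth away from the origin, supported in the parabolic
ball of radius `C`, causal, even in space, equal to the heat kernel on the parabolic ball of
radius `C / 2`, and with vanishing moments up to parabolic order `r`. -/
structure IsTruncatedHeatKernel (K : ℝ × ℝ → ℝ) (C r : ℝ) : Prop where
  smooth : ContDiffOn ℝ ∞ K {0}ᶜ
  supported : ∀ z, C < parNorm z → K z = 0
  causal : ∀ t x, t ≤ 0 → K (t, x) = 0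
  even : ∀ t x, K (t, -x) = K (t, x)
  eq_heat : ∀ z, parNorm z ≤ C / 2 → K z = heatKernel z
  moments : ∀ k₀ k₁ : ℕ, 2 * (k₀ : ℝ) + k₁ ≤ r → ∫ z : ℝ × ℝ, K z * z.1 ^ k₀ * z.2 ^ k₁ = 0

/-- A space-time mollifier: smooth, compactly supported, symmetric in `x`, nonnegative and of
total mass one. -/
structure IsMollifier (ρ : ℝ × ℝ → ℝ) : Prop where
  smooth : ContDiff ℝ ∞ ρ
  compact : HasCompactSupport ρ
  even : ∀ t x, ρ (t, -x) = ρ (t, x)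
  nonneg : ∀ z, 0 ≤ ρ z
  mass : ∫ z, ρ z = 1

/-- `ρ_ε(t, x) = ε⁻³ ρ(ε⁻² t, ε⁻¹ x)`. -/
noncomputable def rescale (ρ : ℝ × ℝ → ℝ) (ε : ℝ) (z : ℝ × ℝ) : ℝ :=
  (ε ^ 3)⁻¹ * ρ (z.1 / ε ^ 2, z.2 / ε)

/-- The spatial derivative `A' = ∂ₓ A`. -/
noncomputable def spaceDeriv (A : ℝ × ℝ → ℝ) (z : ℝ × ℝ) : ℝ :=
  deriv (fun y => A (z.1, y)) z.2

/-- `(-Δ)^{γ/2}` on the line: the Fourier multiplier `(2π|ξ|)^γ`. The multiplier is even, so that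
the result is real for real `f`, and taking the real part only changes the codomain. -/
noncomputable def fracLaplacian (γ : ℝ) (f : ℝ → ℝ) (x : ℝ) : ℝ :=
  (𝓕⁻ (fun ξ : ℝ => (((2 * Real.pi * |ξ|) ^ γ : ℝ) : ℂ) * 𝓕 (fun y : ℝ => (f y : ℂ)) ξ) x).re

/-- `∂ₓ^γ A (t, ·) = (-Δ)^{γ/2} (A (t, ·))`. -/
noncomputable def fracDeriv (γ : ℝ) (A : ℝ × ℝ → ℝ) (z : ℝ × ℝ) : ℝ :=
  fracLaplacian γ (fun y => A (z.1, y)) z.2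

/-- The spatial periodization `(π A)(t, x) = ∑ₙ A(t, x + n)`. -/
noncomputable def periodize (A : ℝ × ℝ → ℝ) (z : ℝ × ℝ) : ℝ :=
  ∑' n : ℤ, A (z.1, z.2 + n)

/-- `π ∂ₓ^γ K'_ε` with `K'_ε = K' * ρ_ε` (space-time convolution). -/
noncomputable def noiseKernel (K ρ : ℝ × ℝ → ℝ) (γ ε : ℝ) : ℝ × ℝ → ℝ :=
  periodize (fracDeriv γ
    (convolution (spaceDeriv K) (rescale ρ ε) (ContinuousLinearMap.mul ℝ ℝ) volume))

/-- Symbols built from the noise `Ξ` by the operation `(τ₁, τ₂) ↦ 𝓘'(τ₁) 𝓘'(τ₂)`. -/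
inductive Symbol : Type
  | Xi : Symbol
  | node (l r : Symbol) : Symbol

namespace Symbol

/-- The number `‖τ‖` of occurrences of the noise in `τ`. -/
def noises : Symbol → ℕ
  | Xi => 1
  | node l r => l.noises + r.noises

/-- `V = 𝓘'(Ξ)²`. -/
def V : Symbol := node Xi Xi
/-- `W = 𝓘'(Ξ) 𝓘'(V)`. -/
def W : Symbol := node Xi V
/-- `B = 𝓘'(V)²`. -/
def B : Symbol := node V V
/-- `WV = 𝓘'(Ξ) 𝓘'(W)`. -/
def WV : Symbol := node Xi W
/-- `F = 𝓘'(W)²`. -/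
def F : Symbol := node W W
/-- `BW = 𝓘'(V) 𝓘'(B)`. -/
def BW : Symbol := node V B
/-- `WB = 𝓘'(V) 𝓘'(WV)`. -/
def WB : Symbol := node V WV
/-- `VBV = 𝓘'(Ξ) 𝓘'(𝓘'(V) 𝓘'(W))`. -/
def VBV : Symbol := node Xi (node V W)
/-- `BVV = 𝓘'(Ξ) 𝓘'(𝓘'(Ξ) 𝓘'(B))`. -/
def BVV : Symbol := node Xi (node Xi B)
/-- `WWV = 𝓘'(Ξ) 𝓘'(𝓘'(Ξ) 𝓘'(WV))`. -/
def WWV : Symbol := node Xi (node Xi WV)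

end Symbol

/-- The symbols of negative homogeneity with six noises (all the binary trees with six leaves, up
to exchanging the two factors of a product). -/
def sixNoise : Set Symbol :=
  {Symbol.F, Symbol.BW, Symbol.WB, Symbol.VBV, Symbol.BVV, Symbol.WWV}

/-- The kernel `(z; w₁, …, wₙ)` of `𝓘'(τ)`, `n = ‖τ‖`, for the canonical (not recentred) lift of
the noise: an edge ending in a noise `w` carries `π ∂ₓ^γ K'_ε(z - w)`, every other edge carries
`K'(z - u)`, where the inner vertex `u` is integrated out. -/
noncomputable def edgeKernel (K ρ : ℝ × ℝ → ℝ) (γ ε : ℝ) :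
    (τ : Symbol) → ℝ × ℝ → (Fin τ.noises → ℝ × ℝ) → ℝ
  | .Xi => fun z w => noiseKernel K ρ γ ε (z - w (0 : Fin 1))
  | .node l r => fun z w => ∫ u : ℝ × ℝ, spaceDeriv K (z - u) *
      (edgeKernel K ρ γ ε l u (fun i => w (Fin.castAdd r.noises i)) *
        edgeKernel K ρ γ ε r u (fun j => w (Fin.natAdd l.noises j)))

/-- The kernel `(z; w₁, …, wₙ)` of the symbol `τ` itself, `n = ‖τ‖`. -/
noncomputable def symbolKernel (K ρ : ℝ × ℝ → ℝ) (γ ε : ℝ) :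
    (τ : Symbol) → ℝ × ℝ → (Fin τ.noises → ℝ × ℝ) → ℝ
  | .Xi => fun z w => periodize (fracDeriv γ (rescale ρ ε)) (z - w (0 : Fin 1))
  | .node l r => fun z w =>
      edgeKernel K ρ γ ε l z (fun i => w (Fin.castAdd r.noises i)) *
        edgeKernel K ρ γ ε r z (fun j => w (Fin.natAdd l.noises j))

/-- The perfect matchings of `{1, …, n}`, as involutions without fixed points. -/
def pairings (n : ℕ) : Finset (Equiv.Perm (Fin n)) :=
  Finset.univ.filter fun σ => σ * σ = 1 ∧ ∀ i, σ i ≠ i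

/-- One period `ℝ × [0, 1)` of space-time. -/
def strip : Set (ℝ × ℝ) := Set.univ ×ˢ Set.Ico (0 : ℝ) 1

/-- One variable for each pair `{i, σ i}`, indexed by the smaller element, is substituted for
both variables of the pair. (The last branch does not occur if `σ` is a perfect matching.) -/
def pairVars {n : ℕ} (σ : Equiv.Perm (Fin n)) (y : {i : Fin n // i < σ i} → ℝ × ℝ)
    (i : Fin n) : ℝ × ℝ :=
  if h : i < σ i then y ⟨i, h⟩ else if h' : σ i < σ (σ i) then y ⟨σ i, h'⟩ else 0

/-- The full contraction of a kernel `f(w₁, …, wₙ)` along the perfect matching `σ`: the variables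
of every pair are identified and integrated over one period. -/
noncomputable def contraction {n : ℕ} (σ : Equiv.Perm (Fin n))
    (f : (Fin n → ℝ × ℝ) → ℝ) : ℝ :=
  ∫ y : {i : Fin n // i < σ i} → ℝ × ℝ in Set.univ.pi fun _ => strip, f (pairVars σ y)

/-- The renormalization constant `C_τ^{(ε)}`: the sum of all the full contractions of the kernel
of `τ` at `z = 0`, that is, the (constant) expectation of the canonical lift of `τ`. -/
noncomputable def renormConst (K ρ : ℝ × ℝ → ℝ) (γ ε : ℝ) (τ : Symbol) : ℝ :=
  ∑ σ ∈ pairings τ.noises, contraction σ (symbolKernel K ρ γ ε τ 0)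

end FracKPZ

/-! ### Parabolic scaling: power kernels, their integrals, convolutions and mollifications -/

namespace FracKPZ
open Set ENNReal

/-! The constants are sums of Feynman diagrams, and the theorem is power counting in parabolic
dimension 3, supplemented by cancellations coming from parity in space.

The kernels. The derivative `K'` is bounded by `‖z‖^{-2}`, and `∂ₓ^γ K'` by `‖z‖^{-2-γ}`; both have
matching Hölder bounds of exponent 1/2 in space. For `γ > 0` the Fourier multiplier is turned into
the singular integral `fracInt` of `K` (`fracLaplacian_deriv`), which is split at a distance
comparable to `√t + |x|`. Mollifying replaces `‖z‖` by `‖z‖ + ε`, and periodizing only adds a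
bounded smooth remainder (`exists_isNoiseKernel`). Integrating out a pair of contracted noises gives
the covariance `cov`, the convolution of two kernels of order `2 + γ`. It has order `2(2 + γ) - 3 =
1 + 2γ`, and each half derivative in space costs 1/2 in the exponent (`exists_isCovariance`).

The diagrams. By Fubini a contraction is an integral over the `‖τ‖ - 2` inner vertices, with the
root at the origin, a factor `K'` for every inner edge and a covariance for every pair
(`contraction_eq`). The sum of the exponents minus three times the number of integrations is `1 +
2γ` for two noises, `2·2 + 2(1 + 2γ) - 6 = 4γ` for four and `4·2 + 3(1 + 2γ) - 12 = 6γ - 1` for six.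
These are the claimed powers of `1/ε`, provided that no subdiagram diverges faster.

Power counting. For six noises each covariance is first bounded by `ε^{-(2γ - 1/3 + κ)} ‖z‖^{-(4/3 -
κ)}`. This produces the factor `ε^{1 - 6γ - 3κ}` and leaves an integral without `ε`. It is finite if
the exponents inside every set `A` of vertices sum to at most `s (#A - 1)` for some `s < 3`
(`lintegral_powerCounting`). The reason is that, for every configuration of points, the product of
powers of distances is dominated by the product of `‖·‖^{-s}` along some spanning tree
(`exists_tree_of_powerCounting`), and a tree is integrated leaf by leaf.

Parity. `K'` is odd in space and the covariance is invariant under simultaneous reflection. If a set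
of vertices hangs on one vertex only, reflecting it about that vertex multiplies the integrand by a
sign, and when the number of tree edges involved is odd the diagram vanishes (`diag_eq_zero`). The
surviving diagrams that violate power counting contain a tree edge with a parallel covariance, whose
exponent `3 + 2γ` is too large. There a vertex is reflected and exactly one of its edges spoils the
antisymmetry. The integral then sees only the increment of that edge, which is a gain of 1/2 at the
bad place and a loss of 1/2 at the spoiling edge (`enorm_integral_le_antisymm` and the
symmetrization theorems). That every pairing of every six-noise symbol vanishes, satisfies power
counting directly, or does so after such a move is a finite check in integer arithmetic. For four
noises the same symmetrization is followed by explicit convolution estimates, where `γ < 1/4` keeps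
the exponents `2 + 4γ` and `5/2 + 2γ` below 3.

The lower bound. `C_V` equals `∫ N²` over one period, where `N` is the noise kernel. On a set of
volume of order `ε³` the noise kernel has size at least a constant times `ε^{-2-γ}`
(`exists_le_abs_noiseKernel`), because at points with `√t ≪ x ≪ 1` the kernel `∂ₓ^γ K'` looks like a
multiple of `x^{-2-γ}`, and for `γ = 0` it is an explicit Gaussian derivative of one sign. -/

lemma parNorm_nonneg (z : ℝ × ℝ) : 0 ≤ parNorm z := by unfold parNorm; positivity

lemma parNorm_zero : parNorm 0 = 0 := by simp [parNorm]

lemma parNorm_neg (z : ℝ × ℝ) : parNorm (-z) = parNorm z := by simp [parNorm]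

lemma parNorm_sub_comm (z w : ℝ × ℝ) : parNorm (z - w) = parNorm (w - z) := by
  rw [← parNorm_neg, neg_sub]

lemma continuous_parNorm : Continuous parNorm := by unfold parNorm; fun_prop

lemma parNorm_add_le (z w : ℝ × ℝ) : parNorm (z + w) ≤ parNorm z + parNorm w := by
  have h1 : √|z.1 + w.1| ≤ √|z.1| + √|w.1| := by
    rw [Real.sqrt_le_left (by positivity)]
    have := abs_add_le z.1 w.1
    nlinarith [Real.sq_sqrt (abs_nonneg z.1), Real.sq_sqrt (abs_nonneg w.1),
      mul_nonneg (Real.sqrt_nonneg |z.1|) (Real.sqrt_nonneg |w.1|)]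
  have h2 := abs_add_le z.2 w.2
  simp only [parNorm, Prod.fst_add, Prod.snd_add]
  linarith

lemma parNorm_sub_le (z w v : ℝ × ℝ) : parNorm (z - v) ≤ parNorm (z - w) + parNorm (w - v) := by
  simpa using parNorm_add_le (z - w) (w - v)

lemma parNorm_pos_iff {z : ℝ × ℝ} : 0 < parNorm z ↔ z ≠ 0 := by
  constructor
  · rintro h rfl
    simp [parNorm_zero] at h
  · intro h
    rcases (parNorm_nonneg z).lt_or_eq with h' | h'
    · exact h'
    · exfalso
      apply h
      have h1 := Real.sqrt_nonneg |z.1|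
      have h2 := abs_nonneg z.2
      have h3 : √|z.1| = 0 := by unfold parNorm at h'; linarith
      have h4 : |z.2| = 0 := by unfold parNorm at h'; linarith
      rw [Real.sqrt_eq_zero (abs_nonneg _)] at h3
      exact Prod.ext (abs_eq_zero.1 h3) (abs_eq_zero.1 h4)

lemma abs_snd_le_parNorm (z : ℝ × ℝ) : |z.2| ≤ parNorm z := by
  unfold parNorm; linarith [Real.sqrt_nonneg |z.1|]

lemma sqrt_abs_fst_le_parNorm (z : ℝ × ℝ) : √|z.1| ≤ parNorm z := by
  unfold parNorm; linarith [abs_nonneg z.2]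

lemma abs_fst_le_parNorm_sq (z : ℝ × ℝ) : |z.1| ≤ parNorm z ^ 2 := by
  have := sqrt_abs_fst_le_parNorm z
  rw [← Real.sq_sqrt (abs_nonneg z.1)]
  gcongr

/-- The kernel `(‖z‖ + ε)^{-α}`, with value `∞` at a singularity. -/
noncomputable def pker (ε α : ℝ) (z : ℝ × ℝ) : ℝ≥0∞ := ENNReal.ofReal (parNorm z + ε) ^ (-α)

lemma measurable_pker (ε α : ℝ) : Measurable (pker ε α) := by
  unfold pker
  have := continuous_parNorm.measurable
  fun_prop

lemma pker_sub_comm (ε α : ℝ) (z w : ℝ × ℝ) : pker ε α (z - w) = pker ε α (w - z) := by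
  rw [pker, pker, parNorm_sub_comm]

lemma pker_neg (ε α : ℝ) (z : ℝ × ℝ) : pker ε α (-z) = pker ε α z := by
  rw [pker, pker, parNorm_neg]

lemma ofReal_rpow_neg_anti {a b α : ℝ} (hα : 0 ≤ α) (h : a ≤ b) :
    ENNReal.ofReal b ^ (-α) ≤ ENNReal.ofReal a ^ (-α) := by
  rw [ENNReal.rpow_neg, ENNReal.rpow_neg, ENNReal.inv_le_inv]
  exact ENNReal.rpow_le_rpow (ENNReal.ofReal_le_ofReal h) hα

/-- Only an inequality: for `α > 0` the real power at `a = 0` has the default value 0, the extended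
one is `∞`. -/
lemma ofReal_rpow_neg_le {a α : ℝ} (ha : 0 ≤ a) (hα : 0 ≤ α) :
    ENNReal.ofReal (a ^ (-α)) ≤ ENNReal.ofReal a ^ (-α) := by
  rcases ha.lt_or_eq with h | rfl
  · rw [ENNReal.ofReal_rpow_of_pos h]
  · rcases hα.lt_or_eq with h | rfl
    · simp [h]
    · simp

lemma lintegral_comp_abs {f : ℝ → ℝ≥0∞} :
    ∫⁻ x, f |x| = 2 * ∫⁻ x in Ioi 0, f x := by
  have h1 : ∫⁻ x, f |x| = (∫⁻ x in Ioi 0, f |x|) + ∫⁻ x in (Ioi 0)ᶜ, f |x| :=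
    (lintegral_add_compl _ measurableSet_Ioi).symm
  have h2 : ∫⁻ x in Ioi (0 : ℝ), f |x| = ∫⁻ x in Ioi 0, f x :=
    setLIntegral_congr_fun measurableSet_Ioi fun x hx => by rw [abs_of_pos hx]
  have h3 : ∫⁻ x in (Ioi (0 : ℝ))ᶜ, f |x| = ∫⁻ x in Ioi 0, f x := by
    rw [compl_Ioi, ← h2, ← (Measure.measurePreserving_neg (volume : Measure ℝ)).setLIntegral_comp_preimage_emb
      (Homeomorph.neg ℝ).measurableEmbedding]
    have : Neg.neg ⁻¹' Iic (0 : ℝ) = Ici 0 := by ext; simp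
    rw [this, ← setLIntegral_congr Ioi_ae_eq_Ici]
    simp
  rw [h1, h2, h3, two_mul]

lemma lintegral_abs_rpow_le {β r : ℝ} (hβ : β < 1) (hr : 0 < r) :
    ∫⁻ x in {x : ℝ | |x| ≤ r}, ENNReal.ofReal |x| ^ (-β) ≤ ENNReal.ofReal (2 * r ^ (1 - β) / (1 - β)) := by
  have hm : MeasurableSet {x : ℝ | |x| ≤ r} := measurableSet_le (by fun_prop) (by fun_prop)
  rw [← lintegral_indicator hm]
  have : ∀ x : ℝ, {x : ℝ | |x| ≤ r}.indicator (fun x => ENNReal.ofReal |x| ^ (-β)) x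
      = (Iic r).indicator (fun x => ENNReal.ofReal x ^ (-β)) |x| := by
    intro x; simp [indicator]
  simp_rw [this]
  rw [lintegral_comp_abs (f := (Iic r).indicator (fun x => ENNReal.ofReal x ^ (-β))),
    lintegral_indicator measurableSet_Iic, Measure.restrict_restrict measurableSet_Iic, inter_comm, Ioi_inter_Iic]
  have h1 : ∫⁻ x in Ioc 0 r, ENNReal.ofReal x ^ (-β) = ∫⁻ x in Ioc 0 r, ENNReal.ofReal (x ^ (-β)) :=
    setLIntegral_congr_fun measurableSet_Ioc fun x hx => ENNReal.ofReal_rpow_of_pos hx.1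
  have hi : IntegrableOn (fun x : ℝ => x ^ (-β)) (Ioc 0 r) :=
    (intervalIntegrable_iff_integrableOn_Ioc_of_le hr.le).1
      (intervalIntegral.intervalIntegrable_rpow' (by linarith))
  rw [h1, ← ofReal_integral_eq_lintegral_ofReal hi
    ((ae_restrict_iff' measurableSet_Ioc).2 (ae_of_all _ fun x hx => by have := hx.1; positivity)),
    ← intervalIntegral.integral_of_le hr.le, integral_rpow (Or.inl (by linarith)),
    Real.zero_rpow (by linarith), show (2 : ℝ≥0∞) = ENNReal.ofReal 2 by simp,
    ← ENNReal.ofReal_mul (by norm_num)]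
  apply le_of_eq; congr 1
  rw [show -β + 1 = 1 - β by ring]; ring

lemma lintegral_add_abs_rpow_le {β r : ℝ} (hβ : 1 < β) (hr : 0 < r) :
    ∫⁻ x : ℝ, ENNReal.ofReal (r + |x|) ^ (-β) ≤ ENNReal.ofReal (2 * r ^ (1 - β) / (β - 1)) := by
  rw [lintegral_comp_abs (f := fun x => ENNReal.ofReal (r + x) ^ (-β))]
  have h0 : ∫⁻ x in Ioi (0 : ℝ), ENNReal.ofReal (r + x) ^ (-β) = ∫⁻ x in Ioi r, ENNReal.ofReal x ^ (-β) := by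
    rw [← (measurePreserving_add_left (volume : Measure ℝ) r).setLIntegral_comp_preimage_emb
      (measurableEmbedding_addLeft r) (fun x => ENNReal.ofReal x ^ (-β)) (Ioi r)]
    simp
  have h1 : ∫⁻ x in Ioi r, ENNReal.ofReal x ^ (-β) = ∫⁻ x in Ioi r, ENNReal.ofReal (x ^ (-β)) :=
    setLIntegral_congr_fun measurableSet_Ioi fun x hx => ENNReal.ofReal_rpow_of_pos (hr.trans hx)
  rw [h0, h1, ← ofReal_integral_eq_lintegral_ofReal (integrableOn_Ioi_rpow_of_lt (by linarith) hr)
    ((ae_restrict_iff' measurableSet_Ioi).2 (ae_of_all _ fun x hx => by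
      have := hr.trans hx; positivity)), integral_Ioi_rpow_of_lt (by linarith) hr,
    show (2 : ℝ≥0∞) = ENNReal.ofReal 2 by simp, ← ENNReal.ofReal_mul (by norm_num)]
  apply le_of_eq; congr 1
  rw [show -β + 1 = -(β - 1) by ring, show 1 - β = -(β - 1) by ring, neg_div_neg_eq]; ring

/-- Products of functions of time and of space integrate to products. -/
lemma lintegral_fst_mul_snd {f g : ℝ → ℝ≥0∞} (hf : Measurable f) (hg : Measurable g) :
    ∫⁻ z : ℝ × ℝ, f z.1 * g z.2 = (∫⁻ t, f t) * ∫⁻ x, g x :=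
  lintegral_prod_mul hf.aemeasurable hg.aemeasurable

/-- Since `|t| |x| ≤ ‖z‖³`, the kernel is at most `|t|^{-α/3} |x|^{-α/3}`, and the ball lies in the
box `|t| ≤ R²`, `|x| ≤ R`. Both one-dimensional integrals converge because `α/3 < 1`, and their
powers add up to `2(1 - α/3) + (1 - α/3) = 3 - α`. -/
lemma lintegral_pker_ball_le {α : ℝ} (h0 : 0 ≤ α) (hα : α < 3) : ∃ c : ℝ, 0 < c ∧ ∀ R : ℝ, 0 < R →
    ∫⁻ z in {z | parNorm z ≤ R}, pker 0 α z ≤ ENNReal.ofReal (c * R ^ (3 - α)) := by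
  have hβ : 0 < 1 - α / 3 := by linarith
  refine ⟨(2 / (1 - α / 3)) ^ 2, by positivity, fun R hR => ?_⟩
  set f : ℝ → ℝ → ℝ≥0∞ := fun r => {x : ℝ | |x| ≤ r}.indicator (fun x => ENNReal.ofReal |x| ^ (-(α / 3))) with hf
  have hm : ∀ r : ℝ, MeasurableSet {x : ℝ | |x| ≤ r} := fun r => measurableSet_le (by fun_prop) (by fun_prop)
  have hfm : ∀ r, Measurable (f r) := fun r => by
    apply Measurable.indicator _ (hm r); fun_prop
  have hB : MeasurableSet {z | parNorm z ≤ R} := measurableSet_le continuous_parNorm.measurable (by fun_prop)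
  rw [← lintegral_indicator hB]
  calc ∫⁻ z, {z | parNorm z ≤ R}.indicator (pker 0 α) z
      ≤ ∫⁻ z : ℝ × ℝ, f (R ^ 2) z.1 * f R z.2 := by
        apply lintegral_mono
        intro z
        by_cases hz : parNorm z ≤ R
        · have h1 : |z.1| ≤ R ^ 2 := (abs_fst_le_parNorm_sq z).trans
            (by have := parNorm_nonneg z; gcongr)
          have h2 : |z.2| ≤ R := (abs_snd_le_parNorm z).trans hz
          simp only [hf, indicator, mem_ofPred_eq, hz, h1, h2, if_true, pker, add_zero]
          rw [ENNReal.rpow_neg, ENNReal.rpow_neg, ENNReal.rpow_neg,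
            ← ENNReal.mul_inv (Or.inr (ENNReal.rpow_ne_top_of_nonneg (by positivity) ofReal_ne_top))
              (Or.inl (ENNReal.rpow_ne_top_of_nonneg (by positivity) ofReal_ne_top)), ENNReal.inv_le_inv,
            ← ENNReal.mul_rpow_of_nonneg _ _ (by positivity), ← ENNReal.ofReal_mul (abs_nonneg _)]
          rw [show α = 3 * (α / 3) by ring, ENNReal.rpow_mul, show 3 * (α / 3) / 3 = α / 3 by ring]
          apply ENNReal.rpow_le_rpow _ (by positivity)
          rw [show (3 : ℝ) = ((3 : ℕ) : ℝ) by norm_num, ENNReal.rpow_natCast,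
            ← ENNReal.ofReal_pow (parNorm_nonneg z)]
          apply ENNReal.ofReal_le_ofReal
          calc |z.1| * |z.2| ≤ parNorm z ^ 2 * parNorm z := by
                gcongr
                · exact abs_fst_le_parNorm_sq z
                · exact abs_snd_le_parNorm z
            _ = _ := by ring
        · simp [indicator, hz]
    _ = (∫⁻ t, f (R ^ 2) t) * ∫⁻ x, f R x := lintegral_fst_mul_snd (hfm _) (hfm _)
    _ ≤ ENNReal.ofReal (2 * (R ^ 2) ^ (1 - α / 3) / (1 - α / 3)) * ENNReal.ofReal (2 * R ^ (1 - α / 3) / (1 - α / 3)) := by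
        simp only [hf]
        rw [lintegral_indicator (hm _), lintegral_indicator (hm _)]
        gcongr
        · exact lintegral_abs_rpow_le (by linarith) (by positivity)
        · exact lintegral_abs_rpow_le (by linarith) (by positivity)
    _ = _ := by
        rw [← ENNReal.ofReal_mul (by positivity)]
        congr 1
        rw [show (R ^ 2) ^ (1 - α / 3) = R ^ (2 * (1 - α / 3)) by
          rw [← Real.rpow_natCast, ← Real.rpow_mul hR.le]; norm_num]
        rw [show (3 - α) = 2 * (1 - α / 3) + (1 - α / 3) by ring, Real.rpow_add hR]
        ring

/-- Outside the ball `(R² + |t|)(R + |x|) ≤ (2‖z‖)³`, so the integrand is again dominated by a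
product of functions of time and of space, now integrable at infinity because `α/3 > 1`. -/
lemma lintegral_pker_compl_le {α : ℝ} (hα : 3 < α) : ∃ c : ℝ, 0 < c ∧ ∀ R : ℝ, 0 < R →
    ∫⁻ z in {z | R ≤ parNorm z}, pker 0 α z ≤ ENNReal.ofReal (c * R ^ (3 - α)) := by
  have hβ : 0 < α / 3 - 1 := by linarith
  refine ⟨2 ^ α * (2 / (α / 3 - 1)) ^ 2, by positivity, fun R hR => ?_⟩
  have hB : MeasurableSet {z | R ≤ parNorm z} := measurableSet_le (by fun_prop) continuous_parNorm.measurable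
  rw [← lintegral_indicator hB]
  calc ∫⁻ z, {z | R ≤ parNorm z}.indicator (pker 0 α) z
      ≤ ∫⁻ z : ℝ × ℝ, ENNReal.ofReal (2 ^ α) * (ENNReal.ofReal (R ^ 2 + |z.1|) ^ (-(α / 3)) * ENNReal.ofReal (R + |z.2|) ^ (-(α / 3))) := by
        apply lintegral_mono
        intro z
        by_cases hz : R ≤ parNorm z
        · simp only [indicator, mem_ofPred_eq, hz, if_true, pker, add_zero]
          have hp : 0 < parNorm z := hR.trans_le hz
          rw [ENNReal.ofReal_rpow_of_pos hp, ENNReal.ofReal_rpow_of_pos (by positivity),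
            ENNReal.ofReal_rpow_of_pos (by positivity), ← ENNReal.ofReal_mul (by positivity),
            ← ENNReal.ofReal_mul (by positivity)]
          apply ENNReal.ofReal_le_ofReal
          rw [← Real.mul_rpow (by positivity) (by positivity)]
          have : parNorm z ^ (-α) = 2 ^ α * (((2 * parNorm z) ^ 3) ^ (-(α / 3))) := by
            rw [← Real.rpow_natCast, ← Real.rpow_mul (by positivity), Real.mul_rpow (by norm_num) hp.le]
            rw [show ((3 : ℕ) : ℝ) * (-(α / 3)) = -α by push_cast; ring, ← mul_assoc,
              ← Real.rpow_add (by norm_num)]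
            simp
          rw [this]
          gcongr 2 ^ α * ?_
          apply Real.rpow_le_rpow_of_nonpos (by positivity) _ (by linarith)
          have h1 := abs_fst_le_parNorm_sq z
          have h2 := abs_snd_le_parNorm z
          calc (R ^ 2 + |z.1|) * (R + |z.2|) ≤ (parNorm z ^ 2 + parNorm z ^ 2) * (parNorm z + parNorm z) := by
                gcongr
            _ ≤ _ := by nlinarith [pow_pos hp 3]
        · simp [indicator, hz]
    _ = ENNReal.ofReal (2 ^ α) * ((∫⁻ t : ℝ, ENNReal.ofReal (R ^ 2 + |t|) ^ (-(α / 3))) * ∫⁻ x : ℝ, ENNReal.ofReal (R + |x|) ^ (-(α / 3))) := by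
        rw [lintegral_const_mul _ (by fun_prop)]
        congr 1
        exact lintegral_fst_mul_snd (f := fun t => ENNReal.ofReal (R ^ 2 + |t|) ^ (-(α / 3)))
          (g := fun x => ENNReal.ofReal (R + |x|) ^ (-(α / 3))) (by fun_prop) (by fun_prop)
    _ ≤ ENNReal.ofReal (2 ^ α) * (ENNReal.ofReal (2 * (R ^ 2) ^ (1 - α / 3) / (α / 3 - 1)) * ENNReal.ofReal (2 * R ^ (1 - α / 3) / (α / 3 - 1))) := by
        gcongr
        · exact lintegral_add_abs_rpow_le (by linarith) (by positivity)
        · exact lintegral_add_abs_rpow_le (by linarith) (by positivity)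
    _ = _ := by
        rw [← ENNReal.ofReal_mul (by positivity), ← ENNReal.ofReal_mul (by positivity)]
        congr 1
        rw [show (R ^ 2) ^ (1 - α / 3) = R ^ (2 * (1 - α / 3)) by
          rw [← Real.rpow_natCast, ← Real.rpow_mul hR.le]; norm_num]
        rw [show (3 - α) = 2 * (1 - α / 3) + (1 - α / 3) by ring, Real.rpow_add hR]
        ring


lemma pker_anti {ε ε' α : ℝ} (hα : 0 ≤ α) {z w : ℝ × ℝ} (h : parNorm z + ε ≤ parNorm w + ε') :
    pker ε' α w ≤ pker ε α z := ofReal_rpow_neg_anti hα h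

/-- Split at `‖z‖ = ε`: inside, the regularised factor is at most `ε^{-β}`; outside, `ε` is dropped
and the exponents add to more than 3. -/
lemma lintegral_pker_mul_pker_le {α β : ℝ} (h0 : 0 ≤ α) (hα : α < 3) (hβ : 0 ≤ β) (h : 3 < α + β) :
    ∃ c : ℝ, 0 < c ∧ ∀ ε : ℝ, 0 < ε →
      ∫⁻ z, pker 0 α z * pker ε β z ≤ ENNReal.ofReal (c * ε ^ (3 - α - β)) := by
  obtain ⟨c₁, h₁, H₁⟩ := lintegral_pker_ball_le h0 hα
  obtain ⟨c₂, h₂, H₂⟩ := lintegral_pker_compl_le h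
  refine ⟨c₁ + c₂, by positivity, fun ε hε => ?_⟩
  have hB : MeasurableSet {z | parNorm z ≤ ε} := measurableSet_le continuous_parNorm.measurable (by fun_prop)
  rw [← lintegral_add_compl _ hB]
  have hε' : ENNReal.ofReal ε ^ (-β) = ENNReal.ofReal (ε ^ (-β)) := ENNReal.ofReal_rpow_of_pos hε
  calc _ ≤ (∫⁻ z in {z | parNorm z ≤ ε}, pker 0 α z * ENNReal.ofReal (ε ^ (-β))) +
        ∫⁻ z in {z | ε ≤ parNorm z}, pker 0 (α + β) z := by
        apply add_le_add
        · apply lintegral_mono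
          intro z
          dsimp only
          gcongr
          rw [← hε']
          exact ofReal_rpow_neg_anti hβ (by linarith [parNorm_nonneg z])
        · refine (lintegral_mono_set (t := {z | ε ≤ parNorm z}) ?_).trans ?_
          · intro z hz
            exact (not_le.1 (by simpa using hz) : ε < parNorm z).le
          · apply setLIntegral_mono (measurable_pker _ _)
            intro z hz
            have hz' : 0 < parNorm z := hε.trans_le hz
            have : pker 0 (α + β) z = pker 0 α z * pker 0 β z := by
              rw [pker, pker, pker, neg_add, ENNReal.rpow_add _ _ (by simpa using hz') (by simp)]
            rw [this]
            gcongr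
            exact pker_anti hβ (by linarith)
    _ ≤ ENNReal.ofReal (c₁ * ε ^ (3 - α)) * ENNReal.ofReal (ε ^ (-β)) + ENNReal.ofReal (c₂ * ε ^ (3 - (α + β))) := by
        rw [lintegral_mul_const _ (measurable_pker _ _)]
        gcongr
        · exact H₁ ε hε
        · exact H₂ ε hε
    _ = _ := by
        rw [← ENNReal.ofReal_mul (by positivity), ← ENNReal.ofReal_add (by positivity) (by positivity)]
        congr 1
        rw [show 3 - α - β = 3 - α + -β by ring, Real.rpow_add hε, show 3 - (α + β) = 3 - α + -β by ring,
          Real.rpow_add hε]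
        ring

lemma measurableSet_parNorm_le (R : ℝ) : MeasurableSet {z | parNorm z ≤ R} :=
  measurableSet_le continuous_parNorm.measurable (by fun_prop)

lemma lintegral_sub_left_set (f : ℝ × ℝ → ℝ≥0∞) (z : ℝ × ℝ) :
    ∫⁻ w, f (z - w) = ∫⁻ w, f w := lintegral_sub_left_eq_self f z

/-- The convolution of two kernels of orders `α, β < 3` has order `α + β - 3`. -/
lemma lintegral_pker_conv_le {α β : ℝ} (h0 : 0 ≤ α) (hα : α < 3) (hβ0 : 0 ≤ β) (hβ : β < 3)
    (h : 3 < α + β) :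
    ∃ c : ℝ, 0 < c ∧ ∀ ε : ℝ, 0 ≤ ε → ∀ z : ℝ × ℝ,
      ∫⁻ w, pker 0 α w * pker ε β (z - w) ≤ ENNReal.ofReal c * pker ε (α + β - 3) z := by
  obtain ⟨c₁, h₁, H₁⟩ := lintegral_pker_ball_le h0 hα
  obtain ⟨c₂, h₂, H₂⟩ := lintegral_pker_ball_le hβ0 hβ
  obtain ⟨c₃, h₃, H₃⟩ := lintegral_pker_compl_le h
  obtain ⟨c₄, h₄, H₄⟩ := lintegral_pker_mul_pker_le h0 hα hβ0 h
  set δ := α + β - 3 with hδ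
  have hδ0 : 0 < δ := by linarith
  refine ⟨((c₁ + c₂ + 2 * c₃) * 2 ^ δ + 2 ^ β * c₄) * 2 ^ δ, by positivity, fun ε hε z => ?_⟩
  -- If `z = 0` and `ε = 0`, the right-hand side is `∞`.
  rcases (add_nonneg (parNorm_nonneg z) hε).lt_or_eq with hpos | hzero
  swap
  · rw [pker, ← hzero]
    simp [hδ0]
    rw [ENNReal.mul_top]
    · exact le_top
    · simp; positivity
  -- If `‖z‖ ≥ ε`, split according to whether `w` is within `‖z‖/2` of `0`, within `‖z‖/2` of `z`,
  -- or far from both; in the last zone the smaller of the two distances carries the whole exponent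
  -- `α + β`. If `‖z‖ < ε`, the shift by `z` changes the regularised factor by at most `2^β`, and
  -- the integral at `z = 0` suffices.
  rcases le_or_gt ε (parNorm z) with hz | hz
  · set D := parNorm z with hD
    have hDpos : 0 < D := by linarith
    have hDh : 0 < D / 2 := by linarith
    have e1 : ENNReal.ofReal (D / 2) ^ (-α) = ENNReal.ofReal ((D / 2) ^ (-α)) := ENNReal.ofReal_rpow_of_pos hDh
    have e2 : ENNReal.ofReal (D / 2) ^ (-β) = ENNReal.ofReal ((D / 2) ^ (-β)) := ENNReal.ofReal_rpow_of_pos hDh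
    have key : ∀ w, pker 0 α w * pker ε β (z - w) ≤
        {w | parNorm w ≤ D / 2}.indicator (pker 0 α) w * ENNReal.ofReal ((D / 2) ^ (-β)) +
        {w | parNorm w ≤ D / 2}.indicator (pker 0 β) (z - w) * ENNReal.ofReal ((D / 2) ^ (-α)) +
        ({w | D / 2 ≤ parNorm w}.indicator (pker 0 (α + β)) w +
         {w | D / 2 ≤ parNorm w}.indicator (pker 0 (α + β)) (z - w)) := by
      intro w
      have tri : D ≤ parNorm (z - w) + parNorm w := by simpa using parNorm_add_le (z - w) w
      rcases le_or_gt (parNorm w) (D / 2) with hw | hw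
      · refine le_trans ?_ (le_add_right (le_add_right le_rfl))
        simp only [indicator, mem_ofPred_eq, hw, if_true]
        gcongr
        rw [← e2]
        exact ofReal_rpow_neg_anti hβ0 (by linarith)
      rcases le_or_gt (parNorm (z - w)) (D / 2) with hw' | hw'
      · refine le_trans ?_ (le_add_right (le_add_left le_rfl))
        simp only [indicator, mem_ofPred_eq, hw', if_true]
        rw [mul_comm]
        gcongr
        · exact pker_anti hβ0 (by linarith)
        · rw [← e1]
          exact ofReal_rpow_neg_anti h0 (by linarith)
      · refine le_trans ?_ (le_add_left le_rfl)
        simp only [indicator, mem_ofPred_eq, hw'.le, hw.le, if_true]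
        have split : ∀ v, D / 2 < parNorm v → pker 0 (α + β) v = pker 0 α v * pker 0 β v := by
          intro v hv
          rw [pker, pker, pker, neg_add, ENNReal.rpow_add _ _ (by simpa using hDh.trans hv) (by simp)]
        rcases le_total (parNorm w) (parNorm (z - w)) with hle | hle
        · refine le_trans ?_ (le_add_right le_rfl)
          rw [split w hw]
          gcongr
          exact pker_anti hβ0 (by linarith)
        · refine le_trans ?_ (le_add_left le_rfl)
          rw [split _ hw']
          gcongr
          · exact pker_anti h0 (by linarith)
          · exact pker_anti hβ0 (by linarith)
    have m1 : MeasurableSet {w | parNorm w ≤ D / 2} := measurableSet_parNorm_le _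
    have m2 : MeasurableSet {w | D / 2 ≤ parNorm w} := measurableSet_le (by fun_prop) continuous_parNorm.measurable
    have n1 : Measurable ({w | parNorm w ≤ D / 2}.indicator (pker 0 α)) := (measurable_pker _ _).indicator m1
    have n2 : Measurable ({w | parNorm w ≤ D / 2}.indicator (pker 0 β)) := (measurable_pker _ _).indicator m1
    have n3 : Measurable ({w | D / 2 ≤ parNorm w}.indicator (pker 0 (α + β))) := (measurable_pker _ _).indicator m2
    calc _ ≤ _ := lintegral_mono key
      _ = (∫⁻ w, {w | parNorm w ≤ D / 2}.indicator (pker 0 α) w) * ENNReal.ofReal ((D / 2) ^ (-β)) +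
        (∫⁻ w, {w | parNorm w ≤ D / 2}.indicator (pker 0 β) w) * ENNReal.ofReal ((D / 2) ^ (-α)) +
        ((∫⁻ w, {w | D / 2 ≤ parNorm w}.indicator (pker 0 (α + β)) w) +
         ∫⁻ w, {w | D / 2 ≤ parNorm w}.indicator (pker 0 (α + β)) w) := by
          rw [lintegral_add_left (by fun_prop), lintegral_add_left (by fun_prop), lintegral_add_left (by fun_prop),
            lintegral_mul_const _ (by fun_prop), lintegral_mul_const _ (by fun_prop),
            lintegral_sub_left_set ({w | parNorm w ≤ D / 2}.indicator (pker 0 β)) z,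
            lintegral_sub_left_set ({w | D / 2 ≤ parNorm w}.indicator (pker 0 (α + β))) z]
      _ ≤ ENNReal.ofReal (c₁ * (D / 2) ^ (3 - α)) * ENNReal.ofReal ((D / 2) ^ (-β)) +
          ENNReal.ofReal (c₂ * (D / 2) ^ (3 - β)) * ENNReal.ofReal ((D / 2) ^ (-α)) +
          (ENNReal.ofReal (c₃ * (D / 2) ^ (3 - (α + β))) + ENNReal.ofReal (c₃ * (D / 2) ^ (3 - (α + β)))) := by
          rw [lintegral_indicator m1, lintegral_indicator m1, lintegral_indicator m2]
          gcongr
          · exact H₁ _ hDh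
          · exact H₂ _ hDh
          · exact H₃ _ hDh
          · exact H₃ _ hDh
      _ = ENNReal.ofReal ((c₁ + c₂ + 2 * c₃) * (D / 2) ^ (-δ)) := by
          rw [← ENNReal.ofReal_mul (by positivity), ← ENNReal.ofReal_mul (by positivity),
            ← ENNReal.ofReal_add (by positivity) (by positivity), ← ENNReal.ofReal_add (by positivity) (by positivity),
            ← ENNReal.ofReal_add (by positivity) (by positivity)]
          congr 1
          rw [mul_assoc, mul_assoc, ← Real.rpow_add hDh, ← Real.rpow_add hDh,
            show 3 - α + -β = -δ by rw [hδ]; ring, show 3 - β + -α = -δ by rw [hδ]; ring,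
            show 3 - (α + β) = -δ by rw [hδ]; ring]
          ring
      _ ≤ _ := by
          rw [pker, ENNReal.ofReal_rpow_of_pos hpos, ← ENNReal.ofReal_mul (by positivity)]
          apply ENNReal.ofReal_le_ofReal
          have : (D / 2) ^ (-δ) = D ^ (-δ) * 2 ^ δ := by
            rw [Real.div_rpow hDpos.le (by norm_num), Real.rpow_neg (by norm_num : (0:ℝ) ≤ 2)]
            simp
          rw [this]
          have : D ^ (-δ) ≤ 2 ^ δ * (D + ε) ^ (-δ) := by
            have h5 : ((D + ε) / 2) ^ (-δ) = 2 ^ δ * (D + ε) ^ (-δ) := by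
              rw [Real.div_rpow hpos.le (by norm_num), Real.rpow_neg (by norm_num : (0:ℝ) ≤ 2)]
              simp; ring
            rw [← h5]
            exact Real.rpow_le_rpow_of_nonpos (by positivity) (by linarith) (by linarith)
          calc (c₁ + c₂ + 2 * c₃) * (D ^ (-δ) * 2 ^ δ) ≤ (c₁ + c₂ + 2 * c₃) * ((2 ^ δ * (D + ε) ^ (-δ)) * 2 ^ δ) := by gcongr
            _ = ((c₁ + c₂ + 2 * c₃) * 2 ^ δ) * 2 ^ δ * (D + ε) ^ (-δ) := by ring
            _ ≤ _ := by
              gcongr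
              have : 0 ≤ 2 ^ β * c₄ := by positivity
              linarith
  · have hεpos : 0 < ε := (parNorm_nonneg z).trans_lt hz
    have key : ∀ w, pker ε β (z - w) ≤ ENNReal.ofReal (2 ^ β) * pker ε β w := by
      intro w
      have tri : parNorm w ≤ parNorm (z - w) + parNorm z := by
        have := parNorm_add_le (w - z) z
        rw [parNorm_sub_comm] at this; simpa using this
      have p1 := parNorm_nonneg w
      have p2 := parNorm_nonneg (z - w)
      rw [pker, pker, ENNReal.ofReal_rpow_of_pos (by linarith), ENNReal.ofReal_rpow_of_pos (by linarith),
        ← ENNReal.ofReal_mul (by positivity)]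
      apply ENNReal.ofReal_le_ofReal
      have h5 : ((parNorm w + ε) / 2) ^ (-β) = 2 ^ β * (parNorm w + ε) ^ (-β) := by
        rw [Real.div_rpow (by linarith) (by norm_num), Real.rpow_neg (by norm_num : (0:ℝ) ≤ 2)]
        simp; ring
      rw [← h5]
      exact Real.rpow_le_rpow_of_nonpos (by linarith) (by linarith) (by linarith)
    calc _ ≤ ∫⁻ w, ENNReal.ofReal (2 ^ β) * (pker 0 α w * pker ε β w) := by
          apply lintegral_mono
          intro w
          calc _ ≤ pker 0 α w * (ENNReal.ofReal (2 ^ β) * pker ε β w) := by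
                dsimp only
                gcongr; exact key w
            _ = _ := by ring
      _ = ENNReal.ofReal (2 ^ β) * ∫⁻ w, (pker 0 α w * pker ε β w) :=
          lintegral_const_mul _ ((measurable_pker _ _).mul (measurable_pker _ _))
      _ ≤ ENNReal.ofReal (2 ^ β) * ENNReal.ofReal (c₄ * ε ^ (3 - α - β)) := by gcongr; exact H₄ ε hεpos
      _ ≤ _ := by
          rw [pker, ENNReal.ofReal_rpow_of_pos hpos, ← ENNReal.ofReal_mul (by positivity),
            ← ENNReal.ofReal_mul (by positivity)]
          apply ENNReal.ofReal_le_ofReal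
          have h5 : ((parNorm z + ε) / 2) ^ (-δ) = 2 ^ δ * (parNorm z + ε) ^ (-δ) := by
            rw [Real.div_rpow hpos.le (by norm_num), Real.rpow_neg (by norm_num : (0:ℝ) ≤ 2)]
            simp; ring
          have h6 : ε ^ (3 - α - β) ≤ 2 ^ δ * (parNorm z + ε) ^ (-δ) := by
            rw [← h5, show 3 - α - β = -δ by rw [hδ]; ring]
            exact Real.rpow_le_rpow_of_nonpos (by positivity) (by linarith) (by linarith)
          calc 2 ^ β * (c₄ * ε ^ (3 - α - β)) ≤ 2 ^ β * (c₄ * (2 ^ δ * (parNorm z + ε) ^ (-δ))) := by gcongr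
            _ = (2 ^ β * c₄) * 2 ^ δ * (parNorm z + ε) ^ (-δ) := by ring
            _ ≤ _ := by
              gcongr
              have : 0 ≤ (c₁ + c₂ + 2 * c₃) * 2 ^ δ := by positivity
              linarith


lemma parNorm_rescale {ε : ℝ} (hε : 0 < ε) (z : ℝ × ℝ) :
    parNorm (z.1 / ε ^ 2, z.2 / ε) = parNorm z / ε := by
  simp only [parNorm, abs_div, abs_of_pos hε, abs_of_pos (pow_pos hε 2)]
  rw [Real.sqrt_div (abs_nonneg _), Real.sqrt_sq hε.le]
  ring

lemma IsMollifier.rescale_bound {ρ : ℝ × ℝ → ℝ} (hρ : IsMollifier ρ) :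
    ∃ M R : ℝ, 0 < M ∧ 0 < R ∧ ∀ ε : ℝ, 0 < ε → ∀ z, 0 ≤ rescale ρ ε z ∧
      rescale ρ ε z ≤ M * ε ^ (-3 : ℝ) ∧ (R * ε < parNorm z → rescale ρ ε z = 0) := by
  obtain ⟨M, hM⟩ := hρ.compact.exists_bound_of_continuous hρ.smooth.continuous
  obtain ⟨R, hR⟩ := hρ.compact.isCompact.exists_bound_of_continuousOn
    (f := parNorm) continuous_parNorm.continuousOn
  refine ⟨|M| + 1, |R| + 1, by positivity, by positivity, fun ε hε z => ⟨?_, ?_, ?_⟩⟩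
  · exact mul_nonneg (by positivity) (hρ.nonneg _)
  · rw [rescale, mul_comm, Real.rpow_neg hε.le, show (3 : ℝ) = (3 : ℕ) by norm_num, Real.rpow_natCast]
    gcongr
    have := (le_abs_self _).trans (hM (z.1 / ε ^ 2, z.2 / ε))
    linarith [le_abs_self M]
  · intro hz
    suffices h : ρ (z.1 / ε ^ 2, z.2 / ε) = 0 by rw [rescale, h, mul_zero]
    refine image_eq_zero_of_notMem_tsupport fun hmem => ?_
    have := (le_abs_self _).trans (hR _ hmem)
    rw [parNorm_rescale hε, div_le_iff₀ hε] at this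
    nlinarith [le_abs_self R]

/-- Mollification at scale `ε` regularises a kernel of order `α < 3`. -/
lemma lintegral_pker_mul_rescale_le {ρ : ℝ × ℝ → ℝ} (hρ : IsMollifier ρ) {α : ℝ} (h0 : 0 ≤ α) (hα : α < 3) :
    ∃ c : ℝ, 0 < c ∧ ∀ ε : ℝ, 0 < ε → ∀ z : ℝ × ℝ,
      ∫⁻ w, pker 0 α w * ENNReal.ofReal (rescale ρ ε (z - w)) ≤ ENNReal.ofReal c * pker ε α z := by
  obtain ⟨M, R, hM, hR, H⟩ := hρ.rescale_bound
  obtain ⟨c₁, h₁, H₁⟩ := lintegral_pker_ball_le h0 hα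
  obtain ⟨c₀, h₀, H₀⟩ := lintegral_pker_ball_le le_rfl (show (0 : ℝ) < 3 by norm_num)
  set L : ℝ := 1 + 2 * R with hL
  refine ⟨M * c₁ * (3 * R) ^ (3 - α) * L ^ α +
    M * c₀ * R ^ (3 : ℝ) * 2 ^ α * (1 + 1 / (2 * R)) ^ α,
    by positivity, fun ε hε z => ?_⟩
  have hzε : 0 < parNorm z + ε := by linarith [parNorm_nonneg z]
  rw [pker, ENNReal.ofReal_rpow_of_pos hzε, ← ENNReal.ofReal_mul (by positivity)]
  have hmem : ∀ w, ENNReal.ofReal (rescale ρ ε (z - w)) ≤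
      {v | parNorm v ≤ R * ε}.indicator (fun _ => ENNReal.ofReal (M * ε ^ (-3 : ℝ))) (z - w) := by
    intro w
    by_cases hw : parNorm (z - w) ≤ R * ε
    · simp only [indicator, mem_ofPred_eq, hw, if_true]
      exact ENNReal.ofReal_le_ofReal (H ε hε _).2.1
    · simp [indicator, hw, (H ε hε _).2.2 (not_le.1 hw)]
  -- Far from the origin `‖w‖ ≥ ‖z‖/2` on the support of the mollifier. Near it, `w` ranges over a
  -- ball of radius `3Rε`, and the sup bound `M ε⁻³` is combined with the integral over that ball.
  rcases le_or_gt (2 * R * ε) (parNorm z) with hz | hz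
  · have hzp : 0 < parNorm z := lt_of_lt_of_le (by positivity) hz
    calc _ ≤ ∫⁻ w, ENNReal.ofReal ((parNorm z / 2) ^ (-α)) * {v | parNorm v ≤ R * ε}.indicator (fun _ => ENNReal.ofReal (M * ε ^ (-3 : ℝ))) (z - w) := by
          apply lintegral_mono
          intro w
          by_cases hw : parNorm (z - w) ≤ R * ε
          · apply mul_le_mul' _ (hmem w)
            rw [pker, ← ENNReal.ofReal_rpow_of_pos (by positivity)]
            apply ofReal_rpow_neg_anti h0
            have := parNorm_add_le (z - w) w
            simp only [sub_add_cancel] at this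
            linarith
          · dsimp only
            rw [(H ε hε _).2.2 (not_le.1 hw)]; simp
      _ = ENNReal.ofReal ((parNorm z / 2) ^ (-α)) * (ENNReal.ofReal (M * ε ^ (-3 : ℝ)) * ∫⁻ w in {v | parNorm v ≤ R * ε}, pker 0 0 w) := by
          have m : Measurable ({v | parNorm v ≤ R * ε}.indicator (fun _ => ENNReal.ofReal (M * ε ^ (-3 : ℝ)))) :=
            measurable_const.indicator (measurableSet_parNorm_le _)
          rw [lintegral_const_mul _ (by fun_prop),
            lintegral_sub_left_set ({v | parNorm v ≤ R * ε}.indicator (fun _ => ENNReal.ofReal (M * ε ^ (-3 : ℝ)))),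
            lintegral_indicator (measurableSet_parNorm_le _), ← lintegral_const_mul _ (measurable_pker _ _)]
          simp [pker]
      _ ≤ ENNReal.ofReal ((parNorm z / 2) ^ (-α)) * (ENNReal.ofReal (M * ε ^ (-3 : ℝ)) * ENNReal.ofReal (c₀ * (R * ε) ^ ((3:ℝ) - 0))) := by
          gcongr; exact H₀ _ (by positivity)
      _ = ENNReal.ofReal (M * c₀ * R ^ (3 : ℝ) * 2 ^ α * parNorm z ^ (-α)) := by
          rw [← ENNReal.ofReal_mul (by positivity), ← ENNReal.ofReal_mul (by positivity)]
          congr 1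
          rw [sub_zero, Real.mul_rpow hR.le hε.le, Real.div_rpow hzp.le (by norm_num), Real.rpow_neg (by norm_num : (0:ℝ) ≤ 2),
            Real.rpow_neg hε.le]
          field_simp
      _ ≤ _ := by
          apply ENNReal.ofReal_le_ofReal
          have h5 : parNorm z ^ (-α) ≤ (1 + 1 / (2 * R)) ^ α * (parNorm z + ε) ^ (-α) := by
            have : ((parNorm z + ε) / (1 + 1 / (2 * R))) ^ (-α) = (1 + 1 / (2 * R)) ^ α * (parNorm z + ε) ^ (-α) := by
              rw [Real.div_rpow hzε.le (by positivity), Real.rpow_neg (by positivity : (0:ℝ) ≤ 1 + 1 / (2 * R))]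
              simp; ring
            rw [← this]
            apply Real.rpow_le_rpow_of_nonpos (by positivity) _ (by linarith)
            rw [div_le_iff₀ (by positivity)]
            have : ε ≤ parNorm z * (1 / (2 * R)) := by
              rw [mul_one_div, le_div_iff₀ (by positivity)]; linarith
            linarith
          calc _ ≤ M * c₀ * R ^ (3 : ℝ) * 2 ^ α * ((1 + 1 / (2 * R)) ^ α * (parNorm z + ε) ^ (-α)) := by gcongr
            _ = M * c₀ * R ^ (3 : ℝ) * 2 ^ α * (1 + 1 / (2 * R)) ^ α * (parNorm z + ε) ^ (-α) := by ring
            _ ≤ _ := by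
              gcongr
              have : 0 ≤ M * c₁ * (3 * R) ^ (3 - α) * L ^ α := by positivity
              linarith
  · calc _ ≤ ∫⁻ w, {v | parNorm v ≤ 3 * R * ε}.indicator (pker 0 α) w * ENNReal.ofReal (M * ε ^ (-3 : ℝ)) := by
          apply lintegral_mono
          intro w
          by_cases hw : parNorm (z - w) ≤ R * ε
          · have : parNorm w ≤ 3 * R * ε := by
              have := parNorm_add_le (w - z) z
              rw [parNorm_sub_comm] at this
              simp only [sub_add_cancel] at this
              linarith
            simp only [indicator, mem_ofPred_eq, this, if_true]
            gcongr
            exact (H ε hε _).2.1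
          · dsimp only
            rw [(H ε hε _).2.2 (not_le.1 hw)]; simp
      _ = (∫⁻ w in {v | parNorm v ≤ 3 * R * ε}, pker 0 α w) * ENNReal.ofReal (M * ε ^ (-3 : ℝ)) := by
          rw [lintegral_mul_const _ ((measurable_pker _ _).indicator (measurableSet_parNorm_le _)),
            lintegral_indicator (measurableSet_parNorm_le _)]
      _ ≤ ENNReal.ofReal (c₁ * (3 * R * ε) ^ (3 - α)) * ENNReal.ofReal (M * ε ^ (-3 : ℝ)) := by
          gcongr; exact H₁ _ (by positivity)
      _ = ENNReal.ofReal (M * c₁ * (3 * R) ^ (3 - α) * ε ^ (-α)) := by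
          rw [← ENNReal.ofReal_mul (by positivity)]
          congr 1
          rw [Real.mul_rpow (by positivity) hε.le, show -α = (3 - α) + (-3) by ring, Real.rpow_add hε]
          ring
      _ ≤ _ := by
          apply ENNReal.ofReal_le_ofReal
          have h5 : ε ^ (-α) ≤ L ^ α * (parNorm z + ε) ^ (-α) := by
            have : ((parNorm z + ε) / L) ^ (-α) = L ^ α * (parNorm z + ε) ^ (-α) := by
              rw [Real.div_rpow hzε.le (by positivity), Real.rpow_neg (by positivity : (0:ℝ) ≤ L)]
              simp; ring
            rw [← this]
            apply Real.rpow_le_rpow_of_nonpos (by positivity) _ (by linarith)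
            rw [div_le_iff₀ (by positivity)]
            rw [hL]; linarith
          calc _ ≤ M * c₁ * (3 * R) ^ (3 - α) * (L ^ α * (parNorm z + ε) ^ (-α)) := by gcongr
            _ = M * c₁ * (3 * R) ^ (3 - α) * L ^ α * (parNorm z + ε) ^ (-α) := by ring
            _ ≤ _ := by
              gcongr
              have h1 : 0 ≤ M * c₀ * R ^ (3 : ℝ) * 2 ^ α * (1 + 1 / (2 * R)) ^ α := by positivity
              linarith

end FracKPZ

/-! ### Scaling bounds for the derivatives of the truncated heat kernel -/

namespace FracKPZ
open Set ENNReal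

lemma mk_ne_zero_of_pos {t : ℝ} (ht : 0 < t) (x : ℝ) : (t, x) ≠ (0 : ℝ × ℝ) := by
  intro h; exact ht.ne' (congrArg Prod.fst h)

lemma hasDerivAt_spaceDeriv {A : ℝ × ℝ → ℝ} (hA : ContDiffOn ℝ ∞ A {0}ᶜ) {t x : ℝ}
    (hz : (t, x) ≠ (0 : ℝ × ℝ)) : HasDerivAt (fun y => A (t, y)) (spaceDeriv A (t, x)) x := by
  have h1 : DifferentiableAt ℝ A (t, x) :=
    (hA.contDiffAt (isOpen_compl_singleton.mem_nhds hz)).differentiableAt (by simp)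
  have h2 : DifferentiableAt ℝ (fun y => A (t, y)) x := by
    apply DifferentiableAt.comp x h1; fun_prop
  exact h2.hasDerivAt

lemma contDiffOn_spaceDeriv {A : ℝ × ℝ → ℝ} (hA : ContDiffOn ℝ ∞ A {0}ᶜ) :
    ContDiffOn ℝ ∞ (spaceDeriv A) {0}ᶜ := by
  have h : ContDiffOn ℝ ∞ (fun z => fderiv ℝ A z (0, 1)) {0}ᶜ :=
    (hA.fderiv_of_isOpen isOpen_compl_singleton (by simp)).clm_apply contDiffOn_const
  refine h.congr fun z hz => ?_
  have h1 : DifferentiableAt ℝ A (z.1, z.2) :=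
    (hA.contDiffAt (isOpen_compl_singleton.mem_nhds hz)).differentiableAt (by simp)
  have h2 : HasDerivAt (fun y : ℝ => (z.1, y)) (0, 1) z.2 :=
    (hasDerivAt_const z.2 z.1).prodMk (hasDerivAt_id z.2)
  exact (h1.hasFDerivAt.comp_hasDerivAt z.2 h2).deriv

lemma contDiffOn_iterate_spaceDeriv {A : ℝ × ℝ → ℝ} (hA : ContDiffOn ℝ ∞ A {0}ᶜ) (k : ℕ) :
    ContDiffOn ℝ ∞ (spaceDeriv^[k] A) {0}ᶜ := by
  induction k with
  | zero => exact hA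
  | succ k ih => rw [Function.iterate_succ_apply']; exact contDiffOn_spaceDeriv ih

lemma iterate_spaceDeriv_eq_of_eqOn {A B : ℝ × ℝ → ℝ} {U : Set (ℝ × ℝ)} (hU : IsOpen U)
    (h : EqOn A B U) (k : ℕ) : EqOn (spaceDeriv^[k] A) (spaceDeriv^[k] B) U := by
  induction k with
  | zero => exact h
  | succ k ih =>
    intro z hz
    rw [Function.iterate_succ_apply', Function.iterate_succ_apply']
    apply Filter.EventuallyEq.deriv_eq
    have : Continuous fun y : ℝ => (z.1, y) := by fun_prop
    filter_upwards [(hU.preimage this).mem_nhds (show z.2 ∈ _ from hz)] with y hy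
    exact ih hy

lemma iterate_spaceDeriv_zero (k : ℕ) : spaceDeriv^[k] (fun _ => (0 : ℝ)) = fun _ => 0 := by
  induction k with
  | zero => rfl
  | succ k ih =>
    rw [Function.iterate_succ_apply', ih]; funext z; simp [spaceDeriv]

/-- A spatial derivative sees only its own time slice, so causality passes to derivatives even at
the origin, where the kernel is not smooth. -/
lemma spaceDeriv_of_slice_zero {A : ℝ × ℝ → ℝ} {t : ℝ} (h : ∀ x, A (t, x) = 0) (k : ℕ) (x : ℝ) :
    spaceDeriv^[k] A (t, x) = 0 := by
  induction k generalizing x with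
  | zero => exact h x
  | succ k ih => rw [Function.iterate_succ_apply']; simp [spaceDeriv, ih]

/-! ### The heat kernel -/

lemma heatKernel_sq {s : ℝ} (hs : 0 < s) (x : ℝ) :
    heatKernel (s ^ 2, x) = (√(4 * Real.pi))⁻¹ * s⁻¹ * Real.exp (-(x / s) ^ 2 / 4) := by
  rw [heatKernel, if_pos (by positivity), Real.sqrt_mul (by positivity), Real.sqrt_sq hs.le, mul_inv]
  congr 2
  field_simp

/-- The polynomial factors of the first derivatives of the Gaussian. -/
noncomputable def heatPoly : ℕ → ℝ → ℝ
  | 0, _ => 1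
  | 1, v => -v / 2
  | 2, v => v ^ 2 / 4 - 1 / 2
  | 3, v => -v ^ 3 / 8 + 3 * v / 4
  | _, _ => 0

lemma hasDerivAt_heat {s : ℝ} (hs : 0 < s) (k : ℕ) (hk : k < 3) (x : ℝ) :
    HasDerivAt (fun x => (√(4 * Real.pi))⁻¹ * s⁻¹ ^ (k + 1) * (heatPoly k (x / s) * Real.exp (-(x / s) ^ 2 / 4)))
      ((√(4 * Real.pi))⁻¹ * s⁻¹ ^ (k + 2) * (heatPoly (k + 1) (x / s) * Real.exp (-(x / s) ^ 2 / 4))) x := by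
  have h0 : HasDerivAt (fun x : ℝ => x / s) (1 / s) x := (hasDerivAt_id x).div_const s
  have h1 : HasDerivAt (fun x : ℝ => Real.exp (-(x / s) ^ 2 / 4))
      (Real.exp (-(x / s) ^ 2 / 4) * (-((2 : ℕ) * (x / s) ^ (2 - 1) * (1 / s)) / 4)) x :=
    ((h0.pow 2).neg.div_const 4).exp
  interval_cases k
  · convert! (h1.const_mul ((√(4 * Real.pi))⁻¹ * s⁻¹ ^ (0 + 1))) using 1
    · funext y; simp [heatPoly]
    · simp [heatPoly]; field_simp; ring
  · have h2 : HasDerivAt (fun x : ℝ => heatPoly 1 (x / s)) (-(1 / s) / 2) x := (h0.neg.div_const 2)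
    convert! ((h2.mul h1).const_mul ((√(4 * Real.pi))⁻¹ * s⁻¹ ^ (1 + 1))) using 1
    simp [heatPoly]; field_simp; ring
  · have h2 : HasDerivAt (fun x : ℝ => heatPoly 2 (x / s)) ((2 : ℕ) * (x / s) ^ (2 - 1) * (1 / s) / 4) x :=
      ((h0.pow 2).div_const 4).sub_const _
    convert! ((h2.mul h1).const_mul ((√(4 * Real.pi))⁻¹ * s⁻¹ ^ (2 + 1))) using 1
    simp [heatPoly]; field_simp; ring

lemma iterate_spaceDeriv_heat {s : ℝ} (hs : 0 < s) (k : ℕ) (hk : k ≤ 3) (x : ℝ) :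
    spaceDeriv^[k] heatKernel (s ^ 2, x) =
      (√(4 * Real.pi))⁻¹ * s⁻¹ ^ (k + 1) * (heatPoly k (x / s) * Real.exp (-(x / s) ^ 2 / 4)) := by
  induction k generalizing x with
  | zero => rw [Function.iterate_zero, id, heatKernel_sq hs]; simp [heatPoly]
  | succ k ih =>
    rw [Function.iterate_succ_apply', spaceDeriv]
    simp_rw [fun x => ih (by omega) x]
    exact (hasDerivAt_heat hs k (by omega) x).deriv

lemma abs_heatPoly_le (k : ℕ) (v : ℝ) : |heatPoly k v| ≤ (1 + |v|) ^ 3 := by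
  have h := abs_nonneg v
  have h2 : v ^ 2 = |v| ^ 2 := (sq_abs v).symm
  match k with
  | 0 => simp only [heatPoly, abs_one]; nlinarith [pow_nonneg h 2, pow_nonneg h 3]
  | 1 => simp only [heatPoly, abs_div, abs_neg, abs_two]; nlinarith [pow_nonneg h 2, pow_nonneg h 3]
  | 2 =>
    simp only [heatPoly]
    rw [abs_le]; constructor <;> nlinarith [pow_nonneg h 2, pow_nonneg h 3]
  | 3 =>
    simp only [heatPoly]
    refine (abs_add_le _ _).trans ?_
    rw [abs_div, abs_div, abs_neg, abs_mul, abs_pow, abs_of_pos (show (0:ℝ) < 8 by norm_num),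
      abs_of_pos (show (0:ℝ) < 4 by norm_num), abs_of_pos (show (0:ℝ) < 3 by norm_num)]
    nlinarith [pow_nonneg h 2, pow_nonneg h 3]
  | (n + 4) => simp only [heatPoly, abs_zero]; positivity

/-- From `1 + |v| ≤ e^{|v|}` and completion of the square at `|v| = 16`. The exponent 8 leaves room
for the weight `k + 2 ≤ 5` and for the polynomial factor of degree at most 3. -/
lemma pow_mul_exp_neg_le (v : ℝ) : (1 + |v|) ^ 8 * Real.exp (-v ^ 2 / 4) ≤ Real.exp 64 := by
  have h1 : (1 + |v|) ^ 8 ≤ Real.exp (8 * |v|) := by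
    rw [show 8 * |v| = (8 : ℕ) * |v| by norm_num, Real.exp_nat_mul]
    gcongr
    linarith [Real.add_one_le_exp |v|]
  calc _ ≤ Real.exp (8 * |v|) * Real.exp (-v ^ 2 / 4) := by gcongr
    _ = Real.exp (8 * |v| + -v ^ 2 / 4) := by rw [Real.exp_add]
    _ ≤ _ := by
      apply Real.exp_le_exp.2
      nlinarith [sq_nonneg (|v| - 16), sq_abs v]

/-- In the variable `x/√t` this is Gaussian decay against a power. Keeping the factor `√t` is
stronger than scaling alone: it says that the derivatives are small at fixed `x` for small times,
which the lower bound on `∂ₓ^γ K'` needs. -/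
lemma abs_iterate_spaceDeriv_heat_le {t : ℝ} (ht : 0 < t) (k : ℕ) (hk : k ≤ 3) (x : ℝ) :
    |spaceDeriv^[k] heatKernel (t, x)| ≤ Real.exp 64 * √t * (parNorm (t, x) ^ (k + 2))⁻¹ := by
  set s := √t with hs'
  have hs : 0 < s := Real.sqrt_pos.2 ht
  have hts : t = s ^ 2 := (Real.sq_sqrt ht.le).symm
  have hp : parNorm (t, x) = s * (1 + |x / s|) := by
    rw [parNorm]; simp only [abs_of_pos ht]; rw [abs_div, abs_of_pos hs]; field_simp; rfl
  rw [hp, hts, iterate_spaceDeriv_heat hs k hk]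
  set v := x / s
  have hv : 0 < 1 + |v| := by positivity
  have h4 : (√(4 * Real.pi))⁻¹ ≤ 1 := by
    apply inv_le_one_of_one_le₀
    rw [Real.one_le_sqrt]; linarith [Real.pi_gt_three]
  rw [abs_mul, abs_mul, abs_mul, abs_of_pos (show (0:ℝ) < s⁻¹ ^ (k + 1) by positivity),
    abs_of_nonneg (show (0:ℝ) ≤ (√(4 * Real.pi))⁻¹ by positivity), Real.abs_exp]
  have h5 : (1 + |v|) ^ (k + 2) * (|heatPoly k v| * Real.exp (-v ^ 2 / 4)) ≤ Real.exp 64 := by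
    calc (1 + |v|) ^ (k + 2) * (|heatPoly k v| * Real.exp (-v ^ 2 / 4))
        ≤ (1 + |v|) ^ 5 * ((1 + |v|) ^ 3 * Real.exp (-v ^ 2 / 4)) := by
          gcongr
          · linarith [abs_nonneg v]
          · omega
          · exact abs_heatPoly_le k v
      _ = (1 + |v|) ^ 8 * Real.exp (-v ^ 2 / 4) := by ring
      _ ≤ _ := pow_mul_exp_neg_le v
  calc _ ≤ 1 * s⁻¹ ^ (k + 1) * (|heatPoly k v| * Real.exp (-v ^ 2 / 4)) := by gcongr
    _ ≤ 1 * s⁻¹ ^ (k + 1) * (Real.exp 64 * ((1 + |v|) ^ (k + 2))⁻¹) := by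
        refine mul_le_mul_of_nonneg_left ?_ (by positivity)
        rw [← div_eq_mul_inv, le_div_iff₀ (by positivity)]; linarith
    _ = _ := by
        rw [mul_pow, inv_pow]; field_simp; ring

lemma heatKernel_nonneg (z : ℝ × ℝ) : 0 ≤ heatKernel z := by
  unfold heatKernel; split_ifs <;> positivity

lemma integrable_heatKernel {t : ℝ} (ht : 0 < t) : Integrable fun x => heatKernel (t, x) := by
  simp only [heatKernel, if_pos ht]
  apply Integrable.const_mul
  convert! integrable_exp_neg_mul_sq (b := 1 / (4 * t)) (by positivity) using 2 with x
  congr 1; field_simp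

lemma integral_heatKernel {t : ℝ} (ht : 0 < t) : ∫ x, heatKernel (t, x) = 1 := by
  simp only [heatKernel, if_pos ht]
  rw [integral_const_mul]
  have : ∀ x : ℝ, -x ^ 2 / (4 * t) = -(1 / (4 * t)) * x ^ 2 := fun x => by field_simp
  simp_rw [this, integral_gaussian]
  rw [show Real.pi / (1 / (4 * t)) = 4 * Real.pi * t by field_simp]
  exact inv_mul_cancel₀ (by positivity)

/-! ### The truncated heat kernel -/

section
variable {K : ℝ × ℝ → ℝ} {C r : ℝ}

lemma isOpen_parNorm_lt (R : ℝ) : IsOpen {z | parNorm z < R} :=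
  isOpen_lt continuous_parNorm continuous_const

lemma isOpen_lt_parNorm (R : ℝ) : IsOpen {z | R < parNorm z} :=
  isOpen_lt continuous_const continuous_parNorm

lemma isCompact_parNorm_le (R : ℝ) : IsCompact {z | parNorm z ≤ R} := by
  apply (isCompact_Icc (a := ((-R ^ 2, -R) : ℝ × ℝ)) (b := (R ^ 2, R))).of_isClosed_subset
    (isClosed_le continuous_parNorm continuous_const)
  intro z hz
  have hz : parNorm z ≤ R := hz
  have h1 := abs_le.1 ((abs_fst_le_parNorm_sq z).trans
    (pow_le_pow_left₀ (parNorm_nonneg z) hz 2))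
  have h2 := abs_le.1 ((abs_snd_le_parNorm z).trans hz)
  exact ⟨⟨h1.1, h2.1⟩, ⟨h1.2, h2.2⟩⟩

lemma IsTruncatedHeatKernel.iterate_causal (hK : IsTruncatedHeatKernel K C r) (k : ℕ) {t : ℝ}
    (ht : t ≤ 0) (x : ℝ) : spaceDeriv^[k] K (t, x) = 0 :=
  spaceDeriv_of_slice_zero (fun x => hK.causal t x ht) k x

lemma IsTruncatedHeatKernel.iterate_supported (hK : IsTruncatedHeatKernel K C r) (k : ℕ)
    {z : ℝ × ℝ} (hz : C < parNorm z) : spaceDeriv^[k] K z = 0 := by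
  have := iterate_spaceDeriv_eq_of_eqOn (isOpen_lt_parNorm C)
    (A := K) (B := fun _ => 0) (fun w hw => hK.supported w hw) k hz
  rw [this, iterate_spaceDeriv_zero]

lemma IsTruncatedHeatKernel.iterate_eq_heat (hK : IsTruncatedHeatKernel K C r) (k : ℕ)
    {z : ℝ × ℝ} (hz : parNorm z < C / 2) : spaceDeriv^[k] K z = spaceDeriv^[k] heatKernel z :=
  iterate_spaceDeriv_eq_of_eqOn (isOpen_parNorm_lt (C / 2))
    (fun w hw => hK.eq_heat w (le_of_lt hw)) k hz

lemma IsTruncatedHeatKernel.measurable_iterate (hK : IsTruncatedHeatKernel K C r) (k : ℕ) :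
    Measurable (spaceDeriv^[k] K) := by
  have h := (contDiffOn_iterate_spaceDeriv hK.smooth k).continuousOn
  have h2 : spaceDeriv^[k] K = ({0}ᶜ : Set (ℝ × ℝ)).indicator (spaceDeriv^[k] K) := by
    funext z
    by_cases hz : z = 0
    · subst hz
      simp only [indicator, mem_compl_iff, mem_singleton_iff, not_true_eq_false, if_false]
      exact hK.iterate_causal k le_rfl 0
    · simp [indicator, hz]
  rw [h2, ← piecewise_eq_indicator]
  classical
  exact h.measurable_piecewise continuousOn_const (measurableSet_singleton 0).compl

/-- Derivatives of a truncated heat kernel have the scaling of those of the heat kernel. -/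
lemma IsTruncatedHeatKernel.exists_bound (hK : IsTruncatedHeatKernel K C r) (hC : 0 < C) (k : ℕ) (hk : k ≤ 3) :
    ∃ c : ℝ, 0 < c ∧ ∀ z, |spaceDeriv^[k] K z| ≤ c * (parNorm z ^ (k + 1))⁻¹ := by
  -- In the annulus between the radii `C/2` and `C` nothing is known but smoothness, so compactness
  -- is used; inside the kernel is the heat kernel, outside it vanishes.
  have hcpt : IsCompact ({z | parNorm z ≤ C} ∩ {z | C / 2 ≤ parNorm z}) :=
    (isCompact_parNorm_le C).inter_right (isClosed_le continuous_const continuous_parNorm)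
  obtain ⟨M, hM⟩ := hcpt.exists_bound_of_continuousOn (f := spaceDeriv^[k] K)
    ((contDiffOn_iterate_spaceDeriv hK.smooth k).continuousOn.mono fun z hz => by
      have : C / 2 ≤ parNorm z := hz.2
      exact parNorm_pos_iff.1 (by linarith))
  refine ⟨Real.exp 64 + |M| * C ^ (k + 1), by positivity, fun z => ?_⟩
  rcases lt_or_ge C (parNorm z) with h1 | h1
  · rw [hK.iterate_supported k h1, abs_zero]
    have := parNorm_nonneg z; positivity
  rcases lt_or_ge (parNorm z) (C / 2) with h2 | h2
  · rcases le_or_gt z.1 0 with h3 | h3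
    · rw [show z = (z.1, z.2) from rfl, hK.iterate_causal k h3, abs_zero]
      have := parNorm_nonneg (z.1, z.2); positivity
    · rw [hK.iterate_eq_heat k h2]
      have h4 := abs_iterate_spaceDeriv_heat_le h3 k hk z.2
      have h5 : 0 < parNorm z := parNorm_pos_iff.2 (mk_ne_zero_of_pos h3 z.2)
      have h6 : √z.1 ≤ parNorm z := by
        have := sqrt_abs_fst_le_parNorm z; rwa [abs_of_pos h3] at this
      calc |spaceDeriv^[k] heatKernel z| ≤ Real.exp 64 * √z.1 * (parNorm z ^ (k + 2))⁻¹ := h4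
        _ ≤ Real.exp 64 * parNorm z * (parNorm z ^ (k + 2))⁻¹ := by gcongr
        _ = Real.exp 64 * (parNorm z ^ (k + 1))⁻¹ := by rw [pow_succ _ (k + 1)]; field_simp
        _ ≤ _ := by
          gcongr
          have : 0 ≤ |M| * C ^ (k + 1) := by positivity
          linarith
  · have h3 := hM z ⟨h1, h2⟩
    have h5 : 0 < parNorm z := by linarith
    rw [Real.norm_eq_abs] at h3
    calc _ ≤ |M| := h3.trans (le_abs_self M)
      _ ≤ |M| * C ^ (k + 1) * (parNorm z ^ (k + 1))⁻¹ := by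
        rw [← div_eq_mul_inv, le_div_iff₀ (by positivity)]
        gcongr
      _ ≤ _ := by
        gcongr
        linarith [Real.exp_pos 64]

lemma IsTruncatedHeatKernel.contDiff_slice (hK : IsTruncatedHeatKernel K C r) (k : ℕ) {t : ℝ} (ht : 0 < t) :
    ContDiff ℝ ∞ fun x => spaceDeriv^[k] K (t, x) := by
  rw [contDiff_iff_contDiffAt]
  intro x
  have h1 := (contDiffOn_iterate_spaceDeriv hK.smooth k).contDiffAt
    (isOpen_compl_singleton.mem_nhds (mk_ne_zero_of_pos ht x))
  exact h1.comp x (contDiff_const.prodMk contDiff_id).contDiffAt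

lemma IsTruncatedHeatKernel.hasDerivAt_slice (hK : IsTruncatedHeatKernel K C r) (k : ℕ) (t x : ℝ) (h : t ≠ 0) :
    HasDerivAt (fun x => spaceDeriv^[k] K (t, x)) (spaceDeriv^[k + 1] K (t, x)) x := by
  rw [Function.iterate_succ_apply']
  apply hasDerivAt_spaceDeriv (contDiffOn_iterate_spaceDeriv hK.smooth k)
  intro h'; exact h (congrArg Prod.fst h')

/-- Integrating the pointwise bound `c ‖z‖⁻¹` in space would give a logarithm as `t → 0`. Keeping
the heat kernel itself, of mass one, gives an `L¹` bound uniform in time. -/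
lemma IsTruncatedHeatKernel.abs_le_heat_add (hK : IsTruncatedHeatKernel K C r) (hC : 0 < C) :
    ∃ M : ℝ, 0 < M ∧ ∀ t x, |K (t, x)| ≤ heatKernel (t, x) + (Icc (-C) C).indicator (fun _ => M) x := by
  obtain ⟨c, hc, H⟩ := hK.exists_bound hC 0 (by norm_num)
  refine ⟨c * (2 / C), by positivity, fun t x => ?_⟩
  have hn := heatKernel_nonneg (t, x)
  have hi : 0 ≤ (Icc (-C) C).indicator (fun _ => c * (2 / C)) x :=
    indicator_nonneg (fun _ _ => by positivity) _
  rcases lt_or_ge C (parNorm (t, x)) with h1 | h1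
  · rw [hK.supported _ h1, abs_zero]; positivity
  rcases le_or_gt (parNorm (t, x)) (C / 2) with h2 | h2
  · rw [hK.eq_heat _ h2, abs_of_nonneg hn]; linarith
  · have h3 : x ∈ Icc (-C) C := abs_le.1 ((abs_snd_le_parNorm (t, x)).trans h1)
    rw [indicator_of_mem h3]
    have h4 := H (t, x)
    simp only [Function.iterate_zero, id, zero_add, pow_one] at h4
    have : c * (parNorm (t, x))⁻¹ ≤ c * (2 / C) := by
      rw [show 2 / C = (C / 2)⁻¹ by rw [inv_div]]
      gcongr
    linarith

lemma IsTruncatedHeatKernel.exists_L1_bound (hK : IsTruncatedHeatKernel K C r) (hC : 0 < C) :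
    ∃ c : ℝ, 0 < c ∧ ∀ t, 0 < t → Integrable (fun x => K (t, x)) ∧ ∫ x, |K (t, x)| ≤ c := by
  obtain ⟨M, hM, H⟩ := hK.abs_le_heat_add hC
  refine ⟨1 + M * (2 * C), by positivity, fun t ht => ?_⟩
  have hi : Integrable ((Icc (-C) C).indicator (fun _ : ℝ => M)) :=
    (integrableOn_const (by simp) : IntegrableOn (fun _ : ℝ => M) (Icc (-C) C)).integrable_indicator measurableSet_Icc
  have hI := (integrable_heatKernel ht).add hi
  have hfint : Integrable (fun x => K (t, x)) :=
    hI.mono' (hK.contDiff_slice 0 ht).continuous.aestronglyMeasurable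
      (ae_of_all _ fun x => by simpa using H t x)
  refine ⟨hfint, ?_⟩
  calc ∫ x, |K (t, x)| ≤ ∫ x, (heatKernel (t, x) + (Icc (-C) C).indicator (fun _ => M) x) :=
        integral_mono hfint.abs hI (fun x => H t x)
    _ = _ := by
        rw [integral_add (integrable_heatKernel ht) hi, integral_heatKernel ht, integral_indicator measurableSet_Icc]
        simp [hC.le]; ring

end

end FracKPZ

/-! ### The singular integral for `∂ₓ^γ ∂ₓ` and the order of the kernel `∂ₓ^γ K'` -/

namespace FracKPZ
open Set ENNReal

/-- Up to a constant, the value at `x` of `(-Δ)^{γ/2} φ'`, written in terms of `φ`. -/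
noncomputable def fracInt (γ : ℝ) (φ φ' : ℝ → ℝ) (x : ℝ) : ℝ :=
  ∫ y in Ioi (0 : ℝ), (2 * y * φ' x - φ (x + y) + φ (x - y)) * y ^ (-2 - γ)

/-- A Lipschitz regularisation of `sign y |y|^{-2-γ}` at scale `R`. -/
noncomputable def farKer (γ R y : ℝ) : ℝ := y * max |y| R ^ (-3 - γ)

lemma farKer_neg (γ R y : ℝ) : farKer γ R (-y) = -farKer γ R y := by simp [farKer]

lemma continuous_farKer {γ R : ℝ} (hR : 0 < R) : Continuous (farKer γ R) := by
  unfold farKer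
  refine continuous_id.mul (Continuous.rpow_const (by fun_prop) fun y => Or.inl ?_)
  exact (lt_max_of_lt_right hR).ne'

lemma abs_farKer_le {γ R : ℝ} (hγ : 0 ≤ γ) (hR : 0 < R) (y : ℝ) : |farKer γ R y| ≤ R ^ (-2 - γ) := by
  have hm : 0 < max |y| R := lt_max_of_lt_right hR
  rw [farKer, abs_mul, abs_of_pos (show 0 < max |y| R ^ (-3 - γ) by positivity)]
  calc |y| * max |y| R ^ (-3 - γ) ≤ max |y| R * max |y| R ^ (-3 - γ) := by gcongr; exact le_max_left _ _
    _ = max |y| R ^ (-2 - γ) := by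
      rw [show -2 - γ = 1 + (-3 - γ) by ring, Real.rpow_add hm, Real.rpow_one]
    _ ≤ _ := Real.rpow_le_rpow_of_nonpos hR (le_max_right _ _) (by linarith)

lemma abs_rpow_neg_sub_le {p a b : ℝ} (hp : 0 ≤ p) (ha : 0 < a) (hab : a ≤ b) :
    |a ^ (-p) - b ^ (-p)| ≤ p * a ^ (-p - 1) * (b - a) := by
  have := (convex_Icc a b).norm_image_sub_le_of_norm_hasDerivWithin_le (f := fun x : ℝ => x ^ (-p))
    (f' := fun x => -p * x ^ (-p - 1)) (C := p * a ^ (-p - 1)) (x := b) (y := a)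
    (fun x hx => (Real.hasDerivAt_rpow_const (Or.inl (ha.trans_le hx.1).ne')).hasDerivWithinAt)
    (fun x hx => by
      have hx0 : 0 < x := ha.trans_le hx.1
      rw [Real.norm_eq_abs, abs_mul, abs_neg, abs_of_nonneg hp, abs_of_pos (Real.rpow_pos_of_pos hx0 _)]
      exact mul_le_mul_of_nonneg_left (Real.rpow_le_rpow_of_nonpos ha hx.1 (by linarith)) hp)
    ⟨hab, le_rfl⟩ ⟨le_rfl, hab⟩
  rw [Real.norm_eq_abs, Real.norm_eq_abs] at this
  rw [abs_of_nonpos (by linarith : a - b ≤ 0)] at this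
  simpa using this

/-- Linear inside `[-R, R]` and a smooth power outside, with no jump: this is what allows an
increment of the singular integral to be moved onto the kernel. A sharp cutoff at `R` would not. -/
lemma abs_farKer_sub_le {γ R : ℝ} (hγ : 0 ≤ γ) (hR : 0 < R) (y y' : ℝ) :
    |farKer γ R y - farKer γ R y'| ≤ (4 + γ) * R ^ (-3 - γ) * |y - y'| := by
  wlog h : max |y'| R ≤ max |y| R generalizing y y'
  · rw [abs_sub_comm, abs_sub_comm y y']
    exact this y' y (le_of_not_ge h)
  set m := max |y| R
  set m' := max |y'| R
  have hm' : 0 < m' := lt_max_of_lt_right hR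
  have hRm' : R ≤ m' := le_max_right _ _
  have hy' : |y'| ≤ m' := le_max_left _ _
  have hmm : m - m' ≤ |y - y'| := by
    have h1 := abs_max_sub_max_le_max |y| R |y'| R
    have h2 := abs_abs_sub_abs_le y y'
    simp only [sub_self, abs_zero] at h1
    have h3 : max |(|y| - |y'|)| 0 ≤ |y - y'| := max_le h2 (abs_nonneg _)
    exact (le_abs_self _).trans (h1.trans h3)
  have e : farKer γ R y - farKer γ R y' = (y - y') * m ^ (-3 - γ) - y' * (m' ^ (-3 - γ) - m ^ (-3 - γ)) := by
    simp only [farKer]; ring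
  have hr := abs_rpow_neg_sub_le (p := 3 + γ) (by linarith) hm' h
  rw [show -(3 + γ) = -3 - γ by ring] at hr
  rw [e]
  calc _ ≤ |y - y'| * m ^ (-3 - γ) + |y'| * |m' ^ (-3 - γ) - m ^ (-3 - γ)| := by
        refine (abs_sub _ _).trans ?_
        rw [abs_mul, abs_mul, abs_of_nonneg (Real.rpow_nonneg (hm'.le.trans h) _)]
    _ ≤ |y - y'| * R ^ (-3 - γ) + m' * ((3 + γ) * m' ^ (-3 - γ - 1) * |y - y'|) := by
        gcongr ?_ + ?_
        · gcongr ?_ * ?_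
          exact Real.rpow_le_rpow_of_nonpos hR (hRm'.trans h) (by linarith)
        · refine mul_le_mul hy' (hr.trans ?_) (abs_nonneg _) hm'.le
          gcongr
    _ = |y - y'| * R ^ (-3 - γ) + (3 + γ) * m' ^ (-3 - γ) * |y - y'| := by
        rw [Real.rpow_sub_one hm'.ne']; field_simp
    _ ≤ |y - y'| * R ^ (-3 - γ) + (3 + γ) * R ^ (-3 - γ) * |y - y'| := by
        have := Real.rpow_le_rpow_of_nonpos hR hRm' (show -3 - γ ≤ 0 by linarith)
        gcongr ?_ + _ * ?_ * _
        exact le_rfl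
    _ = _ := by ring

lemma farKer_of_le {γ R y : ℝ} (hR : 0 < R) (hy : R ≤ y) : farKer γ R y = y ^ (-2 - γ) := by
  have : 0 < y := hR.trans_le hy
  rw [farKer, abs_of_pos this, max_eq_left hy, show -2 - γ = 1 + (-3 - γ) by ring, Real.rpow_add this, Real.rpow_one]

lemma abs_sub_farKer_le {γ R y : ℝ} (hγ : 0 ≤ γ) (hy0 : 0 < y) (hy : y ≤ R) :
    |y ^ (-2 - γ) - farKer γ R y| ≤ y ^ (-2 - γ) := by
  rw [farKer, abs_of_pos hy0, max_eq_right hy]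
  have h1 : 0 ≤ y * R ^ (-3 - γ) := mul_nonneg hy0.le (Real.rpow_nonneg (hy0.le.trans hy) _)
  have h2 : y * R ^ (-3 - γ) ≤ y ^ (-2 - γ) := by
    rw [show -2 - γ = 1 + (-3 - γ) by ring, Real.rpow_add hy0, Real.rpow_one]
    gcongr y * ?_
    exact Real.rpow_le_rpow_of_nonpos hy0 hy (by linarith)
  rw [abs_le]; constructor <;> linarith

/-- The linear parts cancel; the remainder is the mean value inequality for `g(s) - g₁(0) s` on
`[-y, y]`. An error of order `y²` is enough against `y^{-2-γ}` since `γ < 1`. -/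
lemma abs_second_diff_le {g g₁ g₂ : ℝ → ℝ} {R M : ℝ} (h1 : ∀ y, HasDerivAt g (g₁ y) y)
    (h2 : ∀ y, HasDerivAt g₁ (g₂ y) y) (hM : ∀ s, |s| ≤ R → |g₂ s| ≤ M) {y : ℝ} (hy : 0 < y) (hyR : y ≤ R) :
    |2 * y * g₁ 0 - g y + g (-y)| ≤ 2 * M * y ^ 2 := by
  have hb : ∀ s ∈ Icc (-y) y, |g₁ s - g₁ 0| ≤ M * y := by
    intro s hs
    have := (convex_Icc (-y) y).norm_image_sub_le_of_norm_hasDerivWithin_le (f := g₁) (f' := g₂) (C := M)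
      (fun x _ => (h2 x).hasDerivWithinAt)
      (fun x hx => hM x ((abs_le.2 hx).trans hyR)) (⟨by linarith, hy.le⟩ : (0:ℝ) ∈ Icc (-y) y) hs
    have hM0 : 0 ≤ M := (abs_nonneg _).trans (hM 0 (by rw [abs_zero]; linarith))
    rw [Real.norm_eq_abs, Real.norm_eq_abs, sub_zero] at this
    refine this.trans ?_
    gcongr; exact abs_le.2 hs
  have := (convex_Icc (-y) y).norm_image_sub_le_of_norm_hasDerivWithin_le
    (f := fun s => g s - g₁ 0 * s) (f' := fun s => g₁ s - g₁ 0 * 1) (C := M * y) (x := -y) (y := y)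
    (fun x _ => ((h1 x).sub ((hasDerivAt_id x).const_mul _)).hasDerivWithinAt)
    (fun x hx => by simpa using hb x hx) ⟨le_rfl, by linarith⟩ ⟨by linarith, le_rfl⟩
  rw [Real.norm_eq_abs, Real.norm_eq_abs] at this
  have e : y - -y = 2 * y := by ring
  rw [e, abs_of_pos (by linarith : (0:ℝ) < 2 * y)] at this
  rw [abs_sub_comm] at this
  calc _ = |g (-y) - g₁ 0 * -y - (g y - g₁ 0 * y)| := by congr 1; ring
    _ ≤ _ := this
    _ = _ := by ring

section
variable {g g₁ g₂ : ℝ → ℝ} {γ R M : ℝ}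

lemma integrableOn_near (hγ : 0 < γ) (hγ1 : γ < 1) (hR : 0 < R) (h1 : ∀ y, HasDerivAt g (g₁ y) y)
    (h2 : ∀ y, HasDerivAt g₁ (g₂ y) y) (hM : ∀ s, |s| ≤ R → |g₂ s| ≤ M) :
    IntegrableOn (fun y => (2 * y * g₁ 0 - g y + g (-y)) * (y ^ (-2 - γ) - farKer γ R y)) (Ioi 0) ∧
    ∫ y in Ioi 0, |(2 * y * g₁ 0 - g y + g (-y)) * (y ^ (-2 - γ) - farKer γ R y)| ≤
      2 / (1 - γ) * R ^ (1 - γ) * M := by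
  have hgc : Continuous g := continuous_iff_continuousAt.2 fun x => (h1 x).continuousAt
  have hi : IntegrableOn (fun y : ℝ => 2 * M * y ^ (-γ)) (Ioc 0 R) :=
    (((intervalIntegrable_iff_integrableOn_Ioc_of_le hR.le).1
      (intervalIntegral.intervalIntegrable_rpow' (by linarith)))).const_mul _
  have hi' : IntegrableOn ((Ioc 0 R).indicator fun y : ℝ => 2 * M * y ^ (-γ)) (Ioi 0) :=
    (hi.integrable_indicator measurableSet_Ioc).integrableOn
  have hb : ∀ y ∈ Ioi (0 : ℝ), ‖(2 * y * g₁ 0 - g y + g (-y)) * (y ^ (-2 - γ) - farKer γ R y)‖ ≤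
      (Ioc 0 R).indicator (fun y : ℝ => 2 * M * y ^ (-γ)) y := by
    intro y hy
    have hy : 0 < y := hy
    by_cases hyR : y ≤ R
    · rw [indicator_of_mem (show y ∈ Ioc 0 R from ⟨hy, hyR⟩), norm_mul, Real.norm_eq_abs, Real.norm_eq_abs]
      calc _ ≤ 2 * M * y ^ 2 * y ^ (-2 - γ) := by
            gcongr
            · have hM0 : 0 ≤ M := (abs_nonneg _).trans (hM 0 (by rw [abs_zero]; linarith))
              positivity
            · exact abs_second_diff_le h1 h2 hM hy hyR
            · exact abs_sub_farKer_le hγ.le hy hyR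
        _ = _ := by
            rw [mul_assoc, show -γ = (2 : ℕ) + (-2 - γ) by push_cast; ring, Real.rpow_add hy, Real.rpow_natCast]
    · rw [farKer_of_le hR (not_le.1 hyR).le]; simp
      exact indicator_nonneg (fun y hy => by
        have hM0 : 0 ≤ M := (abs_nonneg _).trans (hM 0 (by rw [abs_zero]; linarith))
        have := hy.1; positivity) y
  have hmeas : AEStronglyMeasurable (fun y => (2 * y * g₁ 0 - g y + g (-y)) * (y ^ (-2 - γ) - farKer γ R y))
      (volume.restrict (Ioi 0)) := by
    have := (continuous_farKer (γ := γ) hR).measurable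
    have := hgc.measurable
    apply Measurable.aestronglyMeasurable
    fun_prop
  have hb' := (ae_restrict_iff' measurableSet_Ioi).2 (ae_of_all volume hb)
  have hI := hi'.mono' hmeas hb'
  refine ⟨hI, ?_⟩
  calc _ ≤ ∫ y in Ioi 0, (Ioc 0 R).indicator (fun y : ℝ => 2 * M * y ^ (-γ)) y :=
        integral_mono_ae hI.abs hi' hb'
    _ = ∫ y in Ioc 0 R, 2 * M * y ^ (-γ) := by
        rw [integral_indicator measurableSet_Ioc, Measure.restrict_restrict measurableSet_Ioc]
        congr 2; ext; simp +contextual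
    _ = _ := by
        rw [← intervalIntegral.integral_of_le hR.le, intervalIntegral.integral_const_mul,
          integral_rpow (Or.inl (by linarith)), Real.zero_rpow (by linarith)]
        rw [show -γ + 1 = 1 - γ by ring]; ring

lemma integrableOn_mul_farKer (hγ : 0 < γ) (hR : 0 < R) :
    IntegrableOn (fun y => y * farKer γ R y) (Ioi 0) ∧
    |∫ y in Ioi 0, y * farKer γ R y| ≤ (1 + 1 / γ) * R ^ (-γ) := by
  have hi : IntegrableOn (fun y : ℝ => R ^ (-1 - γ)) (Ioc 0 R) := integrableOn_const (by simp)
  have hj : IntegrableOn (fun y : ℝ => y ^ (-1 - γ)) (Ioi R) := integrableOn_Ioi_rpow_of_lt (by linarith) hR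
  have hi' := (hi.integrable_indicator measurableSet_Ioc).add (hj.integrable_indicator measurableSet_Ioi)
  have hb : ∀ y ∈ Ioi (0 : ℝ), ‖y * farKer γ R y‖ ≤ (Ioc 0 R).indicator (fun y : ℝ => R ^ (-1 - γ)) y +
      (Ioi R).indicator (fun y : ℝ => y ^ (-1 - γ)) y := by
    intro y hy
    have hy : 0 < y := hy
    by_cases hyR : y ≤ R
    · rw [indicator_of_mem (show y ∈ Ioc 0 R from ⟨hy, hyR⟩), indicator_of_notMem (by simpa using hyR), add_zero,
        norm_mul, Real.norm_eq_abs, Real.norm_eq_abs, abs_of_pos hy]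
      calc _ ≤ R * R ^ (-2 - γ) := by gcongr; exact abs_farKer_le hγ.le hR y
        _ = _ := by rw [show -1 - γ = 1 + (-2 - γ) by ring, Real.rpow_add hR, Real.rpow_one]
    · have hyR' := not_le.1 hyR
      rw [indicator_of_notMem (by simp [hyR]), indicator_of_mem (show y ∈ Ioi R from hyR'), zero_add,
        farKer_of_le hR hyR'.le, Real.norm_eq_abs, abs_of_pos (by positivity),
        show -1 - γ = 1 + (-2 - γ) by ring, Real.rpow_add hy, Real.rpow_one]
  have hmeas : AEStronglyMeasurable (fun y => y * farKer γ R y) (volume.restrict (Ioi 0)) :=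
    (continuous_id.mul (continuous_farKer hR)).aestronglyMeasurable
  have hb' := (ae_restrict_iff' measurableSet_Ioi).2 (ae_of_all volume hb)
  refine ⟨hi'.integrableOn.mono' hmeas hb', ?_⟩
  have hii : Integrable ((Ioc 0 R).indicator (fun y : ℝ => R ^ (-1 - γ))) (volume.restrict (Ioi 0)) :=
    (hi.integrable_indicator measurableSet_Ioc).integrableOn
  have hjj : Integrable ((Ioi R).indicator (fun y : ℝ => y ^ (-1 - γ))) (volume.restrict (Ioi 0)) :=
    (hj.integrable_indicator measurableSet_Ioi).integrableOn
  calc _ ≤ ∫ y in Ioi 0, ((Ioc 0 R).indicator (fun y : ℝ => R ^ (-1 - γ)) y +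
      (Ioi R).indicator (fun y : ℝ => y ^ (-1 - γ)) y) := norm_integral_le_of_norm_le hi'.integrableOn hb'
    _ = (∫ y in Ioc 0 R, R ^ (-1 - γ)) + ∫ y in Ioi R, y ^ (-1 - γ) := by
        rw [integral_add hii hjj,
          integral_indicator measurableSet_Ioc, Measure.restrict_restrict measurableSet_Ioc,
          integral_indicator measurableSet_Ioi, Measure.restrict_restrict measurableSet_Ioi]
        congr 3
        · ext; simp +contextual
        · rw [inter_eq_left]; exact Ioi_subset_Ioi hR.le
    _ = _ := by
        rw [integral_Ioi_rpow_of_lt (by linarith) hR]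
        simp only [integral_const, MeasurableSet.univ, measureReal_restrict_apply, univ_inter, Real.volume_real_Ioc,
          sub_zero, smul_eq_mul, max_eq_left hR.le]
        rw [show -1 - γ = -γ - 1 by ring, Real.rpow_sub_one hR.ne']
        rw [show -γ - 1 + 1 = -γ by ring]; field_simp

lemma integrable_mul_farKer (hγ : 0 ≤ γ) (hR : 0 < R) (hg : Integrable g) :
    Integrable fun y => g y * farKer γ R y :=
  hg.mul_bdd (c := R ^ (-2 - γ)) (continuous_farKer hR).aestronglyMeasurable
    (ae_of_all _ fun y => abs_farKer_le hγ hR y)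

/-- Splitting `fracInt` at distance `R` from the base point. -/
lemma abs_fracInt_zero_add_le (hγ : 0 < γ) (hγ1 : γ < 1) (hR : 0 < R) (h1 : ∀ y, HasDerivAt g (g₁ y) y)
    (h2 : ∀ y, HasDerivAt g₁ (g₂ y) y) (hM : ∀ s, |s| ≤ R → |g₂ s| ≤ M) (hg : Integrable g) :
    IntegrableOn (fun y => (2 * y * g₁ 0 - g y + g (-y)) * y ^ (-2 - γ)) (Ioi 0) ∧
    |(∫ y in Ioi 0, (2 * y * g₁ 0 - g y + g (-y)) * y ^ (-2 - γ)) + ∫ y, g y * farKer γ R y| ≤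
      2 / (1 - γ) * R ^ (1 - γ) * M + 2 * (1 + 1 / γ) * R ^ (-γ) * |g₁ 0| := by
  obtain ⟨I1, B1'⟩ := integrableOn_near hγ hγ1 hR h1 h2 hM
  have B1 := (abs_integral_le_integral_abs (μ := volume.restrict (Ioi 0))
    (f := fun y => (2 * y * g₁ 0 - g y + g (-y)) * (y ^ (-2 - γ) - farKer γ R y))).trans B1'
  obtain ⟨I2, B2⟩ := integrableOn_mul_farKer (γ := γ) hγ hR
  have I3 := integrable_mul_farKer hγ.le hR hg
  have I3' : IntegrableOn (fun y => g y * farKer γ R y) (Ioi 0) := I3.integrableOn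
  have I4 : IntegrableOn (fun y => g (-y) * farKer γ R y) (Ioi 0) := by
    have := I3.comp_neg.neg
    simp only [farKer_neg] at this
    refine this.integrableOn.congr_fun ?_ measurableSet_Ioi
    intro y _; simp
  have e : ∀ y, (2 * y * g₁ 0 - g y + g (-y)) * y ^ (-2 - γ) =
      (2 * y * g₁ 0 - g y + g (-y)) * (y ^ (-2 - γ) - farKer γ R y) +
      (2 * g₁ 0 * (y * farKer γ R y) - g y * farKer γ R y + g (-y) * farKer γ R y) := fun y => by ring
  simp_rw [e]
  have I5 : IntegrableOn (fun y => 2 * g₁ 0 * (y * farKer γ R y)) (Ioi 0) := I2.const_mul _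
  refine ⟨I1.add ((I5.sub I3').add I4), ?_⟩
  have E1 := integral_add I1 ((I5.sub I3').add I4)
  have E2 := integral_add (I5.sub I3') I4
  have E3 := integral_sub I5 I3'
  simp only [Pi.add_apply, Pi.sub_apply] at E1 E2 E3
  rw [E1, E2, E3, integral_const_mul]
  -- The regularised kernel is odd, so the two one-sided integrals of `g` against it combine into
  -- one integral over the line.
  have e2 : ∫ y in Ioi 0, g (-y) * farKer γ R y = -∫ y in Iic 0, g y * farKer γ R y := by
    have := integral_comp_neg_Ioi 0 (fun y => g y * farKer γ R y)
    simp only [farKer_neg, neg_zero, mul_neg] at this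
    rw [integral_neg] at this
    linarith
  have e3 : ∫ y, g y * farKer γ R y = (∫ y in Iic 0, g y * farKer γ R y) + ∫ y in Ioi 0, g y * farKer γ R y :=
    (intervalIntegral.integral_Iic_add_Ioi I3.integrableOn I3.integrableOn).symm
  rw [e2, e3]
  set X := ∫ y in Ioi 0, (2 * y * g₁ 0 - g y + g (-y)) * (y ^ (-2 - γ) - farKer γ R y)
  set Y := ∫ y in Ioi 0, y * farKer γ R y
  set Z := ∫ y in Ioi 0, g y * farKer γ R y
  set W := ∫ y in Iic 0, g y * farKer γ R y
  have h5 : |2 * g₁ 0 * Y| ≤ 2 * (1 + 1 / γ) * R ^ (-γ) * |g₁ 0| := by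
    rw [abs_mul, abs_mul, abs_two]
    nlinarith [mul_le_mul_of_nonneg_left B2 (abs_nonneg (g₁ 0))]
  calc |X + (2 * g₁ 0 * Y - Z + -W) + (W + Z)| = |X + 2 * g₁ 0 * Y| := by congr 1; ring
    _ ≤ |X| + |2 * g₁ 0 * Y| := abs_add_le _ _
    _ ≤ _ := by gcongr

lemma abs_fracInt_zero_le (hγ : 0 < γ) (hγ1 : γ < 1) (hR : 0 < R) (h1 : ∀ y, HasDerivAt g (g₁ y) y)
    (h2 : ∀ y, HasDerivAt g₁ (g₂ y) y) (hM : ∀ s, |s| ≤ R → |g₂ s| ≤ M) (hg : Integrable g) :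
    IntegrableOn (fun y => (2 * y * g₁ 0 - g y + g (-y)) * y ^ (-2 - γ)) (Ioi 0) ∧
    |∫ y in Ioi 0, (2 * y * g₁ 0 - g y + g (-y)) * y ^ (-2 - γ)| ≤
      2 / (1 - γ) * R ^ (1 - γ) * M + 2 * (1 + 1 / γ) * R ^ (-γ) * |g₁ 0| + |∫ y, g y * farKer γ R y| := by
  obtain ⟨hI, hB⟩ := abs_fracInt_zero_add_le hγ hγ1 hR h1 h2 hM hg
  refine ⟨hI, ?_⟩
  set X := ∫ y in Ioi 0, (2 * y * g₁ 0 - g y + g (-y)) * y ^ (-2 - γ)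
  set Z := ∫ y, g y * farKer γ R y
  have : |X| ≤ |X + Z| + |Z| := by simpa using abs_sub (X + Z) Z
  linarith

/-- The absolute version, for Fubini when `∂ₓ^γ` is exchanged with the mollification. Far from the
base point it uses only the `L¹` norm of `g` and the sup of the kernel. -/
lemma integral_abs_fracInt_zero_le (hγ : 0 < γ) (hγ1 : γ < 1) (hR : 0 < R) (h1 : ∀ y, HasDerivAt g (g₁ y) y)
    (h2 : ∀ y, HasDerivAt g₁ (g₂ y) y) (hM : ∀ s, |s| ≤ R → |g₂ s| ≤ M) (hg : Integrable g) :
    ∫ y in Ioi 0, |(2 * y * g₁ 0 - g y + g (-y)) * y ^ (-2 - γ)| ≤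
      2 / (1 - γ) * R ^ (1 - γ) * M + 2 * (1 + 1 / γ) * R ^ (-γ) * |g₁ 0| + R ^ (-2 - γ) * ∫ y, |g y| := by
  obtain ⟨I1, B1⟩ := integrableOn_near hγ hγ1 hR h1 h2 hM
  obtain ⟨I2, B2⟩ := integrableOn_mul_farKer (γ := γ) hγ hR
  have hI := (abs_fracInt_zero_le hγ hγ1 hR h1 h2 hM hg).1
  have I5 : IntegrableOn (fun y => 2 * |g₁ 0| * (y * farKer γ R y)) (Ioi 0) := I2.const_mul _
  have I6 : IntegrableOn (fun y => R ^ (-2 - γ) * (|g y|)) (Ioi 0) := (hg.abs.const_mul _).integrableOn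
  have I7 : IntegrableOn (fun y => R ^ (-2 - γ) * (|g (-y)|)) (Ioi 0) := (hg.comp_neg.abs.const_mul _).integrableOn
  have e2 : ∫ y in Ioi 0, R ^ (-2 - γ) * |g (-y)| = ∫ y in Iic 0, R ^ (-2 - γ) * |g y| := by
    simpa using integral_comp_neg_Ioi 0 (fun y => R ^ (-2 - γ) * |g y|)
  have e3 : ∫ y, R ^ (-2 - γ) * |g y| = (∫ y in Iic 0, R ^ (-2 - γ) * |g y|) + ∫ y in Ioi 0, R ^ (-2 - γ) * |g y| :=
    (intervalIntegral.integral_Iic_add_Ioi (hg.abs.const_mul _).integrableOn (hg.abs.const_mul _).integrableOn).symm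
  calc _ ≤ ∫ y in Ioi 0, (|(2 * y * g₁ 0 - g y + g (-y)) * (y ^ (-2 - γ) - farKer γ R y)| +
        (2 * |g₁ 0| * (y * farKer γ R y) + (R ^ (-2 - γ) * |g y| + R ^ (-2 - γ) * |g (-y)|))) := by
        refine setIntegral_mono_on hI.abs (I1.abs.add (I5.add (I6.add I7))) measurableSet_Ioi fun y hy => ?_
        have hy0 : 0 < y := hy
        have hf := abs_farKer_le hγ.le hR y
        have hfp : 0 ≤ farKer γ R y := mul_nonneg hy0.le (Real.rpow_nonneg (le_max_of_le_right hR.le) _)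
        have : (2 * y * g₁ 0 - g y + g (-y)) * y ^ (-2 - γ) =
          (2 * y * g₁ 0 - g y + g (-y)) * (y ^ (-2 - γ) - farKer γ R y) +
          (2 * y * g₁ 0 - g y + g (-y)) * farKer γ R y := by ring
        rw [this]
        refine (abs_add_le _ _).trans (add_le_add le_rfl ?_)
        rw [abs_of_nonneg hfp] at hf
        rw [abs_mul, abs_of_nonneg hfp]
        calc _ ≤ (2 * y * |g₁ 0| + |g y| + |g (-y)|) * farKer γ R y := by
              gcongr
              refine (abs_add_le _ _).trans (add_le_add ((abs_sub _ _).trans ?_) le_rfl)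
              rw [abs_mul, abs_of_pos (by positivity)]
          _ = 2 * |g₁ 0| * (y * farKer γ R y) + (|g y| * farKer γ R y + |g (-y)| * farKer γ R y) := by ring
          _ ≤ 2 * |g₁ 0| * (y * farKer γ R y) + (|g y| * R ^ (-2 - γ) + |g (-y)| * R ^ (-2 - γ)) := by gcongr
          _ = _ := by ring
    _ = (∫ y in Ioi 0, |(2 * y * g₁ 0 - g y + g (-y)) * (y ^ (-2 - γ) - farKer γ R y)|) +
        (2 * |g₁ 0| * (∫ y in Ioi 0, y * farKer γ R y) + R ^ (-2 - γ) * ∫ y, |g y|) := by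
        have E1 := integral_add I1.abs (I5.add (I6.add I7))
        have E2 := integral_add I5 (I6.add I7)
        have E3 := integral_add I6 I7
        simp only [Pi.add_apply] at E1 E2 E3
        rw [E1, E2, E3, e2, add_comm (∫ y in Ioi 0, R ^ (-2 - γ) * |g y|), ← e3, integral_const_mul, integral_const_mul]
    _ ≤ _ := by
        have h5 : 2 * |g₁ 0| * (∫ y in Ioi 0, y * farKer γ R y) ≤ 2 * (1 + 1 / γ) * R ^ (-γ) * |g₁ 0| := by
          nlinarith [mul_le_mul_of_nonneg_left ((le_abs_self _).trans B2) (abs_nonneg (g₁ 0))]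
        linarith

end


lemma rpow_mul_inv_pow {R : ℝ} (hR : 0 < R) (p : ℝ) (k : ℕ) : R ^ p * (R ^ k)⁻¹ = R ^ (p - k) := by
  rw [Real.rpow_sub hR, Real.rpow_natCast, div_eq_mul_inv]

/-- Scale-invariant control on a function and its derivatives: `|φ^{(k)}(x)| ≤ M (A + |x|)^{-1-k}` for
`k ≤ 3`, and `∫ |φ| ≤ M`. -/
structure KernelControl (A M : ℝ) (φ φ₁ φ₂ φ₃ : ℝ → ℝ) : Prop where
  pos : 0 < A
  d0 : ∀ y, HasDerivAt φ (φ₁ y) y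
  d1 : ∀ y, HasDerivAt φ₁ (φ₂ y) y
  d2 : ∀ y, HasDerivAt φ₂ (φ₃ y) y
  b1 : ∀ x, |φ₁ x| ≤ M * ((A + |x|) ^ 2)⁻¹
  b2 : ∀ x, |φ₂ x| ≤ M * ((A + |x|) ^ 3)⁻¹
  b3 : ∀ x, |φ₃ x| ≤ M * ((A + |x|) ^ 4)⁻¹
  int : Integrable φ
  l1 : ∫ x, |φ x| ≤ M

section
variable {A M γ : ℝ} {φ φ₁ φ₂ φ₃ : ℝ → ℝ}

lemma KernelControl.nonneg (H : KernelControl A M φ φ₁ φ₂ φ₃) : 0 ≤ M :=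
  (integral_nonneg fun _ => abs_nonneg _).trans H.l1

/-- Split at `R = (A + |x|)/4`: within distance `R` of `x` the derivatives still have the size
dictated by the scale `R`. The near part `R^{1-γ} R^{-3}`, the boundary part `R^{-γ} R^{-2}` and the
far part `R^{-2-γ} ‖φ‖_{L¹}` then all have the same order. -/
lemma KernelControl.fracInt_bound (H : KernelControl A M φ φ₁ φ₂ φ₃) (hγ : 0 < γ) (hγ1 : γ < 1) (x : ℝ) :
    IntegrableOn (fun y => (2 * y * φ₁ x - φ (x + y) + φ (x - y)) * y ^ (-2 - γ)) (Ioi 0) ∧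
    ∫ y in Ioi 0, |(2 * y * φ₁ x - φ (x + y) + φ (x - y)) * y ^ (-2 - γ)| ≤
      (2 / (1 - γ) + 2 * (1 + 1 / γ) + 1) * M * ((A + |x|) / 4) ^ (-2 - γ) := by
  have hM0 := H.nonneg
  have ha : 0 < A + |x| := by linarith [H.pos, abs_nonneg x]
  set R := (A + |x|) / 4 with hR'
  have hR : 0 < R := by positivity
  have haR : A + |x| = 4 * R := by rw [hR']; ring
  have hfar : ∀ s, |s| ≤ R → 2 * R ≤ A + |x + s| := by
    intro s hs
    have : |x| ≤ |x + s| + |s| := by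
      have := abs_sub (x + s) s; simpa using this
    linarith
  have key := abs_fracInt_zero_le (g := fun y => φ (x + y)) (g₁ := fun y => φ₁ (x + y)) (g₂ := fun y => φ₂ (x + y))
    (R := R) (M := M * (R ^ 3)⁻¹) hγ hγ1 hR (fun y => (H.d0 (x + y)).comp_const_add x y) (fun y => (H.d1 (x + y)).comp_const_add x y)
    (fun s hs => (H.b2 (x + s)).trans (by
      have := hfar s hs
      gcongr; linarith)) (H.int.comp_add_left x)
  have key2 := integral_abs_fracInt_zero_le (g := fun y => φ (x + y)) (g₁ := fun y => φ₁ (x + y)) (g₂ := fun y => φ₂ (x + y))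
    (R := R) (M := M * (R ^ 3)⁻¹) hγ hγ1 hR (fun y => (H.d0 (x + y)).comp_const_add x y) (fun y => (H.d1 (x + y)).comp_const_add x y)
    (fun s hs => (H.b2 (x + s)).trans (by
      have := hfar s hs
      gcongr; linarith)) (H.int.comp_add_left x)
  simp only [add_zero, ← sub_eq_add_neg] at key key2
  refine ⟨key.1, key2.trans ?_⟩
  have h1 : |φ₁ x| ≤ M * (R ^ 2)⁻¹ := (H.b1 x).trans (by
    rw [haR]; gcongr; linarith)
  have h2 : R ^ (-2 - γ) * ∫ y, |φ (x + y)| ≤ R ^ (-2 - γ) * M := by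
    rw [integral_add_left_eq_self (fun y => |φ y|)]
    exact mul_le_mul_of_nonneg_left H.l1 (by positivity)
  have e1 : R ^ (1 - γ) * (R ^ 3)⁻¹ = R ^ (-2 - γ) := by
    rw [rpow_mul_inv_pow hR]; congr 1; push_cast; ring
  have e2 : R ^ (-γ) * (R ^ 2)⁻¹ = R ^ (-2 - γ) := by
    rw [rpow_mul_inv_pow hR]; congr 1; push_cast; ring
  have hγ1' : 0 < 1 - γ := by linarith
  calc _ ≤ 2 / (1 - γ) * R ^ (1 - γ) * (M * (R ^ 3)⁻¹) + 2 * (1 + 1 / γ) * R ^ (-γ) * (M * (R ^ 2)⁻¹) + R ^ (-2 - γ) * M := by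
        gcongr
    _ = 2 / (1 - γ) * M * (R ^ (1 - γ) * (R ^ 3)⁻¹) + 2 * (1 + 1 / γ) * M * (R ^ (-γ) * (R ^ 2)⁻¹) + R ^ (-2 - γ) * M := by ring
    _ = _ := by rw [e1, e2]; ring

lemma KernelControl.abs_fracInt_le (H : KernelControl A M φ φ₁ φ₂ φ₃) (hγ : 0 < γ) (hγ1 : γ < 1) (x : ℝ) :
    |fracInt γ φ φ₁ x| ≤ (2 / (1 - γ) + 2 * (1 + 1 / γ) + 1) * M * ((A + |x|) / 4) ^ (-2 - γ) :=
  abs_integral_le_integral_abs.trans (H.fracInt_bound hγ hγ1 x).2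

/-- The splitting is applied to the difference of two translates. Near the base points one more
derivative of `φ` is spent; in the far part the translation is moved onto the Lipschitz kernel, so
that only `‖φ‖_{L¹}` is needed. -/
lemma KernelControl.fracInt_lipschitz (H : KernelControl A M φ φ₁ φ₂ φ₃) (hγ : 0 < γ) (hγ1 : γ < 1) (x x' : ℝ)
    (hx : |x - x'| ≤ (A + |x|) / 4) :
    |fracInt γ φ φ₁ x - fracInt γ φ φ₁ x'| ≤
      (2 / (1 - γ) + 2 * (1 + 1 / γ) + (4 + γ)) * M * ((A + |x|) / 4) ^ (-3 - γ) * |x - x'| := by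
  have hM0 := H.nonneg
  have ha : 0 < A + |x| := by linarith [H.pos, abs_nonneg x]
  set R := (A + |x|) / 4 with hR'
  set δ := |x - x'| with hδ
  have hR : 0 < R := by positivity
  have haR : A + |x| = 4 * R := by rw [hR']; ring
  have hfar : ∀ s, |s| ≤ 2 * R → R ≤ A + |x + s| := by
    intro s hs
    have : |x| ≤ |x + s| + |s| := by
      have := abs_sub (x + s) s; simpa using this
    linarith
  have mv : ∀ (f f' : ℝ → ℝ) (k : ℕ), (∀ y, HasDerivAt f (f' y) y) → (∀ y, |f' y| ≤ M * ((A + |y|) ^ k)⁻¹) →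
      ∀ s, |s| ≤ R → |f (x + s) - f (x' + s)| ≤ M * (R ^ k)⁻¹ * δ := by
    intro f f' k hf hb s hs
    have := (convex_Icc (x + s - R) (x + s + R)).norm_image_sub_le_of_norm_hasDerivWithin_le (f := f) (f' := f')
      (C := M * (R ^ k)⁻¹) (x := x' + s) (y := x + s) (fun y _ => (hf y).hasDerivWithinAt)
      (fun y hy => (hb y).trans (by
        have h1 : |y - x| ≤ 2 * R := by
          have h2 : |y - (x + s)| ≤ R := abs_le.2 ⟨by linarith [hy.1], by linarith [hy.2]⟩
          calc |y - x| = |(y - (x + s)) + s| := by congr 1; ring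
            _ ≤ _ := (abs_add_le _ _).trans (by linarith)
        have := hfar (y - x) h1
        rw [add_sub_cancel] at this
        gcongr))
      (by have := abs_le.1 (hδ ▸ hx); constructor <;> linarith [this.1, this.2]) ⟨by linarith, by linarith⟩
    refine this.trans (le_of_eq ?_)
    rw [hδ, Real.norm_eq_abs]; congr 2; ring
  have key := abs_fracInt_zero_le (g := fun y => φ (x + y) - φ (x' + y)) (g₁ := fun y => φ₁ (x + y) - φ₁ (x' + y))
    (g₂ := fun y => φ₂ (x + y) - φ₂ (x' + y))
    (R := R) (M := M * (R ^ 4)⁻¹ * δ) hγ hγ1 hR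
    (fun y => ((H.d0 (x + y)).comp_const_add x y).sub ((H.d0 (x' + y)).comp_const_add x' y))
    (fun y => ((H.d1 (x + y)).comp_const_add x y).sub ((H.d1 (x' + y)).comp_const_add x' y))
    (mv φ₂ φ₃ 4 H.d2 H.b3) ((H.int.comp_add_left x).sub (H.int.comp_add_left x'))
  have e : fracInt γ φ φ₁ x - fracInt γ φ φ₁ x' = ∫ y in Ioi 0, (2 * y * (φ₁ (x + 0) - φ₁ (x' + 0)) - (φ (x + y) - φ (x' + y)) +
      (φ (x + -y) - φ (x' + -y))) * y ^ (-2 - γ) := by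
    rw [fracInt, fracInt, ← integral_sub (H.fracInt_bound hγ hγ1 x).1 (H.fracInt_bound hγ hγ1 x').1]
    congr 1; funext y; simp only [add_zero, ← sub_eq_add_neg]; ring
  rw [e]
  refine key.2.trans ?_
  have h1 : |φ₁ (x + 0) - φ₁ (x' + 0)| ≤ M * (R ^ 3)⁻¹ * δ := mv φ₁ φ₂ 3 H.d1 H.b2 0 (by simpa using hR.le)
  have h2 : |∫ y, (φ (x + y) - φ (x' + y)) * farKer γ R y| ≤ (4 + γ) * R ^ (-3 - γ) * δ * M := by
    have hfint : ∀ z, Integrable fun y => φ y * farKer γ R (y - z) := fun z => by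
      have := (integrable_mul_farKer (γ := γ) hγ.le hR (H.int.comp_add_left z)).comp_sub_right z
      simpa using this
    have e3 : ∀ z, ∫ y, φ (z + y) * farKer γ R y = ∫ y, φ y * farKer γ R (y - z) := fun z => by
      rw [← integral_add_left_eq_self (fun y => φ y * farKer γ R (y - z)) z]
      simp
    have e4 : ∫ y, (φ (x + y) - φ (x' + y)) * farKer γ R y = ∫ y, φ y * (farKer γ R (y - x) - farKer γ R (y - x')) := by
      simp_rw [sub_mul, mul_sub]
      rw [integral_sub (integrable_mul_farKer hγ.le hR (H.int.comp_add_left x))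
        (integrable_mul_farKer hγ.le hR (H.int.comp_add_left x')), e3, e3, integral_sub (hfint x) (hfint x')]
    rw [e4]
    calc _ ≤ ∫ y, (4 + γ) * R ^ (-3 - γ) * δ * |φ y| := by
          rw [← Real.norm_eq_abs]
          refine norm_integral_le_of_norm_le (H.int.abs.const_mul _) (ae_of_all _ fun y => ?_)
          rw [norm_mul, mul_comm]
          refine mul_le_mul_of_nonneg_right ((abs_farKer_sub_le hγ.le hR _ _).trans (le_of_eq ?_)) (abs_nonneg _)
          rw [hδ, abs_sub_comm x x']; congr 2; ring
      _ ≤ _ := by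
          rw [integral_const_mul]
          exact mul_le_mul_of_nonneg_left H.l1 (by positivity)
  have e1 : R ^ (1 - γ) * (R ^ 4)⁻¹ = R ^ (-3 - γ) := by
    rw [rpow_mul_inv_pow hR]; congr 1; push_cast; ring
  have e2 : R ^ (-γ) * (R ^ 3)⁻¹ = R ^ (-3 - γ) := by
    rw [rpow_mul_inv_pow hR]; congr 1; push_cast; ring
  have hγ1' : 0 < 1 - γ := by linarith
  calc _ ≤ 2 / (1 - γ) * R ^ (1 - γ) * (M * (R ^ 4)⁻¹ * δ) + 2 * (1 + 1 / γ) * R ^ (-γ) * (M * (R ^ 3)⁻¹ * δ) + (4 + γ) * R ^ (-3 - γ) * δ * M := by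
        gcongr
    _ = 2 / (1 - γ) * M * (R ^ (1 - γ) * (R ^ 4)⁻¹) * δ + 2 * (1 + 1 / γ) * M * (R ^ (-γ) * (R ^ 3)⁻¹) * δ + (4 + γ) * R ^ (-3 - γ) * δ * M := by ring
    _ = _ := by rw [e1, e2]; ring

end


/-- The constant relating `fracInt` to the Fourier multiplier `(2π|ξ|)^γ`. -/
noncomputable def fracConst (γ : ℝ) : ℝ := (∫ y in Ioi (0 : ℝ), 2 * (y - Real.sin y) * y ^ (-2 - γ))⁻¹

/-- The kernel `∂ₓ^γ K'`. -/
noncomputable def fracKernel (K : ℝ × ℝ → ℝ) (γ : ℝ) (z : ℝ × ℝ) : ℝ :=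
  if γ = 0 then spaceDeriv K z
  else fracConst γ * fracInt γ (fun x => K (z.1, x)) (fun x => spaceDeriv K (z.1, x)) z.2

section
variable {K : ℝ × ℝ → ℝ} {C r : ℝ}

lemma parNorm_mk_pos {t : ℝ} (ht : 0 < t) (x : ℝ) : parNorm (t, x) = √t + |x| := by
  simp [parNorm, abs_of_pos ht]

lemma IsTruncatedHeatKernel.kernelControl (hK : IsTruncatedHeatKernel K C r) (hC : 0 < C) :
    ∃ M : ℝ, 0 < M ∧ ∀ t, 0 < t → KernelControl (√t) M (fun x => K (t, x)) (fun x => spaceDeriv K (t, x))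
      (fun x => spaceDeriv^[2] K (t, x)) (fun x => spaceDeriv^[3] K (t, x)) := by
  obtain ⟨c₁, h₁, H₁⟩ := hK.exists_bound hC 1 (by norm_num)
  obtain ⟨c₂, h₂, H₂⟩ := hK.exists_bound hC 2 (by norm_num)
  obtain ⟨c₃, h₃, H₃⟩ := hK.exists_bound hC 3 (by norm_num)
  obtain ⟨c₀, h₀, H₀⟩ := hK.exists_L1_bound hC
  refine ⟨c₀ + c₁ + c₂ + c₃, by positivity, fun t ht => ?_⟩
  refine ⟨Real.sqrt_pos.2 ht, fun y => hK.hasDerivAt_slice 0 t y ht.ne', fun y => hK.hasDerivAt_slice 1 t y ht.ne',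
    fun y => hK.hasDerivAt_slice 2 t y ht.ne', fun x => ?_, fun x => ?_, fun x => ?_, (H₀ t ht).1,
    (H₀ t ht).2.trans (by linarith)⟩
  · have := H₁ (t, x)
    rw [parNorm_mk_pos ht] at this
    refine this.trans ?_
    gcongr; linarith
  · have := H₂ (t, x)
    rw [parNorm_mk_pos ht] at this
    refine this.trans ?_
    gcongr; linarith
  · have := H₃ (t, x)
    rw [parNorm_mk_pos ht] at this
    refine this.trans ?_
    gcongr; linarith

lemma IsTruncatedHeatKernel.fracKernel_causal (hK : IsTruncatedHeatKernel K C r) (γ : ℝ) {t : ℝ} (ht : t ≤ 0) (x : ℝ) :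
    fracKernel K γ (t, x) = 0 := by
  have h1 : ∀ x, spaceDeriv K (t, x) = 0 := fun x => hK.iterate_causal 1 ht x
  unfold fracKernel
  split_ifs
  · exact h1 x
  · simp [fracInt, h1, hK.causal t _ ht]

/-- Passing from a scale-invariant Lipschitz bound to a scale-invariant `1/2`-Hölder bound. -/
lemma holder_of_lipschitz {f : ℝ → ℝ} {A c p : ℝ} (hA : 0 < A) (hc : 0 ≤ c) (_hp : 0 ≤ p)
    (h0 : ∀ x, |f x| ≤ c * (A + |x|) ^ (-p))
    (h1 : ∀ x x', |x - x'| ≤ (A + |x|) / 4 → |f x - f x'| ≤ c * (A + |x|) ^ (-p - 1) * |x - x'|) (x x' : ℝ) :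
    |f x - f x'| ≤ 3 * c * |x - x'| ^ (1 / 2 : ℝ) * ((A + |x|) ^ (-p - 1 / 2) + (A + |x'|) ^ (-p - 1 / 2)) := by
  have hx : 0 < A + |x| := by linarith [abs_nonneg x]
  have hx' : 0 < A + |x'| := by linarith [abs_nonneg x']
  set a := A + |x|
  set b := A + |x'|
  set δ := |x - x'| with hδ
  have hδ0 : 0 ≤ δ := abs_nonneg _
  rcases le_or_gt δ (a / 4) with h | h
  · calc |f x - f x'| ≤ c * a ^ (-p - 1) * δ := h1 x x' h
      _ = c * δ ^ (1 / 2 : ℝ) * (a ^ (-p - 1) * δ ^ (1 / 2 : ℝ)) := by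
          have : δ = δ ^ (1 / 2 : ℝ) * δ ^ (1 / 2 : ℝ) := by
            rw [← Real.sqrt_eq_rpow, Real.mul_self_sqrt hδ0]
          nth_rewrite 1 [this]; ring
      _ ≤ c * δ ^ (1 / 2 : ℝ) * (a ^ (-p - 1) * a ^ (1 / 2 : ℝ)) := by
          gcongr; linarith
      _ = c * δ ^ (1 / 2 : ℝ) * a ^ (-p - 1 / 2) := by
          rw [← Real.rpow_add hx]; congr 2; ring
      _ ≤ _ := by
          have h2 : 0 ≤ b ^ (-p - 1 / 2) := by positivity
          have h3 : 0 ≤ a ^ (-p - 1 / 2) := by positivity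
          have h4 : 0 ≤ c * δ ^ (1 / 2 : ℝ) := by positivity
          nlinarith [mul_nonneg h4 h2, mul_nonneg h4 h3]
  -- If the increment is not small compared with `a`, then `a ≤ 4δ` and `b ≤ 5δ`, and the size
  -- bounds alone suffice. The constant is enlarged to 9 to have square root 3.
  · have hb : b ≤ 9 * δ := by
      have : |x'| ≤ |x| + δ := by
        have := abs_sub x (x - x'); rw [hδ]; simpa using this
      simp only [a, b] at h ⊢; linarith
    have gen : ∀ q, 0 < q → q ≤ 9 * δ → q ^ (-p) ≤ 3 * δ ^ (1 / 2 : ℝ) * q ^ (-p - 1 / 2) := by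
      intro q hq hq'
      calc q ^ (-p) = q ^ (1 / 2 : ℝ) * q ^ (-p - 1 / 2) := by
            rw [← Real.rpow_add hq]; congr 1; ring
        _ ≤ (9 * δ) ^ (1 / 2 : ℝ) * q ^ (-p - 1 / 2) := by gcongr
        _ = _ := by
            rw [Real.mul_rpow (by norm_num) hδ0, ← Real.sqrt_eq_rpow 9, show (9 : ℝ) = 3 ^ 2 by norm_num,
              Real.sqrt_sq (by norm_num)]
    calc |f x - f x'| ≤ c * a ^ (-p) + c * b ^ (-p) := (abs_sub _ _).trans (add_le_add (h0 x) (h0 x'))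
      _ ≤ c * (3 * δ ^ (1 / 2 : ℝ) * a ^ (-p - 1 / 2)) + c * (3 * δ ^ (1 / 2 : ℝ) * b ^ (-p - 1 / 2)) := by
          gcongr
          · exact gen a hx (by linarith)
          · exact gen b hx' hb
      _ = _ := by ring

lemma IsTruncatedHeatKernel.spaceDeriv_bound_of_pos (hK : IsTruncatedHeatKernel K C r) (hC : 0 < C) (k : ℕ) (hk : k ≤ 2) :
    ∃ c : ℝ, 0 < c ∧ ∀ t, 0 < t → (∀ x, |spaceDeriv^[k] K (t, x)| ≤ c * (√t + |x|) ^ (-(k + 1) : ℝ)) ∧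
      ∀ x x', |x - x'| ≤ (√t + |x|) / 4 →
        |spaceDeriv^[k] K (t, x) - spaceDeriv^[k] K (t, x')| ≤ c * (√t + |x|) ^ (-(k + 1) - 1 : ℝ) * |x - x'| := by
  obtain ⟨c₁, h₁, H₁⟩ := hK.exists_bound hC k (by omega)
  obtain ⟨c₂, h₂, H₂⟩ := hK.exists_bound hC (k + 1) (by omega)
  refine ⟨c₁ + c₂ * 2 ^ (k + 2), by positivity, fun t ht => ⟨fun x => ?_, fun x x' hx => ?_⟩⟩
  · have hp : 0 < √t + |x| := by have := Real.sqrt_pos.2 ht; positivity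
    have := H₁ (t, x)
    rw [parNorm_mk_pos ht] at this
    refine this.trans ?_
    rw [Real.rpow_neg hp.le, show ((k : ℝ) + 1) = ((k + 1 : ℕ) : ℝ) by push_cast; ring, Real.rpow_natCast]
    gcongr
    have : 0 ≤ c₂ * 2 ^ (k + 2) := by positivity
    linarith
  · have hp : 0 < √t + |x| := by have := Real.sqrt_pos.2 ht; positivity
    set a := √t + |x| with ha
    have := (convex_Icc (x - a / 4) (x + a / 4)).norm_image_sub_le_of_norm_hasDerivWithin_le
      (f := fun y => spaceDeriv^[k] K (t, y)) (f' := fun y => spaceDeriv^[k + 1] K (t, y))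
      (C := c₂ * ((a / 2) ^ (k + 2))⁻¹) (x := x') (y := x) (fun y _ => (hK.hasDerivAt_slice k t y ht.ne').hasDerivWithinAt)
      (fun y hy => (H₂ (t, y)).trans (by
        rw [parNorm_mk_pos ht]
        have h1 : |x - y| ≤ a / 4 := abs_le.2 ⟨by linarith [hy.2], by linarith [hy.1]⟩
        have h2 : |x| ≤ |y| + |x - y| := by
          have := abs_add_le y (x - y); simpa using this
        gcongr
        linarith))
      (by have := abs_le.1 hx; constructor <;> linarith [this.1, this.2]) ⟨by linarith, by linarith⟩
    rw [Real.norm_eq_abs, Real.norm_eq_abs] at this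
    refine this.trans (mul_le_mul_of_nonneg_right ?_ (abs_nonneg _))
    rw [show (-(k + 1) - 1 : ℝ) = -((k + 2 : ℕ) : ℝ) by push_cast; ring, Real.rpow_neg hp.le, Real.rpow_natCast,
      div_pow, inv_div, add_mul]
    have h3 : 0 ≤ c₁ * (a ^ (k + 2))⁻¹ := by positivity
    have h4 : c₂ * (2 ^ (k + 2) / a ^ (k + 2)) = c₂ * 2 ^ (k + 2) * (a ^ (k + 2))⁻¹ := by ring
    linarith

/-- The kernel `∂ₓ^γ K'` has parabolic order `-2 - γ`. -/
lemma IsTruncatedHeatKernel.fracKernel_bound_of_pos (hK : IsTruncatedHeatKernel K C r) (hC : 0 < C) {γ : ℝ}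
    (hγ : 0 ≤ γ) (hγ1 : γ < 1) : ∃ c : ℝ, 0 < c ∧ ∀ t, 0 < t →
      (∀ x, |fracKernel K γ (t, x)| ≤ c * (√t + |x|) ^ (-(2 + γ))) ∧
      ∀ x x', |x - x'| ≤ (√t + |x|) / 4 →
        |fracKernel K γ (t, x) - fracKernel K γ (t, x')| ≤ c * (√t + |x|) ^ (-(2 + γ) - 1) * |x - x'| := by
  rcases hγ.eq_or_lt with rfl | hγ
  · obtain ⟨c, hc, H⟩ := hK.spaceDeriv_bound_of_pos hC 1 (by norm_num)
    refine ⟨c, hc, fun t ht => ?_⟩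
    have := H t ht
    simp only [fracKernel, if_true]
    norm_num at this ⊢
    exact this
  · obtain ⟨M, hM, H⟩ := hK.kernelControl hC
    set L := 2 / (1 - γ) + 2 * (1 + 1 / γ) + (4 + γ) with hL
    have hγ' : 0 < 1 - γ := by linarith
    have hLpos : 0 < L := by positivity
    refine ⟨|fracConst γ| * L * M * 4 ^ (3 + γ) + 1, by positivity, fun t ht => ⟨fun x => ?_, fun x x' hx => ?_⟩⟩
    · have hp : 0 < √t + |x| := by have := Real.sqrt_pos.2 ht; positivity
      have h1 := (H t ht).abs_fracInt_le hγ hγ1 x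
      simp only [fracKernel, if_neg hγ.ne']
      rw [abs_mul]
      have h2 : ((√t + |x|) / 4) ^ (-2 - γ) ≤ 4 ^ (3 + γ) * (√t + |x|) ^ (-(2 + γ)) := by
        rw [Real.div_rpow hp.le (by norm_num), show -2 - γ = -(2 + γ) by ring, Real.rpow_neg (by norm_num : (0:ℝ) ≤ 4), div_inv_eq_mul, mul_comm]
        gcongr <;> norm_num
      calc _ ≤ |fracConst γ| * (L * M * (4 ^ (3 + γ) * (√t + |x|) ^ (-(2 + γ)))) := by
            gcongr
            refine h1.trans ?_
            gcongr
            rw [hL]; linarith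
        _ = |fracConst γ| * L * M * 4 ^ (3 + γ) * (√t + |x|) ^ (-(2 + γ)) := by ring
        _ ≤ _ := by gcongr; linarith
    · have hp : 0 < √t + |x| := by have := Real.sqrt_pos.2 ht; positivity
      have h1 := (H t ht).fracInt_lipschitz hγ hγ1 x x' hx
      simp only [fracKernel, if_neg hγ.ne']
      rw [← mul_sub, abs_mul]
      have h2 : ((√t + |x|) / 4) ^ (-3 - γ) = 4 ^ (3 + γ) * (√t + |x|) ^ (-(2 + γ) - 1) := by
        rw [Real.div_rpow hp.le (by norm_num), show -3 - γ = -(3 + γ) by ring, Real.rpow_neg (by norm_num : (0:ℝ) ≤ 4), div_inv_eq_mul, mul_comm]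
        congr 2; ring
      rw [h2] at h1
      calc _ ≤ |fracConst γ| * (L * M * (4 ^ (3 + γ) * (√t + |x|) ^ (-(2 + γ) - 1)) * |x - x'|) := by
            gcongr
        _ = |fracConst γ| * L * M * 4 ^ (3 + γ) * (√t + |x|) ^ (-(2 + γ) - 1) * |x - x'| := by ring
        _ ≤ _ := by gcongr; linarith

/-- A kernel that is causal, of order `-p`, and `1/2`-Hölder in space in a scale-invariant way. -/
structure HasOrder (f : ℝ × ℝ → ℝ) (c p : ℝ) : Prop where
  size : ∀ z, |f z| ≤ c * parNorm z ^ (-p)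
  holder : ∀ t x x', |f (t, x) - f (t, x')| ≤
    c * |x - x'| ^ (1 / 2 : ℝ) * (parNorm (t, x) ^ (-p - 1 / 2) + parNorm (t, x') ^ (-p - 1 / 2))

lemma exists_hasOrder_of_bound {f : ℝ × ℝ → ℝ} {c p : ℝ} (hc : 0 < c) (hp : 0 ≤ p) (h0 : ∀ t x, t ≤ 0 → f (t, x) = 0)
    (h1 : ∀ t, 0 < t → (∀ x, |f (t, x)| ≤ c * (√t + |x|) ^ (-p)) ∧
      ∀ x x', |x - x'| ≤ (√t + |x|) / 4 → |f (t, x) - f (t, x')| ≤ c * (√t + |x|) ^ (-p - 1) * |x - x'|) :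
    HasOrder f (3 * c) p := by
  constructor
  · intro z
    have hz := parNorm_nonneg z
    rcases le_or_gt z.1 0 with h | h
    · rw [show z = (z.1, z.2) from rfl, h0 _ _ h, abs_zero]; positivity
    · have := (h1 z.1 h).1 z.2
      rw [← parNorm_mk_pos h] at this
      refine this.trans ?_
      gcongr; linarith
  · intro t x x'
    have hz := parNorm_nonneg (t, x)
    have hz' := parNorm_nonneg (t, x')
    rcases le_or_gt t 0 with h | h
    · rw [h0 _ _ h, h0 _ _ h, sub_zero, abs_zero]; positivity
    · rw [parNorm_mk_pos h, parNorm_mk_pos h]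
      exact holder_of_lipschitz (f := fun x => f (t, x)) (Real.sqrt_pos.2 h) hc.le hp (h1 t h).1 (h1 t h).2 x x'

lemma IsTruncatedHeatKernel.exists_hasOrder_fracKernel (hK : IsTruncatedHeatKernel K C r) (hC : 0 < C) {γ : ℝ}
    (hγ : 0 ≤ γ) (hγ1 : γ < 1) : ∃ c : ℝ, 0 < c ∧ HasOrder (fracKernel K γ) c (2 + γ) := by
  obtain ⟨c, hc, H⟩ := hK.fracKernel_bound_of_pos hC hγ hγ1
  exact ⟨3 * c, by positivity, exists_hasOrder_of_bound hc (by linarith) (fun t x h => hK.fracKernel_causal γ h x) H⟩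

lemma IsTruncatedHeatKernel.exists_hasOrder_spaceDeriv (hK : IsTruncatedHeatKernel K C r) (hC : 0 < C) :
    ∃ c : ℝ, 0 < c ∧ HasOrder (spaceDeriv K) c 2 := by
  obtain ⟨c, hc, H⟩ := hK.fracKernel_bound_of_pos hC le_rfl zero_lt_one
  refine ⟨3 * c, by positivity, exists_hasOrder_of_bound hc (by norm_num) (fun t x h => hK.iterate_causal 1 h x) ?_⟩
  simpa [fracKernel] using H

end

end FracKPZ

/-! ### The Fourier multiplier as a singular integral -/

namespace FracKPZ
open Set ENNReal

section sine
variable {γ : ℝ}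

lemma sub_sin_nonneg {y : ℝ} (hy : 0 ≤ y) : 0 ≤ y - Real.sin y := by linarith [Real.sin_le hy]

lemma integrableOn_sub_sin (hγ : 0 < γ) (hγ1 : γ < 1) :
    IntegrableOn (fun y : ℝ => 2 * (y - Real.sin y) * y ^ (-2 - γ)) (Ioi 0) := by
  have hm : AEStronglyMeasurable (fun y : ℝ => 2 * (y - Real.sin y) * y ^ (-2 - γ)) := by
    apply Measurable.aestronglyMeasurable; fun_prop
  rw [← Ioc_union_Ioi_eq_Ioi (zero_le_one' ℝ)]
  apply IntegrableOn.union
  · have hi : IntegrableOn (fun y : ℝ => 2 * y ^ (-γ)) (Ioc 0 1) :=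
      (((intervalIntegrable_iff_integrableOn_Ioc_of_le zero_le_one).1
      (intervalIntegral.intervalIntegrable_rpow' (by linarith)))).const_mul _
    refine hi.mono' hm.restrict ((ae_restrict_iff' measurableSet_Ioc).2 (ae_of_all _ fun y hy => ?_))
    have h0 := hy.1
    have h1 := sub_sin_nonneg h0.le
    rw [Real.norm_eq_abs, abs_of_nonneg (by positivity)]
    have h2 : y - Real.sin y ≤ y ^ 2 := by
      have := Real.sin_gt_sub_cube h0 
      nlinarith [hy.2, sq_nonneg y, pow_pos h0 3]
    calc 2 * (y - Real.sin y) * y ^ (-2 - γ) ≤ 2 * y ^ 2 * y ^ (-2 - γ) := by gcongr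
      _ = _ := by
        rw [mul_assoc, show -γ = (2 : ℕ) + (-2 - γ) by push_cast; ring, Real.rpow_add h0, Real.rpow_natCast]
  · have hj : IntegrableOn (fun y : ℝ => 4 * y ^ (-1 - γ)) (Ioi 1) :=
      (integrableOn_Ioi_rpow_of_lt (by linarith) one_pos).const_mul _
    refine hj.mono' hm.restrict ((ae_restrict_iff' measurableSet_Ioi).2 (ae_of_all _ fun y hy => ?_))
    have h0 : 0 < y := one_pos.trans hy
    have h1 := sub_sin_nonneg h0.le
    have h2 : y - Real.sin y ≤ 2 * y := by
      have := Real.neg_one_le_sin y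
      have hy : 1 < y := hy
      linarith
    rw [Real.norm_eq_abs, abs_of_nonneg (by positivity)]
    calc 2 * (y - Real.sin y) * y ^ (-2 - γ) ≤ 2 * (2 * y) * y ^ (-2 - γ) := by gcongr
      _ = _ := by
        rw [show -1 - γ = 1 + (-2 - γ) by ring, Real.rpow_add h0, Real.rpow_one]; ring

lemma fracConst_pos (hγ : 0 < γ) (hγ1 : γ < 1) : 0 < fracConst γ := by
  rw [fracConst, inv_pos, setIntegral_pos_iff_support_of_nonneg_ae _ (integrableOn_sub_sin hγ hγ1)]
  · have : Ioi (0 : ℝ) ⊆ Function.support (fun y : ℝ => 2 * (y - Real.sin y) * y ^ (-2 - γ)) ∩ Ioi 0 := by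
      intro y hy
      have hy0 : 0 < y := hy
      refine ⟨?_, hy⟩
      have := Real.sin_lt hy0
      have : 0 < y - Real.sin y := by linarith
      simp only [Function.mem_support]
      positivity
    exact lt_of_lt_of_le (by simp) (measure_mono this)
  · refine (ae_restrict_iff' measurableSet_Ioi).2 (ae_of_all _ fun y hy => ?_)
    have h0 : 0 < y := hy
    have h1 := sub_sin_nonneg h0.le
    simp only [Pi.zero_apply]
    positivity

lemma sub_sin_scale {b : ℝ} (hb : 0 < b) {y : ℝ} (hy : 0 < y) :
    2 * (b * y - Real.sin (b * y)) * y ^ (-2 - γ) =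
      b ^ (2 + γ) * (2 * (b * y - Real.sin (b * y)) * (b * y) ^ (-2 - γ)) := by
  rw [Real.mul_rpow hb.le hy.le, show -2 - γ = -(2 + γ) by ring, Real.rpow_neg hb.le]
  have : 0 < b ^ (2 + γ) := by positivity
  field_simp

lemma integral_sub_sin_pos (hγ : 0 < γ) (hγ1 : γ < 1) {b : ℝ} (hb : 0 < b) :
    IntegrableOn (fun y : ℝ => 2 * (b * y - Real.sin (b * y)) * y ^ (-2 - γ)) (Ioi 0) ∧
    ∫ y in Ioi (0 : ℝ), 2 * (b * y - Real.sin (b * y)) * y ^ (-2 - γ) = b ^ (1 + γ) * (fracConst γ)⁻¹ := by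
  have hi := (integrableOn_Ioi_comp_mul_left_iff (fun y : ℝ => 2 * (y - Real.sin y) * y ^ (-2 - γ)) 0 hb).2
    (by simpa using integrableOn_sub_sin hγ hγ1)
  constructor
  · have h2 : IntegrableOn (fun y : ℝ => b ^ (2 + γ) * (2 * (b * y - Real.sin (b * y)) * (b * y) ^ (-2 - γ))) (Ioi 0) :=
      hi.const_mul (b ^ (2 + γ))
    exact h2.congr_fun (fun y hy => (sub_sin_scale hb hy).symm) measurableSet_Ioi
  · rw [setIntegral_congr_fun measurableSet_Ioi (fun y hy => sub_sin_scale hb hy), integral_const_mul,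
      integral_comp_mul_left_Ioi (fun y : ℝ => 2 * (y - Real.sin y) * y ^ (-2 - γ)) 0 hb, mul_zero, fracConst, inv_inv,
      smul_eq_mul, ← mul_assoc, show 2 + γ = (1 + γ) + 1 by ring, Real.rpow_add_one hb.ne']
    field_simp

/-- On `e^{ibx}` the integrand of `fracInt` becomes `2i (by - sin by) y^{-2-γ}`, so this computes
its symbol: by scaling and oddness it is a multiple of `i b |b|^γ`, the symbol of `(-Δ)^{γ/2} ∂ₓ`.
The absolute version has no cancellation to lose, since `by - sin by` has the sign of `b` for `y >
0`. -/
lemma integral_sub_sin (hγ : 0 < γ) (hγ1 : γ < 1) (b : ℝ) :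
    IntegrableOn (fun y : ℝ => 2 * (b * y - Real.sin (b * y)) * y ^ (-2 - γ)) (Ioi 0) ∧
    ∫ y in Ioi (0 : ℝ), 2 * (b * y - Real.sin (b * y)) * y ^ (-2 - γ) = b * |b| ^ γ * (fracConst γ)⁻¹ ∧
    ∫ y in Ioi (0 : ℝ), |2 * (b * y - Real.sin (b * y)) * y ^ (-2 - γ)| = |b| ^ (1 + γ) * (fracConst γ)⁻¹ := by
  have habs : ∀ b : ℝ, 0 < b → ∀ y ∈ Ioi (0 : ℝ), |2 * (b * y - Real.sin (b * y)) * y ^ (-2 - γ)| =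
      2 * (b * y - Real.sin (b * y)) * y ^ (-2 - γ) := by
    intro b hb y hy
    have h0 : 0 < y := hy
    have h1 := sub_sin_nonneg (mul_pos hb h0).le
    exact abs_of_nonneg (by positivity)
  rcases lt_trichotomy b 0 with h | rfl | h
  · obtain ⟨h1, h2⟩ := integral_sub_sin_pos hγ hγ1 (neg_pos.2 h)
    have e : ∀ y : ℝ, 2 * (b * y - Real.sin (b * y)) * y ^ (-2 - γ) =
        -(2 * (-b * y - Real.sin (-b * y)) * y ^ (-2 - γ)) := by
      intro y; rw [neg_mul, Real.sin_neg]; ring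
    simp_rw [e, abs_neg]
    refine ⟨h1.neg, ?_, ?_⟩
    · rw [integral_neg, h2, abs_of_neg h, Real.rpow_add (neg_pos.2 h), Real.rpow_one]; ring
    · rw [setIntegral_congr_fun measurableSet_Ioi (habs _ (neg_pos.2 h)), h2, abs_of_neg h]
  · have : (1 + γ) ≠ 0 := by positivity
    simp [Real.zero_rpow this]
  · obtain ⟨h1, h2⟩ := integral_sub_sin_pos hγ hγ1 h
    refine ⟨h1, ?_, ?_⟩
    · rw [h2, abs_of_pos h, Real.rpow_add h, Real.rpow_one]
    · rw [setIntegral_congr_fun measurableSet_Ioi (habs _ h), h2, abs_of_pos h]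

end sine

section fourier
variable {φ : ℝ → ℝ}

lemma fourierInv_real_eq (g : ℝ → ℂ) (x : ℝ) :
    𝓕⁻ g x = ∫ ξ : ℝ, Complex.exp (2 * Real.pi * ξ * x * Complex.I) * g ξ := by
  rw [Real.fourierInv_eq']
  congr 1; funext ξ
  simp only [smul_eq_mul, RCLike.inner_apply, conj_trivial]
  push_cast
  congr 2
  ring

lemma exists_schwartz (hφ : ContDiff ℝ ∞ φ) (hc : HasCompactSupport φ) :
    ∃ f : SchwartzMap ℝ ℂ, (f : ℝ → ℂ) = fun x => (φ x : ℂ) := by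
  have h1 : HasCompactSupport (fun x => (φ x : ℂ)) := hc.comp_left (g := fun x : ℝ => (x : ℂ)) (by simp)
  have h2 : ContDiff ℝ ∞ (fun x => (φ x : ℂ)) := Complex.ofRealCLM.contDiff.comp hφ
  exact ⟨h1.toSchwartzMap h2, rfl⟩

lemma fourier_inversion_of_smooth (hφ : ContDiff ℝ ∞ φ) (hc : HasCompactSupport φ) :
    𝓕⁻ (𝓕 (fun x => (φ x : ℂ))) = fun x => (φ x : ℂ) := by
  obtain ⟨f, hf⟩ := exists_schwartz hφ hc
  rw [← hf]
  apply Continuous.fourierInv_fourier_eq f.continuous f.integrable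
  rw [← SchwartzMap.fourier_coe]
  exact (𝓕 f).integrable

lemma fracLaplacian_zero (hφ : ContDiff ℝ ∞ φ) (hc : HasCompactSupport φ) (x : ℝ) :
    fracLaplacian 0 φ x = φ x := by
  simp only [fracLaplacian, Real.rpow_zero, Complex.ofReal_one, one_mul]
  have := congrFun (fourier_inversion_of_smooth hφ hc) x
  rw [show (fun ξ => 𝓕 (fun y => (φ y : ℂ)) ξ) = 𝓕 (fun y => (φ y : ℂ)) from rfl, this, Complex.ofReal_re]

lemma contDiff_deriv_of_smooth (hφ : ContDiff ℝ ∞ φ) : ContDiff ℝ ∞ (deriv φ) := hφ.iterate_deriv 1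

lemma fourier_ofReal_deriv (hφ : ContDiff ℝ ∞ φ) (hc : HasCompactSupport φ) (ξ : ℝ) :
    𝓕 (fun x => ((deriv φ x : ℝ) : ℂ)) ξ = 2 * Real.pi * Complex.I * ξ * 𝓕 (fun x => (φ x : ℂ)) ξ := by
  have hd : ∀ x, HasDerivAt (fun x => (φ x : ℂ)) ((deriv φ x : ℝ) : ℂ) x := fun x =>
    ((hφ.differentiable (by simp)).differentiableAt.hasDerivAt).ofReal_comp
  have e : (fun x => ((deriv φ x : ℝ) : ℂ)) = deriv (fun x => (φ x : ℂ)) := by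
    funext x; exact (hd x).deriv.symm
  obtain ⟨f, hf⟩ := exists_schwartz hφ hc
  obtain ⟨f', hf'⟩ := exists_schwartz (φ := deriv φ) (contDiff_deriv_of_smooth hφ) hc.deriv
  rw [e, Real.fourier_deriv (hf ▸ f.integrable) (fun x => (hd x).differentiableAt) (by rw [← e, ← hf']; exact f'.integrable)]
  simp [smul_eq_mul]


lemma integral_exp_mul_fourier (hφ : ContDiff ℝ ∞ φ) (hc : HasCompactSupport φ) (x : ℝ) :
    Integrable (fun ξ : ℝ => Complex.exp (2 * Real.pi * ξ * x * Complex.I) * 𝓕 (fun x => (φ x : ℂ)) ξ) ∧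
    ∫ ξ : ℝ, Complex.exp (2 * Real.pi * ξ * x * Complex.I) * 𝓕 (fun x => (φ x : ℂ)) ξ = φ x := by
  constructor
  · obtain ⟨f, hf⟩ := exists_schwartz hφ hc
    rw [← hf, ← SchwartzMap.fourier_coe]
    refine (𝓕 f).integrable.bdd_mul (c := 1) (by fun_prop) (ae_of_all _ fun ξ => ?_)
    rw [show (2 * Real.pi * ξ * x * Complex.I : ℂ) = ((2 * Real.pi * ξ * x : ℝ) : ℂ) * Complex.I by push_cast; ring,
      Complex.norm_exp_ofReal_mul_I]
  · rw [← fourierInv_real_eq, fourier_inversion_of_smooth hφ hc]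

/-- The Fourier multiplier `(2π|ξ|)^γ` applied to a derivative, as a singular integral. -/
theorem fracLaplacian_deriv {γ : ℝ} (hγ : 0 < γ) (hγ1 : γ < 1) (hφ : ContDiff ℝ ∞ φ) (hc : HasCompactSupport φ)
    (x : ℝ) : fracLaplacian γ (deriv φ) x = fracConst γ * fracInt γ φ (deriv φ) x := by
  obtain ⟨f, hf⟩ := exists_schwartz hφ hc
  set F : ℝ → ℂ := 𝓕 (fun x => (φ x : ℂ)) with hF
  have hFf : F = (𝓕 f : SchwartzMap ℝ ℂ) := by rw [hF, ← hf, ← SchwartzMap.fourier_coe]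
  have hFc : Continuous F := by rw [hFf]; exact (𝓕 f).continuous
  have hJ := fracConst_pos hγ hγ1
  set e : ℝ → ℝ → ℂ := fun x ξ => Complex.exp (2 * Real.pi * ξ * x * Complex.I) with he
  have hen : ∀ x ξ, ‖e x ξ‖ = 1 := by
    intro x ξ
    rw [he]
    dsimp only
    rw [show (2 * Real.pi * ξ * x * Complex.I : ℂ) = ((2 * Real.pi * ξ * x : ℝ) : ℂ) * Complex.I by push_cast; ring,
      Complex.norm_exp_ofReal_mul_I]
  set k : ℝ → ℝ → ℝ := fun ξ y => 2 * ((2 * Real.pi * ξ) * y - Real.sin ((2 * Real.pi * ξ) * y)) * y ^ (-2 - γ) with hk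
  set G : ℝ → ℝ → ℂ := fun y ξ => e x ξ * F ξ * Complex.I * (k ξ y : ℂ) with hG
  have hnorm : ∀ y ξ, ‖G y ξ‖ = ‖F ξ‖ * |k ξ y| := by
    intro y ξ
    simp only [hG, norm_mul, hen, Complex.norm_I, Complex.norm_real, Real.norm_eq_abs]; ring
  have hmeas : Measurable (Function.uncurry G) := by
    have := hFc.measurable
    simp only [hG, hk, he, Function.uncurry_def]
    fun_prop
  -- The integral in `y` grows like `|ξ|^{1+γ} ≤ 1 + (2π)² ξ²` up to constants, which the Schwartz
  -- function `F` absorbs.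
  have hfint : Integrable (Function.uncurry G) ((volume.restrict (Ioi 0)).prod volume) := by
    rw [integrable_prod_iff' hmeas.aestronglyMeasurable]
    refine ⟨ae_of_all _ fun ξ => ?_, ?_⟩
    · have h := (Integrable.ofReal (𝕜 := ℂ) (integral_sub_sin hγ hγ1 (2 * Real.pi * ξ)).1).const_mul
        (e x ξ * F ξ * Complex.I)
      exact h
    · have : ∀ ξ : ℝ, ∫ y in Ioi (0:ℝ), ‖Function.uncurry G (y, ξ)‖ = ‖F ξ‖ * (|2 * Real.pi * ξ| ^ (1 + γ) * (fracConst γ)⁻¹) := by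
        intro ξ
        simp only [Function.uncurry, hnorm]
        rw [integral_const_mul, (integral_sub_sin hγ hγ1 (2 * Real.pi * ξ)).2.2]
      simp_rw [this]
      have hi0 := (𝓕 f).integrable_pow_mul volume 0
      have hi2 := (𝓕 f).integrable_pow_mul volume 2
      rw [← hFf] at hi0 hi2
      refine ((hi0.add (hi2.const_mul ((2 * Real.pi) ^ 2))).mul_const (fracConst γ)⁻¹).mono' ?_ (ae_of_all _ fun ξ => ?_)
      · apply Measurable.aestronglyMeasurable
        have := hFc.measurable
        fun_prop
      · simp only [Pi.add_apply, pow_zero, one_mul, Real.norm_eq_abs]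
        rw [abs_of_nonneg (by positivity)]
        have h1 : |2 * Real.pi * ξ| ^ (1 + γ) ≤ 1 + (2 * Real.pi) ^ 2 * |ξ| ^ 2 := by
          set b := |2 * Real.pi * ξ| with hb
          have hb2 : (2 * Real.pi) ^ 2 * |ξ| ^ 2 = b ^ 2 := by
            rw [hb, abs_mul, abs_of_pos Real.two_pi_pos]; ring
          rw [hb2]
          rcases le_total b 1 with h | h
          · have := Real.rpow_le_one (abs_nonneg _) h (show 0 ≤ 1 + γ by linarith)
            nlinarith [sq_nonneg b]
          · have := Real.rpow_le_rpow_of_exponent_le h (show 1 + γ ≤ (2 : ℕ) by push_cast; linarith)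
            rw [Real.rpow_natCast] at this
            linarith
        calc ‖F ξ‖ * (|2 * Real.pi * ξ| ^ (1 + γ) * (fracConst γ)⁻¹)
            ≤ ‖F ξ‖ * ((1 + (2 * Real.pi) ^ 2 * |ξ| ^ 2) * (fracConst γ)⁻¹) := by gcongr
          _ = _ := by ring
  have hswap := integral_integral_swap hfint
  -- For fixed `y`, Fourier inversion at the three points `x`, `x + y`, `x - y` reassembles the
  -- integrand of `fracInt`; integrating in `y` first produces the multiplier instead.
  have hleft : ∫ y in Ioi (0 : ℝ), ∫ ξ, G y ξ = ((fracInt γ φ (deriv φ) x : ℝ) : ℂ) := by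
    rw [fracInt, ← integral_complex_ofReal]
    refine setIntegral_congr_fun measurableSet_Ioi fun y hy => ?_
    obtain ⟨i1, v1⟩ := integral_exp_mul_fourier hφ hc (x + y)
    obtain ⟨i2, v2⟩ := integral_exp_mul_fourier hφ hc (x - y)
    obtain ⟨i3, v3⟩ := integral_exp_mul_fourier (contDiff_deriv_of_smooth hφ) hc.deriv x
    have hpt : ∀ ξ, G y ξ = ((y ^ (-2 - γ) : ℝ) : ℂ) * (2 * y *
        (Complex.exp (2 * Real.pi * ξ * x * Complex.I) * 𝓕 (fun x => ((deriv φ x : ℝ) : ℂ)) ξ)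
        - Complex.exp (2 * Real.pi * ξ * (x + y : ℝ) * Complex.I) * F ξ
        + Complex.exp (2 * Real.pi * ξ * (x - y : ℝ) * Complex.I) * F ξ) := by
      intro ξ
      rw [fourier_ofReal_deriv hφ hc]
      simp only [hG, hk, he]
      have e1 : Complex.exp (2 * Real.pi * ξ * (x + y : ℝ) * Complex.I) =
          Complex.exp (2 * Real.pi * ξ * x * Complex.I) * Complex.exp ((2 * Real.pi * ξ * y) * Complex.I) := by
        rw [← Complex.exp_add]; congr 1; push_cast; ring
      have e2 : Complex.exp (2 * Real.pi * ξ * (x - y : ℝ) * Complex.I) =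
          Complex.exp (2 * Real.pi * ξ * x * Complex.I) * Complex.exp (-(2 * Real.pi * ξ * y) * Complex.I) := by
        rw [← Complex.exp_add]; congr 1; push_cast; ring
      rw [e1, e2]
      push_cast
      rw [Complex.sin]
      -- The sine is expanded into exponentials with a factor `I / 2`, which meets the factor `I` of
      -- the symbol.
      linear_combination (Complex.exp (2 * Real.pi * ξ * x * Complex.I) * F ξ * ((y ^ (-2 - γ) : ℝ) : ℂ) *
        (Complex.exp ((2 * Real.pi * ξ * y) * Complex.I) - Complex.exp (-(2 * Real.pi * ξ * y) * Complex.I))) * Complex.I_sq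
    simp_rw [hpt]
    have E1 := integral_add ((i3.const_mul (2 * (y : ℂ))).sub i1) i2
    have E2 := integral_sub (i3.const_mul (2 * (y : ℂ))) i1
    simp only [Pi.sub_apply] at E1 E2
    rw [integral_const_mul, E1, E2, integral_const_mul, v1, v2, v3]
    push_cast; ring
  have hright : ∫ ξ, ∫ y in Ioi (0 : ℝ), G y ξ = ((fracConst γ)⁻¹ : ℝ) *
      𝓕⁻ (fun ξ : ℝ => (((2 * Real.pi * |ξ|) ^ γ : ℝ) : ℂ) * 𝓕 (fun y : ℝ => ((deriv φ y : ℝ) : ℂ)) ξ) x := by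
    rw [fourierInv_real_eq, ← integral_const_mul]
    congr 1; funext ξ
    simp only [hG]
    rw [integral_const_mul, integral_complex_ofReal, (integral_sub_sin hγ hγ1 (2 * Real.pi * ξ)).2.1,
      fourier_ofReal_deriv hφ hc, abs_mul, abs_of_pos Real.two_pi_pos]
    push_cast
    ring
  have key : ((fracInt γ φ (deriv φ) x : ℝ) : ℂ) = ((fracConst γ)⁻¹ : ℝ) *
      𝓕⁻ (fun ξ : ℝ => (((2 * Real.pi * |ξ|) ^ γ : ℝ) : ℂ) * 𝓕 (fun y : ℝ => ((deriv φ y : ℝ) : ℂ)) ξ) x := by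
    rw [← hleft, ← hright]; exact hswap
  have := congrArg Complex.re key
  rw [Complex.ofReal_re, Complex.re_ofReal_mul] at this
  rw [fracLaplacian, this]
  field_simp

end fourier

end FracKPZ

/-! ### The fractional derivative commutes with mollification -/

namespace FracKPZ
open Set ENNReal

section
variable {K ρ : ℝ × ℝ → ℝ} {C r ε : ℝ}

lemma IsMollifier.contDiff_rescale (hρ : IsMollifier ρ) (ε : ℝ) : ContDiff ℝ ∞ (rescale ρ ε) := by
  unfold rescale
  have := hρ.smooth
  fun_prop

lemma IsMollifier.hasCompactSupport_rescale (hρ : IsMollifier ρ) (hε : 0 < ε) :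
    HasCompactSupport (rescale ρ ε) := by
  obtain ⟨M, R, hM, hR, H⟩ := hρ.rescale_bound
  refine HasCompactSupport.intro (isCompact_parNorm_le (R * ε)) fun z hz => (H ε hε z).2.2 ?_
  simpa using hz

lemma IsMollifier.rescale_even (hρ : IsMollifier ρ) (t x : ℝ) : rescale ρ ε (t, -x) = rescale ρ ε (t, x) := by
  simp only [rescale, neg_div, hρ.even]

lemma IsTruncatedHeatKernel.hasCompactSupport (hK : IsTruncatedHeatKernel K C r) : HasCompactSupport K := by
  refine HasCompactSupport.intro (isCompact_parNorm_le C) fun z hz => hK.supported z ?_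
  simpa using hz

lemma enorm_le_pker {f : ℝ × ℝ → ℝ} {c p : ℝ} (hp : 0 ≤ p) {z : ℝ × ℝ} (h : |f z| ≤ c * parNorm z ^ (-p)) (hc : 0 ≤ c) :
    ‖f z‖ₑ ≤ ENNReal.ofReal c * pker 0 p z := by
  rw [Real.enorm_eq_ofReal_abs]
  refine (ENNReal.ofReal_le_ofReal h).trans ?_
  rw [ENNReal.ofReal_mul hc, pker, add_zero]
  exact mul_le_mul_right (ofReal_rpow_neg_le (parNorm_nonneg z) hp) _

lemma integrable_of_parabolic_bound {f : ℝ × ℝ → ℝ} {c p R : ℝ} (hf : Measurable f) (hp : 0 ≤ p) (hp3 : p < 3) (hc : 0 ≤ c)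
    (hR : 0 < R) (h : ∀ z, |f z| ≤ c * parNorm z ^ (-p)) (h0 : ∀ z, R < parNorm z → f z = 0) : Integrable f := by
  refine ⟨hf.aestronglyMeasurable, ?_⟩
  obtain ⟨c', hc', H⟩ := lintegral_pker_ball_le hp hp3
  calc ∫⁻ z, ‖f z‖ₑ ≤ ∫⁻ z, {z | parNorm z ≤ R}.indicator (fun z => ENNReal.ofReal c * pker 0 p z) z := by
        refine lintegral_mono fun z => ?_
        by_cases hz : parNorm z ≤ R
        · rw [indicator_of_mem (by exact hz)]
          exact enorm_le_pker hp (h z) hc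
        · rw [h0 z (not_le.1 hz)]; simp
    _ = ENNReal.ofReal c * ∫⁻ z in {z | parNorm z ≤ R}, pker 0 p z := by
        rw [lintegral_indicator (measurableSet_parNorm_le R), lintegral_const_mul _ (measurable_pker _ _)]
    _ < ⊤ := ENNReal.mul_lt_top (by simp) ((H R hR).trans_lt (by simp))

lemma IsTruncatedHeatKernel.exists_rpow_bound (hK : IsTruncatedHeatKernel K C r) (hC : 0 < C) (k : ℕ) (hk : k ≤ 3) :
    ∃ c : ℝ, 0 < c ∧ ∀ z, |spaceDeriv^[k] K z| ≤ c * parNorm z ^ (-(k + 1 : ℝ)) := by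
  obtain ⟨c, hc, H⟩ := hK.exists_bound hC k hk
  refine ⟨c, hc, fun z => (H z).trans_eq ?_⟩
  rw [Real.rpow_neg (parNorm_nonneg z), show ((k : ℝ) + 1) = ((k + 1 : ℕ) : ℝ) by push_cast; ring, Real.rpow_natCast]

lemma IsTruncatedHeatKernel.integrable_iterate (hK : IsTruncatedHeatKernel K C r) (hC : 0 < C) (k : ℕ) (hk : k ≤ 1) :
    Integrable (spaceDeriv^[k] K) := by
  obtain ⟨c, hc, H⟩ := hK.exists_rpow_bound hC k (by omega)
  have : (k : ℝ) ≤ 1 := by exact_mod_cast hk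
  exact integrable_of_parabolic_bound (hK.measurable_iterate k) (by positivity) (by linarith) hc.le hC H
    fun z hz => hK.iterate_supported k hz

lemma IsTruncatedHeatKernel.integrable (hK : IsTruncatedHeatKernel K C r) (hC : 0 < C) : Integrable K :=
  hK.integrable_iterate hC 0 (by norm_num)

lemma IsTruncatedHeatKernel.measurable (hK : IsTruncatedHeatKernel K C r) : Measurable K := hK.measurable_iterate 0

lemma IsTruncatedHeatKernel.measurable_spaceDeriv (hK : IsTruncatedHeatKernel K C r) : Measurable (spaceDeriv K) :=
  hK.measurable_iterate 1

lemma IsTruncatedHeatKernel.integrable_spaceDeriv (hK : IsTruncatedHeatKernel K C r) (hC : 0 < C) :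
    Integrable (spaceDeriv K) := hK.integrable_iterate hC 1 le_rfl

lemma integrable_mul_of_compact {f g : ℝ × ℝ → ℝ} (hf : Integrable f) (hg : Continuous g) (hc : HasCompactSupport g)
    (z : ℝ × ℝ) : Integrable fun w => f w * g (z - w) := by
  obtain ⟨M, hM⟩ := hg.bounded_above_of_compact_support hc
  exact hf.mul_bdd (c := M) (by fun_prop) (Filter.Eventually.of_forall fun w => hM _)

lemma ae_fst_ne_zero : ∀ᵐ w : ℝ × ℝ, w.1 ≠ 0 := by
  have : (volume : Measure (ℝ × ℝ)) ((({0} : Set ℝ) ×ˢ (univ : Set ℝ))) = 0 := by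
    rw [Measure.volume_eq_prod, Measure.prod_prod]; simp
  rw [ae_iff]
  convert this using 2
  ext w; simp

/-- The mollification `K * ρ_ε`. -/
noncomputable def mollK (K ρ : ℝ × ℝ → ℝ) (ε : ℝ) : ℝ × ℝ → ℝ :=
  convolution K (rescale ρ ε) (ContinuousLinearMap.mul ℝ ℝ) volume

lemma mollK_apply (z : ℝ × ℝ) : mollK K ρ ε z = ∫ w, K w * rescale ρ ε (z - w) := rfl

lemma contDiff_mollK (hK : IsTruncatedHeatKernel K C r) (hC : 0 < C) (hρ : IsMollifier ρ) (hε : 0 < ε) :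
    ContDiff ℝ ∞ (mollK K ρ ε) :=
  (hρ.hasCompactSupport_rescale hε).contDiff_convolution_right _ (hK.integrable hC).locallyIntegrable (hρ.contDiff_rescale ε)

lemma hasCompactSupport_mollK_slice (hK : IsTruncatedHeatKernel K C r) (hρ : IsMollifier ρ) (hε : 0 < ε) (t : ℝ) :
    HasCompactSupport fun y => mollK K ρ ε (t, y) := by
  have hc : HasCompactSupport (mollK K ρ ε) := HasCompactSupport.convolution _ hK.hasCompactSupport (hρ.hasCompactSupport_rescale hε)
  refine HasCompactSupport.intro (hc.isCompact.image continuous_snd) fun y hy => ?_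
  by_contra h
  exact hy ⟨(t, y), subset_closure h, rfl⟩

/-- The kernel is singular at the origin, so the derivative is first put on the mollifier and then
moved by parts on each time slice `s ≠ 0`, where the kernel is smooth and compactly supported in
space. -/
lemma deriv_mollK (hK : IsTruncatedHeatKernel K C r) (hC : 0 < C) (hρ : IsMollifier ρ) (hε : 0 < ε) (t x : ℝ) :
    deriv (fun y => mollK K ρ ε (t, y)) x =
      convolution (spaceDeriv K) (rescale ρ ε) (ContinuousLinearMap.mul ℝ ℝ) volume (t, x) := by
  have hs := hρ.contDiff_rescale ε
  have hsc := hρ.hasCompactSupport_rescale hε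
  have h1 := hsc.hasFDerivAt_convolution_right (ContinuousLinearMap.mul ℝ ℝ) (hK.integrable hC).locallyIntegrable
    (hs.of_le (by exact_mod_cast le_top)) (t, x)
  have h2 := h1.comp_hasDerivAt x ((hasDerivAt_const x t).prodMk (hasDerivAt_id x))
  have h3 := h2.deriv
  have hcd : Continuous (fderiv ℝ (rescale ρ ε)) := hs.continuous_fderiv (by simp)
  rw [convolution_precompR_apply _ (hK.integrable hC).locallyIntegrable (hsc.fderiv ℝ) hcd] at h3
  refine h3.trans ?_
  simp only [convolution, ContinuousLinearMap.mul_apply']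
  have i1 : Integrable fun w => K w * (fderiv ℝ (rescale ρ ε) ((t, x) - w)) (0, 1) :=
    integrable_mul_of_compact (g := fun w => fderiv ℝ (rescale ρ ε) w (0, 1)) (hK.integrable hC) (by fun_prop)
      (HasCompactSupport.intro (hsc.fderiv ℝ).isCompact fun z hz => by
        rw [image_eq_zero_of_notMem_tsupport hz]; simp) (t, x)
  have i2 : Integrable fun w => spaceDeriv K w * rescale ρ ε ((t, x) - w) :=
    integrable_mul_of_compact (hK.integrable_spaceDeriv hC) hs.continuous hsc (t, x)
  rw [Measure.volume_eq_prod] at i1 i2 ⊢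
  rw [integral_prod _ i1, integral_prod _ i2]
  refine integral_congr_ae ?_
  have hne : ∀ᵐ s : ℝ, s ≠ 0 := by simp [ae_iff]
  filter_upwards [hne, i1.prod_right_ae, i2.prod_right_ae] with s hs0 j1 j2
  have d1 : ∀ y, HasDerivAt (fun y => K (s, y)) (spaceDeriv K (s, y)) y := fun y => hK.hasDerivAt_slice 0 s y hs0
  have d2 : ∀ y, HasDerivAt (fun y => -rescale ρ ε (t - s, x - y)) (fderiv ℝ (rescale ρ ε) (t - s, x - y) (0, 1)) y := by
    intro y
    have e := ((hs.differentiable (by simp)) (t - s, x - y)).hasFDerivAt.comp_hasDerivAt y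
      ((hasDerivAt_const y (t - s)).prodMk ((hasDerivAt_id y).const_sub x))
    have e' := e.neg
    rw [← map_neg] at e'
    exact e'.congr_deriv (by simp)
  have j3 : Integrable fun y => K (s, y) * (-rescale ρ ε (t - s, x - y)) := by
    have hcont : Continuous fun y => K (s, y) * (-rescale ρ ε (t - s, x - y)) := by
      have c1 : Continuous fun y => K (s, y) := continuous_iff_continuousAt.2 fun y => (d1 y).continuousAt
      have c2 : Continuous fun y => -rescale ρ ε (t - s, x - y) := continuous_iff_continuousAt.2 fun y => (d2 y).continuousAt
      exact c1.mul c2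
    refine hcont.integrable_of_hasCompactSupport (HasCompactSupport.intro (isCompact_Icc (a := -C) (b := C)) fun y hy => ?_)
    rw [hK.supported (s, y), zero_mul]
    refine lt_of_lt_of_le ?_ (abs_snd_le_parNorm (s, y))
    by_contra h
    exact hy (abs_le.1 (not_lt.1 h))
  have := integral_mul_deriv_eq_deriv_mul_of_integrable (u := fun y => K (s, y)) (v := fun y => -rescale ρ ε (t - s, x - y))
    (fun y _ => d1 y) (fun y _ => d2 y) j1 (by simpa [Pi.mul_def] using j2) j3
  simp only [Prod.mk_sub_mk]
  rw [this]
  simp [integral_neg]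

lemma integral_mul_shift (f g : ℝ × ℝ → ℝ) (z h : ℝ × ℝ) :
    ∫ w, f w * g (z + h - w) = ∫ w, f (w + h) * g (z - w) := by
  rw [← integral_add_right_eq_self _ h]
  congr 1; ext w; congr 2; abel

/-- The mollification of the kernel `∂ₓ^γ K'`. -/
noncomputable def mollKernel (K ρ : ℝ × ℝ → ℝ) (γ ε : ℝ) (z : ℝ × ℝ) : ℝ :=
  ∫ w, fracKernel K γ w * rescale ρ ε (z - w)

lemma measurable_fracIntegrand (hK : IsTruncatedHeatKernel K C r) (γ : ℝ) :
    Measurable fun p : (ℝ × ℝ) × ℝ =>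
      (2 * p.2 * spaceDeriv K p.1 - K (p.1.1, p.1.2 + p.2) + K (p.1.1, p.1.2 - p.2)) * p.2 ^ (-2 - γ) := by
  have h0 := hK.measurable
  have h1 := hK.measurable_spaceDeriv
  fun_prop

lemma measurable_fracKernel (hK : IsTruncatedHeatKernel K C r) (γ : ℝ) : Measurable (fracKernel K γ) := by
  unfold fracKernel
  split_ifs
  · exact hK.measurable_spaceDeriv
  · refine Measurable.const_mul ?_ _
    unfold fracInt
    exact ((measurable_fracIntegrand hK γ).stronglyMeasurable.integral_prod_right (ν := volume.restrict (Ioi 0))).measurable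

lemma IsMollifier.integrable_pker_mul (hρ : IsMollifier ρ) {f : ℝ × ℝ → ℝ} {c p : ℝ} (hf : Measurable f) (hc : 0 ≤ c)
    (h0 : 0 ≤ p) (h3 : p < 3) (h : ∀ z, |f z| ≤ c * parNorm z ^ (-p)) (hε : 0 < ε) (z : ℝ × ℝ) :
    Integrable fun w => f w * rescale ρ ε (z - w) := by
  have hs := (hρ.contDiff_rescale ε).continuous
  refine ⟨by fun_prop, ?_⟩
  obtain ⟨c', hc', H⟩ := lintegral_pker_mul_rescale_le hρ h0 h3
  obtain ⟨M, R, hM, hR, H'⟩ := hρ.rescale_bound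
  calc ∫⁻ w, ‖f w * rescale ρ ε (z - w)‖ₑ ≤ ∫⁻ w, ENNReal.ofReal c * (pker 0 p w * ENNReal.ofReal (rescale ρ ε (z - w))) := by
        refine lintegral_mono fun w => ?_
        rw [enorm_mul, ← mul_assoc, Real.enorm_eq_ofReal (H' ε hε _).1]
        exact mul_le_mul_left (enorm_le_pker h0 (h w) hc) _
    _ ≤ ENNReal.ofReal c * (ENNReal.ofReal c' * pker ε p z) := by
        rw [lintegral_const_mul' _ _ ENNReal.ofReal_ne_top]
        exact mul_le_mul_right (H ε hε z) _
    _ < ⊤ := by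
        have : 0 < parNorm z + ε := by linarith [parNorm_nonneg z]
        rw [pker, ENNReal.ofReal_rpow_of_pos this]
        exact ENNReal.mul_lt_top (by simp) (ENNReal.mul_lt_top (by simp) (by simp))

/-- `∂ₓ^γ (K' * ρ_ε)` is the mollification of `∂ₓ^γ K'`. -/
theorem fracDeriv_convolution (hK : IsTruncatedHeatKernel K C r) (hC : 0 < C) (hρ : IsMollifier ρ) (hε : 0 < ε) {γ : ℝ}
    (hγ : 0 ≤ γ) (hγ1 : γ < 1) (z : ℝ × ℝ) :
    fracDeriv γ (convolution (spaceDeriv K) (rescale ρ ε) (ContinuousLinearMap.mul ℝ ℝ) volume) z = mollKernel K ρ γ ε z := by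
  obtain ⟨t, x⟩ := z
  have hsm : ContDiff ℝ ∞ fun y => mollK K ρ ε (t, y) := (contDiff_mollK hK hC hρ hε).comp (by fun_prop)
  have hcs := hasCompactSupport_mollK_slice hK hρ hε t
  have hd : (fun y => convolution (spaceDeriv K) (rescale ρ ε) (ContinuousLinearMap.mul ℝ ℝ) volume (t, y)) =
      deriv fun y => mollK K ρ ε (t, y) := by
    ext y; exact (deriv_mollK hK hC hρ hε t y).symm
  simp only [fracDeriv, hd]
  rcases hγ.eq_or_lt with rfl | hγ
  · rw [fracLaplacian_zero (contDiff_deriv_of_smooth hsm) hcs.deriv, deriv_mollK hK hC hρ hε]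
    simp [mollKernel, fracKernel, convolution]
  rw [fracLaplacian_deriv hγ hγ1 hsm hcs, mollKernel]
  simp only [fracKernel, if_neg hγ.ne', mul_assoc]
  rw [integral_const_mul]
  congr 1
  have hs := hρ.contDiff_rescale ε
  have hsc := hρ.hasCompactSupport_rescale hε
  set F : ℝ → ℝ × ℝ → ℝ := fun y w => ((2 * y * spaceDeriv K w - K (w.1, w.2 + y) + K (w.1, w.2 - y)) * y ^ (-2 - γ)) *
    rescale ρ ε ((t, x) - w) with hF
  have hFm : Measurable (Function.uncurry F) := by
    have h0 := (measurable_fracIntegrand hK γ).comp (measurable_swap (α := ℝ) (β := ℝ × ℝ))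
    have := hs.continuous
    exact h0.mul (by fun_prop)
  have e1 : ∀ y, (2 * y * deriv (fun y => mollK K ρ ε (t, y)) x - mollK K ρ ε (t, x + y) + mollK K ρ ε (t, x - y)) * y ^ (-2 - γ)
      = ∫ w, F y w := by
    intro y
    have i1 := integrable_mul_of_compact (hK.integrable_spaceDeriv hC) hs.continuous hsc (t, x)
    have j : ∀ h : ℝ × ℝ, Integrable fun w => K (w + h) * rescale ρ ε ((t, x) - w) := fun h =>
      integrable_mul_of_compact ((hK.integrable hC).comp_add_right h) hs.continuous hsc (t, x)
    have k1 : mollK K ρ ε (t, x + y) = ∫ w, K (w + (0, y)) * rescale ρ ε ((t, x) - w) := by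
      rw [← integral_mul_shift, mollK_apply]; simp
    have k2 : mollK K ρ ε (t, x - y) = ∫ w, K (w + (0, -y)) * rescale ρ ε ((t, x) - w) := by
      rw [← integral_mul_shift, mollK_apply]; simp [sub_eq_add_neg]
    have k3 : deriv (fun y => mollK K ρ ε (t, y)) x = ∫ w, spaceDeriv K w * rescale ρ ε ((t, x) - w) := deriv_mollK hK hC hρ hε t x
    have E1 := integral_sub (i1.const_mul (2 * y)) (j (0, y))
    have E2 := integral_add ((i1.const_mul (2 * y)).sub (j (0, y))) (j (0, -y))
    simp only [Pi.sub_apply] at E1 E2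
    rw [k1, k2, k3, ← integral_const_mul (2 * y), ← E1, ← E2, ← integral_mul_const]
    congr 1; ext w
    simp only [hF, show w + (0, y) = (w.1, w.2 + y) by ext <;> simp, show w + (0, -y) = (w.1, w.2 - y) by ext <;> simp [sub_eq_add_neg]]
    ring
  -- The absolute integral in `y` is at most a multiple of `‖w‖^{-2-γ}`, which is integrable against
  -- the mollifier as `2 + γ < 3`. The slice `w.1 = 0` is null and is discarded.
  have hfint : Integrable (Function.uncurry F) ((volume.restrict (Ioi 0)).prod volume) := by
    obtain ⟨M, hM, HM⟩ := hK.kernelControl hC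
    have hγ' : 0 < 1 - γ := by linarith
    rw [integrable_prod_iff' hFm.aestronglyMeasurable]
    constructor
    · filter_upwards [ae_fst_ne_zero] with w hw
      simp only [Function.uncurry, hF]
      refine Integrable.mul_const ?_ _
      rcases lt_or_gt_of_ne hw with h | h
      · have h1 : spaceDeriv K w = 0 := hK.iterate_causal 1 h.le w.2
        simp [h1, hK.causal _ _ h.le]
      · exact ((HM _ h).fracInt_bound hγ hγ1 w.2).1
    · set L := (2 / (1 - γ) + 2 * (1 + 1 / γ) + 1) * M * 4 ^ (2 + γ)
      set G : ℝ × ℝ → ℝ := fun w => L * parNorm w ^ (-(2 + γ))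
      have hG : Integrable fun w => G w * rescale ρ ε ((t, x) - w) := by
        refine hρ.integrable_pker_mul (c := L) (p := 2 + γ) ((continuous_parNorm.measurable.pow_const _).const_mul _) (by positivity) (by linarith) (by linarith) (fun z => ?_) hε _
        rw [abs_of_nonneg (mul_nonneg (by positivity) (Real.rpow_nonneg (parNorm_nonneg z) _))]
      refine hG.mono' ?_ ?_
      · exact (hFm.comp measurable_swap).norm.stronglyMeasurable.integral_prod_right.aestronglyMeasurable
      · obtain ⟨M', R', hM', hR', H'⟩ := hρ.rescale_bound
        filter_upwards [ae_fst_ne_zero] with w hw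
        simp only [Function.uncurry, hF, norm_mul (_ * _) (rescale _ _ _)]
        rw [integral_mul_const, norm_mul]
        simp only [Real.norm_eq_abs]
        rw [abs_abs, abs_of_nonneg (H' ε hε _).1]
        refine mul_le_mul_of_nonneg_right ?_ (H' ε hε _).1
        rw [abs_of_nonneg (integral_nonneg fun _ => abs_nonneg _)]
        rcases lt_or_gt_of_ne hw with h | h
        · have h1 : spaceDeriv K w = 0 := hK.iterate_causal 1 h.le w.2
          simp only [h1, hK.causal _ _ h.le]
          simp only [mul_zero, sub_zero, add_zero, zero_mul, abs_zero, integral_zero]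
          exact mul_nonneg (by positivity) (Real.rpow_nonneg (parNorm_nonneg w) _)
        · refine ((HM _ h).fracInt_bound hγ hγ1 w.2).2.trans ?_
          have hpos : 0 < √w.1 + |w.2| := by have := Real.sqrt_pos.2 h; positivity
          rw [← parNorm_mk_pos h] at hpos ⊢
          simp only [Prod.mk.eta] at hpos ⊢
          simp only [G, L, show -2 - γ = -(2 + γ) by ring]
          rw [Real.div_rpow hpos.le (by norm_num), Real.rpow_neg (by norm_num : (0:ℝ) ≤ 4), div_inv_eq_mul, mul_assoc (_ * M), mul_comm (4 ^ (2 + γ) : ℝ)]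
  unfold fracInt
  simp only [e1]
  rw [integral_integral_swap hfint]
  congr 1; ext w
  simp only [hF]
  rw [integral_mul_const]

lemma noiseKernel_eq (hK : IsTruncatedHeatKernel K C r) (hC : 0 < C) (hρ : IsMollifier ρ) (hε : 0 < ε) {γ : ℝ}
    (hγ : 0 ≤ γ) (hγ1 : γ < 1) : noiseKernel K ρ γ ε = periodize (mollKernel K ρ γ ε) := by
  unfold noiseKernel
  congr 1; ext z
  exact fracDeriv_convolution hK hC hρ hε hγ hγ1 z

end

end FracKPZ

/-! ### The noise kernel: bounds uniform in `ε`, parity, periodization -/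

namespace FracKPZ
open Set ENNReal

section
variable {K ρ : ℝ × ℝ → ℝ} {C r ε γ : ℝ}

lemma enorm_le_mul_pker_iff {a c p : ℝ} (hc : 0 ≤ c) (hε : 0 < ε) {z : ℝ × ℝ} :
    ‖a‖ₑ ≤ ENNReal.ofReal c * pker ε p z ↔ |a| ≤ c * (parNorm z + ε) ^ (-p) := by
  have h : 0 < parNorm z + ε := by linarith [parNorm_nonneg z]
  rw [Real.enorm_eq_ofReal_abs, pker, ENNReal.ofReal_rpow_of_pos h, ← ENNReal.ofReal_mul hc,
    ENNReal.ofReal_le_ofReal_iff (by positivity)]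

lemma IsMollifier.enorm_integral_mul_le (hρ : IsMollifier ρ) (hε : 0 < ε) {f : ℝ × ℝ → ℝ} {g : ℝ × ℝ → ℝ≥0∞}
    (h : ∀ w, ‖f w‖ₑ ≤ g w) (z : ℝ × ℝ) :
    ‖∫ w, f w * rescale ρ ε (z - w)‖ₑ ≤ ∫⁻ w, g w * ENNReal.ofReal (rescale ρ ε (z - w)) := by
  obtain ⟨M, R, hM, hR, H⟩ := hρ.rescale_bound
  refine (enorm_integral_le_lintegral_enorm _).trans (lintegral_mono fun w => ?_)
  rw [enorm_mul, Real.enorm_eq_ofReal (H ε hε _).1]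
  exact mul_le_mul_left (h w) _

lemma exists_mollKernel_size (hK : IsTruncatedHeatKernel K C r) (hC : 0 < C) (hρ : IsMollifier ρ)
    (hγ : 0 ≤ γ) (hγ1 : γ < 1) : ∃ c : ℝ, 0 < c ∧ ∀ ε : ℝ, 0 < ε → ∀ z,
      |mollKernel K ρ γ ε z| ≤ c * (parNorm z + ε) ^ (-(2 + γ)) := by
  obtain ⟨c, hc, H⟩ := hK.exists_hasOrder_fracKernel hC hγ hγ1
  obtain ⟨c', hc', H'⟩ := lintegral_pker_mul_rescale_le hρ (α := 2 + γ) (by linarith) (by linarith)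
  refine ⟨c * c', by positivity, fun ε hε z => ?_⟩
  rw [← enorm_le_mul_pker_iff (by positivity) hε]
  refine (hρ.enorm_integral_mul_le hε (fun w => enorm_le_pker (by linarith) (H.size w) hc.le) z).trans ?_
  simp only [mul_assoc]
  rw [lintegral_const_mul' _ _ ENNReal.ofReal_ne_top, ENNReal.ofReal_mul hc.le, mul_assoc]
  exact mul_le_mul_right (H' ε hε z) _

/-- A spatial increment of the mollified kernel is the mollification of an increment of the kernel.
The weights have order `5/2 + γ`, and `γ < 1/2` keeps this below 3, so that mollifying regularises
them. -/
lemma exists_mollKernel_holder (hK : IsTruncatedHeatKernel K C r) (hC : 0 < C) (hρ : IsMollifier ρ)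
    (hγ : 0 ≤ γ) (hγ1 : γ < 1 / 2) : ∃ c : ℝ, 0 < c ∧ ∀ ε : ℝ, 0 < ε → ∀ t x x',
      |mollKernel K ρ γ ε (t, x) - mollKernel K ρ γ ε (t, x')| ≤ c * |x - x'| ^ (1 / 2 : ℝ) *
        ((parNorm (t, x) + ε) ^ (-(5 / 2 + γ)) + (parNorm (t, x') + ε) ^ (-(5 / 2 + γ))) := by
  obtain ⟨c, hc, H⟩ := hK.exists_hasOrder_fracKernel hC hγ (by linarith)
  obtain ⟨c', hc', H'⟩ := lintegral_pker_mul_rescale_le hρ (α := 5 / 2 + γ) (by linarith) (by linarith)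
  refine ⟨c * c', by positivity, fun ε hε t x x' => ?_⟩
  set δ := |x - x'| ^ (1 / 2 : ℝ) with hδ
  have hδ0 : 0 ≤ δ := by positivity
  set h : ℝ × ℝ := (0, x' - x) with hh
  have hzh : ((t, x) : ℝ × ℝ) + h = (t, x') := by simp [hh]
  have hfm := measurable_fracKernel hK γ
  have e : mollKernel K ρ γ ε (t, x) - mollKernel K ρ γ ε (t, x') =
      ∫ w, (fracKernel K γ w - fracKernel K γ (w + h)) * rescale ρ ε ((t, x) - w) := by
    have i1 := hρ.integrable_pker_mul hfm hc.le (by linarith) (by linarith) H.size hε (t, x)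
    have i2 : Integrable fun w => fracKernel K γ (w + h) * rescale ρ ε ((t, x) - w) := by
      have := (hρ.integrable_pker_mul hfm hc.le (by linarith) (by linarith) H.size hε (t, x')).comp_add_right h
      refine this.congr (Filter.Eventually.of_forall fun w => ?_)
      simp only [← hzh]; congr 2; abel
    have E := integral_sub i1 i2
    simp only [← sub_mul] at E
    rw [E, mollKernel, mollKernel, ← hzh, integral_mul_shift]
  have hb : ∀ w, ‖fracKernel K γ w - fracKernel K γ (w + h)‖ₑ ≤
      ENNReal.ofReal (c * δ) * (pker 0 (5 / 2 + γ) w + pker 0 (5 / 2 + γ) (w + h)) := by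
    intro w
    have := H.holder w.1 w.2 (w.2 + (x' - x))
    have e2 : w + h = (w.1, w.2 + (x' - x)) := by simp [hh, Prod.ext_iff]
    have e3 : |w.2 - (w.2 + (x' - x))| = |x - x'| := by congr 1; ring
    rw [e3, ← hδ, ← e2, show -(2 + γ) - 1 / 2 = -(5 / 2 + γ) by ring] at this
    rw [Real.enorm_eq_ofReal_abs]
    refine (ENNReal.ofReal_le_ofReal this).trans ?_
    rw [ENNReal.ofReal_mul (by positivity), ENNReal.ofReal_add (Real.rpow_nonneg (parNorm_nonneg _) _) (Real.rpow_nonneg (parNorm_nonneg _) _), pker, pker, add_zero, add_zero]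
    exact mul_le_mul_right (add_le_add (ofReal_rpow_neg_le (parNorm_nonneg _) (by linarith)) (ofReal_rpow_neg_le (parNorm_nonneg _) (by linarith))) _
  have hsm := (hρ.contDiff_rescale ε).continuous
  have key : ‖mollKernel K ρ γ ε (t, x) - mollKernel K ρ γ ε (t, x')‖ₑ ≤
      ENNReal.ofReal (c * δ) * (ENNReal.ofReal c' * pker ε (5 / 2 + γ) (t, x) + ENNReal.ofReal c' * pker ε (5 / 2 + γ) (t, x')) := by
    rw [e]
    refine (hρ.enorm_integral_mul_le hε hb (t, x)).trans ?_
    simp only [mul_assoc]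
    rw [lintegral_const_mul' _ _ ENNReal.ofReal_ne_top]
    refine mul_le_mul_right ?_ _
    simp only [add_mul]
    rw [lintegral_add_left (by have := measurable_pker 0 (5 / 2 + γ); fun_prop)]
    refine add_le_add (H' ε hε _) ?_
    refine le_trans (le_of_eq ?_) (H' ε hε (t, x'))
    rw [← lintegral_add_right_eq_self (fun w => pker 0 (5 / 2 + γ) w * ENNReal.ofReal (rescale ρ ε ((t, x') - w))) h]
    congr 1; ext w; congr 3; rw [← hzh]; abel
  rw [← mul_add, ← mul_assoc, ← ENNReal.ofReal_mul (by positivity), Real.enorm_eq_ofReal_abs, pker, pker,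
    ENNReal.ofReal_rpow_of_pos (by linarith [parNorm_nonneg (t, x)]),
    ENNReal.ofReal_rpow_of_pos (by linarith [parNorm_nonneg (t, x')]), ← ENNReal.ofReal_add, ← ENNReal.ofReal_mul (by positivity),
    ENNReal.ofReal_le_ofReal_iff] at key
  · refine key.trans_eq ?_; ring
  · have := parNorm_nonneg (t, x); have := parNorm_nonneg (t, x'); positivity
  · have := parNorm_nonneg (t, x); positivity
  · have := parNorm_nonneg (t, x'); positivity

lemma IsTruncatedHeatKernel.spaceDeriv_odd (hK : IsTruncatedHeatKernel K C r) (t x : ℝ) :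
    spaceDeriv K (t, -x) = -spaceDeriv K (t, x) := by
  have h : (fun y => K (t, y)) = fun y => K (t, -y) := by ext y; rw [hK.even]
  simp only [spaceDeriv]
  conv_rhs => rw [h, deriv_comp_neg (fun y => K (t, y))]
  simp

lemma IsTruncatedHeatKernel.fracKernel_odd (hK : IsTruncatedHeatKernel K C r) (γ t x : ℝ) :
    fracKernel K γ (t, -x) = -fracKernel K γ (t, x) := by
  unfold fracKernel
  split_ifs
  · exact hK.spaceDeriv_odd t x
  · rw [← mul_neg]
    congr 1
    unfold fracInt
    rw [← integral_neg]
    congr 1; ext y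
    change (2 * y * spaceDeriv K (t, -x) - K (t, -x + y) + K (t, -x - y)) * _ =
      -((2 * y * spaceDeriv K (t, x) - K (t, x + y) + K (t, x - y)) * _)
    rw [hK.spaceDeriv_odd, ← hK.even t (x + y), ← hK.even t (x - y), show -x + y = -(x - y) by ring, show -x - y = -(x + y) by ring]
    ring

/-- The nonlocal operator acts on each time slice separately, so bounded support survives in time
though not in space. This is why decay in space and a sum over periods are needed below. -/
lemma fracKernel_eq_zero_of_time (hK : IsTruncatedHeatKernel K C r) (hC : 0 < C) (γ : ℝ) {t : ℝ} (ht : C ^ 2 < |t|) (x : ℝ) :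
    fracKernel K γ (t, x) = 0 := by
  have h : ∀ y, C < parNorm (t, y) := fun y => by
    refine lt_of_lt_of_le ?_ (sqrt_abs_fst_le_parNorm (t, y))
    exact (Real.lt_sqrt hC.le).2 ht
  have h1 : ∀ y, spaceDeriv K (t, y) = 0 := fun y => hK.iterate_supported 1 (h y)
  unfold fracKernel
  split_ifs
  · exact h1 x
  · simp [fracInt, h1, fun y => hK.supported _ (h y)]

/-- Reflection in space. -/
lemma measurePreserving_reflect : MeasurePreserving (fun w : ℝ × ℝ => (w.1, -w.2)) :=
  (MeasurePreserving.id volume).prod (Measure.measurePreserving_neg volume)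

lemma integral_comp_reflect (f : ℝ × ℝ → ℝ) : ∫ w : ℝ × ℝ, f (w.1, -w.2) = ∫ w, f w :=
  measurePreserving_reflect.integral_comp
    ((Homeomorph.refl ℝ).prodCongr (Homeomorph.neg ℝ)).measurableEmbedding f

lemma mollKernel_odd (hK : IsTruncatedHeatKernel K C r) (hρ : IsMollifier ρ) (t x : ℝ) :
    mollKernel K ρ γ ε (t, -x) = -mollKernel K ρ γ ε (t, x) := by
  simp only [mollKernel]
  rw [← integral_comp_reflect, ← integral_neg]
  congr 1; ext w
  rw [hK.fracKernel_odd, neg_mul]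
  congr 2
  rw [Prod.mk_sub_mk, show -x - -w.2 = -(x - w.2) by ring, hρ.rescale_even]
  rfl

lemma exists_mollKernel_time (hK : IsTruncatedHeatKernel K C r) (hC : 0 < C) (hρ : IsMollifier ρ) (γ : ℝ) :
    ∃ T : ℝ, 0 < T ∧ ∀ ε : ℝ, 0 < ε → ε ≤ 1 → ∀ t x, T < |t| → mollKernel K ρ γ ε (t, x) = 0 := by
  obtain ⟨M, R, hM, hR, H⟩ := hρ.rescale_bound
  refine ⟨C ^ 2 + R ^ 2, by positivity, fun ε hε hε1 t x ht => ?_⟩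
  rw [mollKernel]
  refine integral_eq_zero_of_ae (Filter.Eventually.of_forall fun w => ?_)
  by_cases h : C ^ 2 < |w.1|
  · simp [fracKernel_eq_zero_of_time hK hC γ h w.2]
  · have : R * ε < parNorm ((t, x) - w) := by
      refine lt_of_lt_of_le ?_ (sqrt_abs_fst_le_parNorm _)
      refine (Real.lt_sqrt (by positivity)).2 ?_
      have h1 : |t| ≤ |t - w.1| + |w.1| := by simpa using abs_add_le (t - w.1) w.1
      have h2 : (R * ε) ^ 2 ≤ R ^ 2 := by
        apply pow_le_pow_left₀ (by positivity); nlinarith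
      simp only [Prod.fst_sub]
      linarith [not_lt.1 h]
    simp [(H ε hε _).2.2 this]

lemma measurable_mollKernel (hK : IsTruncatedHeatKernel K C r) (hρ : IsMollifier ρ) : Measurable (mollKernel K ρ γ ε) := by
  have h1 := measurable_fracKernel hK γ
  have h2 := (hρ.contDiff_rescale ε).continuous.measurable
  have : Measurable fun p : (ℝ × ℝ) × (ℝ × ℝ) => fracKernel K γ p.2 * rescale ρ ε (p.1 - p.2) := by fun_prop
  exact this.stronglyMeasurable.integral_prod_right.measurable

end

/-- A kernel which is `1`-periodic and odd in space, compactly supported in time, and which near the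
origin is of order `-p` and `1/2`-Hölder in space, down to the scale `ε`. -/
structure IsNoiseKernel (N : ℝ × ℝ → ℝ) (c T p ε : ℝ) : Prop where
  meas : Measurable N
  periodic : ∀ t x, ∀ k : ℤ, N (t, x + k) = N (t, x)
  odd : ∀ t x, N (t, -x) = -N (t, x)
  time : ∀ t x, T < |t| → N (t, x) = 0
  size : ∀ t x, |x| ≤ 3 / 4 → |N (t, x)| ≤ c * (parNorm (t, x) + ε) ^ (-p)
  holder : ∀ t x x', |x| ≤ 3 / 4 → |x'| ≤ 3 / 4 → |N (t, x) - N (t, x')| ≤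
    c * |x - x'| ^ (1 / 2 : ℝ) * ((parNorm (t, x) + ε) ^ (-(p + 1 / 2)) + (parNorm (t, x') + ε) ^ (-(p + 1 / 2)))

/-- The sum over the periods other than the first. -/
noncomputable def tailSum : ℝ := ∑' k : ℤ, if k = 0 then 0 else 64 * ((k : ℝ) ^ 2)⁻¹

lemma summable_tail : Summable fun k : ℤ => if k = 0 then 0 else 64 * ((k : ℝ) ^ 2)⁻¹ := by
  have h : Summable fun k : ℤ => 64 * ((k : ℝ) ^ 2)⁻¹ := by
    have := (Real.summable_one_div_int_pow (p := 2)).2 (by norm_num)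
    simpa [one_div] using this.mul_left 64
  refine h.of_nonneg_of_le (fun k => ?_) (fun k => ?_) <;> split_ifs <;> first | positivity | exact le_rfl

lemma tailSum_nonneg : 0 ≤ tailSum := tsum_nonneg fun k => by split_ifs <;> positivity

/-- For `k ≠ 0`, `|x + k| ≥ |k| - 3/4 ≥ |k|/4`. The constant is `4³`, and only the summable power
`|k|^{-2}` is kept. -/
lemma rpow_tail_le {t x ε q : ℝ} (hx : |x| ≤ 3 / 4) (hε : 0 < ε) (hq : 2 ≤ q) (hq3 : q ≤ 3) {k : ℤ} (hk : k ≠ 0) :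
    (parNorm (t, x + k) + ε) ^ (-q) ≤ 64 * ((k : ℝ) ^ 2)⁻¹ := by
  have hk1 : (1 : ℝ) ≤ |(k : ℝ)| := by exact_mod_cast Int.one_le_abs hk
  have h1 : |(k : ℝ)| / 4 ≤ parNorm (t, x + k) + ε := by
    have h2 := abs_snd_le_parNorm (t, x + k)
    have h3 : |(k : ℝ)| ≤ |x + k| + |x| := by simpa using abs_sub (x + k) x
    simp only at h2
    linarith
  have hpos : 0 < |(k : ℝ)| / 4 := by positivity
  calc _ ≤ (|(k : ℝ)| / 4) ^ (-q) := Real.rpow_le_rpow_of_nonpos hpos h1 (by linarith)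
    _ = 4 ^ q * |(k : ℝ)| ^ (-q) := by
        rw [Real.div_rpow (by positivity) (by norm_num), Real.rpow_neg (by norm_num : (0:ℝ) ≤ 4), div_inv_eq_mul, mul_comm]
    _ ≤ 4 ^ (3 : ℝ) * |(k : ℝ)| ^ (-2 : ℝ) := by
        have a1 : (4 : ℝ) ^ q ≤ 4 ^ (3 : ℝ) := Real.rpow_le_rpow_of_exponent_le (by norm_num) hq3
        have a2 : |(k : ℝ)| ^ (-q) ≤ |(k : ℝ)| ^ (-2 : ℝ) := Real.rpow_le_rpow_of_exponent_le hk1 (by linarith)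
        exact mul_le_mul a1 a2 (by positivity) (by positivity)
    _ = _ := by
        rw [Real.rpow_neg (by positivity)]
        norm_num

/-- On the support in time the weight is bounded below, so a bounded contribution of the other
periods can be absorbed in it. -/
lemma one_le_mul_rpow {T t x ε q : ℝ} (hT : 0 < T) (ht : |t| ≤ T) (hx : |x| ≤ 3 / 4) (hε : 0 < ε) (hε1 : ε ≤ 1) (hq0 : 0 ≤ q) (hq : q ≤ 3) :
    1 ≤ (√T + 2) ^ 3 * (parNorm (t, x) + ε) ^ (-q) := by
  have h1 : parNorm (t, x) + ε ≤ √T + 2 := by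
    have := Real.sqrt_le_sqrt ht
    simp only [parNorm]; linarith
  have hp : 0 < parNorm (t, x) + ε := by linarith [parNorm_nonneg (t, x)]
  have hT2 : 1 ≤ √T + 2 := by linarith [Real.sqrt_nonneg T]
  calc (1 : ℝ) = (√T + 2) ^ q * (√T + 2) ^ (-q) := by rw [← Real.rpow_add (by linarith)]; simp
    _ ≤ (√T + 2) ^ (3 : ℝ) * (parNorm (t, x) + ε) ^ (-q) := by
        have a1 : (√T + 2) ^ q ≤ (√T + 2) ^ (3 : ℝ) := Real.rpow_le_rpow_of_exponent_le hT2 hq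
        have a2 := Real.rpow_le_rpow_of_nonpos hp h1 (show -q ≤ 0 by linarith)
        exact mul_le_mul a1 a2 (by positivity) (by positivity)
    _ = _ := by norm_num

lemma periodize_add_int (f : ℝ × ℝ → ℝ) (t x : ℝ) (k : ℤ) : periodize f (t, x + k) = periodize f (t, x) := by
  simp only [periodize]
  rw [← (Equiv.addLeft k).tsum_eq (fun n : ℤ => f (t, x + n))]
  refine tsum_congr fun n => ?_
  simp [add_assoc]

lemma tsum_sub_le_of_tail {f : ℤ → ℝ} {A : ℝ} (hA : ∀ k, k ≠ 0 → |f k| ≤ A * (64 * ((k : ℝ) ^ 2)⁻¹)) :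
    Summable f ∧ |(∑' k, f k) - f 0| ≤ A * tailSum := by
  have hs : Summable fun k : ℤ => if k = 0 then 0 else f k := by
    refine Summable.of_norm_bounded (summable_tail.mul_left A) fun k => ?_
    split_ifs with h
    · simp
    · exact hA k h
  have hsum : Summable f := by
    have h2 : Summable fun k : ℤ => if k = 0 then f k else 0 := summable_of_ne_finset_zero (s := {0}) fun k hk => by
      rw [if_neg]; simpa using hk
    refine (hs.add h2).congr fun k => ?_
    by_cases h : k = 0 <;> simp [h]
  refine ⟨hsum, ?_⟩
  rw [hsum.tsum_eq_add_tsum_ite 0, add_sub_cancel_left, ← Real.norm_eq_abs, tailSum, ← tsum_mul_left]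
  refine tsum_of_norm_bounded (summable_tail.mul_left A).hasSum fun k => ?_
  split_ifs with h
  · simp
  · exact hA k h

/-- The singularity sits in the term `k = 0`; the other terms sum to a bounded quantity, or one
bounded by `|x - x'|^{1/2}` for increments. The factor 2 in the constant comes from the two weights
of the Hölder bound. -/
lemma periodize_bound {f : ℝ × ℝ → ℝ} {c T p ε : ℝ} (hc : 0 ≤ c) (hT : 0 < T) (hp : 2 ≤ p) (hp1 : p ≤ 5 / 2) (hε : 0 < ε) (hε1 : ε ≤ 1)
    (hm : Measurable f) (hodd : ∀ t x, f (t, -x) = -f (t, x)) (htime : ∀ t x, T < |t| → f (t, x) = 0)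
    (hsize : ∀ z, |f z| ≤ c * (parNorm z + ε) ^ (-p))
    (hholder : ∀ t x x', |f (t, x) - f (t, x')| ≤
      c * |x - x'| ^ (1 / 2 : ℝ) * ((parNorm (t, x) + ε) ^ (-(p + 1 / 2)) + (parNorm (t, x') + ε) ^ (-(p + 1 / 2)))) :
    IsNoiseKernel (periodize f) (c * (1 + 2 * tailSum * (√T + 2) ^ 3)) T p ε := by
  have htail := tailSum_nonneg
  have hsq := Real.sqrt_nonneg T
  have hsum0 : ∀ t x, |x| ≤ 3 / 4 → Summable (fun k : ℤ => f (t, x + k)) ∧ |periodize f (t, x) - f (t, x)| ≤ c * tailSum := by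
    intro t x hx
    have := tsum_sub_le_of_tail (f := fun k : ℤ => f (t, x + k)) (A := c) fun k hk =>
      (hsize _).trans (mul_le_mul_of_nonneg_left (rpow_tail_le hx hε hp (by linarith) hk) hc)
    simpa [periodize] using this
  have hsum : ∀ t x, Summable (fun k : ℤ => f (t, x + k)) := by
    intro t x
    have h := (hsum0 t (x - round x) ((abs_sub_round x).trans (by norm_num))).1
    rw [← (Equiv.addLeft (round x)).summable_iff] at h
    refine h.congr fun k => ?_
    simp only [Function.comp, Equiv.coe_addLeft]; congr 2; push_cast; ring
  have hzero : ∀ t x, T < |t| → periodize f (t, x) = 0 := fun t x ht => by simp [periodize, htime t _ ht]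
  constructor
  · refine measurable_of_tendsto_metrizable' (Filter.atTop : Filter (Finset ℤ))
      (f := fun s z => ∑ k ∈ s, f (z.1, z.2 + (k : ℤ))) (fun s => ?_) ?_
    · exact Finset.measurable_sum _ fun k _ => by fun_prop
    · rw [tendsto_pi_nhds]
      exact fun z => (hsum z.1 z.2).hasSum
  · exact fun t x k => periodize_add_int f t x k
  · intro t x
    simp only [periodize]
    rw [← tsum_neg, ← (Equiv.neg ℤ).tsum_eq]
    refine tsum_congr fun k => ?_
    rw [← hodd]; simp [add_comm]
  · exact hzero
  · intro t x hx
    have hpos : 0 ≤ (parNorm (t, x) + ε) ^ (-p) := Real.rpow_nonneg (by linarith [parNorm_nonneg (t, x)]) _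
    by_cases ht : T < |t|
    · rw [hzero t x ht, abs_zero]
      exact mul_nonneg (by positivity) hpos
    · have h1 := (hsum0 t x hx).2
      have h2 := hsize (t, x)
      have h3 := mul_le_mul_of_nonneg_left (one_le_mul_rpow hT (not_lt.1 ht) hx hε hε1 (by linarith : 0 ≤ p) (by linarith)) (mul_nonneg hc htail)
      have h4 : |periodize f (t, x)| ≤ |periodize f (t, x) - f (t, x)| + |f (t, x)| := by
        simpa using abs_add_le (periodize f (t, x) - f (t, x)) (f (t, x))
      have h5 : 0 ≤ c * tailSum * ((√T + 2) ^ 3 * (parNorm (t, x) + ε) ^ (-p)) := by positivity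
      nlinarith
  · intro t x x' hx hx'
    have hpos : 0 ≤ (parNorm (t, x) + ε) ^ (-(p + 1 / 2)) := Real.rpow_nonneg (by linarith [parNorm_nonneg (t, x)]) _
    have hpos' : 0 ≤ (parNorm (t, x') + ε) ^ (-(p + 1 / 2)) := Real.rpow_nonneg (by linarith [parNorm_nonneg (t, x')]) _
    by_cases ht : T < |t|
    · rw [hzero t x ht, hzero t x' ht, sub_zero, abs_zero]
      exact mul_nonneg (by positivity) (by positivity)
    · set δ := |x - x'| ^ (1 / 2 : ℝ) with hδ
      have hδ0 : 0 ≤ δ := by positivity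
      have key := tsum_sub_le_of_tail (f := fun k : ℤ => f (t, x + k) - f (t, x' + k)) (A := c * δ * 2) fun k hk => by
        refine (hholder _ _ _).trans ?_
        rw [add_sub_add_right_eq_sub, ← hδ, mul_assoc (c * δ)]
        refine mul_le_mul_of_nonneg_left ?_ (by positivity)
        linarith [rpow_tail_le (t := t) hx hε (q := p + 1 / 2) (by linarith) (by linarith) hk,
          rpow_tail_le (t := t) hx' hε (q := p + 1 / 2) (by linarith) (by linarith) hk]
      have E := key.2
      rw [(hsum t x).tsum_sub (hsum t x')] at E
      simp only [Int.cast_zero, add_zero] at E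
      have h1 := hholder t x x'
      rw [← hδ] at h1
      have h2 := mul_le_mul_of_nonneg_left (one_le_mul_rpow hT (not_lt.1 ht) hx hε hε1 (by linarith : 0 ≤ p + 1 / 2) (by linarith)) (mul_nonneg (mul_nonneg hc hδ0) htail)
      have h4 : |periodize f (t, x) - periodize f (t, x')| ≤ |(periodize f (t, x) - periodize f (t, x')) - (f (t, x) - f (t, x'))| + |f (t, x) - f (t, x')| := by
        simpa using abs_add_le ((periodize f (t, x) - periodize f (t, x')) - (f (t, x) - f (t, x'))) (f (t, x) - f (t, x'))
      have h6 : 0 ≤ c * δ * tailSum * ((√T + 2) ^ 3 * (parNorm (t, x') + ε) ^ (-(p + 1 / 2))) := by positivity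
      simp only [periodize] at h4 ⊢
      nlinarith

/-- Uniformly in `ε`, the kernel `π ∂ₓ^γ K'_ε` is of order `-2 - γ`. -/
theorem exists_isNoiseKernel {K ρ : ℝ × ℝ → ℝ} {C r γ : ℝ} (hK : IsTruncatedHeatKernel K C r) (hC : 0 < C) (hρ : IsMollifier ρ)
    (hγ : 0 ≤ γ) (hγ1 : γ < 1 / 2) : ∃ c T : ℝ, 0 < c ∧ 0 < T ∧ ∀ ε : ℝ, 0 < ε → ε ≤ 1 →
      IsNoiseKernel (noiseKernel K ρ γ ε) c T (2 + γ) ε := by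
  obtain ⟨c₁, h₁, H₁⟩ := exists_mollKernel_size hK hC hρ hγ (by linarith)
  obtain ⟨c₂, h₂, H₂⟩ := exists_mollKernel_holder hK hC hρ hγ hγ1
  obtain ⟨T, hT, H₃⟩ := exists_mollKernel_time hK hC hρ γ
  have htail := tailSum_nonneg
  have hsq := Real.sqrt_nonneg T
  refine ⟨(c₁ + c₂) * (1 + 2 * tailSum * (√T + 2) ^ 3), T, by positivity, hT, fun ε hε hε1 => ?_⟩
  rw [noiseKernel_eq hK hC hρ hε hγ (by linarith)]
  refine periodize_bound (by positivity) hT (by linarith) (by linarith) hε hε1 (measurable_mollKernel hK hρ)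
    (mollKernel_odd hK hρ) (H₃ ε hε hε1) (fun z => (H₁ ε hε z).trans ?_) (fun t x x' => (H₂ ε hε t x x').trans ?_)
  · have : 0 ≤ (parNorm z + ε) ^ (-(2 + γ)) := Real.rpow_nonneg (by linarith [parNorm_nonneg z]) _
    exact mul_le_mul_of_nonneg_right (by linarith) this
  · have a1 : 0 ≤ (parNorm (t, x) + ε) ^ (-(5 / 2 + γ)) := Real.rpow_nonneg (by linarith [parNorm_nonneg (t, x)]) _
    have a2 : 0 ≤ (parNorm (t, x') + ε) ^ (-(5 / 2 + γ)) := Real.rpow_nonneg (by linarith [parNorm_nonneg (t, x')]) _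
    rw [show 2 + γ + 1 / 2 = 5 / 2 + γ by ring]
    refine mul_le_mul_of_nonneg_right (mul_le_mul_of_nonneg_right (by linarith) (by positivity)) (by linarith)

end FracKPZ

/-! ### The covariance: size, increments and reflection invariance -/

namespace FracKPZ
open Set ENNReal

/-- The covariance of the noise smoothed by the kernel `N`. -/
noncomputable def cov (N : ℝ × ℝ → ℝ) (u v : ℝ × ℝ) : ℝ := ∫ w in strip, N (u - w) * N (v - w)

lemma cov_symm (N : ℝ × ℝ → ℝ) (u v : ℝ × ℝ) : cov N u v = cov N v u := by
  simp only [cov, mul_comm]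

/-- Lets the integral over `strip` be taken over any other period, in particular one centred at a
given point. -/
lemma isAddFundamentalDomain_strip {s : Set ℝ} (hs : MeasurableSet s) (h : ∀ x : ℝ, ∃! k : ℤ, x + k ∈ s) :
    IsAddFundamentalDomain (AddSubgroup.zmultiples ((0, 1) : ℝ × ℝ)) ((univ : Set ℝ) ×ˢ s) := by
  refine IsAddFundamentalDomain.mk' (MeasurableSet.univ.prod hs).nullMeasurableSet fun z => ?_
  have hinj : Function.Injective fun n : ℤ => n • ((0, 1) : ℝ × ℝ) := by
    intro m n hmn
    have := congrArg Prod.snd hmn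
    simpa using this
  have : Function.Bijective (codRestrict (fun n : ℤ => n • ((0, 1) : ℝ × ℝ)) (AddSubgroup.zmultiples ((0, 1) : ℝ × ℝ)) fun n => ⟨n, rfl⟩) :=
    (Equiv.ofInjective _ hinj).bijective
  refine this.existsUnique_iff.2 ?_
  convert h z.2 using 2 with k
  simp [AddSubgroup.vadd_def, add_comm]

lemma isAddFundamentalDomain_Ioc_strip (a : ℝ) :
    IsAddFundamentalDomain (AddSubgroup.zmultiples ((0, 1) : ℝ × ℝ)) ((univ : Set ℝ) ×ˢ Ioc a (a + 1)) :=
  isAddFundamentalDomain_strip measurableSet_Ioc fun x => by simpa using existsUnique_add_zsmul_mem_Ioc one_pos x a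

lemma isAddFundamentalDomain_Ico_strip (a : ℝ) :
    IsAddFundamentalDomain (AddSubgroup.zmultiples ((0, 1) : ℝ × ℝ)) ((univ : Set ℝ) ×ˢ Ico a (a + 1)) :=
  isAddFundamentalDomain_strip measurableSet_Ico fun x => by simpa using existsUnique_add_zsmul_mem_Ico one_pos x a

lemma strip_eq : strip = (univ : Set ℝ) ×ˢ Ico (0 : ℝ) (0 + 1) := by simp [strip]

lemma measurableSet_strip : MeasurableSet strip := MeasurableSet.univ.prod measurableSet_Ico

lemma vadd_invariant {E : Type*} {f : ℝ × ℝ → E} (hf : ∀ t x, ∀ k : ℤ, f (t, x + k) = f (t, x))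
    (g : AddSubgroup.zmultiples ((0, 1) : ℝ × ℝ)) (z : ℝ × ℝ) : f (g +ᵥ z) = f z := by
  obtain ⟨_, k, rfl⟩ := g
  rw [← hf z.1 z.2 k]
  congr 1
  simp [AddSubgroup.vadd_def, Prod.ext_iff, add_comm]

lemma integral_strip_eq_Ioc {f : ℝ × ℝ → ℝ} (hf : ∀ t x, ∀ k : ℤ, f (t, x + k) = f (t, x)) (a : ℝ) :
    ∫ w in strip, f w = ∫ w in (univ : Set ℝ) ×ˢ Ioc a (a + 1), f w := by
  rw [strip_eq]
  exact (isAddFundamentalDomain_Ico_strip 0).setIntegral_eq (isAddFundamentalDomain_Ioc_strip a) (vadd_invariant hf)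

/-- After recentring the period at `a`, pointwise bounds valid near the origin apply, and the
majorant may be integrated over the whole plane. -/
lemma enorm_integral_strip_le {f : ℝ × ℝ → ℝ} {g : ℝ × ℝ → ℝ≥0∞} (hf : ∀ t x, ∀ k : ℤ, f (t, x + k) = f (t, x)) (a : ℝ)
    (h : ∀ w, |a - w.2| ≤ 1 / 2 → ‖f w‖ₑ ≤ g w) : ‖∫ w in strip, f w‖ₑ ≤ ∫⁻ w, g w := by
  rw [integral_strip_eq_Ioc hf (a - 1 / 2)]
  refine (enorm_integral_le_lintegral_enorm _).trans ?_
  refine le_trans (setLIntegral_mono' (MeasurableSet.univ.prod measurableSet_Ioc) fun w hw => h w ?_) (setLIntegral_le_lintegral _ _)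
  rw [abs_le]
  constructor <;> linarith [hw.2.1, hw.2.2]

lemma lintegral_pker_pker_le {α β : ℝ} (h0 : 0 ≤ α) (hα : α < 3) (hβ0 : 0 ≤ β) (hβ : β < 3) (h : 3 < α + β) :
    ∃ c : ℝ, 0 < c ∧ ∀ ε : ℝ, 0 ≤ ε → ∀ u v : ℝ × ℝ,
      ∫⁻ w, pker ε α (u - w) * pker ε β (v - w) ≤ ENNReal.ofReal c * pker ε (α + β - 3) (u - v) := by
  obtain ⟨c, hc, H⟩ := lintegral_pker_conv_le h0 hα hβ0 hβ h
  refine ⟨c, hc, fun ε hε u v => le_trans ?_ (H ε hε (u - v))⟩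
  rw [← lintegral_sub_left_eq_self (fun w => pker 0 α w * pker ε β (u - v - w)) u]
  refine lintegral_mono fun w => ?_
  rw [show u - v - (u - w) = w - v by abel, pker_sub_comm ε β v w]
  exact mul_le_mul_left (pker_anti h0 (by linarith)) _

/-- Reflection of space about the point `q`. -/
def reflectAt (q : ℝ) (z : ℝ × ℝ) : ℝ × ℝ := (z.1, 2 * q - z.2)

lemma measurePreserving_reflectAt (q : ℝ) : MeasurePreserving (reflectAt q) :=
  (MeasurePreserving.id volume).prod (Measure.measurePreserving_sub_left volume (2 * q))

section
variable {N : ℝ × ℝ → ℝ} {c T p ε : ℝ}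

/-- A bound that degenerates as `ε → 0`; it serves only to justify integrability and Fubini at fixed
`ε`. -/
lemma IsNoiseKernel.abs_le (hN : IsNoiseKernel N c T p ε) (hc : 0 ≤ c) (hp : 0 ≤ p) (hε : 0 < ε) (z : ℝ × ℝ) : |N z| ≤ c * ε ^ (-p) := by
  obtain ⟨t, x⟩ := z
  have h := hN.periodic t (x - round x) (round x)
  rw [sub_add_cancel] at h
  rw [h]
  refine (hN.size _ _ ((abs_sub_round x).trans (by norm_num))).trans (mul_le_mul_of_nonneg_left ?_ hc)
  exact Real.rpow_le_rpow_of_nonpos hε (by linarith [parNorm_nonneg (t, x - round x)]) (by linarith)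

lemma IsNoiseKernel.periodic_sub (hN : IsNoiseKernel N c T p ε) (u : ℝ × ℝ) (t x : ℝ) (k : ℤ) :
    N (u - (t, x + k)) = N (u - (t, x)) := by
  have := hN.periodic (u.1 - t) (u.2 - x) (-k)
  push_cast at this
  rw [show u - (t, x + (k : ℝ)) = (u.1 - t, u.2 - x + -(k : ℝ)) by ext <;> simp; ring, this]
  rfl

lemma IsNoiseKernel.integrableOn_mul (hN : IsNoiseKernel N c T p ε) (hc : 0 ≤ c) (hp : 0 ≤ p) (hε : 0 < ε) (u v : ℝ × ℝ)
    {s : Set ℝ} (hs : MeasurableSet s) (hs' : volume s ≠ ⊤) :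
    IntegrableOn (fun w => N (u - w) * N (v - w)) ((univ : Set ℝ) ×ˢ s) := by
  have hm := hN.meas
  have hsub : IntegrableOn (fun w => N (u - w) * N (v - w)) (Icc (u.1 - T) (u.1 + T) ×ˢ s) := by
    refine Measure.integrableOn_of_bounded (M := (c * ε ^ (-p)) * (c * ε ^ (-p))) ?_ (by fun_prop) ?_
    · rw [Measure.volume_eq_prod, Measure.prod_prod]
      exact ENNReal.mul_ne_top (by simp) hs'
    · refine Filter.Eventually.of_forall fun w => ?_
      rw [norm_mul]
      exact mul_le_mul (hN.abs_le hc hp hε _) (hN.abs_le hc hp hε _) (norm_nonneg _) (by positivity)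
  refine hsub.of_forall_sdiff_eq_zero (MeasurableSet.univ.prod hs) fun w hw => ?_
  have : T < |u.1 - w.1| := by
    by_contra h
    refine hw.2 ⟨?_, hw.1.2⟩
    have := _root_.abs_le.1 (not_lt.1 h)
    constructor <;> linarith [this.1, this.2]
  rw [show u - w = (u.1 - w.1, u.2 - w.2) from rfl, hN.time _ _ this, zero_mul]

lemma IsNoiseKernel.integrableOn_strip (hN : IsNoiseKernel N c T p ε) (hc : 0 ≤ c) (hp : 0 ≤ p) (hε : 0 < ε) (u v : ℝ × ℝ) :
    IntegrableOn (fun w => N (u - w) * N (v - w)) strip :=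
  hN.integrableOn_mul hc hp hε u v measurableSet_Ico (by simp)

lemma IsNoiseKernel.measurable_cov (hN : IsNoiseKernel N c T p ε) : Measurable fun z : (ℝ × ℝ) × (ℝ × ℝ) => cov N z.1 z.2 := by
  have hm := hN.meas
  have : Measurable fun q : ((ℝ × ℝ) × (ℝ × ℝ)) × (ℝ × ℝ) => N (q.1.1 - q.2) * N (q.1.2 - q.2) := by fun_prop
  exact this.stronglyMeasurable.integral_prod_right.measurable

/-- The covariance is quadratic in an odd kernel, so the two signs cancel; the reflected strip is
another period, over which the integral is the same. -/
lemma IsNoiseKernel.cov_reflectAt (hN : IsNoiseKernel N c T p ε) (q : ℝ) (u v : ℝ × ℝ) :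
    cov N (reflectAt q u) (reflectAt q v) = cov N u v := by
  have h : ∀ u w, N (reflectAt q u - w) = -N (u - reflectAt q w) := by
    intro u w
    rw [← neg_eq_iff_eq_neg, ← hN.odd]
    congr 1
    simp only [reflectAt, Prod.ext_iff, Prod.fst_sub, Prod.snd_sub, true_and]
    ring
  simp only [cov, h, neg_mul_neg]
  have hemb : MeasurableEmbedding (reflectAt q) :=
    ((Homeomorph.refl ℝ).prodCongr (Homeomorph.subLeft (2 * q))).measurableEmbedding
  have hpre : strip = reflectAt q ⁻¹' ((univ : Set ℝ) ×ˢ Ioc (2 * q - 1) (2 * q - 1 + 1)) := by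
    ext w
    simp only [strip, reflectAt, mem_prod, mem_univ, true_and, mem_Ico, mem_preimage, mem_Ioc]
    constructor <;> rintro ⟨h1, h2⟩ <;> constructor <;> linarith
  conv_lhs => rw [hpre]
  rw [(measurePreserving_reflectAt q).setIntegral_preimage_emb hemb (fun w => N (u - w) * N (v - w)),
    ← integral_strip_eq_Ioc]
  intro t x k
  rw [hN.periodic_sub, hN.periodic_sub]

lemma IsNoiseKernel.enorm_size (hN : IsNoiseKernel N c T p ε) (hc : 0 ≤ c) (hε : 0 < ε) {z : ℝ × ℝ} (hz : |z.2| ≤ 3 / 4) :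
    ‖N z‖ₑ ≤ ENNReal.ofReal c * pker ε p z :=
  (enorm_le_mul_pker_iff hc hε).2 (hN.size z.1 z.2 hz)

lemma IsNoiseKernel.enorm_holder (hN : IsNoiseKernel N c T p ε) (hc : 0 ≤ c) (hε : 0 < ε) {z z' : ℝ × ℝ} (hz : |z.2| ≤ 3 / 4)
    (hz' : |z'.2| ≤ 3 / 4) (h : z.1 = z'.1) :
    ‖N z - N z'‖ₑ ≤ ENNReal.ofReal c * ENNReal.ofReal (|z.2 - z'.2| ^ (1 / 2 : ℝ)) * (pker ε (p + 1 / 2) z + pker ε (p + 1 / 2) z') := by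
  obtain ⟨t, x⟩ := z
  obtain ⟨t', x'⟩ := z'
  obtain rfl : t = t' := h
  have := hN.holder t x x' hz hz'
  have h1 := parNorm_nonneg (t, x)
  have h2 := parNorm_nonneg (t, x')
  rw [Real.enorm_eq_ofReal_abs, ← ENNReal.ofReal_mul hc, pker, pker, ENNReal.ofReal_rpow_of_pos (by linarith),
    ENNReal.ofReal_rpow_of_pos (by linarith), ← ENNReal.ofReal_add (by positivity) (by positivity), ← ENNReal.ofReal_mul (by positivity)]
  exact ENNReal.ofReal_le_ofReal this

end

/-- The origin of the range `3/4` in `IsNoiseKernel`: half a period around one point, plus the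
distance `1/4` to another vertex of the diagram. -/
lemma abs_sub_le_of_center {a b y : ℝ} (h : |a - b| ≤ 1 / 4) (hy : |a - y| ≤ 1 / 2) : |b - y| ≤ 3 / 4 := by
  have := abs_le.1 h
  have := abs_le.1 hy
  rw [abs_le]; constructor <;> linarith

/-- Size of the covariance. -/
lemma exists_cov_size {c p : ℝ} (hc : 0 ≤ c) (hp : 2 ≤ p) (hp1 : p < 5 / 2) : ∃ A : ℝ, 0 < A ∧ ∀ (N : ℝ × ℝ → ℝ) (T ε : ℝ),
    0 < ε → IsNoiseKernel N c T p ε → ∀ u v : ℝ × ℝ, |u.2 - v.2| ≤ 1 / 4 →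
      ‖cov N u v‖ₑ ≤ ENNReal.ofReal A * pker ε (2 * p - 3) (u - v) := by
  obtain ⟨A, hA, H⟩ := lintegral_pker_pker_le (α := p) (β := p) (by linarith) (by linarith) (by linarith) (by linarith) (by linarith)
  refine ⟨c * c * A + 1, by positivity, fun N T ε hε hN u v huv => ?_⟩
  calc ‖cov N u v‖ₑ ≤ ∫⁻ w, ENNReal.ofReal (c * c) * (pker ε p (u - w) * pker ε p (v - w)) := by
        refine enorm_integral_strip_le (fun t x k => by rw [hN.periodic_sub, hN.periodic_sub]) u.2 fun w hw => ?_
        rw [enorm_mul]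
        refine (mul_le_mul' (hN.enorm_size hc hε ?_) (hN.enorm_size hc hε ?_)).trans_eq ?_
        · exact hw.trans (by norm_num)
        · exact abs_sub_le_of_center huv hw
        · rw [ENNReal.ofReal_mul hc]; ring
    _ ≤ ENNReal.ofReal (c * c) * (ENNReal.ofReal A * pker ε (2 * p - 3) (u - v)) := by
        rw [lintegral_const_mul' _ _ ENNReal.ofReal_ne_top, two_mul]
        exact mul_le_mul_right (H ε hε.le u v) _
    _ ≤ _ := by
        rw [← mul_assoc, ← ENNReal.ofReal_mul (by positivity)]
        exact mul_le_mul_left (ENNReal.ofReal_le_ofReal (by linarith)) _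

/-- Size of a spatial increment of the covariance. -/
lemma exists_cov_diff {c p : ℝ} (hc : 0 ≤ c) (hp : 2 ≤ p) (hp1 : p < 5 / 2) : ∃ A : ℝ, 0 < A ∧ ∀ (N : ℝ × ℝ → ℝ) (T ε : ℝ),
    0 < ε → IsNoiseKernel N c T p ε → ∀ u u' v : ℝ × ℝ, u.1 = u'.1 → |u.2 - v.2| ≤ 1 / 4 → |u'.2 - v.2| ≤ 1 / 4 →
      ‖cov N u v - cov N u' v‖ₑ ≤ ENNReal.ofReal A * ENNReal.ofReal (|u.2 - u'.2| ^ (1 / 2 : ℝ)) *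
        (pker ε (2 * p - 5 / 2) (u - v) + pker ε (2 * p - 5 / 2) (u' - v)) := by
  obtain ⟨A, hA, H⟩ := lintegral_pker_pker_le (α := p + 1 / 2) (β := p) (by linarith) (by linarith) (by linarith) (by linarith) (by linarith)
  refine ⟨c * c * A + 1, by positivity, fun N T ε hε hN u u' v huu huv huv' => ?_⟩
  have hp0 : 0 ≤ p := by linarith
  have E : cov N u v - cov N u' v = ∫ w in strip, (N (u - w) - N (u' - w)) * N (v - w) := by
    have := integral_sub (hN.integrableOn_strip hc hp0 hε u v) (hN.integrableOn_strip hc hp0 hε u' v)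
    simp only [← sub_mul] at this
    exact this.symm
  set δ := ENNReal.ofReal (|u.2 - u'.2| ^ (1 / 2 : ℝ)) with hδ
  have hδt : ENNReal.ofReal (c * c) * δ ≠ ⊤ := ENNReal.mul_ne_top (by simp) (by simp [hδ])
  rw [abs_sub_comm] at huv huv'
  calc ‖cov N u v - cov N u' v‖ₑ ≤ ∫⁻ w, (ENNReal.ofReal (c * c) * δ) *
        (pker ε (p + 1 / 2) (u - w) * pker ε p (v - w) + pker ε (p + 1 / 2) (u' - w) * pker ε p (v - w)) := by
        rw [E]
        refine enorm_integral_strip_le (fun t x k => by simp only [hN.periodic_sub]) v.2 fun w hw => ?_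
        rw [enorm_mul]
        refine (mul_le_mul' (hN.enorm_holder hc hε ?_ ?_ ?_) (hN.enorm_size hc hε ?_)).trans_eq ?_
        · exact abs_sub_le_of_center huv hw
        · exact abs_sub_le_of_center huv' hw
        · simp [huu]
        · exact hw.trans (by norm_num)
        · rw [ENNReal.ofReal_mul hc, hδ]
          simp only [Prod.snd_sub, sub_sub_sub_cancel_right]; ring
    _ ≤ (ENNReal.ofReal (c * c) * δ) * (ENNReal.ofReal A * pker ε (2 * p - 5 / 2) (u - v) + ENNReal.ofReal A * pker ε (2 * p - 5 / 2) (u' - v)) := by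
        rw [lintegral_const_mul' _ _ hδt, lintegral_add_left
          (by have h1 := measurable_pker ε (p + 1 / 2); have h2 := measurable_pker ε p; fun_prop)]
        have e : p + 1 / 2 + p - 3 = 2 * p - 5 / 2 := by ring
        rw [← e]
        exact mul_le_mul_right (add_le_add (H ε hε.le u v) (H ε hε.le u' v)) _
    _ = ENNReal.ofReal (c * c * A) * δ * (pker ε (2 * p - 5 / 2) (u - v) + pker ε (2 * p - 5 / 2) (u' - v)) := by
        rw [ENNReal.ofReal_mul (by positivity : 0 ≤ c * c)]; ring
    _ ≤ _ := mul_le_mul_left (mul_le_mul_left (ENNReal.ofReal_le_ofReal (by linarith)) _) _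

/-- Size of a mixed spatial increment of the covariance. -/
lemma exists_cov_diff_diff {c p : ℝ} (hc : 0 ≤ c) (hp : 2 ≤ p) (hp1 : p < 5 / 2) : ∃ A : ℝ, 0 < A ∧ ∀ (N : ℝ × ℝ → ℝ) (T ε : ℝ),
    0 < ε → IsNoiseKernel N c T p ε → ∀ u u' v v' : ℝ × ℝ, u.1 = u'.1 → v.1 = v'.1 → |u.2 - u'.2| ≤ 1 / 4 → |u.2 - v.2| ≤ 1 / 4 → |u.2 - v'.2| ≤ 1 / 4 →
      ‖cov N u v - cov N u' v - (cov N u v' - cov N u' v')‖ₑ ≤ ENNReal.ofReal A * ENNReal.ofReal (|u.2 - u'.2| ^ (1 / 2 : ℝ)) *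
        ENNReal.ofReal (|v.2 - v'.2| ^ (1 / 2 : ℝ)) *
        (pker ε (2 * p - 2) (u - v) + pker ε (2 * p - 2) (u' - v) + (pker ε (2 * p - 2) (u - v') + pker ε (2 * p - 2) (u' - v'))) := by
  obtain ⟨A, hA, H⟩ := lintegral_pker_pker_le (α := p + 1 / 2) (β := p + 1 / 2) (by linarith) (by linarith) (by linarith) (by linarith) (by linarith)
  refine ⟨c * c * A + 1, by positivity, fun N T ε hε hN u u' v v' huu hvv huu2 huv huv' => ?_⟩
  have hp0 : 0 ≤ p := by linarith
  have I := hN.integrableOn_strip hc hp0 hε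
  have E : cov N u v - cov N u' v - (cov N u v' - cov N u' v') = ∫ w in strip, (N (u - w) - N (u' - w)) * (N (v - w) - N (v' - w)) := by
    have e1 := integral_sub (I u v) (I u' v)
    have e2 := integral_sub (I u v') (I u' v')
    have e3 := integral_sub ((I u v).sub (I u' v)) ((I u v').sub (I u' v'))
    simp only [Pi.sub_apply] at e3
    rw [cov, cov, cov, cov, ← e1, ← e2, ← e3]
    congr 1; ext w; ring
  set δ := ENNReal.ofReal (|u.2 - u'.2| ^ (1 / 2 : ℝ)) with hδ
  set δ' := ENNReal.ofReal (|v.2 - v'.2| ^ (1 / 2 : ℝ)) with hδ'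
  have hδt : ENNReal.ofReal (c * c) * δ * δ' ≠ ⊤ := ENNReal.mul_ne_top (ENNReal.mul_ne_top (by simp) (by simp [hδ])) (by simp [hδ'])
  have hm := measurable_pker ε (p + 1 / 2)
  have mm : ∀ a b, Measurable fun w => pker ε (p + 1 / 2) (a - w) * pker ε (p + 1 / 2) (b - w) := fun a b => by fun_prop
  calc _ ≤ ∫⁻ w, (ENNReal.ofReal (c * c) * δ * δ') *
        (pker ε (p + 1 / 2) (u - w) * pker ε (p + 1 / 2) (v - w) + pker ε (p + 1 / 2) (u' - w) * pker ε (p + 1 / 2) (v - w) +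
        (pker ε (p + 1 / 2) (u - w) * pker ε (p + 1 / 2) (v' - w) + pker ε (p + 1 / 2) (u' - w) * pker ε (p + 1 / 2) (v' - w))) := by
        rw [E]
        refine enorm_integral_strip_le (fun t x k => by simp only [hN.periodic_sub]) u.2 fun w hw => ?_
        rw [enorm_mul]
        refine (mul_le_mul' (hN.enorm_holder hc hε ?_ ?_ ?_) (hN.enorm_holder hc hε ?_ ?_ ?_)).trans_eq ?_
        · exact hw.trans (by norm_num)
        · exact abs_sub_le_of_center huu2 hw
        · simp [huu]
        · exact abs_sub_le_of_center huv hw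
        · exact abs_sub_le_of_center huv' hw
        · simp [hvv]
        · rw [ENNReal.ofReal_mul hc, hδ, hδ']
          simp only [Prod.snd_sub, sub_sub_sub_cancel_right]; ring
    _ ≤ (ENNReal.ofReal (c * c) * δ * δ') * (ENNReal.ofReal A * pker ε (2 * p - 2) (u - v) + ENNReal.ofReal A * pker ε (2 * p - 2) (u' - v) +
        (ENNReal.ofReal A * pker ε (2 * p - 2) (u - v') + ENNReal.ofReal A * pker ε (2 * p - 2) (u' - v'))) := by
        rw [lintegral_const_mul' _ _ hδt, lintegral_add_left (by fun_prop), lintegral_add_left (mm _ _), lintegral_add_left (mm _ _)]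
        have e : p + 1 / 2 + (p + 1 / 2) - 3 = 2 * p - 2 := by ring
        rw [← e]
        exact mul_le_mul_right (add_le_add (add_le_add (H ε hε.le _ _) (H ε hε.le _ _)) (add_le_add (H ε hε.le _ _) (H ε hε.le _ _))) _
    _ = ENNReal.ofReal (c * c * A) * δ * δ' * (pker ε (2 * p - 2) (u - v) + pker ε (2 * p - 2) (u' - v) + (pker ε (2 * p - 2) (u - v') + pker ε (2 * p - 2) (u' - v'))) := by
        rw [ENNReal.ofReal_mul (by positivity : 0 ≤ c * c)]; ring
    _ ≤ _ := mul_le_mul_left (mul_le_mul_left (mul_le_mul_left (ENNReal.ofReal_le_ofReal (by linarith)) _) _) _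

end FracKPZ

/-! ### Combinatorial power counting: domination by spanning trees -/

namespace FracKPZ
open Set ENNReal

section Tree
variable {V : Type*} [DecidableEq V]

/-- `Grows x A L`: the list `L` of pairs (child, parent) describes a tree on the vertex set `A` with
root `x`, obtained by adding one leaf after the other (the last one comes first in `L`). -/
inductive Grows (x : V) : Finset V → List (V × V) → Prop
  | single : Grows x {x} []
  | leaf {A : Finset V} {L : List (V × V)} {c p : V} (h : Grows x A L) (hp : p ∈ A) (hc : c ∉ A) :
      Grows x (insert c A) ((c, p) :: L)

lemma Grows.card {x : V} {A : Finset V} {L : List (V × V)} (h : Grows x A L) : A.card = L.length + 1 := by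
  induction h with
  | single => simp
  | leaf h hp hc ih => rw [Finset.card_insert_of_notMem hc, ih]; simp

lemma Grows.root_mem {x : V} {A : Finset V} {L : List (V × V)} (h : Grows x A L) : x ∈ A := by
  induction h with
  | single => simp
  | leaf h hp hc ih => simp [ih]

/-- Grafting: first the root `y` of the second tree is attached at `p` as a leaf, then the leaves of
the second tree are added in their own order. -/
lemma Grows.join {x y p : V} {A B : Finset V} {L M : List (V × V)} (h : Grows x A L) (hp : p ∈ A)
    (h' : Grows y B M) (hd : Disjoint A B) : Grows x (A ∪ B) (M ++ (y, p) :: L) := by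
  induction h' with
  | single =>
    have hy : y ∉ A := by simpa using hd
    rw [Finset.union_comm, Finset.singleton_union]
    exact Grows.leaf h hp hy
  | @leaf B M c q h' hq hc ih =>
    rw [Finset.disjoint_insert_right] at hd
    rw [Finset.union_insert, List.cons_append]
    exact Grows.leaf (ih hd.2) (Finset.mem_union_right _ hq) (by simp [hd.1, hc])

/-- The length of a tree. -/
def treeSum (ℓ : V → V → ℝ) (L : List (V × V)) : ℝ := (L.map fun e => ℓ e.1 e.2).sum

lemma sum_sum_union {A B : Finset V} (hd : Disjoint A B) (f : V → V → ℝ) :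
    ∑ i ∈ A ∪ B, ∑ j ∈ A ∪ B, f i j = (∑ i ∈ A, ∑ j ∈ A, f i j) + (∑ i ∈ B, ∑ j ∈ B, f i j) +
      ∑ i ∈ A, ∑ j ∈ B, (f i j + f j i) := by
  rw [Finset.sum_union hd]
  simp only [Finset.sum_union hd, Finset.sum_add_distrib]
  rw [Finset.sum_comm (s := B) (t := A)]
  ring

/-- If the distances `exp (-ℓ)` have, on every set of at least two points, a cut whose distances are
comparable to the diameter, then a product of powers of distances is dominated by the product along
some tree, provided that the power counting condition `∑ a ≤ s (#S - 1)` holds for all subsets. -/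
theorem exists_tree_of_powerCounting {a ℓ : V → V → ℝ} {s Λ : ℝ} (ha : ∀ i j, 0 ≤ a i j) (hs : 0 ≤ s)
    (hsymm : ∀ i j, ℓ i j = ℓ j i)
    (hcut : ∀ A : Finset V, 2 ≤ A.card → ∃ A₁ A₂ : Finset V, A₁.Nonempty ∧ A₂.Nonempty ∧ Disjoint A₁ A₂ ∧ A = A₁ ∪ A₂ ∧
      ∀ i ∈ A₁, ∀ j ∈ A₂, ∀ p ∈ A, ∀ q ∈ A, p ≠ q → ℓ i j ≤ ℓ p q + Λ)
    (hdiag : ∀ i, a i i = 0)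
    (hpc : ∀ A : Finset V, A.Nonempty → ∑ i ∈ A, ∑ j ∈ A, a i j ≤ s * (A.card - 1)) :
    ∀ (n : ℕ) (A : Finset V), A.card = n + 1 → ∀ x ∈ A, ∀ μ : ℝ, (∀ p ∈ A, ∀ q ∈ A, p ≠ q → μ ≤ ℓ p q) →
      ∃ L, Grows x A L ∧ ∑ i ∈ A, ∑ j ∈ A, a i j * ℓ i j ≤ s * treeSum ℓ L -
        (s * (A.card - 1) - ∑ i ∈ A, ∑ j ∈ A, a i j) * μ + (∑ i ∈ A, ∑ j ∈ A, a i j) * Λ := by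
  intro n
  induction n using Nat.strong_induction_on with
  | _ n ih =>
  intro A hA x hx μ hμ
  rcases Nat.eq_zero_or_pos n with rfl | hn
  · obtain ⟨y, rfl⟩ := Finset.card_eq_one.1 hA
    obtain rfl := Finset.mem_singleton.1 hx
    exact ⟨[], Grows.single, by simp [treeSum, hdiag]⟩
  obtain ⟨A₁, A₂, hn₁, hn₂, hd, hU, hc⟩ := hcut A (by omega)
  -- The part that contains the root keeps it; the other is rooted at an arbitrary point `j₀` and
  -- grafted at `x`.
  wlog hx1 : x ∈ A₁ generalizing A₁ A₂
  · refine this A₂ A₁ hn₂ hn₁ hd.symm (by rw [hU, Finset.union_comm]) (fun i hi j hj p hp q hq hpq => ?_) ?_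
    · rw [hsymm]; exact hc j hj i hi p hp q hq hpq
    · rw [hU, Finset.mem_union] at hx; tauto
  obtain ⟨i₀, hi₀⟩ := hn₁
  obtain ⟨j₀, hj₀⟩ := hn₂
  have hcard : A.card = A₁.card + A₂.card := by rw [hU, Finset.card_union_of_disjoint hd]
  have hc1 : 0 < A₁.card := Finset.card_pos.2 ⟨_, hi₀⟩
  have hc2 : 0 < A₂.card := Finset.card_pos.2 ⟨_, hj₀⟩
  have hsub1 : A₁ ⊆ A := hU ▸ Finset.subset_union_left
  have hsub2 : A₂ ⊆ A := hU ▸ Finset.subset_union_right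
  -- With `ℓ = -log d`, the minimum `m` of `ℓ` is minus the logarithm of the diameter. It serves as
  -- the lower bound `μ` for both halves, and by the choice of the cut every cross term satisfies `ℓ
  -- ≤ m + Λ`.
  obtain ⟨e, he, hmin⟩ := Finset.exists_min_image A.offDiag (fun e => ℓ e.1 e.2)
    ⟨(i₀, j₀), Finset.mem_offDiag.2 ⟨hsub1 hi₀, hsub2 hj₀, fun h => Finset.disjoint_left.1 hd hi₀ ((show i₀ = j₀ from h) ▸ hj₀)⟩⟩
  obtain ⟨he1, he2, he3⟩ := Finset.mem_offDiag.1 he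
  set m := ℓ e.1 e.2 with hm
  have hlow : ∀ p ∈ A, ∀ q ∈ A, p ≠ q → m ≤ ℓ p q := fun p hp q hq hpq => hmin (p, q) (Finset.mem_offDiag.2 ⟨hp, hq, hpq⟩)
  have hμm : μ ≤ m := hμ _ he1 _ he2 he3
  obtain ⟨L₁, g₁, b₁⟩ := ih (A₁.card - 1) (by omega) A₁ (by omega) x hx1 m fun p hp q hq => hlow p (hsub1 hp) q (hsub1 hq)
  obtain ⟨L₂, g₂, b₂⟩ := ih (A₂.card - 1) (by omega) A₂ (by omega) j₀ hj₀ m fun p hp q hq => hlow p (hsub2 hp) q (hsub2 hq)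
  refine ⟨L₂ ++ (j₀, x) :: L₁, hU ▸ g₁.join hx1 g₂ hd, ?_⟩
  have hw := hpc A ⟨x, hx⟩
  have hsplit := sum_sum_union hd a
  have hsplit' := sum_sum_union hd fun i j => a i j * ℓ i j
  rw [← hU] at hsplit hsplit'
  have hcross : ∑ i ∈ A₁, ∑ j ∈ A₂, (a i j * ℓ i j + a j i * ℓ j i) ≤ (∑ i ∈ A₁, ∑ j ∈ A₂, (a i j + a j i)) * (m + Λ) := by
    rw [Finset.sum_mul]
    refine Finset.sum_le_sum fun i hi => ?_
    rw [Finset.sum_mul]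
    refine Finset.sum_le_sum fun j hj => ?_
    have h1 := hc i hi j hj _ he1 _ he2 he3
    rw [← hm] at h1
    rw [← hsymm i j]
    nlinarith [ha i j, ha j i]
  have hedge : m ≤ ℓ j₀ x := hlow _ (hsub2 hj₀) _ hx fun h => Finset.disjoint_left.1 hd hx1 (h ▸ hj₀)
  have htree : treeSum ℓ (L₂ ++ (j₀, x) :: L₁) = treeSum ℓ L₁ + treeSum ℓ L₂ + ℓ j₀ x := by
    simp [treeSum]; ring
  rw [htree]
  have hcardR : (A.card : ℝ) = A₁.card + A₂.card := by exact_mod_cast hcard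
  rw [hcardR] at hw ⊢
  have h5 : s * m ≤ s * ℓ j₀ x := mul_le_mul_of_nonneg_left hedge hs
  set w₁ := ∑ i ∈ A₁, ∑ j ∈ A₁, a i j
  set w₂ := ∑ i ∈ A₂, ∑ j ∈ A₂, a i j
  set w := ∑ i ∈ A, ∑ j ∈ A, a i j
  set wc := ∑ i ∈ A₁, ∑ j ∈ A₂, (a i j + a j i)
  -- Power counting for `A` itself makes the slack nonnegative, so `m` may be lowered to `μ`. In the
  -- sum of the two induction bounds and the cross terms, `m` appears with coefficient minus the
  -- slack plus one extra `s m`, which is paid by the grafted edge since `m ≤ ℓ j₀ x`.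
  have h6 : (s * ((A₁.card : ℝ) + A₂.card - 1) - w) * μ ≤ (s * ((A₁.card : ℝ) + A₂.card - 1) - w) * m :=
    mul_le_mul_of_nonneg_left hμm (by linarith)
  rw [hsplit']
  rw [hsplit] at h6 ⊢
  nlinarith

/-- In a finite pseudometric situation, every set of at least two points can be cut at a scale
comparable to its diameter. -/
lemma exists_cut {d : V → V → ℝ} (htri : ∀ i j k, d i k ≤ d i j + d j k)
    (hpos : ∀ i j, i ≠ j → 0 < d i j) (h0 : ∀ i, d i i = 0) (A : Finset V) (hA : 2 ≤ A.card) :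
    ∃ A₁ A₂ : Finset V, A₁.Nonempty ∧ A₂.Nonempty ∧ Disjoint A₁ A₂ ∧ A = A₁ ∪ A₂ ∧
      ∀ i ∈ A₁, ∀ j ∈ A₂, ∀ p ∈ A, ∀ q ∈ A, d p q ≤ A.card * d i j := by
  obtain ⟨x, hx, y, hy, hxy⟩ := Finset.one_lt_card.1 (show 1 < A.card by omega)
  obtain ⟨e, he, hmax⟩ := Finset.exists_max_image (A ×ˢ A) (fun e => d e.1 e.2) ⟨(x, y), Finset.mem_product.2 ⟨hx, hy⟩⟩
  obtain ⟨he1, he2⟩ := Finset.mem_product.1 he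
  set D := d e.1 e.2 with hD
  have hmax' : ∀ p ∈ A, ∀ q ∈ A, d p q ≤ D := fun p hp q hq => hmax (p, q) (Finset.mem_product.2 ⟨hp, hq⟩)
  have hDpos : 0 < D := (hpos x y hxy).trans_le (hmax' x hx y hy)
  set n := A.card with hn
  have hn0 : (0 : ℝ) < n := by exact_mod_cast (by omega : 0 < n)
  let B : ℕ → Finset V := fun k => A.filter fun z => d e.1 z ≤ k * (D / n)
  -- Pigeonhole: there are `n` open shells of width `D/n` around `e.1` and only `n - 1` other
  -- points, so some shell is empty. Cutting there separates the two parts by at least `D/n`.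
  have hB : ∃ k, k < n ∧ ∀ z ∈ A, ¬ (k * (D / n) < d e.1 z ∧ d e.1 z < (k + 1 : ℕ) * (D / n)) := by
    by_contra hcon
    push Not at hcon
    have : Nonempty V := ⟨x⟩
    choose! f hf hf' using hcon
    have hmaps : ∀ k ∈ Finset.range n, f k ∈ A.erase e.1 := fun k hk => by
      refine Finset.mem_erase.2 ⟨fun h => ?_, hf k (Finset.mem_range.1 hk)⟩
      have := (hf' k (Finset.mem_range.1 hk)).1
      rw [h, h0] at this
      have : 0 ≤ (k : ℝ) * (D / n) := by positivity
      linarith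
    have hlt : (A.erase e.1).card < (Finset.range n).card := by
      rw [Finset.card_erase_of_mem he1, Finset.card_range]; omega
    obtain ⟨k, hk, l, hl, hkl, hfe⟩ := Finset.exists_ne_map_eq_of_card_lt_of_maps_to hlt hmaps
    wlog hlt' : k < l generalizing k l
    · exact this l hl k hk (Ne.symm hkl) hfe.symm (lt_of_le_of_ne (not_lt.1 hlt') (Ne.symm hkl))
    have h1 := (hf' k (Finset.mem_range.1 hk)).2
    have h2 := (hf' l (Finset.mem_range.1 hl)).1
    rw [hfe] at h1
    have : ((k + 1 : ℕ) : ℝ) * (D / n) ≤ l * (D / n) := by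
      apply mul_le_mul_of_nonneg_right _ (by positivity)
      exact_mod_cast hlt'
    linarith
  obtain ⟨k, hk, hgap⟩ := hB
  refine ⟨B k, A \ B k, ⟨e.1, ?_⟩, ⟨e.2, ?_⟩, Finset.disjoint_sdiff, ?_, fun i hi j hj p hp q hq => ?_⟩
  · simp only [B, Finset.mem_filter, he1, h0, true_and]; positivity
  · simp only [B, Finset.mem_sdiff, Finset.mem_filter, he2, true_and, not_le, ← hD]
    have : (k : ℝ) + 1 ≤ n := by exact_mod_cast hk
    have h3 : D = n * (D / n) := by field_simp
    nlinarith [div_pos hDpos hn0]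
  · rw [Finset.union_sdiff_of_subset (Finset.filter_subset _ _)]
  · have hi' := (Finset.mem_filter.1 hi).2
    obtain ⟨hjA, hj'⟩ := Finset.mem_sdiff.1 hj
    have hj'' : k * (D / n) < d e.1 j := by
      by_contra h; exact hj' (Finset.mem_filter.2 ⟨hjA, not_lt.1 h⟩)
    have h1 : (k + 1 : ℕ) * (D / n) ≤ d e.1 j := by
      by_contra h; exact hgap j hjA ⟨hj'', not_le.1 h⟩
    have h2 := htri e.1 i j
    push_cast at h1
    have h3 : D / n ≤ d i j := by linarith
    rw [div_le_iff₀ hn0] at h3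
    linarith [hmax' p hp q hq]

end Tree

end FracKPZ

/-! ### Analytic power counting: integrability of products of powers of distances -/

namespace FracKPZ
open Set ENNReal

section
variable {n : ℕ}

/-- The positions of all the vertices, the root being at the origin. -/
def withRoot (u : Fin n → ℝ × ℝ) : Fin (n + 1) → ℝ × ℝ := Fin.cons 0 u

@[simp] lemma withRoot_zero (u : Fin n → ℝ × ℝ) : withRoot u 0 = 0 := rfl
@[simp] lemma withRoot_succ (u : Fin n → ℝ × ℝ) (i : Fin n) : withRoot u i.succ = u i := rfl

@[fun_prop]
lemma measurable_withRoot (i : Fin (n + 1)) : Measurable fun u : Fin n → ℝ × ℝ => withRoot u i := by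
  refine Fin.cases ?_ (fun i => ?_) i
  · exact measurable_const
  · exact measurable_pi_apply i

lemma withRoot_update_of_ne (u : Fin n → ℝ × ℝ) (i : Fin n) (x : ℝ × ℝ) {j : Fin (n + 1)} (h : j ≠ i.succ) :
    withRoot (Function.update u i x) j = withRoot u j := by
  induction j using Fin.cases with
  | zero => rfl
  | succ j =>
    have : j ≠ i := fun h' => h (by rw [h'])
    simp [this]

/-- The product of `q` along the edges of a tree. -/
noncomputable def treeProd (q : ℝ × ℝ → ℝ≥0∞) (L : List (Fin (n + 1) × Fin (n + 1))) (u : Fin n → ℝ × ℝ) : ℝ≥0∞ :=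
  (L.map fun e => q (withRoot u e.1 - withRoot u e.2)).prod

lemma measurable_treeProd {q : ℝ × ℝ → ℝ≥0∞} (hq : Measurable q) (L : List (Fin (n + 1) × Fin (n + 1))) :
    Measurable (treeProd q L) := by
  induction L with
  | nil => exact measurable_const
  | cons e L ih =>
    have : treeProd q (e :: L) = fun u => q (withRoot u e.1 - withRoot u e.2) * treeProd q L u := by
      ext u; simp [treeProd]
    rw [this]
    fun_prop

lemma Grows.treeProd_update {A : Finset (Fin (n + 1))} {L : List (Fin (n + 1) × Fin (n + 1))} (h : Grows 0 A L) (q : ℝ × ℝ → ℝ≥0∞)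
    (u : Fin n → ℝ × ℝ) {i : Fin n} (hi : i.succ ∉ A) (x : ℝ × ℝ) :
    treeProd q L (Function.update u i x) = treeProd q L u := by
  induction h with
  | single => rfl
  | @leaf A L c p h hp hc ih =>
    rw [Finset.mem_insert, not_or] at hi
    have := ih hi.2
    simp only [treeProd, List.map_cons, List.prod_cons] at this ⊢
    rw [this, withRoot_update_of_ne u i x (Ne.symm hi.1), withRoot_update_of_ne u i x fun h => hi.2 (h ▸ hp)]

/-- The leaf added last occurs in one factor only, and by translation invariance its integral is `∫
q` wherever its parent is. The marginal over a subset of the variables is what makes the induction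
run. -/
lemma Grows.lmarginal_treeProd {A : Finset (Fin (n + 1))} {L : List (Fin (n + 1) × Fin (n + 1))} (h : Grows 0 A L) {q : ℝ × ℝ → ℝ≥0∞}
    (hq : Measurable q) (u : Fin n → ℝ × ℝ) :
    lmarginal (fun _ => volume) (Finset.univ.filter fun i : Fin n => i.succ ∈ A) (treeProd q L) u = (∫⁻ z, q z) ^ L.length := by
  induction h generalizing u with
  | single => simp [treeProd, Fin.succ_ne_zero]
  | @leaf A L c p h hp hc ih =>
    obtain ⟨i, rfl⟩ := Fin.exists_succ_eq.2 fun h0 : c = 0 => hc (h0 ▸ h.root_mem)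
    have e : (Finset.univ.filter fun j : Fin n => j.succ ∈ insert i.succ A) = insert i (Finset.univ.filter fun j : Fin n => j.succ ∈ A) := by
      ext j; simp
    rw [e, lmarginal_insert' _ (measurable_treeProd hq _) (by simpa using hc)]
    have e2 : (fun x : Fin n → ℝ × ℝ => ∫⁻ y, treeProd q ((i.succ, p) :: L) (Function.update x i y)) =
        fun x => (∫⁻ z, q z) * treeProd q L x := by
      ext x
      have : ∀ y, treeProd q ((i.succ, p) :: L) (Function.update x i y) = q (y - withRoot x p) * treeProd q L x := by
        intro y
        have h1 := h.treeProd_update q x hc y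
        simp only [treeProd, List.map_cons, List.prod_cons] at h1 ⊢
        rw [h1, withRoot_update_of_ne x i y fun h => hc (h ▸ hp)]
        simp
      simp only [this]
      rw [lintegral_mul_const _ (by fun_prop), lintegral_sub_right_eq_self]
    rw [e2]
    have e3 : lmarginal (fun _ => volume) (Finset.univ.filter fun i : Fin n => i.succ ∈ A) (fun x => (∫⁻ z, q z) * treeProd q L x) u =
        (∫⁻ z, q z) * lmarginal (fun _ => volume) (Finset.univ.filter fun i : Fin n => i.succ ∈ A) (treeProd q L) u := by
      simp only [lmarginal]
      exact lintegral_const_mul _ ((measurable_treeProd hq L).comp measurable_updateFinset)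
    rw [e3, ih, List.length_cons, pow_succ']

lemma Grows.lintegral_treeProd {L : List (Fin (n + 1) × Fin (n + 1))} (h : Grows 0 Finset.univ L) {q : ℝ × ℝ → ℝ≥0∞}
    (hq : Measurable q) : ∫⁻ u, treeProd q L u = (∫⁻ z, q z) ^ n := by
  have hl : L.length = n := by have := h.card; simp at this; omega
  have := h.lmarginal_treeProd hq 0
  simp only [Finset.mem_univ, Finset.filter_true, hl] at this
  rw [← this, volume_pi, lintegral_eq_lmarginal_univ 0]

/-- Coincidence of two vertices is a proper linear subspace, hence null. Off these sets all
distances are positive and the algebra of exponents holds without conventions at `0` and `∞`. -/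
lemma ae_withRoot_ne {i j : Fin (n + 1)} (h : i ≠ j) : ∀ᵐ u : Fin n → ℝ × ℝ, withRoot u i ≠ withRoot u j := by
  have hlin : ∀ k : Fin (n + 1), ∃ f : (Fin n → ℝ × ℝ) →ₗ[ℝ] ℝ × ℝ, ∀ u, f u = withRoot u k := by
    intro k
    induction k using Fin.cases with
    | zero => exact ⟨0, fun u => rfl⟩
    | succ k => exact ⟨LinearMap.proj k, fun u => rfl⟩
  obtain ⟨f, hf⟩ := hlin i
  obtain ⟨g, hg⟩ := hlin j
  have hne : LinearMap.ker (f - g) ≠ ⊤ := by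
    intro htop
    have h1 : ∀ u, withRoot u i = withRoot u j := fun u => by
      have : u ∈ LinearMap.ker (f - g) := htop ▸ Submodule.mem_top
      rw [LinearMap.mem_ker, LinearMap.sub_apply, sub_eq_zero, hf, hg] at this
      exact this
    -- A configuration with distinct vertices, none of them at the root, shows that the subspace is
    -- proper.
    have h2 := h1 fun k => ((k : ℝ) + 1, 0)
    apply h
    induction i using Fin.cases with
    | zero =>
      induction j using Fin.cases with
      | zero => rfl
      | succ j =>
        have := congrArg Prod.fst h2
        simp at this
        exfalso; linarith [(Nat.cast_nonneg (j : ℕ) : (0 : ℝ) ≤ _)]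
    | succ i =>
      induction j using Fin.cases with
      | zero =>
        have := congrArg Prod.fst h2
        simp at this
        exfalso; linarith [(Nat.cast_nonneg (i : ℕ) : (0 : ℝ) ≤ _)]
      | succ j =>
        have := congrArg Prod.fst h2
        simp at this
        rw [Fin.ext this]
  have := Measure.addHaar_submodule (volume : Measure (Fin n → ℝ × ℝ)) _ hne
  rw [ae_iff]
  convert this using 2
  ext u
  simp [LinearMap.mem_ker, sub_eq_zero, hf, hg]

/-- The configurations of diameter at most one. -/
def closeSet (n : ℕ) : Set (Fin n → ℝ × ℝ) := {u | ∀ i j, parNorm (withRoot u i - withRoot u j) ≤ 1}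

lemma pker_zero_eq_exp {α : ℝ} {z : ℝ × ℝ} (hz : 0 < parNorm z) :
    pker 0 α z = ENNReal.ofReal (Real.exp (α * -Real.log (parNorm z))) := by
  rw [pker, add_zero, ENNReal.ofReal_rpow_of_pos hz, Real.rpow_def_of_pos hz]
  congr 2; ring

/-- Power counting: if every subset of the vertices is subcritical, then the product of powers of
the distances is integrable over the configurations of diameter at most one. -/
theorem lintegral_powerCounting {a : Fin (n + 1) → Fin (n + 1) → ℝ} {s : ℝ} (ha : ∀ i j, 0 ≤ a i j) (hs : 0 ≤ s) (hs3 : s < 3)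
    (hdiag : ∀ i, a i i = 0)
    (hpc : ∀ A : Finset (Fin (n + 1)), A.Nonempty → ∑ i ∈ A, ∑ j ∈ A, a i j ≤ s * (A.card - 1)) :
    ∃ c : ℝ, 0 < c ∧ ∫⁻ u in closeSet n, ∏ i, ∏ j, pker 0 (a i j) (withRoot u i - withRoot u j) ≤ ENNReal.ofReal c := by
  classical
  set q : ℝ × ℝ → ℝ≥0∞ := {z | parNorm z ≤ 1}.indicator (pker 0 s) with hq
  have hqm : Measurable q := (measurable_pker 0 s).indicator (measurableSet_parNorm_le 1)
  have hqint : ∫⁻ z, q z < ⊤ := by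
    obtain ⟨c, hc, H⟩ := lintegral_pker_ball_le hs hs3
    rw [hq, lintegral_indicator (measurableSet_parNorm_le 1)]
    exact (H 1 one_pos).trans_lt (by simp)
  -- The dominating tree depends on the configuration; summing over all the finitely many candidates
  -- makes the bound uniform and measurable.
  set Ls : Finset (List (Fin (n + 1) × Fin (n + 1))) := (List.finite_length_eq (Fin (n + 1) × Fin (n + 1)) n).toFinset with hLs
  set w := ∑ i, ∑ j, a i j with hw
  -- The loss of the cuts: each cross distance is within a factor `n + 1` of the diameter, and the
  -- exponents have total `w`.
  set B := ENNReal.ofReal (Real.exp (w * Real.log (n + 1))) with hB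
  have key : ∀ᵐ u : Fin n → ℝ × ℝ, u ∈ closeSet n → ∏ i, ∏ j, pker 0 (a i j) (withRoot u i - withRoot u j) ≤
      ∑ L ∈ Ls, B * (if Grows 0 Finset.univ L then treeProd q L u else 0) := by
    have hall : ∀ᵐ u : Fin n → ℝ × ℝ, ∀ i j : Fin (n + 1), i ≠ j → withRoot u i ≠ withRoot u j := by
      rw [ae_all_iff]; intro i
      rw [ae_all_iff]; intro j
      by_cases h : i = j
      · simp [h]
      · filter_upwards [ae_withRoot_ne h] with u hu _ using hu
    filter_upwards [hall] with u hu hclose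
    set d : Fin (n + 1) → Fin (n + 1) → ℝ := fun i j => parNorm (withRoot u i - withRoot u j) with hd
    have hpos : ∀ i j, i ≠ j → 0 < d i j := fun i j hij => parNorm_pos_iff.2 (sub_ne_zero.2 (hu i j hij))
    have hd0 : ∀ i, d i i = 0 := fun i => by simp [hd, parNorm_zero]
    have hdl : ∀ i j, d i j ≤ 1 := fun i j => hclose i j
    set ℓ : Fin (n + 1) → Fin (n + 1) → ℝ := fun i j => -Real.log (d i j) with hℓ
    obtain ⟨L, hL, hbound⟩ := exists_tree_of_powerCounting (a := a) (ℓ := ℓ) (s := s) (Λ := Real.log (n + 1)) ha hs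
      (fun i j => by simp only [hℓ, hd]; rw [parNorm_sub_comm])
      (fun A hA => by
        obtain ⟨A₁, A₂, h1, h2, h3, h4, h5⟩ := exists_cut (d := d) (fun i j k => parNorm_sub_le _ _ _) hpos hd0 A hA
        refine ⟨A₁, A₂, h1, h2, h3, h4, fun i hi j hj p hp r hr hpr => ?_⟩
        have h6 := h5 i hi j hj p hp r hr
        have hij : i ≠ j := fun h => Finset.disjoint_left.1 h3 hi (h ▸ hj)
        have hcard : (A.card : ℝ) ≤ n + 1 := by
          have := A.card_le_univ
          rw [Fintype.card_fin] at this
          exact_mod_cast this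
        have h7 : d p r ≤ (n + 1) * d i j := h6.trans (mul_le_mul_of_nonneg_right hcard (hpos i j hij).le)
        have h8 := Real.log_le_log (hpos p r hpr) h7
        rw [Real.log_mul (by positivity) (hpos i j hij).ne'] at h8
        simp only [hℓ]; linarith) hdiag hpc n Finset.univ (by simp) 0 (Finset.mem_univ _) 0
      (fun p _ r _ hpr => neg_nonneg.2 (Real.log_nonpos (hpos p r hpr).le (hdl p r)))
    have hlen : L.length = n := by have := hL.card; simp at this; omega
    have hprod : ∏ i, ∏ j, pker 0 (a i j) (withRoot u i - withRoot u j) = ENNReal.ofReal (Real.exp (∑ i, ∑ j, a i j * ℓ i j)) := by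
      rw [Real.exp_sum, ENNReal.ofReal_prod_of_nonneg fun _ _ => (Real.exp_pos _).le]
      refine Finset.prod_congr rfl fun i _ => ?_
      rw [Real.exp_sum, ENNReal.ofReal_prod_of_nonneg fun _ _ => (Real.exp_pos _).le]
      refine Finset.prod_congr rfl fun j _ => ?_
      by_cases hij : i = j
      · subst hij; simp [hdiag, pker]
      · exact pker_zero_eq_exp (hpos i j hij)
    have htree : ∀ L' : List (Fin (n + 1) × Fin (n + 1)), (∀ e ∈ L', e.1 ≠ e.2) →
        ENNReal.ofReal (Real.exp (s * treeSum ℓ L')) = treeProd q L' u := by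
      intro L' hL'
      induction L' with
      | nil => simp [treeSum, treeProd]
      | cons e L' ih =>
        have h1 := ih fun e' he' => hL' e' (List.mem_cons_of_mem _ he')
        have h2 := hL' e List.mem_cons_self
        simp only [treeSum, treeProd, List.map_cons, List.sum_cons, List.prod_cons] at h1 ⊢
        rw [mul_add, Real.exp_add, ENNReal.ofReal_mul (Real.exp_pos _).le, h1]
        congr 1
        rw [hq, indicator_of_mem (by exact hdl e.1 e.2), pker_zero_eq_exp (hpos _ _ h2)]
    have hne : ∀ (A : Finset (Fin (n + 1))) L', Grows 0 A L' → ∀ e ∈ L', e.1 ≠ e.2 := by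
      intro A L' h
      induction h with
      | single => simp
      | leaf h hp hc ih =>
        intro e he
        rcases List.mem_cons.1 he with rfl | he
        · exact fun h' => hc (by simp only at h'; exact h' ▸ hp)
        · exact ih e he
    have hmem : L ∈ Ls := by simp [hLs, hlen]
    calc _ ≤ B * (if Grows 0 Finset.univ L then treeProd q L u else 0) := by
          rw [if_pos hL, hprod, ← htree L (hne _ _ hL), hB, ← ENNReal.ofReal_mul (Real.exp_pos _).le, ← Real.exp_add]
          refine ENNReal.ofReal_le_ofReal (Real.exp_le_exp.2 ?_)
          rw [mul_zero, sub_zero] at hbound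
          linarith
      _ ≤ _ := Finset.single_le_sum (f := fun L => B * (if Grows 0 Finset.univ L then treeProd q L u else 0)) (fun _ _ => zero_le) hmem
  have hfin : ∫⁻ u in closeSet n, ∏ i, ∏ j, pker 0 (a i j) (withRoot u i - withRoot u j) < ⊤ := by
    calc _ ≤ ∫⁻ u in closeSet n, ∑ L ∈ Ls, B * (if Grows 0 Finset.univ L then treeProd q L u else 0) := by
          refine lintegral_mono_ae ?_
          have hms : MeasurableSet (closeSet n) := by
            simp only [closeSet, ofPred_forall]
            refine MeasurableSet.iInter fun i => MeasurableSet.iInter fun j => measurableSet_le ?_ measurable_const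
            exact continuous_parNorm.measurable.comp (by fun_prop)
          exact (ae_restrict_iff' hms).2 key
      _ ≤ ∫⁻ u, ∑ L ∈ Ls, B * (if Grows 0 Finset.univ L then treeProd q L u else 0) := setLIntegral_le_lintegral _ _
      _ = ∑ L ∈ Ls, ∫⁻ u, B * (if Grows 0 Finset.univ L then treeProd q L u else 0) := by
          refine lintegral_finsetSum _ fun L _ => Measurable.const_mul ?_ _
          split_ifs
          · exact measurable_treeProd hqm L
          · exact measurable_const
      _ < ⊤ := by
          refine ENNReal.sum_lt_top.2 fun L _ => ?_
          split_ifs with h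
          · rw [lintegral_const_mul _ (measurable_treeProd hqm L), h.lintegral_treeProd hqm]
            exact ENNReal.mul_lt_top (by simp [hB]) (ENNReal.pow_lt_top hqint)
          · simp
  refine ⟨(∫⁻ u in closeSet n, ∏ i, ∏ j, pker 0 (a i j) (withRoot u i - withRoot u j)).toReal + 1, by positivity, ?_⟩
  rw [ENNReal.le_ofReal_iff_toReal_le hfin.ne (by positivity)]
  linarith

end

end FracKPZ

/-! ### From symbols to integrals over inner vertices -/

namespace FracKPZ
open Set ENNReal

/-- The inner vertices of `𝓘'(τ)`. -/
def Symbol.Inner : Symbol → Type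
  | .Xi => Empty
  | .node l r => Unit ⊕ (Inner l ⊕ Inner r)

instance Symbol.fintypeInner : (τ : Symbol) → Fintype τ.Inner
  | .Xi => inferInstanceAs (Fintype Empty)
  | .node l r =>
    letI := fintypeInner l
    letI := fintypeInner r
    inferInstanceAs (Fintype (Unit ⊕ (l.Inner ⊕ r.Inner)))

instance Symbol.decidableEqInner : (τ : Symbol) → DecidableEq τ.Inner
  | .Xi => inferInstanceAs (DecidableEq Empty)
  | .node l r =>
    letI := decidableEqInner l
    letI := decidableEqInner r
    inferInstanceAs (DecidableEq (Unit ⊕ (l.Inner ⊕ r.Inner)))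

/-- The product of the kernels `D` along the inner edges of `𝓘'(τ)`. -/
def treeKer (D : ℝ × ℝ → ℝ) : (τ : Symbol) → ℝ × ℝ → (τ.Inner → ℝ × ℝ) → ℝ
  | .Xi => fun _ _ => 1
  | .node l r => fun z u => D (z - u (.inl ())) *
      (treeKer D l (u (.inl ())) (fun i => u (.inr (.inl i))) * treeKer D r (u (.inl ())) (fun i => u (.inr (.inr i))))

/-- The positions at which the noises are attached. -/
def attach : (τ : Symbol) → ℝ × ℝ → (τ.Inner → ℝ × ℝ) → Fin τ.noises → ℝ × ℝ
  | .Xi => fun z _ _ => z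
  | .node l r => fun _ u => Fin.append (attach l (u (.inl ())) fun i => u (.inr (.inl i)))
      (attach r (u (.inl ())) fun i => u (.inr (.inr i)))

/-- Splitting off the vertex next to the root. -/
noncomputable def splitNode (A B : Type) :
    (Unit ⊕ (A ⊕ B) → ℝ × ℝ) ≃ᵐ (ℝ × ℝ) × ((A → ℝ × ℝ) × (B → ℝ × ℝ)) :=
  (MeasurableEquiv.sumPiEquivProdPi fun _ => ℝ × ℝ).trans
    ((MeasurableEquiv.funUnique Unit (ℝ × ℝ)).prodCongr (MeasurableEquiv.sumPiEquivProdPi fun _ => ℝ × ℝ))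

lemma measurePreserving_splitNode (A B : Type) [Fintype A] [Fintype B] : MeasurePreserving (splitNode A B) :=
  ((volume_preserving_funUnique Unit (ℝ × ℝ)).prod (volume_measurePreserving_sumPiEquivProdPi fun _ => ℝ × ℝ)).comp
    (volume_measurePreserving_sumPiEquivProdPi fun _ => ℝ × ℝ)

section
variable {D : ℝ × ℝ → ℝ}

lemma measurable_treeKer (hD : Measurable D) (τ : Symbol) :
    Measurable fun p : (ℝ × ℝ) × (τ.Inner → ℝ × ℝ) => treeKer D τ p.1 p.2 := by
  induction τ with
  | Xi => exact measurable_const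
  | node l r ihl ihr =>
    have h1 : Measurable fun p : (ℝ × ℝ) × ((Symbol.node l r).Inner → ℝ × ℝ) => p.2 (Sum.inl ()) :=
      (measurable_pi_apply _).comp measurable_snd
    have h2 : Measurable fun p : (ℝ × ℝ) × ((Symbol.node l r).Inner → ℝ × ℝ) => fun i : l.Inner => p.2 (Sum.inr (Sum.inl i)) :=
      measurable_pi_lambda _ fun i => (measurable_pi_apply _).comp measurable_snd
    have h3 : Measurable fun p : (ℝ × ℝ) × ((Symbol.node l r).Inner → ℝ × ℝ) => fun i : r.Inner => p.2 (Sum.inr (Sum.inr i)) :=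
      measurable_pi_lambda _ fun i => (measurable_pi_apply _).comp measurable_snd
    exact (hD.comp (measurable_fst.sub h1)).mul ((ihl.comp (h1.prodMk h2)).mul (ihr.comp (h1.prodMk h3)))

lemma measurable_append {α : Type*} [MeasurableSpace α] {m n : ℕ} {f : α → Fin m → ℝ × ℝ} {g : α → Fin n → ℝ × ℝ}
    (hf : Measurable f) (hg : Measurable g) : Measurable fun a => Fin.append (f a) (g a) := by
  refine measurable_pi_lambda _ fun i => ?_
  induction i using Fin.addCases with
  | left i => simp only [Fin.append_left]; exact (measurable_pi_apply i).comp hf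
  | right i => simp only [Fin.append_right]; exact (measurable_pi_apply i).comp hg

lemma measurable_attach (τ : Symbol) : Measurable fun p : (ℝ × ℝ) × (τ.Inner → ℝ × ℝ) => attach τ p.1 p.2 := by
  induction τ with
  | Xi => exact measurable_pi_lambda _ fun _ => measurable_fst
  | node l r ihl ihr =>
    have h1 : Measurable fun p : (ℝ × ℝ) × ((Symbol.node l r).Inner → ℝ × ℝ) => p.2 (Sum.inl ()) :=
      (measurable_pi_apply _).comp measurable_snd
    have h2 : Measurable fun p : (ℝ × ℝ) × ((Symbol.node l r).Inner → ℝ × ℝ) => fun i : l.Inner => p.2 (Sum.inr (Sum.inl i)) :=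
      measurable_pi_lambda _ fun i => (measurable_pi_apply _).comp measurable_snd
    have h3 : Measurable fun p : (ℝ × ℝ) × ((Symbol.node l r).Inner → ℝ × ℝ) => fun i : r.Inner => p.2 (Sum.inr (Sum.inr i)) :=
      measurable_pi_lambda _ fun i => (measurable_pi_apply _).comp measurable_snd
    exact measurable_append (ihl.comp (h1.prodMk h2)) (ihr.comp (h1.prodMk h3))

/-- By translation invariance every inner vertex contributes one factor `‖D‖_{L¹}`, whatever the
position of the root; this independence is what the induction needs. -/
lemma exists_lintegral_treeKer (hD : Measurable D) (hD' : Integrable D) (τ : Symbol) :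
    ∃ B : ℝ≥0∞, B ≠ ⊤ ∧ ∀ z, ∫⁻ u, ‖treeKer D τ z u‖ₑ = B := by
  induction τ with
  | Xi =>
    refine ⟨1, by simp, fun z => ?_⟩
    have : IsEmpty (Symbol.Xi).Inner := inferInstanceAs (IsEmpty Empty)
    have hv : (volume : Measure (Symbol.Xi.Inner → ℝ × ℝ)) = Measure.dirac (fun i => isEmptyElim i) := by
      rw [volume_pi]; exact Measure.pi_of_empty _ _
    simp [treeKer, hv]
  | node l r ihl ihr =>
    obtain ⟨Bl, hl, Hl⟩ := ihl
    obtain ⟨Br, hr, Hr⟩ := ihr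
    refine ⟨(∫⁻ z, ‖D z‖ₑ) * (Bl * Br), ENNReal.mul_ne_top hD'.2.ne (ENNReal.mul_ne_top hl hr), fun z => ?_⟩
    have ml := measurable_treeKer hD l
    have mr := measurable_treeKer hD r
    have m1 : Measurable fun p : (ℝ × ℝ) × ((l.Inner → ℝ × ℝ) × (r.Inner → ℝ × ℝ)) =>
        ‖D (z - p.1)‖ₑ * (‖treeKer D l p.1 p.2.1‖ₑ * ‖treeKer D r p.1 p.2.2‖ₑ) :=
      ((hD.comp (measurable_const.sub measurable_fst)).enorm).mul
        (((ml.comp (measurable_fst.prodMk (measurable_fst.comp measurable_snd))).enorm).mul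
        ((mr.comp (measurable_fst.prodMk (measurable_snd.comp measurable_snd))).enorm))
    have e := (measurePreserving_splitNode l.Inner r.Inner).lintegral_comp m1
    calc ∫⁻ u, ‖treeKer D (.node l r) z u‖ₑ = ∫⁻ p : (ℝ × ℝ) × ((l.Inner → ℝ × ℝ) × (r.Inner → ℝ × ℝ)),
          ‖D (z - p.1)‖ₑ * (‖treeKer D l p.1 p.2.1‖ₑ * ‖treeKer D r p.1 p.2.2‖ₑ) := by
          rw [← e]
          refine lintegral_congr fun u => ?_
          simp only [treeKer, enorm_mul]; rfl
      _ = ∫⁻ z', ‖D (z - z')‖ₑ * (Bl * Br) := by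
          rw [Measure.volume_eq_prod, lintegral_prod _ m1.aemeasurable]
          refine lintegral_congr fun z' => ?_
          change ∫⁻ y : (l.Inner → ℝ × ℝ) × (r.Inner → ℝ × ℝ), ‖D (z - z')‖ₑ * (‖treeKer D l z' y.1‖ₑ * ‖treeKer D r z' y.2‖ₑ) = _
          rw [lintegral_const_mul _ (by
            exact ((ml.comp (measurable_const.prodMk measurable_fst)).enorm).mul ((mr.comp (measurable_const.prodMk measurable_snd)).enorm)),
            Measure.volume_eq_prod, lintegral_prod_mul (f := fun a => ‖treeKer D l z' a‖ₑ) (g := fun a => ‖treeKer D r z' a‖ₑ)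
              (ml.comp (measurable_const.prodMk measurable_id)).enorm.aemeasurable
              (mr.comp (measurable_const.prodMk measurable_id)).enorm.aemeasurable, Hl, Hr]
      _ = _ := by
          rw [lintegral_mul_const' _ _ (ENNReal.mul_ne_top hl hr), lintegral_sub_left_eq_self (fun w => ‖D w‖ₑ)]

lemma integrable_treeKer (hD : Measurable D) (hD' : Integrable D) (τ : Symbol) (z : ℝ × ℝ) : Integrable (treeKer D τ z) := by
  obtain ⟨B, hB, H⟩ := exists_lintegral_treeKer hD hD' τ
  refine ⟨((measurable_treeKer hD τ).comp (measurable_const.prodMk measurable_id)).aestronglyMeasurable, ?_⟩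
  rw [HasFiniteIntegral, H]
  exact lt_top_iff_ne_top.2 hB

lemma prod_append {N : ℝ × ℝ → ℝ} {m n : ℕ} (a : Fin m → ℝ × ℝ) (b : Fin n → ℝ × ℝ) (w : Fin (m + n) → ℝ × ℝ) :
    ∏ i, N (Fin.append a b i - w i) = (∏ i, N (a i - w (Fin.castAdd n i))) * ∏ j, N (b j - w (Fin.natAdd m j)) := by
  rw [Fin.prod_univ_add]
  simp only [Fin.append_left, Fin.append_right]

lemma integrable_mul_prod_noise {α : Type*} [MeasureSpace α] {f : α → ℝ} (hf : Integrable f) {N : ℝ × ℝ → ℝ} {M : ℝ} (hN : Measurable N)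
    (hM : ∀ z, |N z| ≤ M) {n : ℕ} {a : α → Fin n → ℝ × ℝ} (ha : Measurable a) (w : Fin n → ℝ × ℝ) :
    Integrable fun u => f u * ∏ i, N (a u i - w i) := by
  refine hf.mul_bdd (c := M ^ n) ?_ (Filter.Eventually.of_forall fun u => ?_)
  · refine (Finset.measurable_prod _ fun i _ => ?_).aestronglyMeasurable
    exact hN.comp (((measurable_pi_apply i).comp ha).sub_const _)
  · rw [norm_prod]
    calc _ ≤ ∏ i : Fin n, M := Finset.prod_le_prod (fun _ _ => norm_nonneg _) fun i _ => hM _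
      _ = M ^ n := by simp

variable {K ρ : ℝ × ℝ → ℝ} {γ ε : ℝ}

/-- Unrolls the recursive definition into a single integral over all inner vertices. At each node
Fubini is justified by the integrability of the tree kernel and the boundedness of the noise kernel
at fixed `ε`. -/
lemma edgeKernel_eq (hD : Measurable (spaceDeriv K)) (hD' : Integrable (spaceDeriv K)) {M : ℝ} (hN : Measurable (noiseKernel K ρ γ ε))
    (hM : ∀ z, |noiseKernel K ρ γ ε z| ≤ M) (τ : Symbol) (z : ℝ × ℝ) (w : Fin τ.noises → ℝ × ℝ) :
    edgeKernel K ρ γ ε τ z w = ∫ u, treeKer (spaceDeriv K) τ z u * ∏ i, noiseKernel K ρ γ ε (attach τ z u i - w i) := by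
  induction τ generalizing z with
  | Xi =>
    have : IsEmpty (Symbol.Xi).Inner := inferInstanceAs (IsEmpty Empty)
    have hv : (volume : Measure (Symbol.Xi.Inner → ℝ × ℝ)) = Measure.dirac (fun i => isEmptyElim i) := by
      rw [volume_pi]; exact Measure.pi_of_empty _ _
    rw [hv, integral_dirac]
    simp only [treeKer, attach, edgeKernel, one_mul]
    exact (Fin.prod_univ_one (fun i : Fin 1 => noiseKernel K ρ γ ε (z - w i))).symm
  | node l r ihl ihr =>
    set N := noiseKernel K ρ γ ε with hNdef
    set H : (ℝ × ℝ) × ((l.Inner → ℝ × ℝ) × (r.Inner → ℝ × ℝ)) → ℝ := fun p => spaceDeriv K (z - p.1) *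
      ((treeKer (spaceDeriv K) l p.1 p.2.1 * ∏ i, N (attach l p.1 p.2.1 i - w (Fin.castAdd r.noises i))) *
       (treeKer (spaceDeriv K) r p.1 p.2.2 * ∏ j, N (attach r p.1 p.2.2 j - w (Fin.natAdd l.noises j)))) with hH
    have hF : ∀ u, treeKer (spaceDeriv K) (.node l r) z u * ∏ i, N (attach (.node l r) z u i - w i) =
        H (splitNode l.Inner r.Inner u) := by
      intro u
      have e1 := prod_append (N := N) (attach l (u (.inl ())) fun i => u (.inr (.inl i))) (attach r (u (.inl ())) fun i => u (.inr (.inr i))) w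
      have e2 : ∏ i, N (attach (.node l r) z u i - w i) = _ := e1
      rw [e2]
      simp only [hH, treeKer]
      change _ = spaceDeriv K (z - u (.inl ())) *
        ((treeKer (spaceDeriv K) l (u (.inl ())) (fun i => u (.inr (.inl i))) *
          ∏ i, N (attach l (u (.inl ())) (fun i => u (.inr (.inl i))) i - w (Fin.castAdd r.noises i))) *
         (treeKer (spaceDeriv K) r (u (.inl ())) (fun i => u (.inr (.inr i))) *
          ∏ j, N (attach r (u (.inl ())) (fun i => u (.inr (.inr i))) j - w (Fin.natAdd l.noises j))))
      ring
    have hatt : Measurable (attach (.node l r) z) := (measurable_attach (.node l r)).comp ((measurable_const (a := z)).prodMk measurable_id)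
    have hfint := integrable_mul_prod_noise (integrable_treeKer hD hD' (.node l r) z) hN hM hatt w
    have hHint : Integrable H := by
      rw [← (measurePreserving_splitNode l.Inner r.Inner).integrable_comp_emb (MeasurableEquiv.measurableEmbedding _)]
      exact hfint.congr (Filter.Eventually.of_forall hF)
    have step : ∫ u, treeKer (spaceDeriv K) (.node l r) z u * ∏ i, N (attach (.node l r) z u i - w i) = ∫ p, H p := by
      rw [← (measurePreserving_splitNode l.Inner r.Inner).integral_comp']
      exact integral_congr_ae (Filter.Eventually.of_forall hF)
    rw [step, Measure.volume_eq_prod, integral_prod _ (by rwa [Measure.volume_eq_prod] at hHint)]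
    simp only [edgeKernel]
    congr 1; ext z'
    rw [ihl, ihr]
    simp only [hH]
    rw [integral_const_mul, Measure.volume_eq_prod, integral_prod_mul (f := fun a => treeKer (spaceDeriv K) l z' a *
      ∏ i, N (attach l z' a i - w (Fin.castAdd r.noises i))) (g := fun b => treeKer (spaceDeriv K) r z' b *
      ∏ j, N (attach r z' b j - w (Fin.natAdd l.noises j)))]

/-- The product of the kernels along the inner edges of `𝓘'(l) 𝓘'(r)`, with the root at the origin. -/
def pairKer (D : ℝ × ℝ → ℝ) (l r : Symbol) (u : l.Inner ⊕ r.Inner → ℝ × ℝ) : ℝ :=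
  treeKer D l 0 (fun i => u (.inl i)) * treeKer D r 0 (fun i => u (.inr i))

/-- The positions of the noises of `𝓘'(l) 𝓘'(r)`, with the root at the origin. -/
def pairAttach (l r : Symbol) (u : l.Inner ⊕ r.Inner → ℝ × ℝ) : Fin (l.noises + r.noises) → ℝ × ℝ :=
  Fin.append (attach l 0 fun i => u (.inl i)) (attach r 0 fun i => u (.inr i))

lemma measurable_pairAttach (l r : Symbol) : Measurable (pairAttach l r) :=
  measurable_append ((measurable_attach l).comp (measurable_const.prodMk (measurable_pi_lambda _ fun i => measurable_pi_apply (Sum.inl i))))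
    ((measurable_attach r).comp (measurable_const.prodMk (measurable_pi_lambda _ fun i => measurable_pi_apply (Sum.inr i))))

lemma integrable_pairKer (hD : Measurable D) (hD' : Integrable D) (l r : Symbol) : Integrable (pairKer D l r) := by
  have h : Integrable (fun z : (l.Inner → ℝ × ℝ) × (r.Inner → ℝ × ℝ) => treeKer D l 0 z.1 * treeKer D r 0 z.2) := by
    rw [Measure.volume_eq_prod]
    exact (integrable_treeKer hD hD' l 0).mul_prod (integrable_treeKer hD hD' r 0)
  exact ((volume_measurePreserving_sumPiEquivProdPi fun _ : l.Inner ⊕ r.Inner => ℝ × ℝ).integrable_comp_emb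
    (MeasurableEquiv.measurableEmbedding _)).2 h

lemma symbolKernel_eq (hD : Measurable (spaceDeriv K)) (hD' : Integrable (spaceDeriv K)) {M : ℝ} (hN : Measurable (noiseKernel K ρ γ ε))
    (hM : ∀ z, |noiseKernel K ρ γ ε z| ≤ M) (l r : Symbol) (w : Fin (l.noises + r.noises) → ℝ × ℝ) :
    symbolKernel K ρ γ ε (.node l r) 0 w = ∫ u, pairKer (spaceDeriv K) l r u * ∏ i, noiseKernel K ρ γ ε (pairAttach l r u i - w i) := by
  simp only [symbolKernel]
  rw [edgeKernel_eq hD hD' hN hM, edgeKernel_eq hD hD' hN hM, ← integral_prod_mul,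
    ← Measure.volume_eq_prod, ← (volume_measurePreserving_sumPiEquivProdPi fun _ : l.Inner ⊕ r.Inner => ℝ × ℝ).integral_comp']
  congr 1; ext u
  rw [pairAttach, prod_append, pairKer]
  change (treeKer (spaceDeriv K) l 0 (fun i => u (.inl i)) * _) * (treeKer (spaceDeriv K) r 0 (fun i => u (.inr i)) * _) = _
  rw [mul_mul_mul_comm]
  rfl

end

section
variable {N : ℝ × ℝ → ℝ} {c T p ε : ℝ}

/-- Not uniform in `ε`, but uniform in the two points, which is what exchanging the noise variables
with the inner vertices requires. -/
lemma IsNoiseKernel.exists_integral_abs_le (hN : IsNoiseKernel N c T p ε) (hc : 0 ≤ c) (hp : 0 ≤ p) (hε : 0 < ε) :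
    ∃ B : ℝ, ∀ u v, ∫ w in strip, ‖N (u - w) * N (v - w)‖ ≤ B := by
  set M := c * ε ^ (-p) with hM
  have hM0 : 0 ≤ M := by positivity
  refine ⟨∫ w in strip, (Icc (-T) T ×ˢ (univ : Set ℝ)).indicator (fun _ => M * M) w, fun u v => ?_⟩
  have e : ∀ a : ℝ, ∫ w in strip, (Icc (a - T) (a + T) ×ˢ (univ : Set ℝ)).indicator (fun _ => M * M) w =
      (volume (Icc (a - T) (a + T)) * volume (Ico (0 : ℝ) 1)).toReal * (M * M) := by
    intro a
    rw [setIntegral_indicator (measurableSet_Icc.prod MeasurableSet.univ), setIntegral_const, smul_eq_mul, strip, prod_inter_prod,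
      univ_inter, inter_univ, Measure.real, Measure.volume_eq_prod, Measure.prod_prod]
  have e0 := e 0
  have e1 := e u.1
  simp only [zero_sub, zero_add] at e0
  rw [e0, ← show volume (Icc (u.1 - T) (u.1 + T)) = volume (Icc (-T) T) by simp, ← e1]
  refine setIntegral_mono_on (hN.integrableOn_strip hc hp hε u v).norm ?_ measurableSet_strip fun w _ => ?_
  · refine IntegrableOn.integrable_indicator ?_ (measurableSet_Icc.prod MeasurableSet.univ)
    refine integrableOn_const ?_
    rw [Measure.restrict_apply (measurableSet_Icc.prod MeasurableSet.univ), strip, prod_inter_prod, Measure.volume_eq_prod, Measure.prod_prod]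
    simp
  · by_cases h : w.1 ∈ Icc (u.1 - T) (u.1 + T)
    · rw [indicator_of_mem (by exact ⟨h, trivial⟩), norm_mul]
      exact mul_le_mul (hN.abs_le hc hp hε _) (hN.abs_le hc hp hε _) (norm_nonneg _) hM0
    · have : T < |u.1 - w.1| := by
        by_contra h'
        apply h
        have := _root_.abs_le.1 (not_lt.1 h')
        constructor <;> linarith [this.1, this.2]
      rw [show u - w = (u.1 - w.1, u.2 - w.2) from rfl, hN.time _ _ this, zero_mul, norm_zero]
      exact indicator_nonneg (fun _ _ => by positivity) _

/-- Every noise is either the smaller or the larger element of its pair, and `σ` matches the two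
halves of the product. -/
lemma prod_pairVars {n : ℕ} {σ : Equiv.Perm (Fin n)} (hσ : σ ∈ pairings n) (y : {i : Fin n // i < σ i} → ℝ × ℝ) (f : Fin n → ℝ × ℝ → ℝ) :
    ∏ i, f i (pairVars σ y i) = ∏ i : {i : Fin n // i < σ i}, f i (y i) * f (σ i) (y i) := by
  obtain ⟨h1, h2⟩ : σ * σ = 1 ∧ ∀ i, σ i ≠ i := by simpa [pairings] using hσ
  have hinv : ∀ i, σ (σ i) = i := fun i => by
    have := congrArg (fun τ : Equiv.Perm (Fin n) => τ i) h1; simpa using this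
  rw [← Finset.prod_filter_mul_prod_filter_not Finset.univ (fun i => i < σ i), Finset.prod_mul_distrib]
  congr 1
  · rw [Finset.prod_subtype (Finset.univ.filter fun i => i < σ i) (p := fun i => i < σ i) (by simp)]
    exact Finset.prod_congr rfl fun i _ => by simp [pairVars, i.2]
  · refine (Finset.prod_bij (fun (i : {i : Fin n // i < σ i}) _ => σ i) ?_ ?_ ?_ ?_).symm
    · intro i _
      simp [hinv, i.2.le]
    · intro i _ j _ h
      exact Subtype.ext (σ.injective h)
    · intro j hj
      have hj' : σ j < j := lt_of_le_of_ne (not_lt.1 (Finset.mem_filter.1 hj).2) (h2 j)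
      exact ⟨⟨σ j, by rw [hinv]; exact hj'⟩, Finset.mem_univ _, hinv j⟩
    · intro i _
      have hi := i.2
      simp [pairVars, hinv, hi, not_lt.2 hi.le]

end

section
variable {K ρ : ℝ × ℝ → ℝ} {γ ε c T p : ℝ}

/-- The contraction of a kernel as an integral over the inner vertices. -/
theorem contraction_eq (hD : Measurable (spaceDeriv K)) (hD' : Integrable (spaceDeriv K))
    (hN : IsNoiseKernel (noiseKernel K ρ γ ε) c T p ε) (hc : 0 ≤ c) (hp : 0 ≤ p) (hε : 0 < ε) (l r : Symbol)
    {σ : Equiv.Perm (Fin (l.noises + r.noises))} (hσ : σ ∈ pairings (l.noises + r.noises)) :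
    contraction σ (symbolKernel K ρ γ ε (.node l r) 0) = ∫ u, pairKer (spaceDeriv K) l r u *
      ∏ i : {i // i < σ i}, cov (noiseKernel K ρ γ ε) (pairAttach l r u i) (pairAttach l r u (σ i)) := by
  set N := noiseKernel K ρ γ ε with hNdef
  have hNm := hN.meas
  set I := {i : Fin (l.noises + r.noises) // i < σ i}
  set F : (I → ℝ × ℝ) → (l.Inner ⊕ r.Inner → ℝ × ℝ) → ℝ := fun y u => pairKer (spaceDeriv K) l r u *
    ∏ i : I, N (pairAttach l r u i - y i) * N (pairAttach l r u (σ i) - y i) with hF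
  have hrestr : (volume : Measure (I → ℝ × ℝ)).restrict (univ.pi fun _ => strip) = Measure.pi fun _ => volume.restrict strip := by
    rw [volume_pi, Measure.restrict_pi_pi]
  have h1 : contraction σ (symbolKernel K ρ γ ε (.node l r) 0) = ∫ y, (∫ u, F y u) ∂(Measure.pi fun _ => volume.restrict strip) := by
    rw [← hrestr]
    refine integral_congr_ae (Filter.Eventually.of_forall fun y => ?_)
    refine (symbolKernel_eq hD hD' hNm (hN.abs_le hc hp hε) l r _).trans ?_
    refine integral_congr_ae (Filter.Eventually.of_forall fun u => ?_)
    simp only [hF]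
    rw [prod_pairVars hσ y fun i x => N (pairAttach l r u i - x)]
  have hatt := measurable_pairAttach l r
  have hatt' : ∀ i, Measurable fun q : (I → ℝ × ℝ) × (l.Inner ⊕ r.Inner → ℝ × ℝ) => pairAttach l r q.2 i := fun i =>
    (measurable_pi_apply i).comp (hatt.comp measurable_snd)
  have hker := integrable_pairKer hD hD' l r
  have hmeas : AEStronglyMeasurable (Function.uncurry F) ((Measure.pi fun _ : I => volume.restrict strip).prod volume) := by
    refine (hker.aestronglyMeasurable.comp_snd).mul (Finset.measurable_prod _ fun i _ => ?_).aestronglyMeasurable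
    have hy : Measurable fun q : (I → ℝ × ℝ) × (l.Inner ⊕ r.Inner → ℝ × ℝ) => q.1 i := (measurable_pi_apply i).comp measurable_fst
    exact (hNm.comp ((hatt' i).sub hy)).mul (hNm.comp ((hatt' (σ i)).sub hy))
  have hstrip : ∀ u (i : I), Integrable (fun w => N (pairAttach l r u i - w) * N (pairAttach l r u (σ i) - w)) (volume.restrict strip) :=
    fun u i => hN.integrableOn_strip hc hp hε _ _
  -- The noise variables separate for fixed inner vertices, and the product of their absolute
  -- integrals is bounded by a constant, leaving the integrable tree kernel.
  have hfint : Integrable (Function.uncurry F) ((Measure.pi fun _ : I => volume.restrict strip).prod volume) := by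
    rw [integrable_prod_iff' hmeas]
    refine ⟨Filter.Eventually.of_forall fun u => (Integrable.fintype_prod (hstrip u)).const_mul (pairKer (spaceDeriv K) l r u), ?_⟩
    obtain ⟨B, hB⟩ := hN.exists_integral_abs_le hc hp hε
    refine (hker.norm.mul_const (B ^ Fintype.card I)).mono' hmeas.norm.prod_swap.integral_prod_right' (Filter.Eventually.of_forall fun u => ?_)
    simp only [Function.uncurry, hF, norm_mul (pairKer _ _ _ _), norm_prod]
    rw [integral_const_mul, integral_fintype_prod_eq_prod (fun (i : I) w => ‖N (pairAttach l r u i - w) * N (pairAttach l r u (σ i) - w)‖),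
      norm_mul, norm_norm]
    refine mul_le_mul_of_nonneg_left ?_ (norm_nonneg _)
    rw [norm_prod]
    calc _ ≤ ∏ i : I, B := Finset.prod_le_prod (fun _ _ => norm_nonneg _) fun i _ => by
          rw [Real.norm_of_nonneg (integral_nonneg fun _ => norm_nonneg _)]
          exact hB _ _
      _ = _ := by simp
  rw [h1, integral_integral_swap hfint]
  refine integral_congr_ae (Filter.Eventually.of_forall fun u => ?_)
  simp only [hF]
  rw [integral_const_mul, integral_fintype_prod_eq_prod (fun (i : I) w => N (pairAttach l r u i - w) * N (pairAttach l r u (σ i) - w))]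
  rfl

lemma integral_reindex {n : ℕ} {ι : Type*} [Fintype ι] {f : Fin n → ι} (hf : Function.Bijective f) {F : (ι → ℝ × ℝ) → ℝ}
    {G : (Fin n → ℝ × ℝ) → ℝ} (h : ∀ w, F w = G fun k => w (f k)) :
    ∫ w, F w = ∫ v, G v ∧ (Integrable F → Integrable G) := by
  set e := Equiv.ofBijective f hf
  have he := volume_measurePreserving_piCongrLeft (fun _ : ι => ℝ × ℝ) e
  have hG : ∀ v, F (MeasurableEquiv.piCongrLeft (fun _ : ι => ℝ × ℝ) e v) = G v := fun v => by
    rw [h]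
    congr 1; ext1 k
    exact Equiv.piCongrLeft_apply_apply (fun _ : ι => ℝ × ℝ) e v k
  constructor
  · rw [← he.integral_comp']
    simp only [hG]
  · intro hF
    rw [← he.integrable_comp_emb (MeasurableEquiv.measurableEmbedding _)] at hF
    exact hF.congr (Filter.Eventually.of_forall hG)

end

end FracKPZ

/-! ### Feynman diagrams, reflections and perfect matchings -/

namespace FracKPZ
open Set ENNReal

section
variable {n : ℕ} {D N : ℝ × ℝ → ℝ} {par : Fin n → Fin (n + 1)} {G : List (Fin (n + 1) × Fin (n + 1))}

/-- The integrand of a Feynman diagram: the vertices form a tree with root `0`, the parent of the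
vertex `k + 1` being `par k`; the tree edges in `s` carry the kernel `D` and the edges in `G` the covariance. -/
noncomputable def diagInt (D N : ℝ × ℝ → ℝ) (par : Fin n → Fin (n + 1)) (s : Finset (Fin n)) (G : List (Fin (n + 1) × Fin (n + 1)))
    (u : Fin n → ℝ × ℝ) : ℝ :=
  (∏ k ∈ s, D (withRoot u (par k) - u k)) * (G.map fun e => cov N (withRoot u e.1) (withRoot u e.2)).prod

/-- The value of a Feynman diagram. -/
noncomputable def diag (D N : ℝ × ℝ → ℝ) (par : Fin n → Fin (n + 1)) (G : List (Fin (n + 1) × Fin (n + 1))) : ℝ :=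
  ∫ u, diagInt D N par Finset.univ G u

lemma diag_perm {G' : List (Fin (n + 1) × Fin (n + 1))} (h : G.Perm G') : diag D N par G = diag D N par G' := by
  simp only [diag, diagInt, (h.map _).prod_eq]

/-- Reflect the vertices in `S` about the vertex `p`. -/
def reflectSet (S : Finset (Fin (n + 1))) (p : Fin (n + 1)) (u : Fin n → ℝ × ℝ) : Fin n → ℝ × ℝ :=
  fun k => if k.succ ∈ S then reflectAt (withRoot u p).2 (u k) else u k

variable {S : Finset (Fin (n + 1))} {p : Fin (n + 1)}

lemma withRoot_reflectSet (h0 : 0 ∉ S) (u : Fin n → ℝ × ℝ) (j : Fin (n + 1)) :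
    withRoot (reflectSet S p u) j = if j ∈ S then reflectAt (withRoot u p).2 (withRoot u j) else withRoot u j := by
  induction j using Fin.cases with
  | zero => simp [h0]
  | succ j => rfl

lemma withRoot_reflectSet_of_notMem (h0 : 0 ∉ S) (u : Fin n → ℝ × ℝ) {j : Fin (n + 1)} (hj : j ∉ S) :
    withRoot (reflectSet S p u) j = withRoot u j := by rw [withRoot_reflectSet h0, if_neg hj]

lemma withRoot_reflectSet_of_mem (h0 : 0 ∉ S) (hp : p ∉ S) (u : Fin n → ℝ × ℝ) {j : Fin (n + 1)} (hj : j ∈ insert p S) :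
    withRoot (reflectSet S p u) j = reflectAt (withRoot u p).2 (withRoot u j) := by
  rw [withRoot_reflectSet h0]
  rcases Finset.mem_insert.1 hj with rfl | hj
  · rw [if_neg hp]
    ext
    · rfl
    · simp [reflectAt]; ring
  · rw [if_pos hj]

lemma reflectSet_involutive (h0 : 0 ∉ S) (hp : p ∉ S) : Function.Involutive (reflectSet S p) := by
  intro u
  funext k
  simp only [reflectSet, withRoot_reflectSet_of_notMem h0 u hp]
  split_ifs
  · ext
    · rfl
    · simp only [reflectAt]
      ring
  · rfl

lemma withRoot_add (u v : Fin n → ℝ × ℝ) (j : Fin (n + 1)) : withRoot (u + v) j = withRoot u j + withRoot v j := by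
  induction j using Fin.cases with
  | zero => simp
  | succ j => rfl

lemma withRoot_smul (c : ℝ) (u : Fin n → ℝ × ℝ) (j : Fin (n + 1)) : withRoot (c • u) j = c • withRoot u j := by
  induction j using Fin.cases with
  | zero => simp
  | succ j => rfl

lemma isLinearMap_reflectSet : IsLinearMap ℝ (reflectSet S p) := by
  constructor
  · intro u v
    funext k
    simp only [reflectSet, Pi.add_apply, withRoot_add]
    split_ifs
    · ext
      · rfl
      · simp [reflectAt]; ring
    · rfl
  · intro c u
    funext k
    simp only [reflectSet, Pi.smul_apply, withRoot_smul]
    split_ifs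
    · ext
      · rfl
      · simp [reflectAt]; ring
    · rfl

/-- The centre of the reflection is itself a vertex, so this is a shear combined with sign changes.
It is linear and involutive, hence of determinant `±1`. -/
lemma measurePreserving_reflectSet (h0 : 0 ∉ S) (hp : p ∉ S) : MeasurePreserving (reflectSet S p) := by
  set L := (isLinearMap_reflectSet (S := S) (p := p)).mk' with hL
  have hLL : L * L = 1 := by
    exact LinearMap.ext fun u => reflectSet_involutive h0 hp u
  have hdet : LinearMap.det L * LinearMap.det L = 1 := by rw [← map_mul, hLL, map_one]
  have habs : |(LinearMap.det L)⁻¹| = 1 := by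
    rw [abs_inv, inv_eq_one]
    have := mul_self_eq_one_iff.1 hdet
    rcases this with h | h <;> simp [h]
  have hne : LinearMap.det L ≠ 0 := fun h => by simp [h] at hdet
  refine ⟨?_, ?_⟩
  · exact (L.continuous_of_finiteDimensional).measurable
  · have := Measure.map_linearMap_addHaar_eq_smul_addHaar (volume : Measure (Fin n → ℝ × ℝ)) hne
    rw [habs, ENNReal.ofReal_one, one_smul] at this
    exact this

/-- The reflection as a measurable equivalence. -/
noncomputable def reflectEquiv (h0 : 0 ∉ S) (hp : p ∉ S) : (Fin n → ℝ × ℝ) ≃ᵐ (Fin n → ℝ × ℝ) :=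
  MeasurableEquiv.ofInvolutive (reflectSet S p) (reflectSet_involutive h0 hp) (measurePreserving_reflectSet h0 hp).measurable

lemma integral_comp_reflectSet (h0 : 0 ∉ S) (hp : p ∉ S) (f : (Fin n → ℝ × ℝ) → ℝ) : ∫ u, f (reflectSet S p u) = ∫ u, f u :=
  (measurePreserving_reflectSet h0 hp).integral_comp (reflectEquiv h0 hp).measurableEmbedding f

lemma lintegral_comp_reflectSet (h0 : 0 ∉ S) (hp : p ∉ S) (f : (Fin n → ℝ × ℝ) → ℝ≥0∞) : ∫⁻ u, f (reflectSet S p u) = ∫⁻ u, f u :=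
  (measurePreserving_reflectSet h0 hp).lintegral_comp_emb (reflectEquiv h0 hp).measurableEmbedding f

lemma reflectAt_sub (q : ℝ) (a b : ℝ × ℝ) : reflectAt q a - reflectAt q b = ((a - b).1, -(a - b).2) := by
  ext
  · rfl
  · simp [reflectAt]

/-- The integrand is antisymmetric under the reflection of the vertices in `S` about the vertex `p`. -/
abbrev Antisymmetric (par : Fin n → Fin (n + 1)) (s : Finset (Fin n)) (G : List (Fin (n + 1) × Fin (n + 1)))
    (S : Finset (Fin (n + 1))) (p : Fin (n + 1)) : Prop :=
  0 ∉ S ∧ p ∉ S ∧ (∀ k ∈ s, (par k ∉ S ∧ k.succ ∉ S) ∨ (par k ∈ insert p S ∧ k.succ ∈ insert p S)) ∧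
    (∀ e ∈ G, (e.1 ∉ S ∧ e.2 ∉ S) ∨ (e.1 ∈ insert p S ∧ e.2 ∈ insert p S)) ∧
    (s.filter fun k => par k ∈ S ∨ k.succ ∈ S).card % 2 = 1

lemma cov_reflectSet {c T q ε : ℝ} (hN : IsNoiseKernel N c T q ε) (h0 : 0 ∉ S) (hp : p ∉ S) {i j : Fin (n + 1)}
    (h : (i ∉ S ∧ j ∉ S) ∨ (i ∈ insert p S ∧ j ∈ insert p S)) (u : Fin n → ℝ × ℝ) :
    cov N (withRoot (reflectSet S p u) i) (withRoot (reflectSet S p u) j) = cov N (withRoot u i) (withRoot u j) := by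
  rcases h with ⟨h1, h2⟩ | ⟨h1, h2⟩
  · rw [withRoot_reflectSet_of_notMem h0 u h1, withRoot_reflectSet_of_notMem h0 u h2]
  · rw [withRoot_reflectSet_of_mem h0 hp u h1, withRoot_reflectSet_of_mem h0 hp u h2, hN.cov_reflectAt]

/-- A tree edge that meets `S` has both ends in `S ∪ {p}`, and since `p` is fixed its argument is
reflected as a whole: it contributes a sign. The covariances are invariant, and the number of signs
is odd. -/
theorem diagInt_reflectSet {c T q ε : ℝ} {s : Finset (Fin n)} (hD : ∀ t x, D (t, -x) = -D (t, x)) (hN : IsNoiseKernel N c T q ε)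
    (h : Antisymmetric par s G S p) (u : Fin n → ℝ × ℝ) : diagInt D N par s G (reflectSet S p u) = -diagInt D N par s G u := by
  obtain ⟨h0, hp, hK, hG, hodd⟩ := h
  have e1 : ∀ k ∈ s, D (withRoot (reflectSet S p u) (par k) - reflectSet S p u k) =
      (if par k ∈ S ∨ k.succ ∈ S then -1 else 1) * D (withRoot u (par k) - u k) := by
    intro k hk
    rw [← withRoot_succ (reflectSet S p u) k, ← withRoot_succ u k]
    by_cases ht : par k ∈ S ∨ k.succ ∈ S
    · rw [if_pos ht]
      have h2 : par k ∈ insert p S ∧ k.succ ∈ insert p S := by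
        rcases hK k hk with h | h
        · tauto
        · exact h
      rw [withRoot_reflectSet_of_mem h0 hp u h2.1, withRoot_reflectSet_of_mem h0 hp u h2.2, reflectAt_sub, hD, neg_one_mul]
    · rw [if_neg ht]
      rw [not_or] at ht
      rw [withRoot_reflectSet_of_notMem h0 u ht.1, withRoot_reflectSet_of_notMem h0 u ht.2, one_mul]
  have e2 : (G.map fun e => cov N (withRoot (reflectSet S p u) e.1) (withRoot (reflectSet S p u) e.2)) =
      G.map fun e => cov N (withRoot u e.1) (withRoot u e.2) :=
    List.map_congr_left fun e he => cov_reflectSet hN h0 hp (hG e he) u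
  rw [diagInt, diagInt, e2, Finset.prod_congr rfl e1]
  simp only [Finset.prod_mul_distrib, Finset.prod_ite, Finset.prod_const, one_pow, mul_one]
  rw [Odd.neg_one_pow (Nat.odd_iff.2 hodd)]
  ring

/-- The integral equals its own negative. Integrability need not be known, since the change of
variables holds for the Bochner integral in any case. -/
theorem diag_eq_zero {c T q ε : ℝ} (hD : ∀ t x, D (t, -x) = -D (t, x)) (hN : IsNoiseKernel N c T q ε)
    (S : Finset (Fin (n + 1))) (p : Fin (n + 1)) (h : Antisymmetric par Finset.univ G S p) : diag D N par G = 0 := by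
  have := integral_comp_reflectSet h.1 h.2.1 (diagInt D N par Finset.univ G)
  simp only [diagInt_reflectSet hD hN h, integral_neg] at this
  rw [diag]
  linarith

end

/-- The pairs of a perfect matching, as a list. -/
def IsPairList {m : ℕ} (σ : Equiv.Perm (Fin m)) (L : List (Fin m × Fin m)) : Prop :=
  ∀ f : Fin m → Fin m → ℝ, ∏ i : {i : Fin m // i < σ i}, f i (σ i) = (L.map fun e => f e.1 e.2).prod

lemma mem_pairings {m : ℕ} {σ : Equiv.Perm (Fin m)} (hσ : σ ∈ pairings m) : (∀ i, σ (σ i) = i) ∧ ∀ i, σ i ≠ i := by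
  obtain ⟨h1, h2⟩ : σ * σ = 1 ∧ ∀ i, σ i ≠ i := by simpa [pairings] using hσ
  refine ⟨fun i => ?_, h2⟩
  have := congrArg (fun τ : Equiv.Perm (Fin m) => τ i) h1
  simpa using this

lemma prod_pairs_eq {m : ℕ} (σ : Equiv.Perm (Fin m)) (f : Fin m → Fin m → ℝ) :
    ∏ i : {i : Fin m // i < σ i}, f i (σ i) = ∏ i, if i < σ i then f i (σ i) else 1 := by
  rw [← Finset.prod_filter, Finset.prod_subtype (Finset.univ.filter fun i => i < σ i) (p := fun i => i < σ i) (by simp)]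

/-- The three perfect matchings of four points. -/
def fourPairs : List (List (Fin 4 × Fin 4)) :=
  [[(0, 1), (2, 3)], [(0, 2), (1, 3)], [(0, 3), (1, 2)]]

/-- The fifteen perfect matchings of six points. -/
def sixPairs : List (List (Fin 6 × Fin 6)) :=
  [[(0, 1), (2, 3), (4, 5)], [(0, 1), (2, 4), (3, 5)], [(0, 1), (2, 5), (3, 4)],
   [(0, 2), (1, 3), (4, 5)], [(0, 2), (1, 4), (3, 5)], [(0, 2), (1, 5), (3, 4)],
   [(0, 3), (1, 2), (4, 5)], [(0, 3), (1, 4), (2, 5)], [(0, 3), (1, 5), (2, 4)],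
   [(0, 4), (1, 2), (3, 5)], [(0, 4), (1, 3), (2, 5)], [(0, 4), (1, 5), (2, 3)],
   [(0, 5), (1, 2), (3, 4)], [(0, 5), (1, 3), (2, 4)], [(0, 5), (1, 4), (2, 3)]]

lemma isPairList_of_four {σ : Equiv.Perm (Fin 4)} {a b c d : Fin 4} (h0 : σ 0 = a) (h1 : σ 1 = b) (h2 : σ 2 = c) (h3 : σ 3 = d)
    {L : List (Fin 4 × Fin 4)}
    (hL : L = [(0, a), (1, b), (2, c), (3, d)].filter fun e => e.1 < e.2) : IsPairList σ L := by
  intro f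
  rw [prod_pairs_eq, Fin.prod_univ_four, h0, h1, h2, h3, hL]
  simp only [List.filter_cons, List.filter_nil, decide_eq_true_eq]
  split_ifs <;> simp [mul_assoc]

lemma isPairList_of_six {σ : Equiv.Perm (Fin 6)} {a b c d e g : Fin 6} (h0 : σ 0 = a) (h1 : σ 1 = b) (h2 : σ 2 = c) (h3 : σ 3 = d)
    (h4 : σ 4 = e) (h5 : σ 5 = g) {L : List (Fin 6 × Fin 6)}
    (hL : L = [(0, a), (1, b), (2, c), (3, d), (4, e), (5, g)].filter fun e => e.1 < e.2) : IsPairList σ L := by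
  intro f
  rw [prod_pairs_eq, Fin.prod_univ_six, h0, h1, h2, h3, h4, h5, hL]
  simp only [List.filter_cons, List.filter_nil, decide_eq_true_eq]
  split_ifs <;> simp [mul_assoc]

lemma exists_fourPairs {σ : Equiv.Perm (Fin 4)} (hσ : σ ∈ pairings 4) : ∃ L ∈ fourPairs, IsPairList σ L := by
  obtain ⟨hinv, hne⟩ := mem_pairings hσ
  have key : ∀ i, σ i = 0 ∨ σ i = 1 ∨ σ i = 2 ∨ σ i = 3 := fun i => by
    generalize σ i = x; revert x; decide
  have hs := fun i j (h : σ i = j) => (by rw [← h, hinv] : σ j = i)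
  rcases key 0 with h0 | h0 | h0 | h0
  · exact absurd h0 (hne 0)
  · have h1 := hs _ _ h0
    have h2 : σ 2 = 3 := by
      rcases key 2 with h | h | h | h
      · have := hs _ _ h; grind
      · have := hs _ _ h; grind
      · exact absurd h (hne 2)
      · exact h
    exact ⟨_, by simp [fourPairs], isPairList_of_four h0 h1 h2 (hs _ _ h2) rfl⟩
  · have h2 := hs _ _ h0
    have h1 : σ 1 = 3 := by
      rcases key 1 with h | h | h | h
      · have := hs _ _ h; grind
      · exact absurd h (hne 1)
      · have := hs _ _ h; grind
      · exact h
    exact ⟨_, by simp [fourPairs], isPairList_of_four h0 h1 h2 (hs _ _ h1) rfl⟩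
  · have h3 := hs _ _ h0
    have h1 : σ 1 = 2 := by
      rcases key 1 with h | h | h | h
      · have := hs _ _ h; grind
      · exact absurd h (hne 1)
      · exact h
      · have := hs _ _ h; grind
    exact ⟨_, by simp [fourPairs], isPairList_of_four h0 h1 (hs _ _ h1) h3 rfl⟩

lemma exists_sixPairs {σ : Equiv.Perm (Fin 6)} (hσ : σ ∈ pairings 6) : ∃ L ∈ sixPairs, IsPairList σ L := by
  obtain ⟨hinv, hne⟩ := mem_pairings hσ
  have key : ∀ i, σ i = 0 ∨ σ i = 1 ∨ σ i = 2 ∨ σ i = 3 ∨ σ i = 4 ∨ σ i = 5 := fun i => by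
    generalize σ i = x; revert x; decide
  have hs := fun i j (h : σ i = j) => (by rw [← h, hinv] : σ j = i)
  clear hinv hσ
  rcases key 0 with h0 | h0 | h0 | h0 | h0 | h0
  all_goals first | exact absurd h0 (hne 0) | have h0s := hs _ _ h0
  all_goals rcases key 1 with h1 | h1 | h1 | h1 | h1 | h1
  all_goals first | exact absurd h1 (hne 1) | have h1s := hs _ _ h1
  -- A choice that contradicts the partners already fixed by the involution is discarded at once, so
  -- the case tree keeps only partial matchings.
  all_goals try (exfalso; clear hne key hs; grind only)
  all_goals rcases key 2 with h2 | h2 | h2 | h2 | h2 | h2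
  all_goals first | exact absurd h2 (hne 2) | have h2s := hs _ _ h2
  all_goals try (exfalso; clear hne key hs; grind only)
  all_goals rcases key 3 with h3 | h3 | h3 | h3 | h3 | h3
  all_goals first | exact absurd h3 (hne 3) | have h3s := hs _ _ h3
  all_goals try (exfalso; clear hne key hs; grind only)
  all_goals rcases key 4 with h4 | h4 | h4 | h4 | h4 | h4
  all_goals first | exact absurd h4 (hne 4) | have h4s := hs _ _ h4
  all_goals try (exfalso; clear hne key hs; grind only)
  all_goals rcases key 5 with h5 | h5 | h5 | h5 | h5 | h5
  all_goals first | exact absurd h5 (hne 5) | have h5s := hs _ _ h5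
  all_goals try (exfalso; clear hne key hs; grind only)
  all_goals exact ⟨_, by simp [sixPairs], isPairList_of_six h0 h1 h2 h3 h4 h5 rfl⟩

section
variable {K ρ : ℝ × ℝ → ℝ} {γ ε c T p : ℝ}

/-- Passes to numbered vertices: `f` numbers the inner vertices from 1, `par` lists their parents
and `att` the vertex carrying each noise. After this a contraction is finite combinatorial data, on
which the classification can be decided. -/
theorem contraction_eq_diag (hD : Measurable (spaceDeriv K)) (hD' : Integrable (spaceDeriv K))
    (hN : IsNoiseKernel (noiseKernel K ρ γ ε) c T p ε) (hc : 0 ≤ c) (hp : 0 ≤ p) (hε : 0 < ε) {l r : Symbol} {n : ℕ}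
    (f : Fin n → l.Inner ⊕ r.Inner) (hf : Function.Bijective f) (par : Fin n → Fin (n + 1))
    (att : Fin (l.noises + r.noises) → Fin (n + 1))
    (hker : ∀ w, pairKer (spaceDeriv K) l r w = ∏ k, spaceDeriv K (withRoot (fun k => w (f k)) (par k) - w (f k)))
    (hatt : ∀ w i, pairAttach l r w i = withRoot (fun k => w (f k)) (att i))
    {σ : Equiv.Perm (Fin (l.noises + r.noises))} (hσ : σ ∈ pairings _) {L : List (Fin (l.noises + r.noises) × Fin (l.noises + r.noises))}
    (hL : IsPairList σ L) :
    contraction σ (symbolKernel K ρ γ ε (.node l r) 0) =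
      diag (spaceDeriv K) (noiseKernel K ρ γ ε) par (L.map (Prod.map att att)) := by
  rw [contraction_eq hD hD' hN hc hp hε l r hσ, diag]
  refine (integral_reindex hf fun w => ?_).1
  rw [diagInt, hker, hL fun i j => cov (noiseKernel K ρ γ ε) (pairAttach l r w i) (pairAttach l r w j), List.map_map]
  simp only [hatt]
  rfl

end

end FracKPZ

/-! ### Power counting with integer weights -/

namespace FracKPZ
open Set ENNReal

lemma pker_zero_add {x y : ℝ} {z : ℝ × ℝ} (hz : 0 < parNorm z) : pker 0 (x + y) z = pker 0 x z * pker 0 y z := by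
  rw [pker_zero_eq_exp hz, pker_zero_eq_exp hz, pker_zero_eq_exp hz, ← ENNReal.ofReal_mul (Real.exp_nonneg _), ← Real.exp_add, add_mul]

lemma pker_zero_zero (z : ℝ × ℝ) : pker 0 0 z = 1 := by simp [pker]

section
variable {n : ℕ}

/-- The exponent of the edge `(i, j)` in a list of weighted edges. -/
def edgeSum {α M : Type*} [DecidableEq α] [AddMonoid M] (E : List (α × M)) (i : α) : M :=
  (E.map fun e => if e.1 = i then e.2 else 0).sum

/-- Exponents of parallel edges add, which may include negative ones; for this the points must be
distinct. The pairs are ordered, so a negative exponent is only merged with edges of the same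
orientation. -/
lemma prod_pker_eq (E : List ((Fin (n + 1) × Fin (n + 1)) × ℝ)) (hE : ∀ e ∈ E, e.1.1 ≠ e.1.2) {u : Fin n → ℝ × ℝ}
    (hu : ∀ i j, i ≠ j → 0 < parNorm (withRoot u i - withRoot u j)) :
    (E.map fun e => pker 0 e.2 (withRoot u e.1.1 - withRoot u e.1.2)).prod =
      ∏ i, ∏ j, pker 0 (edgeSum E (i, j)) (withRoot u i - withRoot u j) := by
  induction E with
  | nil => simp [edgeSum, pker_zero_zero]
  | cons e E ih =>
    have hne := hE e (by simp)
    have key : ∀ i j, pker 0 (edgeSum (e :: E) (i, j)) (withRoot u i - withRoot u j) =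
        (if (i, j) = e.1 then pker 0 e.2 (withRoot u e.1.1 - withRoot u e.1.2) else 1) *
          pker 0 (edgeSum E (i, j)) (withRoot u i - withRoot u j) := by
      intro i j
      by_cases h : (i, j) = e.1
      · have hd := hu _ _ hne
        simp only [edgeSum, List.map_cons, List.sum_cons, h, if_true]
        obtain ⟨h1, h2⟩ : i = e.1.1 ∧ j = e.1.2 := by rw [← h]; simp
        rw [h1, h2, pker_zero_add hd]
      · simp only [edgeSum, List.map_cons, List.sum_cons, if_neg h, if_neg (Ne.symm h), zero_add, one_mul]
    simp only [key, Finset.prod_mul_distrib, List.map_cons, List.prod_cons]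
    rw [ih fun e he => hE e (by simp [he])]
    congr 1
    rw [← Fintype.prod_prod_type' (f := fun i j => if (i, j) = e.1 then pker 0 e.2 (withRoot u e.1.1 - withRoot u e.1.2) else 1)]
    simp

lemma edgeSum_affine {α : Type*} [DecidableEq α] (E : List (α × ℤ × ℕ)) (κ : ℝ) (i : α) :
    edgeSum (E.map fun e => (e.1, (e.2.1 : ℝ) / 6 - κ * e.2.2)) i = ((edgeSum E i).1 : ℝ) / 6 - κ * (edgeSum E i).2 := by
  induction E with
  | nil => simp [edgeSum]
  | cons e E ih =>
    simp only [edgeSum, List.map_cons, List.sum_cons] at ih ⊢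
    rw [ih]
    split_ifs
    · simp only [Prod.fst_add, Prod.snd_add]; push_cast; ring
    · simp

/-- The power counting condition for a list of weighted edges between five vertices; the weight `(b, m)` stands for
the exponent `b / 6 - κ m`. -/
abbrev Admissible (E : List ((Fin 5 × Fin 5) × ℤ × ℕ)) : Prop :=
  (∀ e ∈ E, e.1.1 ≠ e.1.2) ∧ (∀ i j, ((edgeSum E (i, j)).2 : ℤ) ≤ (edgeSum E (i, j)).1) ∧
    (∀ A : Finset (Fin 5), 2 ≤ A.card → A.card < 5 → ∑ i ∈ A, ∑ j ∈ A, (edgeSum E (i, j)).1 + 1 ≤ 18 * ((A.card : ℤ) - 1)) ∧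
    ∑ i, ∑ j, (edgeSum E (i, j)).1 ≤ 72 ∧ ∑ i, ∑ j, (edgeSum E (i, j)).2 = 3

/-- Measured in sixths all exponents are integers apart from the `κ` terms, so power counting
becomes decidable. Proper subsets of at least two vertices are subcritical by at least `1/6`; the
full set may be exactly critical, `72/6 = 3·4`, and is saved by the total gain `3κ`. -/
theorem Admissible.exists_bound {E : List ((Fin 5 × Fin 5) × ℤ × ℕ)} (hE : Admissible E) {κ : ℝ} (hκ : 0 < κ) (hκ' : κ ≤ 1 / 48) :
    ∃ c : ℝ, 0 < c ∧ ∫⁻ u in closeSet 4, (E.map fun e => pker 0 ((e.2.1 : ℝ) / 6 - κ * e.2.2)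
      (withRoot u e.1.1 - withRoot u e.1.2)).prod ≤ ENNReal.ofReal c := by
  obtain ⟨h1, h2, h3, h4, h5⟩ := hE
  set a : Fin 5 → Fin 5 → ℝ := fun i j => ((edgeSum E (i, j)).1 : ℝ) / 6 - κ * (edgeSum E (i, j)).2 with ha
  have hcast : ∀ i j, ((edgeSum E (i, j)).2 : ℝ) ≤ ((edgeSum E (i, j)).1 : ℝ) := fun i j => by exact_mod_cast h2 i j
  have ha0 : ∀ i j, 0 ≤ a i j := by
    intro i j
    have := hcast i j
    have h0 : (0 : ℝ) ≤ (edgeSum E (i, j)).2 := by positivity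
    simp only [ha]
    nlinarith
  have hdiag : ∀ i, edgeSum E (i, i) = 0 := by
    intro i
    rw [edgeSum]
    refine List.sum_eq_zero fun x hx => ?_
    obtain ⟨e, he, rfl⟩ := List.mem_map.1 hx
    rw [if_neg]
    intro h
    exact h1 e he (by rw [h])
  -- The choice `s = 3 - 3κ/4` makes the full set tight: `4s = 12 - 3κ`. For proper subsets the loss
  -- `(3κ/4)(#A - 1)` is below the margin `1/6`.
  have hpc : ∀ A : Finset (Fin 5), A.Nonempty → ∑ i ∈ A, ∑ j ∈ A, a i j ≤ (3 - 3 * κ / 4) * (A.card - 1) := by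
    intro A hA
    have hsum : ∑ i ∈ A, ∑ j ∈ A, a i j = ((∑ i ∈ A, ∑ j ∈ A, (edgeSum E (i, j)).1 : ℤ) : ℝ) / 6 -
        κ * ((∑ i ∈ A, ∑ j ∈ A, (edgeSum E (i, j)).2 : ℕ) : ℝ) := by
      simp only [ha, Finset.sum_sub_distrib, ← Finset.mul_sum, ← Finset.sum_div]
      push_cast
      rfl
    have hcard : A.card ≤ 5 := by simpa using Finset.card_le_univ A
    have hm : (0 : ℝ) ≤ ((∑ i ∈ A, ∑ j ∈ A, (edgeSum E (i, j)).2 : ℕ) : ℝ) := by positivity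
    rw [hsum]
    rcases Nat.lt_or_ge A.card 2 with hc | hc
    · have hc1 : A.card = 1 := by have := hA.card_pos; omega
      obtain ⟨i, rfl⟩ := Finset.card_eq_one.1 hc1
      simp [hdiag]
    · have hc2 : (2 : ℝ) ≤ A.card := by exact_mod_cast hc
      rcases Nat.lt_or_ge A.card 5 with hc' | hc'
      · have := h3 A hc hc'
        have hR : ((∑ i ∈ A, ∑ j ∈ A, (edgeSum E (i, j)).1 : ℤ) : ℝ) + 1 ≤ 18 * ((A.card : ℝ) - 1) := by exact_mod_cast this
        have hc4 : (A.card : ℝ) ≤ 4 := by exact_mod_cast Nat.lt_succ_iff.1 hc'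
        nlinarith
      · have hAu : A = Finset.univ := by
          rw [← Finset.card_eq_iff_eq_univ]; simp; omega
        subst hAu
        rw [h5]
        have hR : ((∑ i, ∑ j, (edgeSum E (i, j)).1 : ℤ) : ℝ) ≤ 72 := by exact_mod_cast h4
        simp only [Finset.card_univ, Fintype.card_fin]
        push_cast at hR ⊢
        linarith
  obtain ⟨c, hc, H⟩ := lintegral_powerCounting (n := 4) ha0 (by linarith : 0 ≤ 3 - 3 * κ / 4) (by linarith)
    (fun i => by simp [ha, hdiag]) hpc
  refine ⟨c, hc, le_of_eq_of_le (lintegral_congr_ae (ae_restrict_of_ae ?_)) H⟩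
  have hae : ∀ᵐ u : Fin 4 → ℝ × ℝ, ∀ i j : Fin 5, i ≠ j → withRoot u i ≠ withRoot u j := by
    rw [ae_all_iff]; intro i
    rw [ae_all_iff]; intro j
    by_cases h : i = j
    · simp [h]
    · simpa [h] using ae_withRoot_ne h
  filter_upwards [hae] with u hu
  have := prod_pker_eq (E.map fun e => (e.1, (e.2.1 : ℝ) / 6 - κ * e.2.2)) (by
    intro e he
    obtain ⟨e', he', rfl⟩ := List.mem_map.1 he
    exact h1 e' he') (u := u) fun i j hij => parNorm_pos_iff.2 (sub_ne_zero.2 (hu i j hij))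
  rw [List.map_map] at this
  refine Eq.trans ?_ (this.trans ?_)
  · rfl
  · simp only [edgeSum_affine, ha]

/-- The majorant of a diagram: tree edges with the exponents `b / 2`, a gain of one half for every edge in `X`, and covariances
of exponent `q + g / 2`. -/
noncomputable def majorant (ε q : ℝ) (par : Fin n → Fin (n + 1)) (b : Fin n → ℕ) (X : List (Fin (n + 1) × Fin (n + 1)))
    (G : List ((Fin (n + 1) × Fin (n + 1)) × ℕ)) (u : Fin n → ℝ × ℝ) : ℝ≥0∞ :=
  (∏ k, pker 0 ((b k : ℝ) / 2) (withRoot u (par k) - u k)) *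
    (X.map fun e => pker 0 (-1 / 2) (withRoot u e.1 - withRoot u e.2)).prod *
    (G.map fun e => pker ε (q + (e.2 : ℝ) / 2) (withRoot u e.1.1 - withRoot u e.1.2)).prod

/-- The weighted edges of a majorant. -/
def majorantEdges (par : Fin n → Fin (n + 1)) (b : Fin n → ℕ) (X : List (Fin (n + 1) × Fin (n + 1)))
    (G : List ((Fin (n + 1) × Fin (n + 1)) × ℕ)) : List ((Fin (n + 1) × Fin (n + 1)) × ℤ × ℕ) :=
  (List.ofFn fun k => ((par k, k.succ), 3 * (b k : ℤ), 0)) ++ X.map (fun e => (e, -3, 0)) ++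
    G.map fun e => (e.1, 8 + 3 * (e.2 : ℤ), 1)

/-- Interpolation: the part `α - β` of the exponent is spent on the regularisation, the part `β` on
the distance. -/
lemma pker_le_rpow_mul {ε α β : ℝ} (hε : 0 < ε) (hβ : 0 ≤ β) (hαβ : β ≤ α) (z : ℝ × ℝ) :
    pker ε α z ≤ ENNReal.ofReal (ε ^ (-(α - β))) * pker 0 β z := by
  have hz : 0 ≤ parNorm z := by unfold parNorm; positivity
  have h0 : 0 < parNorm z + ε := by linarith
  have e : pker ε α z = ENNReal.ofReal ((parNorm z + ε) ^ (-(α - β))) * pker ε β z := by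
    rw [pker, pker, ENNReal.ofReal_rpow_of_pos h0, ENNReal.ofReal_rpow_of_pos h0, ← ENNReal.ofReal_mul (by positivity),
      ← Real.rpow_add h0]
    congr 2; ring
  rw [e]
  refine mul_le_mul' (ENNReal.ofReal_le_ofReal ?_) (pker_anti hβ ?_)
  · exact Real.rpow_le_rpow_of_nonpos hε (by linarith) (by linarith)
  · linarith

/-- Each covariance keeps the exponent `4/3 - κ`, plus its half-integer loss. The value `4/3` is `1
+ 2γ` at `γ = 1/6`, where a six-noise diagram is critical; the excess `2γ - 1/3 + κ` becomes a power
of `ε`, which is why `γ ≥ 1/6` is needed. -/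
lemma majorant_le {ε γ κ : ℝ} (hε : 0 < ε) (hγ : 1 / 6 ≤ γ) (hκ : 0 < κ) (hκ' : κ ≤ 1 / 48) (par : Fin n → Fin (n + 1)) (b : Fin n → ℕ)
    (X : List (Fin (n + 1) × Fin (n + 1))) (G : List ((Fin (n + 1) × Fin (n + 1)) × ℕ)) (u : Fin n → ℝ × ℝ) :
    majorant ε (1 + 2 * γ) par b X G u ≤ ENNReal.ofReal (ε ^ (-(2 * γ - 1 / 3 + κ))) ^ G.length *
      ((majorantEdges par b X G).map fun e => pker 0 ((e.2.1 : ℝ) / 6 - κ * e.2.2)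
        (withRoot u e.1.1 - withRoot u e.1.2)).prod := by
  have hG : ∀ G : List ((Fin (n + 1) × Fin (n + 1)) × ℕ),
      (G.map fun e => pker ε (1 + 2 * γ + (e.2 : ℝ) / 2) (withRoot u e.1.1 - withRoot u e.1.2)).prod ≤
      ENNReal.ofReal (ε ^ (-(2 * γ - 1 / 3 + κ))) ^ G.length *
      ((G.map fun e => (e.1, 8 + 3 * (e.2 : ℤ), 1)).map fun e : (Fin (n + 1) × Fin (n + 1)) × ℤ × ℕ => pker 0 ((e.2.1 : ℝ) / 6 - κ * e.2.2)
        (withRoot u e.1.1 - withRoot u e.1.2)).prod := by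
    intro G
    induction G with
    | nil => simp
    | cons e G ih =>
      simp only [List.map_cons, List.prod_cons, List.length_cons, pow_succ']
      refine (mul_le_mul' ?_ ih).trans_eq (mul_mul_mul_comm _ _ _ _)
      have he : (0 : ℝ) ≤ (e.2 : ℝ) := by positivity
      refine (pker_le_rpow_mul hε (β := (((8 + 3 * (e.2 : ℤ) : ℤ)) : ℝ) / 6 - κ * ((1 : ℕ) : ℝ)) ?_ ?_ _).trans_eq ?_
      · push_cast; linarith
      · push_cast; linarith
      · congr 3
        push_cast; ring
  rw [majorant, majorantEdges, List.map_append, List.map_append, List.prod_append, List.prod_append,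
    mul_left_comm]
  refine mul_le_mul' (le_of_eq ?_) (hG G)
  congr 1
  · rw [List.map_ofFn, List.prod_ofFn]
    refine Finset.prod_congr rfl fun k _ => ?_
    simp only [Function.comp, withRoot_succ]
    congr 1
    push_cast; ring
  · rw [List.map_map]
    congr 1
    refine List.map_congr_left fun e _ => ?_
    simp only [Function.comp]
    congr 1
    push_cast; ring

theorem exists_majorant_bound {γ κ : ℝ} (hγ : 1 / 6 ≤ γ) (hκ : 0 < κ) (hκ' : κ ≤ 1 / 48) {par : Fin 4 → Fin 5} {b : Fin 4 → ℕ}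
    {X : List (Fin 5 × Fin 5)} {G : List ((Fin 5 × Fin 5) × ℕ)} (hG : G.length = 3) (h : Admissible (majorantEdges par b X G)) :
    ∃ c : ℝ, 0 < c ∧ ∀ ε : ℝ, 0 < ε → ∫⁻ u in closeSet 4, majorant ε (1 + 2 * γ) par b X G u ≤
      ENNReal.ofReal (c * ε ^ (1 - 6 * γ - 3 * κ)) := by
  obtain ⟨c, hc, H⟩ := h.exists_bound hκ hκ'
  refine ⟨c, hc, fun ε hε => ?_⟩
  calc _ ≤ ∫⁻ u in closeSet 4, ENNReal.ofReal (ε ^ (1 - 6 * γ - 3 * κ)) *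
      ((majorantEdges par b X G).map fun e => pker 0 ((e.2.1 : ℝ) / 6 - κ * e.2.2)
        (withRoot u e.1.1 - withRoot u e.1.2)).prod := by
        refine lintegral_mono fun u => (majorant_le hε hγ hκ hκ' par b X G u).trans_eq ?_
        rw [hG, ← ENNReal.ofReal_pow (by positivity), ← Real.rpow_natCast, ← Real.rpow_mul hε.le]
        congr 3
        push_cast; ring
    _ ≤ ENNReal.ofReal (ε ^ (1 - 6 * γ - 3 * κ)) * ENNReal.ofReal c := by
        rw [lintegral_const_mul' _ _ ofReal_ne_top]
        exact mul_le_mul_right H _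
    _ = _ := by rw [← ENNReal.ofReal_mul (by positivity), mul_comm]

end

end FracKPZ

/-! ### Bounds on the edges and the direct estimate of a diagram -/

namespace FracKPZ
open Set ENNReal

/-- The bounds on the kernel of the tree edges. -/
structure IsEdgeKernel (D : ℝ × ℝ → ℝ) (C c : ℝ) : Prop where
  meas : Measurable D
  odd : ∀ t x, D (t, -x) = -D (t, x)
  supported : ∀ z, C < parNorm z → D z = 0
  size : ∀ z, ‖D z‖ₑ ≤ ENNReal.ofReal c * pker 0 2 z
  diff : ∀ z w : ℝ × ℝ, z.1 = w.1 → ‖D z - D w‖ₑ ≤ ENNReal.ofReal c * ENNReal.ofReal (|z.2 - w.2| ^ (1 / 2 : ℝ)) *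
    ({z | parNorm z ≤ C}.indicator (pker 0 (5 / 2)) z + {z | parNorm z ≤ C}.indicator (pker 0 (5 / 2)) w)

/-- The bounds on the covariance of the noise. -/
structure IsCovariance (N : ℝ × ℝ → ℝ) (A q ε : ℝ) : Prop where
  meas : Measurable fun z : (ℝ × ℝ) × (ℝ × ℝ) => cov N z.1 z.2
  size : ∀ u v : ℝ × ℝ, |u.2 - v.2| ≤ 1 / 4 → ‖cov N u v‖ₑ ≤ ENNReal.ofReal A * pker ε q (u - v)
  diff : ∀ u u' v : ℝ × ℝ, u.1 = u'.1 → |u.2 - v.2| ≤ 1 / 4 → |u'.2 - v.2| ≤ 1 / 4 →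
      ‖cov N u v - cov N u' v‖ₑ ≤ ENNReal.ofReal A * ENNReal.ofReal (|u.2 - u'.2| ^ (1 / 2 : ℝ)) *
        (pker ε (q + 1 / 2) (u - v) + pker ε (q + 1 / 2) (u' - v))
  diff_diff : ∀ u u' v v' : ℝ × ℝ, u.1 = u'.1 → v.1 = v'.1 → |u.2 - u'.2| ≤ 1 / 4 → |u.2 - v.2| ≤ 1 / 4 → |u.2 - v'.2| ≤ 1 / 4 →
      ‖cov N u v - cov N u' v - (cov N u v' - cov N u' v')‖ₑ ≤ ENNReal.ofReal A * ENNReal.ofReal (|u.2 - u'.2| ^ (1 / 2 : ℝ)) *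
        ENNReal.ofReal (|v.2 - v'.2| ^ (1 / 2 : ℝ)) *
        (pker ε (q + 1) (u - v) + pker ε (q + 1) (u' - v) + (pker ε (q + 1) (u - v') + pker ε (q + 1) (u' - v')))

lemma exists_isCovariance {c p : ℝ} (hc : 0 ≤ c) (hp : 2 ≤ p) (hp1 : p < 5 / 2) : ∃ A : ℝ, 0 < A ∧ ∀ (N : ℝ × ℝ → ℝ) (T ε : ℝ),
    0 < ε → IsNoiseKernel N c T p ε → IsCovariance N A (2 * p - 3) ε := by
  obtain ⟨A, hA, HA⟩ := exists_cov_size hc hp hp1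
  obtain ⟨B, hB, HB⟩ := exists_cov_diff hc hp hp1
  obtain ⟨E, hE, HE⟩ := exists_cov_diff_diff hc hp hp1
  have hA1 : ENNReal.ofReal A ≤ ENNReal.ofReal (A + B + E) := ENNReal.ofReal_le_ofReal (by linarith)
  have hB1 : ENNReal.ofReal B ≤ ENNReal.ofReal (A + B + E) := ENNReal.ofReal_le_ofReal (by linarith)
  have hE1 : ENNReal.ofReal E ≤ ENNReal.ofReal (A + B + E) := ENNReal.ofReal_le_ofReal (by linarith)
  refine ⟨A + B + E, by positivity, fun N T ε hε hN => ⟨hN.measurable_cov, fun u v h => (HA N T ε hε hN u v h).trans (mul_le_mul_left hA1 _),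
    fun u u' v h h1 h2 => ?_, fun u u' v v' h h' h1 h2 h3 => ?_⟩⟩
  · have := HB N T ε hε hN u u' v h h1 h2
    rw [show 2 * p - 3 + 1 / 2 = 2 * p - 5 / 2 by ring]
    exact this.trans (mul_le_mul_left (mul_le_mul_left hB1 _) _)
  · have := HE N T ε hε hN u u' v v' h h' h1 h2 h3
    rw [show 2 * p - 3 + 1 = 2 * p - 2 by ring]
    exact this.trans (mul_le_mul_left (mul_le_mul_left (mul_le_mul_left hE1 _) _) _)

/-- Of the two weights in the Hölder bound the one at the point nearer to the origin dominates. If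
that point is outside the support both values vanish; this allows the indicators, which later keep
the configuration compact. -/
lemma IsTruncatedHeatKernel.exists_isEdgeKernel {K : ℝ × ℝ → ℝ} {C r : ℝ} (hK : IsTruncatedHeatKernel K C r) (hC : 0 < C) :
    ∃ c : ℝ, 0 < c ∧ IsEdgeKernel (spaceDeriv K) C c := by
  obtain ⟨c, hc, H⟩ := hK.exists_hasOrder_spaceDeriv hC
  have hsupp : ∀ z, C < parNorm z → spaceDeriv K z = 0 := fun z hz => by
    exact hK.iterate_supported 1 hz
  refine ⟨2 * c, by positivity, hK.measurable_spaceDeriv, hK.spaceDeriv_odd, hsupp, fun z => ?_, ?_⟩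
  · refine (enorm_le_pker (by norm_num) (H.size z) hc.le).trans (mul_le_mul_left (ENNReal.ofReal_le_ofReal (by linarith)) _)
  · have key : ∀ t x x', parNorm (t, x) ≤ parNorm (t, x') → parNorm (t, x) ≤ C →
        ‖spaceDeriv K (t, x) - spaceDeriv K (t, x')‖ₑ ≤ ENNReal.ofReal (2 * c) * ENNReal.ofReal (|x - x'| ^ (1 / 2 : ℝ)) *
          {z | parNorm z ≤ C}.indicator (pker 0 (5 / 2)) (t, x) := by
      intro t x x' h1 h2
      rw [indicator_of_mem (by exact h2)]
      -- At the origin the right-hand side is `∞` unless the increment is zero, whereas the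
      -- real-valued Hölder bound uses the default value of the power there.
      rcases eq_or_ne (t, x) 0 with h0 | h0
      · by_cases hx : x = x'
        · simp [hx]
        · have hpos : 0 < |x - x'| ^ (1 / 2 : ℝ) := Real.rpow_pos_of_pos (abs_pos.2 (sub_ne_zero.2 hx)) _
          rw [h0, pker, parNorm_zero, add_zero, ENNReal.ofReal_zero, ENNReal.zero_rpow_of_neg (by norm_num), ENNReal.mul_top]
          · exact le_top
          · rw [← ENNReal.ofReal_mul (by positivity)]
            exact (ENNReal.ofReal_pos.2 (by positivity)).ne'
      · have hpos : 0 < parNorm (t, x) := parNorm_pos_iff.2 h0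
        have hh := H.holder t x x'
        have h3 : parNorm (t, x') ^ (-2 - 1 / 2 : ℝ) ≤ parNorm (t, x) ^ (-2 - 1 / 2 : ℝ) :=
          Real.rpow_le_rpow_of_nonpos hpos h1 (by norm_num)
        rw [pker, add_zero, ENNReal.ofReal_rpow_of_pos hpos, ← ENNReal.ofReal_mul (by positivity), ← ENNReal.ofReal_mul (by positivity),
          ← ofReal_norm, Real.norm_eq_abs]
        refine ENNReal.ofReal_le_ofReal (hh.trans ?_)
        rw [show (-(5 / 2) : ℝ) = -2 - 1 / 2 by norm_num]
        have h4 : 0 ≤ c * |x - x'| ^ (1 / 2 : ℝ) := by positivity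
        nlinarith
    rintro ⟨t, x⟩ ⟨t', x'⟩ (rfl : t = t')
    rcases le_total (parNorm (t, x)) (parNorm (t, x')) with h | h
    · by_cases hC : parNorm (t, x) ≤ C
      · exact (key t x x' h hC).trans (mul_le_mul_right le_self_add _)
      · rw [hsupp _ (not_le.1 hC), hsupp _ ((not_le.1 hC).trans_le h)]; simp
    · by_cases hC : parNorm (t, x') ≤ C
      · rw [← enorm_neg, neg_sub, show |(t, x).2 - (t, x').2| = |x' - x| from abs_sub_comm _ _]
        exact (key t x' x h hC).trans (mul_le_mul_right le_add_self _)
      · rw [hsupp _ (not_le.1 hC), hsupp _ ((not_le.1 hC).trans_le h)]; simp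

section
variable {n : ℕ} {D N : ℝ × ℝ → ℝ} {par : Fin n → Fin (n + 1)} {G : List (Fin (n + 1) × Fin (n + 1))} {C c A q ε : ℝ}
  {u : Fin n → ℝ × ℝ}

/-- The tree edges have length at most `C`. -/
def TreeClose (C : ℝ) (par : Fin n → Fin (n + 1)) (u : Fin n → ℝ × ℝ) : Prop :=
  ∀ k, parNorm (withRoot u (par k) - u k) ≤ C

/-- Parents are numbered before their children, so each new vertex is within `C` of an earlier one
and enlarges the diameter by at most `C`. -/
lemma TreeClose.dist_le (h : TreeClose C par u) (hC : 0 ≤ C) (hpar : ∀ k, par k ≤ k.castSucc) (m : ℕ) :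
    ∀ i j : Fin (n + 1), (i : ℕ) ≤ m → (j : ℕ) ≤ m → parNorm (withRoot u i - withRoot u j) ≤ m * C := by
  induction m with
  | zero =>
    intro i j hi hj
    have : i = j := Fin.ext (by omega)
    subst this
    simp [parNorm_zero]
  | succ m ih =>
    have key : ∀ i j : Fin (n + 1), (i : ℕ) ≤ m → (j : ℕ) = m + 1 → parNorm (withRoot u i - withRoot u j) ≤ (m + 1 : ℕ) * C := by
      intro i j hi hj
      obtain ⟨k, rfl⟩ : ∃ k : Fin n, j = k.succ := Fin.exists_succ_eq.2 (by rintro rfl; simp at hj) |>.imp fun _ h => h.symm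
      have hk : (k : ℕ) = m := by simpa using hj
      have h1 := ih i (par k) hi (by have := hpar k; rw [Fin.le_def] at this; simp at this; omega)
      have h2 := h k
      have h3 := parNorm_sub_le (withRoot u i) (withRoot u (par k)) (withRoot u k.succ)
      rw [withRoot_succ] at h3 ⊢
      push_cast
      linarith
    intro i j hi hj
    rcases Nat.lt_or_ge m i with hi' | hi' <;> rcases Nat.lt_or_ge m j with hj' | hj'
    · have : i = j := Fin.ext (by omega)
      subst this
      simp [parNorm_zero]; positivity
    · rw [parNorm_sub_comm]
      exact key j i hj' (by omega)
    · exact key i j hi' (by omega)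
    · exact (ih i j hi' hj').trans (by push_cast; linarith)

/-- The role of `C ≤ 1/16`: with at most four inner vertices all mutual distances stay below `1/4`,
where the covariance bounds see only one period. -/
lemma TreeClose.parNorm_le (h : TreeClose C par u) (hC : 0 ≤ C) (hpar : ∀ k, par k ≤ k.castSucc) (hn : n * C ≤ 1 / 4) (i j : Fin (n + 1)) :
    parNorm (withRoot u i - withRoot u j) ≤ 1 / 4 :=
  (h.dist_le hC hpar n i j (Nat.lt_succ_iff.1 i.2) (Nat.lt_succ_iff.1 j.2)).trans hn

lemma TreeClose.abs_le (h : TreeClose C par u) (hC : 0 ≤ C) (hpar : ∀ k, par k ≤ k.castSucc) (hn : n * C ≤ 1 / 4) (i j : Fin (n + 1)) :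
    |(withRoot u i).2 - (withRoot u j).2| ≤ 1 / 4 :=
  (abs_snd_le_parNorm (withRoot u i - withRoot u j)).trans (h.parNorm_le hC hpar hn i j)

lemma IsEdgeKernel.treeClose (hD : IsEdgeKernel D C c) (h : diagInt D N par Finset.univ G u ≠ 0) : TreeClose C par u := by
  intro k
  by_contra hk
  apply h
  rw [diagInt, Finset.prod_eq_zero (Finset.mem_univ k) (hD.supported _ (not_le.1 hk)), zero_mul]

lemma enorm_diagInt_le (hD : IsEdgeKernel D C c) (hN : IsCovariance N A q ε) (hC : 0 ≤ C) (hpar : ∀ k, par k ≤ k.castSucc)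
    (hn : n * C ≤ 1 / 4) (hu : TreeClose C par u) (s : Finset (Fin n)) (G : List (Fin (n + 1) × Fin (n + 1))) :
    ‖diagInt D N par s G u‖ₑ ≤ (ENNReal.ofReal c ^ s.card * ENNReal.ofReal A ^ G.length) *
      ((∏ k ∈ s, pker 0 2 (withRoot u (par k) - u k)) *
        (G.map fun e => pker ε q (withRoot u e.1 - withRoot u e.2)).prod) := by
  rw [diagInt, enorm_mul, mul_mul_mul_comm]
  refine mul_le_mul' ?_ ?_
  · have : ‖∏ k ∈ s, D (withRoot u (par k) - u k)‖ₑ = ∏ k ∈ s, ‖D (withRoot u (par k) - u k)‖ₑ := by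
      simp only [← ofReal_norm, norm_prod]
      exact ENNReal.ofReal_prod_of_nonneg fun _ _ => norm_nonneg _
    rw [this, ← Finset.prod_const, ← Finset.prod_mul_distrib]
    exact Finset.prod_le_prod' fun k _ => hD.size _
  · induction G with
    | nil => simp
    | cons e G ih =>
      simp only [List.map_cons, List.prod_cons, List.length_cons, pow_succ', enorm_mul]
      refine (mul_le_mul' (hN.size _ _ (hu.abs_le hC hpar hn _ _)) ih).trans_eq (mul_mul_mul_comm _ _ _ _)

lemma measurableSet_closeSet (n : ℕ) : MeasurableSet (closeSet n) := by
  simp only [closeSet, ofPred_forall]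
  refine MeasurableSet.iInter fun i => MeasurableSet.iInter fun j => ?_
  exact measurableSet_le (continuous_parNorm.measurable.comp (by fun_prop)) measurable_const

lemma lintegral_le_of_treeClose (hC : 0 ≤ C) (hpar : ∀ k, par k ≤ k.castSucc) (hn : n * C ≤ 1 / 4) {M F : (Fin n → ℝ × ℝ) → ℝ≥0∞}
    {B : ℝ≥0∞} (hB : B ≠ ⊤) (h1 : ∀ u, TreeClose C par u → M u ≤ B * F u) (h2 : ∀ u, ¬ TreeClose C par u → M u = 0) :
    ∫⁻ u, M u ≤ B * ∫⁻ u in closeSet n, F u := by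
  rw [← lintegral_const_mul' _ _ hB, ← lintegral_indicator (measurableSet_closeSet n)]
  refine lintegral_mono fun u => ?_
  by_cases hu : TreeClose C par u
  · rw [indicator_of_mem]
    · exact h1 u hu
    · exact fun i j => (hu.parNorm_le hC hpar hn i j).trans (by norm_num)
  · rw [h2 u hu]; exact zero_le

theorem enorm_diag_le (hD : IsEdgeKernel D C c) (hN : IsCovariance N A q ε) (hC : 0 ≤ C) (hpar : ∀ k, par k ≤ k.castSucc)
    (hn : n * C ≤ 1 / 4) (G : List (Fin (n + 1) × Fin (n + 1))) :
    ‖diag D N par G‖ₑ ≤ (ENNReal.ofReal c ^ n * ENNReal.ofReal A ^ G.length) *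
      ∫⁻ u in closeSet n, majorant ε q par (fun _ => 4) [] (G.map fun e => (e, 0)) u := by
  refine (enorm_integral_le_lintegral_enorm _).trans (lintegral_le_of_treeClose hC hpar hn
    (ENNReal.mul_ne_top (pow_ne_top ofReal_ne_top) (pow_ne_top ofReal_ne_top)) (fun u hu => ?_) fun u hu => ?_)
  · refine (enorm_diagInt_le hD hN hC hpar hn hu Finset.univ G).trans_eq ?_
    simp only [Finset.card_univ, Fintype.card_fin, majorant, List.map_nil, List.prod_nil, mul_one, List.map_map]
    congr 2
    · refine Finset.prod_congr rfl fun k _ => ?_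
      congr 1; norm_num
    · congr 1
      refine List.map_congr_left fun e _ => ?_
      simp [Function.comp]
  · by_contra h
    exact hu (hD.treeClose fun h0 => h (by rw [h0, enorm_zero]))

end

end FracKPZ

/-! ### Symmetrization: trading oddness for half a derivative -/

namespace FracKPZ
open Set ENNReal

section
variable {n : ℕ} {D N : ℝ × ℝ → ℝ} {par : Fin n → Fin (n + 1)} {G : List (Fin (n + 1) × Fin (n + 1))} {C c A q ε : ℝ}
  {u : Fin n → ℝ × ℝ} {S : Finset (Fin (n + 1))} {p : Fin (n + 1)}

/-- If `A` changes sign under a measure-preserving map `R`, then `∫ A g = ½ ∫ A (g - g ∘ R)`; the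
factor `½` is given away. Without integrability the left-hand side is zero by convention. -/
lemma enorm_integral_le_antisymm (h0 : 0 ∉ S) (hp : p ∉ S) {A g : (Fin n → ℝ × ℝ) → ℝ} (hA : ∀ u, A (reflectSet S p u) = -A u) :
    ‖∫ u, A u * g u‖ₑ ≤ ‖∫ u, A u * (g u - g (reflectSet S p u))‖ₑ := by
  by_cases hi : Integrable fun u => A u * g u
  · have hi' : Integrable fun u => A (reflectSet S p u) * g (reflectSet S p u) :=
      (measurePreserving_reflectSet h0 hp).integrable_comp_of_integrable hi
    have e : ∫ u, A u * (g u - g (reflectSet S p u)) = 2 * ∫ u, A u * g u := by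
      have h1 := integral_add hi hi'
      rw [integral_comp_reflectSet h0 hp fun u => A u * g u] at h1
      rw [two_mul, ← h1]
      refine integral_congr_ae (Filter.Eventually.of_forall fun u => ?_)
      simp only [hA]
      ring
    rw [e, enorm_mul]
    refine le_mul_of_one_le_left' ?_
    rw [← ofReal_norm, ENNReal.one_le_ofReal]
    norm_num
  · rw [integral_undef hi, enorm_zero]; exact zero_le

lemma measurable_diagInt (hD : Measurable D) (hN : Measurable fun z : (ℝ × ℝ) × (ℝ × ℝ) => cov N z.1 z.2) (s : Finset (Fin n))
    (G : List (Fin (n + 1) × Fin (n + 1))) : Measurable (diagInt D N par s G) := by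
  refine (Finset.measurable_prod _ fun k _ => hD.comp (by fun_prop)).mul ?_
  induction G with
  | nil => simp
  | cons e G ih =>
    simp only [List.map_cons, List.prod_cons]
    exact (hN.comp ((measurable_withRoot e.1).prodMk (measurable_withRoot e.2))).mul ih

/-- The square root of twice the spatial distance of two vertices. -/
noncomputable def halfDist (i j : Fin (n + 1)) (u : Fin n → ℝ × ℝ) : ℝ≥0∞ :=
  ENNReal.ofReal ((2 * |(withRoot u i).2 - (withRoot u j).2|) ^ (1 / 2 : ℝ))

/-- Writes the gain as a kernel of negative exponent, so that it merges with the parallel edges in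
the power counting. -/
lemma halfDist_le (i j : Fin (n + 1)) (u : Fin n → ℝ × ℝ) : halfDist i j u ≤ 2 * pker 0 (-1 / 2) (withRoot u i - withRoot u j) := by
  have h := abs_snd_le_parNorm (withRoot u i - withRoot u j)
  have h0 : 0 ≤ parNorm (withRoot u i - withRoot u j) := (abs_nonneg _).trans h
  rw [halfDist, pker, add_zero, ← ENNReal.ofReal_ofNat 2, show -(-1 / 2 : ℝ) = 1 / 2 by norm_num,
    ENNReal.ofReal_rpow_of_nonneg h0 (by norm_num), ← ENNReal.ofReal_mul (by norm_num)]
  refine ENNReal.ofReal_le_ofReal ?_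
  rw [Real.mul_rpow (by norm_num) (abs_nonneg _)]
  refine mul_le_mul ?_ (Real.rpow_le_rpow (abs_nonneg _) h (by norm_num)) (by positivity) (by norm_num)
  calc (2 : ℝ) ^ (1 / 2 : ℝ) ≤ 2 ^ (1 : ℝ) := Real.rpow_le_rpow_of_exponent_le (by norm_num) (by norm_num)
    _ = 2 := by norm_num

lemma measurable_halfDist (i j : Fin (n + 1)) : Measurable (halfDist (n := n) i j) := by
  unfold halfDist
  have h1 := measurable_withRoot (n := n) i
  have h2 := measurable_withRoot (n := n) j
  fun_prop

lemma halfDist_reflectSet (h0 : 0 ∉ S) (hp : p ∉ S) {v : Fin (n + 1)} (hv : v ∈ S) (u : Fin n → ℝ × ℝ) :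
    halfDist p v (reflectSet S p u) = halfDist p v u := by
  rw [halfDist, halfDist, withRoot_reflectSet_of_notMem h0 u hp, withRoot_reflectSet_of_mem h0 hp u (Finset.mem_insert_of_mem hv)]
  congr 3
  simp only [reflectAt]
  rw [show (withRoot u p).2 - (2 * (withRoot u p).2 - (withRoot u v).2) = -((withRoot u p).2 - (withRoot u v).2) by ring, abs_neg]

lemma halfDist_eq (h0 : 0 ∉ S) (hp : p ∉ S) {v : Fin (n + 1)} (hv : v ∈ S) (u : Fin n → ℝ × ℝ) :
    ENNReal.ofReal (|(withRoot u v).2 - (withRoot (reflectSet S p u) v).2| ^ (1 / 2 : ℝ)) = halfDist p v u := by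
  rw [halfDist, withRoot_reflectSet_of_mem h0 hp u (Finset.mem_insert_of_mem hv)]
  congr 2
  simp only [reflectAt]
  rw [show (withRoot u v).2 - (2 * (withRoot u p).2 - (withRoot u v).2) = -(2 * ((withRoot u p).2 - (withRoot u v).2)) by ring, abs_neg,
    abs_mul, abs_two]

lemma fst_reflectSet (h0 : 0 ∉ S) (u : Fin n → ℝ × ℝ) (v : Fin (n + 1)) :
    (withRoot (reflectSet S p u) v).1 = (withRoot u v).1 := by
  rw [withRoot_reflectSet h0]
  split_ifs <;> rfl

lemma lintegral_reflectSet_add {M : (Fin n → ℝ × ℝ) → ℝ≥0∞} (hM : Measurable M) (h0 : 0 ∉ S) (hp : p ∉ S) :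
    ∫⁻ u, (M u + M (reflectSet S p u)) = 2 * ∫⁻ u, M u := by
  rw [lintegral_add_left hM, lintegral_comp_reflectSet h0 hp M, two_mul]

/-- Symmetrization at a leaf `v` whose only asymmetric edge is the covariance with `i`. -/
theorem enorm_diag_le_of_leaf {c' T p' : ℝ} (hD : IsEdgeKernel D C c) (hN : IsCovariance N A q ε) (hN' : IsNoiseKernel N c' T p' ε)
    (hC : 0 ≤ C) (hpar : ∀ k, par k ≤ k.castSucc) (hn : n * C ≤ 1 / 4) {v i : Fin (n + 1)}
    (hA : Antisymmetric par Finset.univ G {v} p) (hi : i ≠ v) :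
    ‖diag D N par ((i, v) :: G)‖ₑ ≤ (ENNReal.ofReal c ^ n * ENNReal.ofReal A ^ G.length * (4 * ENNReal.ofReal A)) *
      ∫⁻ u in closeSet n, majorant ε q par (fun _ => 4) [(p, v)] (((i, v), 1) :: G.map fun e => (e, 0)) u := by
  have h0 := hA.1
  have hp := hA.2.1
  have hv : v ∈ ({v} : Finset (Fin (n + 1))) := Finset.mem_singleton_self v
  have hiS : i ∉ ({v} : Finset (Fin (n + 1))) := by simpa using hi
  set F := diagInt D N par Finset.univ G with hF
  have hFT : ∀ u, F (reflectSet {v} p u) = -F u := diagInt_reflectSet hD.odd hN' hA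
  have hFm : Measurable F := measurable_diagInt hD.meas hN.meas _ _
  set M : (Fin n → ℝ × ℝ) → ℝ≥0∞ := fun u => ‖F u‖ₑ * (ENNReal.ofReal A * halfDist p v u * pker ε (q + 1 / 2) (withRoot u v - withRoot u i)) with hM
  have hMm : Measurable M := by
    refine hFm.enorm.mul (((measurable_halfDist p v).const_mul _).mul ((measurable_pker _ _).comp ?_))
    exact (measurable_withRoot v).sub (measurable_withRoot i)
  have e1 : diag D N par ((i, v) :: G) = ∫ u, F u * cov N (withRoot u v) (withRoot u i) := by
    rw [diag]
    refine integral_congr_ae (Filter.Eventually.of_forall fun u => ?_)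
    simp only [hF, diagInt, List.map_cons, List.prod_cons]
    rw [cov_symm N (withRoot u i)]
    ring
  rw [e1]
  refine (enorm_integral_le_antisymm h0 hp hFT).trans ((enorm_integral_le_lintegral_enorm _).trans ?_)
  -- The Hölder bound has one weight at the old and one at the reflected position. As `‖F‖` and the
  -- displacement are invariant, the second term is the first composed with the reflection, and both
  -- have the same integral.
  calc ∫⁻ u, ‖F u * (cov N (withRoot u v) (withRoot u i) - cov N (withRoot (reflectSet {v} p u) v) (withRoot (reflectSet {v} p u) i))‖ₑ
      ≤ ∫⁻ u, (M u + M (reflectSet {v} p u)) := by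
        refine lintegral_mono fun u => ?_
        rw [enorm_mul]
        rcases eq_or_ne (F u) 0 with hz | hz
        · rw [hz, enorm_zero, zero_mul]; exact zero_le
        have hu := hD.treeClose hz
        -- The covariance bound needs the reflected vertex to be close as well; `F` does not vanish
        -- there, by antisymmetry.
        have hu' : TreeClose C par (reflectSet {v} p u) := hD.treeClose (N := N) (G := G) (by rw [← hF, hFT]; exact neg_ne_zero.2 hz)
        have ei : withRoot (reflectSet {v} p u) i = withRoot u i := withRoot_reflectSet_of_notMem h0 u hiS
        have hd := hN.diff (withRoot u v) (withRoot (reflectSet {v} p u) v) (withRoot u i) (fst_reflectSet h0 u v).symm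
          (hu.abs_le hC hpar hn v i) (by rw [← ei]; exact hu'.abs_le hC hpar hn v i)
        rw [halfDist_eq h0 hp hv] at hd
        rw [ei]
        refine (mul_le_mul_right hd _).trans_eq ?_
        simp only [hM, hFT, enorm_neg, ei, halfDist_reflectSet h0 hp hv]
        ring
    _ = 2 * ∫⁻ u, M u := lintegral_reflectSet_add hMm h0 hp
    _ ≤ 2 * ((ENNReal.ofReal c ^ n * ENNReal.ofReal A ^ G.length * (2 * ENNReal.ofReal A)) *
      ∫⁻ u in closeSet n, majorant ε q par (fun _ => 4) [(p, v)] (((i, v), 1) :: G.map fun e => (e, 0)) u) := by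
        refine mul_le_mul_right (lintegral_le_of_treeClose hC hpar hn (by finiteness) (fun u hu => ?_) fun u hu => ?_) _
        · refine (mul_le_mul' (enorm_diagInt_le hD hN hC hpar hn hu Finset.univ G)
            (mul_le_mul_left (mul_le_mul_right (halfDist_le p v u) _) _)).trans_eq ?_
          simp only [Finset.card_univ, Fintype.card_fin, majorant, List.map_cons, List.map_nil, List.prod_nil, List.prod_cons, mul_one,
            List.map_map, Function.comp_def]
          rw [pker_sub_comm ε _ (withRoot u v)]
          norm_num
          ring
        · by_contra h
          refine hu (hD.treeClose (N := N) (G := G) fun h0 => h ?_)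
          simp only [hM, hF, h0, enorm_zero, zero_mul]
    _ = _ := by ring

/-- The tree edges other than `w` and the covariances give a closed tree if the edge `w` is short as well. -/
lemma IsEdgeKernel.treeClose_of_erase (hD : IsEdgeKernel D C c) {w : Fin n} (h : diagInt D N par (Finset.univ.erase w) G u ≠ 0)
    (hw : parNorm (withRoot u (par w) - u w) ≤ C) : TreeClose C par u := by
  intro k
  by_cases hk : k = w
  · rw [hk]; exact hw
  by_contra hk'
  apply h
  rw [diagInt, Finset.prod_eq_zero (Finset.mem_erase.2 ⟨hk, Finset.mem_univ k⟩) (hD.supported _ (not_le.1 hk')), zero_mul]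

/-- The majorant of a difference of two values of the edge kernel. -/
noncomputable def nearKer (C : ℝ) (z : ℝ × ℝ) : ℝ≥0∞ := {z | parNorm z ≤ C}.indicator (pker 0 (5 / 2)) z

lemma measurable_nearKer (C : ℝ) : Measurable (nearKer C) := (measurable_pker _ _).indicator (measurableSet_parNorm_le C)

lemma nearKer_le (C : ℝ) (z : ℝ × ℝ) : nearKer C z ≤ pker 0 (5 / 2) z := indicator_le_self _ _ _

lemma parNorm_le_of_nearKer_ne_zero {z : ℝ × ℝ} (h : nearKer C z ≠ 0) : parNorm z ≤ C := by
  by_contra hz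
  refine h ?_
  rw [nearKer, indicator_of_notMem]
  exact hz

/-- The edge that is differenced has exponent `5/2` instead of `2`; in half units, the weight 5
replaces 4 at `w`. -/
lemma prod_pker_update (w : Fin n) (f : Fin n → ℝ × ℝ) :
    (∏ k ∈ Finset.univ.erase w, pker 0 2 (f k)) * pker 0 (5 / 2) (f w) =
      ∏ k, pker 0 (((Function.update (fun _ => 4) w 5 : Fin n → ℕ) k : ℝ) / 2) (f k) := by
  rw [← Finset.prod_erase_mul _ _ (Finset.mem_univ w)]
  congr 1
  · refine Finset.prod_congr rfl fun k hk => ?_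
    rw [Function.update_of_ne (Finset.ne_of_mem_erase hk)]
    norm_num
  · rw [Function.update_self]
    norm_num

lemma enorm_edge_diff_le (hD : IsEdgeKernel D C c) (h0 : 0 ∉ S) (hp : p ∉ S) {w : Fin n} (hv : par w ∈ S) (hw : w.succ ∉ S)
    (u : Fin n → ℝ × ℝ) : ‖D (withRoot u (par w) - u w) - D (withRoot (reflectSet S p u) (par w) - reflectSet S p u w)‖ₑ ≤
      ENNReal.ofReal c * halfDist p (par w) u *
        (nearKer C (withRoot u (par w) - u w) + nearKer C (withRoot (reflectSet S p u) (par w) - reflectSet S p u w)) := by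
  have ew : reflectSet S p u w = u w := by
    have := withRoot_reflectSet_of_notMem (p := p) h0 u hw
    simpa using this
  rw [ew]
  refine (hD.diff _ _ ?_).trans_eq ?_
  · simp only [Prod.fst_sub, fst_reflectSet h0]
  · rw [← halfDist_eq h0 hp hv]
    simp only [Prod.snd_sub, sub_sub_sub_cancel_right]
    rfl

/-- Symmetrization at a vertex `par w` whose only asymmetric edge is the tree edge `w`. -/
theorem enorm_diag_le_of_edge {c' T p' : ℝ} (hD : IsEdgeKernel D C c) (hN : IsCovariance N A q ε) (hN' : IsNoiseKernel N c' T p' ε)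
    (hC : 0 ≤ C) (hpar : ∀ k, par k ≤ k.castSucc) (hn : n * C ≤ 1 / 4) {w : Fin n}
    (hA : Antisymmetric par (Finset.univ.erase w) G {par w} p) (hw : w.succ ≠ par w) :
    ‖diag D N par G‖ₑ ≤ (ENNReal.ofReal c ^ (Finset.univ.erase w).card * ENNReal.ofReal A ^ G.length * (4 * ENNReal.ofReal c)) *
      ∫⁻ u in closeSet n, majorant ε q par (Function.update (fun _ => 4) w 5) [(p, par w)] (G.map fun e => (e, 0)) u := by
  have h0 := hA.1
  have hp := hA.2.1
  have hv : par w ∈ ({par w} : Finset (Fin (n + 1))) := Finset.mem_singleton_self _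
  have hwS : w.succ ∉ ({par w} : Finset (Fin (n + 1))) := by simpa using hw
  set F := diagInt D N par (Finset.univ.erase w) G with hF
  have hFT : ∀ u, F (reflectSet {par w} p u) = -F u := diagInt_reflectSet hD.odd hN' hA
  have hFm : Measurable F := measurable_diagInt hD.meas hN.meas _ _
  set M : (Fin n → ℝ × ℝ) → ℝ≥0∞ := fun u => ‖F u‖ₑ * (ENNReal.ofReal c * halfDist p (par w) u * nearKer C (withRoot u (par w) - u w)) with hM
  have hMm : Measurable M := by
    refine hFm.enorm.mul (((measurable_halfDist p _).const_mul _).mul ((measurable_nearKer _).comp ?_))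
    exact (measurable_withRoot _).sub (measurable_pi_apply w)
  have e1 : diag D N par G = ∫ u, F u * D (withRoot u (par w) - u w) := by
    rw [diag]
    refine integral_congr_ae (Filter.Eventually.of_forall fun u => ?_)
    simp only [hF, diagInt]
    rw [← Finset.prod_erase_mul _ _ (Finset.mem_univ w)]
    ring
  rw [e1]
  refine (enorm_integral_le_antisymm h0 hp hFT).trans ((enorm_integral_le_lintegral_enorm _).trans ?_)
  calc ∫⁻ u, ‖F u * (D (withRoot u (par w) - u w) - D (withRoot (reflectSet {par w} p u) (par w) - reflectSet {par w} p u w))‖ₑ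
      ≤ ∫⁻ u, (M u + M (reflectSet {par w} p u)) := by
        refine lintegral_mono fun u => ?_
        rw [enorm_mul]
        refine (mul_le_mul_right (enorm_edge_diff_le hD h0 hp hv hwS u) _).trans_eq ?_
        simp only [hM, hFT, enorm_neg, halfDist_reflectSet h0 hp hv]
        ring
    _ = 2 * ∫⁻ u, M u := lintegral_reflectSet_add hMm h0 hp
    _ ≤ 2 * ((ENNReal.ofReal c ^ (Finset.univ.erase w).card * ENNReal.ofReal A ^ G.length * (2 * ENNReal.ofReal c)) *
      ∫⁻ u in closeSet n, majorant ε q par (Function.update (fun _ => 4) w 5) [(p, par w)] (G.map fun e => (e, 0)) u) := by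
        refine mul_le_mul_right (lintegral_le_of_treeClose hC hpar hn (by finiteness) (fun u hu => ?_) fun u hu => ?_) _
        · refine (mul_le_mul' (enorm_diagInt_le hD hN hC hpar hn hu _ G)
            (mul_le_mul' (mul_le_mul_right (halfDist_le p _ u) _) (nearKer_le _ _))).trans_eq ?_
          simp only [majorant, List.map_cons, List.map_nil, List.prod_nil, List.prod_cons, mul_one,
            List.map_map, Function.comp_def, ← prod_pker_update w fun k => withRoot u (par k) - u k]
          norm_num
          ring
        · by_contra h
          -- The edge `w` has been taken out of `F`, so its shortness must come from the indicator
          -- in `nearKer`.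
          refine hu (hD.treeClose_of_erase (N := N) (G := G) (w := w) (fun h0 => h ?_) (parNorm_le_of_nearKer_ne_zero fun h0 => h ?_))
          · simp only [hM, hF, h0, enorm_zero, zero_mul]
          · simp only [hM, h0, mul_zero]
    _ = _ := by ring

/-- Symmetrization at two vertices `v`, `v'` whose only asymmetric edge is the covariance of `v` and `v'`. -/
theorem enorm_diag_le_of_two_leaves {c' T p' : ℝ} (hD : IsEdgeKernel D C c) (hN : IsCovariance N A q ε) (hN' : IsNoiseKernel N c' T p' ε)
    (hC : 0 ≤ C) (hpar : ∀ k, par k ≤ k.castSucc) (hn : n * C ≤ 1 / 4) {v v' p₁ p₂ : Fin (n + 1)}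
    (h₁ : Antisymmetric par Finset.univ G {v} p₁) (h₂ : Antisymmetric par Finset.univ G {v'} p₂) (hvv : v ≠ v') (hp₁ : p₁ ≠ v') (hp₂ : p₂ ≠ v) :
    ‖diag D N par ((v, v') :: G)‖ₑ ≤ (ENNReal.ofReal c ^ n * ENNReal.ofReal A ^ G.length * (16 * ENNReal.ofReal A)) *
      ∫⁻ u in closeSet n, majorant ε q par (fun _ => 4) [(p₁, v), (p₂, v')] (((v, v'), 2) :: G.map fun e => (e, 0)) u := by
  have h10 := h₁.1
  have h1p := h₁.2.1
  have h20 := h₂.1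
  have h2p := h₂.2.1
  have hv : v ∈ ({v} : Finset (Fin (n + 1))) := Finset.mem_singleton_self v
  have hv' : v' ∈ ({v'} : Finset (Fin (n + 1))) := Finset.mem_singleton_self v'
  have hvS : v ∉ ({v'} : Finset (Fin (n + 1))) := by simpa using hvv
  have hvS' : v' ∉ ({v} : Finset (Fin (n + 1))) := by simpa using hvv.symm
  have hpS : p₁ ∉ ({v'} : Finset (Fin (n + 1))) := by simpa using hp₁
  have hpS' : p₂ ∉ ({v} : Finset (Fin (n + 1))) := by simpa using hp₂
  set F := diagInt D N par Finset.univ G with hF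
  set R := reflectSet {v} p₁ with hR
  set R' := reflectSet {v'} p₂ with hR'
  have hFT : ∀ u, F (R u) = -F u := diagInt_reflectSet hD.odd hN' h₁
  have hFT' : ∀ u, F (R' u) = -F u := diagInt_reflectSet hD.odd hN' h₂
  have hFm : Measurable F := measurable_diagInt hD.meas hN.meas _ _
  set M : (Fin n → ℝ × ℝ) → ℝ≥0∞ := fun u => ‖F u‖ₑ * (ENNReal.ofReal A * halfDist p₁ v u * halfDist p₂ v' u *
    pker ε (q + 1) (withRoot u v - withRoot u v')) with hM
  have hMm : Measurable M := by
    refine hFm.enorm.mul ((((measurable_halfDist _ _).const_mul _).mul (measurable_halfDist _ _)).mul ((measurable_pker _ _).comp ?_))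
    exact (measurable_withRoot _).sub (measurable_withRoot _)
  have e1 : diag D N par ((v, v') :: G) = ∫ u, F u * cov N (withRoot u v) (withRoot u v') := by
    rw [diag]
    refine integral_congr_ae (Filter.Eventually.of_forall fun u => ?_)
    simp only [hF, diagInt, List.map_cons, List.prod_cons]
    ring
  have r1 : ∀ u, withRoot (R u) v' = withRoot u v' := fun u => withRoot_reflectSet_of_notMem h10 u hvS'
  have r2 : ∀ u, withRoot (R' u) v = withRoot u v := fun u => withRoot_reflectSet_of_notMem h20 u hvS
  have r3 : ∀ u, withRoot (R (R' u)) v = withRoot (R u) v := fun u => by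
    rw [hR, withRoot_reflectSet_of_mem h10 h1p _ (Finset.mem_insert_of_mem hv), withRoot_reflectSet_of_mem h10 h1p _ (Finset.mem_insert_of_mem hv),
      r2, hR', withRoot_reflectSet_of_notMem h20 u hpS]
  have d1 : ∀ u, halfDist p₁ v (R u) = halfDist p₁ v u := fun u => halfDist_reflectSet h10 h1p hv u
  have d2 : ∀ u, halfDist p₂ v' (R' u) = halfDist p₂ v' u := fun u => halfDist_reflectSet h20 h2p hv' u
  have d3 : ∀ u, halfDist p₁ v (R' u) = halfDist p₁ v u := fun u => by
    rw [halfDist, halfDist, r2, hR', withRoot_reflectSet_of_notMem h20 u hpS]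
  have d4 : ∀ u, halfDist p₂ v' (R u) = halfDist p₂ v' u := fun u => by
    rw [halfDist, halfDist, r1, hR, withRoot_reflectSet_of_notMem h10 u hpS']
  rw [e1]
  refine (enorm_integral_le_antisymm h10 h1p hFT).trans ((enorm_integral_le_antisymm h20 h2p hFT').trans
    ((enorm_integral_le_lintegral_enorm _).trans ?_))
  rw [← hR, ← hR']
  calc ∫⁻ u, ‖F u * ((cov N (withRoot u v) (withRoot u v') - cov N (withRoot (R u) v) (withRoot (R u) v')) -
        (cov N (withRoot (R' u) v) (withRoot (R' u) v') - cov N (withRoot (R (R' u)) v) (withRoot (R (R' u)) v')))‖ₑ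
      ≤ ∫⁻ u, ((M u + M (R u)) + (M (R' u) + M (R (R' u)))) := by
        refine lintegral_mono fun u => ?_
        rw [enorm_mul]
        rcases eq_or_ne (F u) 0 with hz | hz
        · rw [hz, enorm_zero, zero_mul]; exact zero_le
        have hu := hD.treeClose hz
        have hu' : TreeClose C par (R' u) := hD.treeClose (N := N) (G := G) (by rw [← hF, hFT']; exact neg_ne_zero.2 hz)
        -- The displacement is twice the spatial distance from `v` to `p₁`. By oddness of the count
        -- some tree edge meets `v`, and the condition on the edges forces it to join `v` to `p₁`;
        -- so the displacement is at most `2C`.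
        have hvR : |(withRoot u v).2 - (withRoot (R u) v).2| ≤ 1 / 4 := by
          obtain ⟨k, hk⟩ : ∃ k, par k ∈ ({v} : Finset (Fin (n + 1))) ∨ k.succ ∈ ({v} : Finset (Fin (n + 1))) := by
            by_contra! hcon
            have := h₁.2.2.2.2
            rw [Finset.filter_false_of_mem fun k _ => by simpa using hcon k] at this
            simp at this
          have hkp : (par k = p₁ ∧ k.succ = v) ∨ (par k = v ∧ k.succ = p₁) ∨ par k = k.succ := by
            have := h₁.2.2.1 k (Finset.mem_univ k)
            simp only [Finset.mem_singleton, Finset.mem_insert] at this hk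
            grind
          have hne : par k ≠ k.succ := fun h => by
            have := hpar k
            rw [h] at this
            simp [Fin.le_def] at this
          have hle : |(withRoot u p₁).2 - (withRoot u v).2| ≤ C := by
            have := (abs_snd_le_parNorm _).trans (hu k)
            rw [← withRoot_succ u k] at this
            rcases hkp with ⟨h1, h2⟩ | ⟨h1, h2⟩ | h
            · rwa [h1, h2] at this
            · rw [h1, h2] at this
              rw [abs_sub_comm]; exact this
            · exact absurd h hne
          -- There are at least two inner vertices, since `v` and `v'` are distinct and neither is
          -- the root.
          have h2n : (2 : ℝ) * C ≤ 1 / 4 := by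
            have : (2 : ℕ) ≤ n := by
              have h1 : v ≠ 0 := fun h => h10 (by simp [h])
              have h2 : v' ≠ 0 := fun h => h20 (by simp [h])
              by_contra hlt
              have h3 := v.2
              have h4 := v'.2
              apply hvv
              ext
              have h5 : (v : ℕ) ≠ 0 := fun h => h1 (Fin.ext h)
              have h6 : (v' : ℕ) ≠ 0 := fun h => h2 (Fin.ext h)
              omega
            have : (2 : ℝ) ≤ n := by exact_mod_cast this
            nlinarith
          rw [hR, withRoot_reflectSet_of_mem h10 h1p _ (Finset.mem_insert_of_mem hv)]
          simp only [reflectAt]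
          rw [show (withRoot u v).2 - (2 * (withRoot u p₁).2 - (withRoot u v).2) = -(2 * ((withRoot u p₁).2 - (withRoot u v).2)) by ring, abs_neg,
            abs_mul, abs_two]
          linarith
        have hd := hN.diff_diff (withRoot u v) (withRoot (R u) v) (withRoot u v') (withRoot (R' u) v') (fst_reflectSet h10 u v).symm
          (fst_reflectSet h20 u v').symm hvR (hu.abs_le hC hpar hn v v') (by rw [← r2 u]; exact hu'.abs_le hC hpar hn v v')
        rw [hR, halfDist_eq h10 h1p hv, ← hR, hR', halfDist_eq h20 h2p hv', ← hR'] at hd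
        rw [r1, r1, r2, r3]
        refine (mul_le_mul_right hd _).trans_eq ?_
        simp only [hM, hFT, hFT', enorm_neg, d1, d2, d3, d4, r1, r2, r3]
        ring
    _ = 2 * ∫⁻ u, (M u + M (R u)) :=
        lintegral_reflectSet_add (M := fun u => M u + M (R u))
          (hMm.add (hMm.comp (measurePreserving_reflectSet h10 h1p).measurable)) h20 h2p
    _ = 4 * ∫⁻ u, M u := by
        rw [lintegral_reflectSet_add hMm h10 h1p, ← mul_assoc]; norm_num
    _ ≤ 4 * ((ENNReal.ofReal c ^ n * ENNReal.ofReal A ^ G.length * (4 * ENNReal.ofReal A)) *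
      ∫⁻ u in closeSet n, majorant ε q par (fun _ => 4) [(p₁, v), (p₂, v')] (((v, v'), 2) :: G.map fun e => (e, 0)) u) := by
        refine mul_le_mul_right (lintegral_le_of_treeClose hC hpar hn (by finiteness) (fun u hu => ?_) fun u hu => ?_) _
        · refine (mul_le_mul' (enorm_diagInt_le hD hN hC hpar hn hu Finset.univ G)
            (mul_le_mul_left (mul_le_mul' (mul_le_mul_right (halfDist_le _ _ u) _) (halfDist_le _ _ u)) _)).trans_eq ?_
          simp only [Finset.card_univ, Fintype.card_fin, majorant, List.map_cons, List.map_nil, List.prod_nil, List.prod_cons, mul_one,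
            List.map_map, Function.comp_def]
          norm_num
          ring
        · by_contra h
          refine hu (hD.treeClose (N := N) (G := G) fun h0 => h ?_)
          simp only [hM, hF, h0, enorm_zero, zero_mul]
    _ = _ := by ring

/-- Symmetrization at a vertex `par w` whose only asymmetric edge is the tree edge `w` and at a leaf `v` whose only asymmetric edge
is the covariance with `i`. -/
theorem enorm_diag_le_of_edge_of_leaf {c' T p' : ℝ} (hD : IsEdgeKernel D C c) (hN : IsCovariance N A q ε) (hN' : IsNoiseKernel N c' T p' ε)
    (hC : 0 ≤ C) (hpar : ∀ k, par k ≤ k.castSucc) (hn : n * C ≤ 1 / 4) {w : Fin n} {v i p₁ p₂ : Fin (n + 1)}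
    (h₁ : Antisymmetric par (Finset.univ.erase w) G {par w} p₁) (h₂ : Antisymmetric par (Finset.univ.erase w) G {v} p₂)
    (hw : w.succ ≠ par w) (hpv : par w ≠ v) (hwv : w.succ ≠ v) (hiv : i ≠ v) (hi : i ≠ par w) (hp₁ : p₁ ≠ v) (hp₂ : p₂ ≠ par w) :
    ‖diag D N par ((i, v) :: G)‖ₑ ≤ (ENNReal.ofReal c ^ (Finset.univ.erase w).card * ENNReal.ofReal A ^ G.length *
        (16 * ENNReal.ofReal c * ENNReal.ofReal A)) *
      ∫⁻ u in closeSet n, majorant ε q par (Function.update (fun _ => 4) w 5) [(p₁, par w), (p₂, v)] (((i, v), 1) :: G.map fun e => (e, 0)) u := by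
  have h10 := h₁.1
  have h1p := h₁.2.1
  have h20 := h₂.1
  have h2p := h₂.2.1
  have hv : par w ∈ ({par w} : Finset (Fin (n + 1))) := Finset.mem_singleton_self _
  have hv' : v ∈ ({v} : Finset (Fin (n + 1))) := Finset.mem_singleton_self v
  set F := diagInt D N par (Finset.univ.erase w) G with hF
  set R := reflectSet {par w} p₁ with hR
  set R' := reflectSet {v} p₂ with hR'
  have hFT : ∀ u, F (R u) = -F u := diagInt_reflectSet hD.odd hN' h₁
  have hFT' : ∀ u, F (R' u) = -F u := diagInt_reflectSet hD.odd hN' h₂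
  have hFm : Measurable F := measurable_diagInt hD.meas hN.meas _ _
  have s1 : ∀ {j} u, j ≠ par w → withRoot (R u) j = withRoot u j := fun {j} u hj => withRoot_reflectSet_of_notMem h10 u (by simpa using hj)
  have s2 : ∀ {j} u, j ≠ v → withRoot (R' u) j = withRoot u j := fun {j} u hj => withRoot_reflectSet_of_notMem h20 u (by simpa using hj)
  have w1 : ∀ u, R u w = u w := fun u => by simpa using s1 u hw
  have w2 : ∀ u, R' u w = u w := fun u => by simpa using s2 u hwv
  have r3 : ∀ u, withRoot (R (R' u)) (par w) = withRoot (R u) (par w) := fun u => by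
    rw [hR, withRoot_reflectSet_of_mem h10 h1p _ (Finset.mem_insert_of_mem hv), withRoot_reflectSet_of_mem h10 h1p _ (Finset.mem_insert_of_mem hv),
      s2 u hp₁, s2 u hpv]
  have r4 : ∀ u, withRoot (R' (R u)) v = withRoot (R' u) v := fun u => by
    rw [hR', withRoot_reflectSet_of_mem h20 h2p _ (Finset.mem_insert_of_mem hv'), withRoot_reflectSet_of_mem h20 h2p _ (Finset.mem_insert_of_mem hv'),
      s1 u hp₂, s1 u hpv.symm]
  have d1 : ∀ u, halfDist p₁ (par w) (R u) = halfDist p₁ (par w) u := fun u => halfDist_reflectSet h10 h1p hv u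
  have d2 : ∀ u, halfDist p₂ v (R' u) = halfDist p₂ v u := fun u => halfDist_reflectSet h20 h2p hv' u
  have d3 : ∀ u, halfDist p₁ (par w) (R' u) = halfDist p₁ (par w) u := fun u => by rw [halfDist, halfDist, s2 u hpv, s2 u hp₁]
  have d4 : ∀ u, halfDist p₂ v (R u) = halfDist p₂ v u := fun u => by rw [halfDist, halfDist, s1 u hpv.symm, s1 u hp₂]
  set H : (Fin n → ℝ × ℝ) → ℝ≥0∞ := fun u => ‖F u‖ₑ * (ENNReal.ofReal c * halfDist p₁ (par w) u * nearKer C (withRoot u (par w) - u w)) with hH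
  set M : (Fin n → ℝ × ℝ) → ℝ≥0∞ := fun u => H u * (ENNReal.ofReal A * halfDist p₂ v u * pker ε (q + 1 / 2) (withRoot u v - withRoot u i)) with hM
  have hHm : Measurable H := by
    refine hFm.enorm.mul (((measurable_halfDist _ _).const_mul _).mul ((measurable_nearKer _).comp ?_))
    exact (measurable_withRoot _).sub (measurable_pi_apply w)
  have hMm : Measurable M := by
    refine hHm.mul (((measurable_halfDist _ _).const_mul _).mul ((measurable_pker _ _).comp ?_))
    exact (measurable_withRoot _).sub (measurable_withRoot _)
  have hHR' : ∀ u, H (R' u) = H u := fun u => by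
    simp only [hH, hFT', enorm_neg, d3, s2 u hpv, w2]
  have e1 : diag D N par ((i, v) :: G) = ∫ u, F u * (D (withRoot u (par w) - u w) * cov N (withRoot u v) (withRoot u i)) := by
    rw [diag]
    refine integral_congr_ae (Filter.Eventually.of_forall fun u => ?_)
    simp only [hF, diagInt, List.map_cons, List.prod_cons]
    rw [← Finset.prod_erase_mul _ _ (Finset.mem_univ w), cov_symm N (withRoot u i)]
    ring
  have hclose : ∀ u, H u ≠ 0 → TreeClose C par u := fun u h => by
    refine hD.treeClose_of_erase (N := N) (G := G) (w := w) (fun h0 => h ?_) (parNorm_le_of_nearKer_ne_zero fun h0 => h ?_)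
    · simp only [hH, hF, h0, enorm_zero, zero_mul]
    · simp only [hH, h0, mul_zero]
  have key : ∀ u, H u * ‖cov N (withRoot u v) (withRoot u i) - cov N (withRoot (R' u) v) (withRoot u i)‖ₑ ≤ M u + M (R' u) := by
    intro u
    rcases eq_or_ne (H u) 0 with hz | hz
    · rw [hz, zero_mul]; exact zero_le
    have hu := hclose u hz
    have hu' := hclose (R' u) (by rwa [hHR'])
    have ei := s2 u hiv
    have hd := hN.diff (withRoot u v) (withRoot (R' u) v) (withRoot u i) (fst_reflectSet h20 u v).symm
      (hu.abs_le hC hpar hn v i) (by rw [← ei]; exact hu'.abs_le hC hpar hn v i)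
    rw [hR', halfDist_eq h20 h2p hv', ← hR'] at hd
    refine (mul_le_mul_right hd _).trans_eq ?_
    simp only [hM, hHR', d2, ei]
    ring
  rw [e1]
  refine (enorm_integral_le_antisymm h10 h1p hFT).trans ((enorm_integral_le_antisymm h20 h2p hFT').trans
    ((enorm_integral_le_lintegral_enorm _).trans ?_))
  rw [← hR, ← hR']
  calc _ ≤ ∫⁻ u, ((M u + M (R' u)) + (M (R u) + M (R' (R u)))) := by
        refine lintegral_mono fun u => ?_
        have hkey := key (R u)
        rw [r4, s1 u hpv.symm, s1 u hi] at hkey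
        refine le_trans ?_ (add_le_add (key u) hkey)
        rw [enorm_mul, w1, w2, w1, w2, s1 u hpv.symm, s1 u hi, s2 u hpv, s2 u hiv, r3, s1 (R' u) hpv.symm, s1 (R' u) hi, s2 u hiv]
        -- The first reflection affects only the tree edge and the second only the covariance, so
        -- the double difference of the product factorises.
        have e : ∀ a b x y : ℝ, a * x - b * x - (a * y - b * y) = (a - b) * (x - y) := fun a b x y => by ring
        rw [e, enorm_mul]
        have hd := enorm_edge_diff_le hD h10 h1p hv (by simpa using hw) u
        rw [← hR, w1] at hd
        refine (mul_le_mul_right (mul_le_mul_left hd _) _).trans_eq ?_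
        simp only [hH, hFT, enorm_neg, d1, w1]
        ring
    _ = 2 * ∫⁻ u, (M u + M (R' u)) :=
        lintegral_reflectSet_add (M := fun u => M u + M (R' u))
          (hMm.add (hMm.comp (measurePreserving_reflectSet h20 h2p).measurable)) h10 h1p
    _ = 4 * ∫⁻ u, M u := by
        rw [lintegral_reflectSet_add hMm h20 h2p, ← mul_assoc]; norm_num
    _ ≤ 4 * ((ENNReal.ofReal c ^ (Finset.univ.erase w).card * ENNReal.ofReal A ^ G.length * (4 * ENNReal.ofReal c * ENNReal.ofReal A)) *
      ∫⁻ u in closeSet n, majorant ε q par (Function.update (fun _ => 4) w 5) [(p₁, par w), (p₂, v)] (((i, v), 1) :: G.map fun e => (e, 0)) u) := by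
        refine mul_le_mul_right (lintegral_le_of_treeClose hC hpar hn (by finiteness) (fun u hu => ?_) fun u hu => ?_) _
        · refine (mul_le_mul' (mul_le_mul' (enorm_diagInt_le hD hN hC hpar hn hu _ G)
            (mul_le_mul' (mul_le_mul_right (halfDist_le _ _ u) _) (nearKer_le _ _)))
            (mul_le_mul_left (mul_le_mul_right (halfDist_le _ _ u) _) _)).trans_eq ?_
          simp only [majorant, List.map_cons, List.map_nil, List.prod_nil, List.prod_cons, mul_one,
            List.map_map, Function.comp_def, ← prod_pker_update w fun k => withRoot u (par k) - u k]
          rw [pker_sub_comm ε _ (withRoot u v)]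
          norm_num
          ring
        · by_contra h
          refine hu (hclose u fun h0 => h ?_)
          simp only [hM, h0, zero_mul]
    _ = _ := by ring

end

end FracKPZ

/-! ### Classification of contractions and bounds on renormalization constants -/

namespace FracKPZ
open Set ENNReal

/-- The diagram is of order `ε ^ a`, uniformly in the noise kernel. -/
def Controlled {n : ℕ} (D : ℝ × ℝ → ℝ) (c T A γ a : ℝ) (par : Fin n → Fin (n + 1)) (G : List (Fin (n + 1) × Fin (n + 1))) : Prop :=
  ∃ B : ℝ, 0 < B ∧ ∀ (ε : ℝ) (N : ℝ × ℝ → ℝ), 0 < ε → IsNoiseKernel N c T (2 + γ) ε → IsCovariance N A (1 + 2 * γ) ε →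
    ‖diag D N par G‖ₑ ≤ ENNReal.ofReal (B * ε ^ a)

section
variable {n : ℕ} {D : ℝ × ℝ → ℝ} {c T A γ a C c₀ κ : ℝ} {par : Fin n → Fin (n + 1)} {G G' : List (Fin (n + 1) × Fin (n + 1))}

lemma Controlled.perm (h : G.Perm G') (hG : Controlled D c T A γ a par G') : Controlled D c T A γ a par G := by
  obtain ⟨B, hB, H⟩ := hG
  exact ⟨B, hB, fun ε N hε hN hN' => by rw [diag_perm h]; exact H ε N hε hN hN'⟩

lemma controlled_of_antisymmetric (hD : IsEdgeKernel D C c₀) {S : Finset (Fin (n + 1))} {p : Fin (n + 1)}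
    (h : Antisymmetric par Finset.univ G S p) : Controlled D c T A γ a par G :=
  ⟨1, one_pos, fun ε N _ hN _ => by rw [diag_eq_zero hD.odd hN S p h, enorm_zero]; exact zero_le⟩

lemma controlled_of_le {B : ℝ≥0∞} (hB : B ≠ ⊤) {I : ℝ → ℝ≥0∞} (h1 : ∀ (ε : ℝ) (N : ℝ × ℝ → ℝ), 0 < ε → IsNoiseKernel N c T (2 + γ) ε →
    IsCovariance N A (1 + 2 * γ) ε → ‖diag D N par G‖ₑ ≤ B * I ε) (h2 : ∃ b : ℝ, 0 < b ∧ ∀ ε : ℝ, 0 < ε → I ε ≤ ENNReal.ofReal (b * ε ^ a)) :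
    Controlled D c T A γ a par G := by
  obtain ⟨b, hb, H⟩ := h2
  refine ⟨(B.toReal + 1) * b, by positivity, fun ε N hε hN hN' => (h1 ε N hε hN hN').trans ((mul_le_mul_right (H ε hε) _).trans ?_)⟩
  rw [← ENNReal.ofReal_toReal hB, ← ENNReal.ofReal_mul ENNReal.toReal_nonneg, ENNReal.toReal_ofReal ENNReal.toReal_nonneg, ← mul_assoc]
  refine ENNReal.ofReal_le_ofReal ?_
  have : 0 ≤ b * ε ^ a := by positivity
  nlinarith

end

/-- The diagrams that are bounded by power counting after symmetrization. -/
inductive Symmetrizable (par : Fin 4 → Fin 5) : List (Fin 5 × Fin 5) → Prop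
  | plain {G} (h : Admissible (majorantEdges par (fun _ => 4) [] (G.map fun e => (e, 0)))) : Symmetrizable par G
  | leaf {G v i p} (h : Antisymmetric par Finset.univ G {v} p) (hi : i ≠ v)
      (ha : Admissible (majorantEdges par (fun _ => 4) [(p, v)] (((i, v), 1) :: G.map fun e => (e, 0)))) : Symmetrizable par ((i, v) :: G)
  | edge {G p} {w : Fin 4} (h : Antisymmetric par (Finset.univ.erase w) G {par w} p) (hw : w.succ ≠ par w)
      (ha : Admissible (majorantEdges par (Function.update (fun _ => 4) w 5) [(p, par w)] (G.map fun e => (e, 0)))) : Symmetrizable par G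
  | two_leaves {G v v' p₁ p₂} (h₁ : Antisymmetric par Finset.univ G {v} p₁) (h₂ : Antisymmetric par Finset.univ G {v'} p₂) (hvv : v ≠ v')
      (hp₁ : p₁ ≠ v') (hp₂ : p₂ ≠ v)
      (ha : Admissible (majorantEdges par (fun _ => 4) [(p₁, v), (p₂, v')] (((v, v'), 2) :: G.map fun e => (e, 0)))) :
      Symmetrizable par ((v, v') :: G)
  | edge_leaf {G v i p₁ p₂} {w : Fin 4} (h₁ : Antisymmetric par (Finset.univ.erase w) G {par w} p₁)
      (h₂ : Antisymmetric par (Finset.univ.erase w) G {v} p₂)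
      (hne : w.succ ≠ par w ∧ par w ≠ v ∧ w.succ ≠ v ∧ i ≠ v ∧ i ≠ par w ∧ p₁ ≠ v ∧ p₂ ≠ par w)
      (ha : Admissible (majorantEdges par (Function.update (fun _ => 4) w 5) [(p₁, par w), (p₂, v)] (((i, v), 1) :: G.map fun e => (e, 0)))) :
      Symmetrizable par ((i, v) :: G)

section
variable {D : ℝ × ℝ → ℝ} {c T A γ C c₀ κ : ℝ} {par : Fin 4 → Fin 5} {G : List (Fin 5 × Fin 5)}

theorem Symmetrizable.controlled (h : Symmetrizable par G) (hG : G.length = 3) (hD : IsEdgeKernel D C c₀) (hC : 0 ≤ C) (hC' : C ≤ 1 / 16)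
    (hpar : ∀ k, par k ≤ k.castSucc) (hγ : 1 / 6 ≤ γ) (hκ : 0 < κ) (hκ' : κ ≤ 1 / 48) :
    Controlled D c T A γ (1 - 6 * γ - 3 * κ) par G := by
  have hn : ((4 : ℕ) : ℝ) * C ≤ 1 / 4 := by push_cast; linarith
  cases h with
  | plain h =>
    exact controlled_of_le (by finiteness) (fun ε N hε hN hN' => enorm_diag_le hD hN' hC hpar hn G)
      (exists_majorant_bound hγ hκ hκ' (by simpa using hG) h)
  | leaf h hi ha =>
    exact controlled_of_le (by finiteness) (fun ε N hε hN hN' => enorm_diag_le_of_leaf hD hN' hN hC hpar hn h hi)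
      (exists_majorant_bound hγ hκ hκ' (by simpa using hG) ha)
  | edge h hw ha =>
    exact controlled_of_le (by finiteness) (fun ε N hε hN hN' => enorm_diag_le_of_edge hD hN' hN hC hpar hn h hw)
      (exists_majorant_bound hγ hκ hκ' (by simpa using hG) ha)
  | two_leaves h₁ h₂ hvv hp₁ hp₂ ha =>
    exact controlled_of_le (by finiteness) (fun ε N hε hN hN' => enorm_diag_le_of_two_leaves hD hN' hN hC hpar hn h₁ h₂ hvv hp₁ hp₂)
      (exists_majorant_bound hγ hκ hκ' (by simpa using hG) ha)
  | edge_leaf h₁ h₂ hne ha =>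
    obtain ⟨a1, a2, a3, a4, a5, a6, a7⟩ := hne
    exact controlled_of_le (by finiteness) (fun ε N hε hN hN' => enorm_diag_le_of_edge_of_leaf hD hN' hN hC hpar hn h₁ h₂ a1 a2 a3 a4 a5 a6 a7)
      (exists_majorant_bound hγ hκ hκ' (by simpa using hG) ha)

/-- Every contraction of the tree vanishes by symmetry, or is bounded by power counting, possibly after symmetrization. -/
abbrev Classified (par : Fin 4 → Fin 5) (att : Fin 6 → Fin 5) (moves : List (List (Fin 5 × Fin 5))) : Prop :=
  ∀ L ∈ sixPairs, (∃ S p, Antisymmetric par Finset.univ (L.map (Prod.map att att)) S p) ∨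
    Admissible (majorantEdges par (fun _ => 4) [] ((L.map (Prod.map att att)).map fun e => (e, 0))) ∨
    ∃ G ∈ moves, (L.map (Prod.map att att)).Perm G

theorem Classified.controlled {att : Fin 6 → Fin 5} {moves : List (List (Fin 5 × Fin 5))} (h : Classified par att moves)
    (hm : ∀ G ∈ moves, Symmetrizable par G) (hD : IsEdgeKernel D C c₀) (hC : 0 ≤ C) (hC' : C ≤ 1 / 16)
    (hpar : ∀ k, par k ≤ k.castSucc) (hγ : 1 / 6 ≤ γ) (hκ : 0 < κ) (hκ' : κ ≤ 1 / 48) {L : List (Fin 6 × Fin 6)} (hL : L ∈ sixPairs) :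
    Controlled D c T A γ (1 - 6 * γ - 3 * κ) par (L.map (Prod.map att att)) := by
  have hlen : (L.map (Prod.map att att)).length = 3 := by
    rw [List.length_map]
    have : ∀ L ∈ sixPairs, L.length = 3 := by decide
    exact this L hL
  rcases h L hL with ⟨S, p, h⟩ | h | ⟨G, hG, h⟩
  · exact controlled_of_antisymmetric hD h
  · exact (Symmetrizable.plain h).controlled hlen hD hC hC' hpar hγ hκ hκ'
  · exact Controlled.perm h ((hm G hG).controlled (by rw [← h.length_eq, hlen]) hD hC hC' hpar hγ hκ hκ')

end

section
variable {K ρ : ℝ × ℝ → ℝ} {γ c T A a : ℝ}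

/-- It is enough to control the diagrams of finitely many pair lists; the constants are merged by
induction over the list, because they must not depend on `ε` or on the kernel. -/
theorem exists_renormConst_le (hD : Measurable (spaceDeriv K)) (hD' : Integrable (spaceDeriv K)) (hc : 0 ≤ c) (hγ : 0 ≤ γ) {l r : Symbol} {n : ℕ}
    (pairs : List (List (Fin (l.noises + r.noises) × Fin (l.noises + r.noises))))
    (hpairs : ∀ σ ∈ pairings (l.noises + r.noises), ∃ L ∈ pairs, IsPairList σ L)
    (f : Fin n → l.Inner ⊕ r.Inner) (hf : Function.Bijective f) (par : Fin n → Fin (n + 1))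
    (att : Fin (l.noises + r.noises) → Fin (n + 1))
    (hker : ∀ D w, pairKer D l r w = ∏ k, D (withRoot (fun k => w (f k)) (par k) - w (f k)))
    (hatt : ∀ w i, pairAttach l r w i = withRoot (fun k => w (f k)) (att i))
    (hL : ∀ L ∈ pairs, Controlled (spaceDeriv K) c T A γ a par (L.map (Prod.map att att))) :
    ∃ B : ℝ, 0 < B ∧ ∀ ε, 0 < ε → IsNoiseKernel (noiseKernel K ρ γ ε) c T (2 + γ) ε →
      IsCovariance (noiseKernel K ρ γ ε) A (1 + 2 * γ) ε → |renormConst K ρ γ ε (.node l r)| ≤ B * ε ^ a := by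
  have huni : ∀ P : List (List (Fin (l.noises + r.noises) × Fin (l.noises + r.noises))), (∀ L ∈ P, L ∈ pairs) →
      ∃ B : ℝ, 0 < B ∧ ∀ L ∈ P, ∀ (ε : ℝ) (N : ℝ × ℝ → ℝ), 0 < ε → IsNoiseKernel N c T (2 + γ) ε → IsCovariance N A (1 + 2 * γ) ε →
        ‖diag (spaceDeriv K) N par (L.map (Prod.map att att))‖ₑ ≤ ENNReal.ofReal (B * ε ^ a) := by
    intro P hP
    induction P with
    | nil => exact ⟨1, one_pos, by simp⟩
    | cons L P ih =>
      obtain ⟨B, hB, H⟩ := ih fun L' h' => hP L' (List.mem_cons_of_mem _ h')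
      obtain ⟨B', hB', H'⟩ := hL L (hP L List.mem_cons_self)
      refine ⟨B + B', by positivity, fun L' h' ε N hε h1 h2 => ?_⟩
      have hpos : 0 < ε ^ a := Real.rpow_pos_of_pos hε a
      rcases List.mem_cons.1 h' with rfl | h'
      · exact (H' ε N hε h1 h2).trans (ENNReal.ofReal_le_ofReal (by nlinarith))
      · exact (H L' h' ε N hε h1 h2).trans (ENNReal.ofReal_le_ofReal (by nlinarith))
  obtain ⟨B, hB, H⟩ := huni pairs fun _ h => h
  refine ⟨((pairings (l.noises + r.noises)).card + 1) * B, by positivity, fun ε hε hN hN' => ?_⟩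
  have hpos : 0 < B * ε ^ a := by positivity
  calc |renormConst K ρ γ ε (.node l r)| ≤ ∑ σ ∈ pairings (l.noises + r.noises), |contraction σ (symbolKernel K ρ γ ε (.node l r) 0)| :=
        Finset.abs_sum_le_sum_abs _ _
    _ ≤ ∑ σ ∈ pairings (l.noises + r.noises), B * ε ^ a := by
        refine Finset.sum_le_sum fun σ hσ => ?_
        obtain ⟨L, hLP, hσL⟩ := hpairs σ hσ
        rw [contraction_eq_diag hD hD' hN hc (by linarith) hε f hf par att (hker _) hatt hσ hσL]
        have := H L hLP ε _ hε hN hN'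
        rw [← ofReal_norm, Real.norm_eq_abs] at this
        exact (ENNReal.ofReal_le_ofReal_iff hpos.le).1 this
    _ ≤ _ := by
        rw [Finset.sum_const, nsmul_eq_mul]
        nlinarith

end

end FracKPZ

/-! ### The six symbols with six noises -/

namespace FracKPZ
open Set ENNReal FracKPZ.Symbol

/-- The standing assumptions for the bounds on the symbols with six noises. -/
structure Setting (K : ℝ × ℝ → ℝ) (C c c₀ γ κ : ℝ) : Prop where
  edge : IsEdgeKernel (spaceDeriv K) C c₀
  integrable : Integrable (spaceDeriv K)
  C_nonneg : 0 ≤ C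
  C_le : C ≤ 1 / 16
  c_nonneg : 0 ≤ c
  le_γ : 1 / 6 ≤ γ
  κ_pos : 0 < κ
  κ_le : κ ≤ 1 / 48

/-- The bound on the renormalization constant of a symbol with six noises. -/
def Bound (K ρ : ℝ × ℝ → ℝ) (c T A γ κ : ℝ) (τ : Symbol) : Prop :=
  ∃ b : ℝ, 0 < b ∧ ∀ ε, 0 < ε → IsNoiseKernel (noiseKernel K ρ γ ε) c T (2 + γ) ε →
      IsCovariance (noiseKernel K ρ γ ε) A (1 + 2 * γ) ε → |renormConst K ρ γ ε τ| ≤ b * ε ^ (1 - 6 * γ - 3 * κ)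

section
variable {K ρ : ℝ × ℝ → ℝ} {γ C c c₀ T A κ : ℝ}

/-- The number of noises of a symbol is a sum that equals 6; the list of matchings is transported
along this equality. -/
lemma exists_sixPairs_cast {m : ℕ} (h : m = 6) {σ : Equiv.Perm (Fin m)} (hσ : σ ∈ pairings m) :
    ∃ L ∈ sixPairs.map fun L => L.map (Prod.map (Fin.cast h.symm) (Fin.cast h.symm)), IsPairList σ L := by
  subst h
  obtain ⟨L, hL, H⟩ := exists_sixPairs hσ
  exact ⟨L, List.mem_map.2 ⟨L, hL, by simp [Prod.map_def]⟩, H⟩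

lemma bound_of_classified (h : Setting K C c c₀ γ κ) {l r : Symbol} {f : Fin 4 → l.Inner ⊕ r.Inner} (hf : Function.Bijective f)
    {par : Fin 4 → Fin 5} {att : Fin 6 → Fin 5} {moves : List (List (Fin 5 × Fin 5))} (hcl : Classified par att moves)
    (hm : ∀ G ∈ moves, Symmetrizable par G) (hpar : ∀ k, par k ≤ k.castSucc)
    (hker : ∀ D w, pairKer D l r w = ∏ k, D (withRoot (fun k => w (f k)) (par k) - w (f k)))
    (h6 : l.noises + r.noises = 6)
    (hatt : ∀ w i, pairAttach l r w i = withRoot (fun k => w (f k)) (att (Fin.cast h6 i))) : Bound K ρ c T A γ κ (.node l r) := by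
  refine exists_renormConst_le h.edge.meas h.integrable h.c_nonneg (by linarith [h.le_γ])
    (sixPairs.map fun L => L.map (Prod.map (Fin.cast h6.symm) (Fin.cast h6.symm))) ?_ f hf par (fun i => att (Fin.cast h6 i)) hker hatt ?_
  · exact fun σ hσ => exists_sixPairs_cast h6 hσ
  · intro L hL
    obtain ⟨L', hL', rfl⟩ := List.mem_map.1 hL
    have := hcl.controlled (c := c) (T := T) (A := A) hm h.edge h.C_nonneg h.C_le hpar h.le_γ h.κ_pos h.κ_le hL'
    rw [List.map_map]
    exact this

-- Vertices 1 and 3 carry the two factors `W`, and 2 and 4 the factors `V` above them. In the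
-- exceptional contraction the tree edges `1—2` and `3—4` both have a parallel covariance, of total
-- exponent `2 + 4/3 > 3`. Reflecting 2 about 1 and 4 about 3 gains 1/2 at each, and the covariance
-- `2—4` pays for both.
set_option synthInstance.maxHeartbeats 200000 in
set_option synthInstance.maxSize 1000 in
lemma classified_F : Classified ![0, 1, 0, 3] ![1, 2, 2, 3, 4, 4] [[(2, 4), (1, 2), (3, 4)]] := by decide +kernel

lemma exists_renormConst_F_le (h : Setting K C c c₀ γ κ) : Bound K ρ c T A γ κ Symbol.F :=
  bound_of_classified (l := W) (r := W) h (f := ![.inl (.inl ()), .inl (.inr (.inr (.inl ()))), .inr (.inl ()), .inr (.inr (.inr (.inl ())))])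
    (by decide) classified_F (by
    simp only [List.forall_mem_cons, List.not_mem_nil, false_imp_iff, implies_true, and_true]
    exact .two_leaves (p₁ := 1) (p₂ := 3) (by decide) (by decide) (by decide) (by decide) (by decide) (by decide +kernel)) (by decide)
    (fun D w => by simp only [pairKer, treeKer, W, V, Fin.prod_univ_four, mul_one, mul_assoc, one_mul]; rfl) rfl
    (fun w => by change ∀ i : Fin 6, _; intro i; fin_cases i <;> rfl)

-- No exceptional contraction: the noises sit on the vertices 1, 3, 4, no two of which are joined by
-- a tree edge. The divergent triangle `2, 3, 4` occurs only together with a self-contraction at 1,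
-- which makes the diagram vanish.
set_option synthInstance.maxHeartbeats 200000 in
set_option synthInstance.maxSize 1000 in
lemma classified_BW : Classified ![0, 0, 2, 2] ![1, 1, 3, 3, 4, 4] [] := by decide +kernel

lemma exists_renormConst_BW_le (h : Setting K C c c₀ γ κ) : Bound K ρ c T A γ κ Symbol.BW :=
  bound_of_classified (l := V) (r := B) h (f := ![.inl (.inl ()), .inr (.inl ()), .inr (.inr (.inl (.inl ()))), .inr (.inr (.inr (.inl ())))])
    (by decide) classified_BW (by simp) (by decide)
    (fun D w => by simp only [pairKer, treeKer, V, B, Fin.prod_univ_four, mul_one, mul_assoc]; rfl) rfl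
    (fun w => by change ∀ i : Fin 6, _; intro i; fin_cases i <;> rfl)

-- In the first exception the covariance `3—4` is parallel to a tree edge, and the leaf 4 is
-- reflected about 3 at the cost of the covariance `1—4`. In the second the doubled edge is `2—3`;
-- vertex 3 is reflected about 2, and the asymmetric edge is the tree edge `3—4`.
set_option synthInstance.maxHeartbeats 200000 in
set_option synthInstance.maxSize 1000 in
lemma classified_WB : Classified ![0, 0, 2, 3] ![1, 1, 2, 3, 4, 4] [[(1, 4), (1, 2), (3, 4)], [(1, 4), (1, 4), (2, 3)]] := by decide +kernel

lemma exists_renormConst_WB_le (h : Setting K C c c₀ γ κ) : Bound K ρ c T A γ κ Symbol.WB :=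
  bound_of_classified (l := V) (r := WV) h (f := ![.inl (.inl ()), .inr (.inl ()), .inr (.inr (.inr (.inl ()))), .inr (.inr (.inr (.inr (.inr (.inl ())))))])
    (by decide) classified_WB (by
    simp only [List.forall_mem_cons, List.not_mem_nil, false_imp_iff, implies_true, and_true]
    exact ⟨.leaf (p := 3) (by decide) (by decide) (by decide +kernel), .edge (p := 2) (w := 3) (by decide) (by decide) (by decide +kernel)⟩) (by decide)
    (fun D w => by simp only [pairKer, treeKer, W, V, WV, Fin.prod_univ_four, mul_one, mul_assoc, one_mul]; rfl) rfl
    (fun w => by change ∀ i : Fin 6, _; intro i; fin_cases i <;> rfl)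

-- The exception has the doubled edge `3—4`; the leaf 4 is reflected about 3 and the covariance
-- `2—4` pays.
set_option synthInstance.maxHeartbeats 200000 in
set_option synthInstance.maxSize 1000 in
lemma classified_VBV : Classified ![0, 1, 1, 3] ![0, 2, 2, 3, 4, 4] [[(2, 4), (0, 2), (3, 4)]] := by decide +kernel

lemma exists_renormConst_VBV_le (h : Setting K C c c₀ γ κ) : Bound K ρ c T A γ κ Symbol.VBV :=
  bound_of_classified (l := Xi) (r := (node V W)) h (f := ![.inr (.inl ()), .inr (.inr (.inl (.inl ()))), .inr (.inr (.inr (.inl ()))), .inr (.inr (.inr (.inr (.inr (.inl ())))))])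
    (by decide) classified_VBV (by
    simp only [List.forall_mem_cons, List.not_mem_nil, false_imp_iff, implies_true, and_true]
    exact .leaf (p := 3) (by decide) (by decide) (by decide +kernel)) (by decide)
    (fun D w => by simp only [pairKer, treeKer, W, V, Fin.prod_univ_four, mul_one, mul_assoc, one_mul]; rfl) rfl
    (fun w => by change ∀ i : Fin 6, _; intro i; fin_cases i <;> rfl)

-- The only covariance parallel to a tree edge is `0—1`, and then everything above vertex 1 hangs on
-- it alone; reflecting the vertices 2, 3, 4 about it flips three tree edges, so the diagram
-- vanishes.
set_option synthInstance.maxHeartbeats 200000 in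
set_option synthInstance.maxSize 1000 in
lemma classified_BVV : Classified ![0, 1, 2, 2] ![0, 1, 3, 3, 4, 4] [] := by decide +kernel

lemma exists_renormConst_BVV_le (h : Setting K C c c₀ γ κ) : Bound K ρ c T A γ κ Symbol.BVV :=
  bound_of_classified (l := Xi) (r := (node Xi B)) h (f := ![.inr (.inl ()), .inr (.inr (.inr (.inl ()))), .inr (.inr (.inr (.inr (.inl (.inl ()))))), .inr (.inr (.inr (.inr (.inr (.inl ())))))])
    (by decide) classified_BVV (by simp) (by decide)
    (fun D w => by simp only [pairKer, treeKer, V, B, Fin.prod_univ_four, mul_one, mul_assoc, one_mul]; rfl) rfl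
    (fun w => by change ∀ i : Fin 6, _; intro i; fin_cases i <;> rfl)

-- The vertices form a chain. The exceptions have the doubled edges `3—4`; both `1—2` and `3—4`; and
-- `2—3`. The middle one needs two reflections: 2 about 1, paid by the tree edge `2—3`, and 4 about
-- 3, paid by the covariance `0—4`.
set_option synthInstance.maxHeartbeats 200000 in
set_option synthInstance.maxSize 1000 in
lemma classified_WWV : Classified ![0, 1, 2, 3] ![0, 1, 2, 3, 4, 4] [[(1, 4), (0, 2), (3, 4)], [(0, 4), (1, 2), (3, 4)], [(0, 4), (1, 4), (2, 3)]] := by decide +kernel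

lemma exists_renormConst_WWV_le (h : Setting K C c c₀ γ κ) : Bound K ρ c T A γ κ Symbol.WWV :=
  bound_of_classified (l := Xi) (r := (node Xi WV)) h (f := ![.inr (.inl ()), .inr (.inr (.inr (.inl ()))), .inr (.inr (.inr (.inr (.inr (.inl ()))))), .inr (.inr (.inr (.inr (.inr (.inr (.inr (.inl ())))))))])
    (by decide) classified_WWV (by
    simp only [List.forall_mem_cons, List.not_mem_nil, false_imp_iff, implies_true, and_true]
    exact ⟨.leaf (p := 3) (by decide) (by decide) (by decide +kernel), .edge_leaf (p₁ := 1) (p₂ := 3) (w := 2) (by decide) (by decide) (by decide) (by decide +kernel), .edge (p := 2) (w := 3) (by decide) (by decide) (by decide +kernel)⟩) (by decide)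
    (fun D w => by simp only [pairKer, treeKer, W, V, WV, Fin.prod_univ_four, mul_one, mul_assoc, one_mul]; rfl) rfl
    (fun w => by change ∀ i : Fin 6, _; intro i; fin_cases i <;> rfl)

theorem bound_of_mem_sixNoise (h : Setting K C c c₀ γ κ) {τ : Symbol} (hτ : τ ∈ sixNoise) : Bound K ρ c T A γ κ τ := by
  rcases hτ with rfl | rfl | rfl | rfl | rfl | rfl
  · exact exists_renormConst_F_le h
  · exact exists_renormConst_BW_le h
  · exact exists_renormConst_WB_le h
  · exact exists_renormConst_VBV_le h
  · exact exists_renormConst_BVV_le h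
  · exact exists_renormConst_WWV_le h

end

end FracKPZ

/-! ### The symbols with four noises -/

namespace FracKPZ
open Set ENNReal FracKPZ.Symbol

lemma lintegral_fin_two (f : ℝ × ℝ → ℝ × ℝ → ℝ≥0∞) (hf : Measurable (Function.uncurry f)) :
    ∫⁻ u : Fin 2 → ℝ × ℝ, f (u 0) (u 1) = ∫⁻ x, ∫⁻ y, f x y := by
  have h := (volume_preserving_finTwoArrow (ℝ × ℝ)).lintegral_comp hf
  rw [Measure.volume_eq_prod (ℝ × ℝ), lintegral_prod _ hf.aemeasurable] at h
  exact h

/-- Integrating `y` first gives a kernel of order `α + β - 3 < 3` in `x`; all the dependence on `ε`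
comes from the last factor. -/
lemma exists_lintegral_triangle_le {α β δ : ℝ} (hα : 0 ≤ α) (hα' : α < 3) (hβ : 0 ≤ β) (hβ' : β < 3) (hδ : 0 ≤ δ) (h : 3 < α + β)
    (h2 : 6 < α + β + δ) (h3 : α + β - 3 < 3) :
    ∃ c : ℝ, 0 < c ∧ (∀ ε : ℝ, 0 < ε → ∫⁻ x, ∫⁻ y, pker 0 α y * (pker 0 β (x - y) * pker ε δ x) ≤ ENNReal.ofReal (c * ε ^ (6 - α - β - δ))) := by
  obtain ⟨c₁, h₁, H₁⟩ := lintegral_pker_conv_le hα hα' hβ hβ' h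
  obtain ⟨c₂, h₂, H₂⟩ := lintegral_pker_mul_pker_le (α := α + β - 3) (β := δ) (by linarith) h3 hδ (by linarith)
  refine ⟨c₁ * c₂, by positivity, fun ε hε => ?_⟩
  calc ∫⁻ x, ∫⁻ y, pker 0 α y * (pker 0 β (x - y) * pker ε δ x)
      = ∫⁻ x, (∫⁻ y, pker 0 α y * pker 0 β (x - y)) * pker ε δ x := by
        refine lintegral_congr fun x => ?_
        have m1 := measurable_pker 0 α
        have m2 := measurable_pker 0 β
        rw [← lintegral_mul_const _ (by fun_prop)]
        simp only [mul_assoc]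
    _ ≤ ∫⁻ x, ENNReal.ofReal c₁ * (pker 0 (α + β - 3) x * pker ε δ x) := by
        refine lintegral_mono fun x => ?_
        rw [← mul_assoc]
        exact mul_le_mul_left (H₁ 0 le_rfl x) _
    _ ≤ ENNReal.ofReal c₁ * ENNReal.ofReal (c₂ * ε ^ (3 - (α + β - 3) - δ)) := by
        rw [lintegral_const_mul' _ _ ofReal_ne_top]
        exact mul_le_mul_right (H₂ ε hε) _
    _ = _ := by
        rw [← ENNReal.ofReal_mul h₁.le, mul_assoc]
        congr 4; ring

lemma forall_mem_fourPairs {P : List (Fin 4 × Fin 4) → Prop} (h1 : P [(0, 1), (2, 3)]) (h2 : P [(0, 2), (1, 3)]) (h3 : P [(0, 3), (1, 2)]) :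
    ∀ L ∈ fourPairs, P L := by
  simp only [fourPairs, List.forall_mem_cons, List.not_mem_nil, false_imp_iff, implies_true, and_true]
  exact ⟨h1, h2, h3⟩

section
variable {K ρ : ℝ × ℝ → ℝ} {γ C c c₀ T A : ℝ}

/-- The squared covariance has order `2 + 4γ`, below 3 exactly because `γ < 1/4`. Convolving with
one tree edge leaves `1 + 4γ`, and integrating against the other gives `ε^{-4γ}`; for `γ = 0` this
would be a logarithm. -/
lemma exists_majorant_B_le (hγ : 0 < γ) (hγ' : γ < 1 / 4) : ∃ b : ℝ, 0 < b ∧ ∀ ε : ℝ, 0 < ε →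
    ∫⁻ u in closeSet 2, majorant ε (1 + 2 * γ) ![0, 0] (fun _ => 4) [] [((1, 2), 0), ((1, 2), 0)] u ≤ ENNReal.ofReal (b * ε ^ (-4 * γ)) := by
  obtain ⟨c₁, h₁, H₁⟩ := lintegral_pker_conv_le (α := 2) (β := 2 + 4 * γ) (by norm_num) (by norm_num) (by linarith) (by linarith) (by linarith)
  obtain ⟨c₂, h₂, H₂⟩ := lintegral_pker_mul_pker_le (α := 2) (β := 1 + 4 * γ) (by norm_num) (by norm_num) (by linarith) (by linarith)
  have m1 := measurable_pker 0 2
  refine ⟨c₁ * c₂, by positivity, fun ε hε => (setLIntegral_le_lintegral _ _).trans ?_⟩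
  have m2 := measurable_pker ε (2 + 4 * γ)
  calc ∫⁻ u, majorant ε (1 + 2 * γ) ![0, 0] (fun _ => 4) [] [((1, 2), 0), ((1, 2), 0)] u
      = ∫⁻ u : Fin 2 → ℝ × ℝ, pker 0 2 (u 0) * (pker 0 2 (u 1) * pker ε (2 + 4 * γ) (u 0 - u 1)) := by
        refine lintegral_congr fun u => ?_
        have e : pker ε (2 + 4 * γ) (u 0 - u 1) = pker ε (1 + 2 * γ) (u 0 - u 1) * pker ε (1 + 2 * γ) (u 0 - u 1) := by
          have h0 : 0 < parNorm (u 0 - u 1) + ε := by have := parNorm_nonneg (u 0 - u 1); linarith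
          rw [pker, pker, ENNReal.ofReal_rpow_of_pos h0, ENNReal.ofReal_rpow_of_pos h0, ← ENNReal.ofReal_mul (by positivity),
            ← Real.rpow_add h0]
          congr 2; ring
        rw [e, majorant, Fin.prod_univ_two]
        have e0 : ∀ z : ℝ × ℝ, pker 0 ((4 : ℕ) / 2) (0 - z) = pker 0 2 z := fun z => by rw [zero_sub, pker_neg]; norm_num
        simp only [List.map_nil, List.prod_nil, mul_one, List.map_cons, List.prod_cons, Matrix.cons_val_zero, Matrix.cons_val_one, withRoot_zero,
          e0, Nat.cast_zero, zero_div, add_zero]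
        rw [show (1 : Fin 3) = Fin.succ 0 from rfl, show (2 : Fin 3) = Fin.succ 1 from rfl, withRoot_succ, withRoot_succ]
        ring
    _ = ∫⁻ x, pker 0 2 x * ∫⁻ y, pker 0 2 y * pker ε (2 + 4 * γ) (x - y) := by
        rw [lintegral_fin_two (fun x y => pker 0 2 x * (pker 0 2 y * pker ε (2 + 4 * γ) (x - y))) (by unfold Function.uncurry; fun_prop)]
        refine lintegral_congr fun x => ?_
        rw [lintegral_const_mul _ (by fun_prop)]
    _ ≤ ∫⁻ x, ENNReal.ofReal c₁ * (pker 0 2 x * pker ε (1 + 4 * γ) x) := by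
        refine lintegral_mono fun x => ?_
        have := H₁ ε hε.le x
        rw [show 2 + (2 + 4 * γ) - 3 = 1 + 4 * γ by ring] at this
        exact (mul_le_mul_right this _).trans_eq (by ring)
    _ ≤ ENNReal.ofReal c₁ * ENNReal.ofReal (c₂ * ε ^ (3 - 2 - (1 + 4 * γ))) := by
        rw [lintegral_const_mul' _ _ ofReal_ne_top]
        exact mul_le_mul_right (H₂ ε hε) _
    _ = _ := by
        rw [← ENNReal.ofReal_mul h₁.le, mul_assoc]
        congr 4; ring

/-- Between the vertices 1 and 2 the tree edge, the covariance and the gain of the symmetrization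
combine to `2 + (1 + 2γ) - 1/2 = 5/2 + 2γ < 3`, so there the regularisation can be dropped. The
covariance with the root, now of order `3/2 + 2γ`, carries the divergence. -/
lemma exists_majorant_WV_le (hγ : 0 < γ) (hγ' : γ < 1 / 4) : ∃ b : ℝ, 0 < b ∧ ∀ ε : ℝ, 0 < ε →
    ∫⁻ u in closeSet 2, majorant ε (1 + 2 * γ) ![0, 1] (fun _ => 4) [(1, 2)] [((0, 2), 1), ((1, 2), 0)] u ≤ ENNReal.ofReal (b * ε ^ (-4 * γ)) := by
  obtain ⟨b, hb, H⟩ := exists_lintegral_triangle_le (α := 2) (β := 5 / 2 + 2 * γ) (δ := 3 / 2 + 2 * γ) (by linarith) (by linarith) (by linarith)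
    (by linarith) (by linarith) (by linarith) (by linarith) (by linarith)
  refine ⟨b, hb, fun ε hε => (setLIntegral_le_lintegral _ _).trans ?_⟩
  have m1 := measurable_pker 0 2
  have m2 := measurable_pker 0 (5 / 2 + 2 * γ)
  have m3 := measurable_pker ε (3 / 2 + 2 * γ)
  calc ∫⁻ u, majorant ε (1 + 2 * γ) ![0, 1] (fun _ => 4) [(1, 2)] [((0, 2), 1), ((1, 2), 0)] u
      ≤ ∫⁻ u : Fin 2 → ℝ × ℝ, pker 0 2 (u 0) * (pker 0 (5 / 2 + 2 * γ) (u 1 - u 0) * pker ε (3 / 2 + 2 * γ) (u 1)) := by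
        refine lintegral_mono_ae ?_
        filter_upwards [ae_withRoot_ne (n := 2) (i := 1) (j := 2) (by decide)] with u hu
        have w1 : withRoot u 1 = u 0 := rfl
        have w2 : withRoot u 2 = u 1 := rfl
        have w0 : withRoot u 0 = 0 := rfl
        rw [w1, w2] at hu
        have hd : 0 < parNorm (u 0 - u 1) := parNorm_pos_iff.2 (sub_ne_zero.2 hu)
        have e : pker 0 (5 / 2 + 2 * γ) (u 1 - u 0) = pker 0 2 (u 0 - u 1) * pker 0 (-1 / 2) (u 0 - u 1) * pker 0 (1 + 2 * γ) (u 0 - u 1) := by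
          rw [pker_sub_comm, ← pker_zero_add hd, ← pker_zero_add hd]
          congr 1; ring
        have h1 : pker ε (1 + 2 * γ) (u 0 - u 1) ≤ pker 0 (1 + 2 * γ) (u 0 - u 1) := pker_anti (by linarith) (by linarith)
        have e0 : ∀ z : ℝ × ℝ, pker 0 ((4 : ℕ) / 2) z = pker 0 2 z := fun z => by norm_num
        rw [e, majorant, Fin.prod_univ_two]
        simp only [List.map_nil, List.prod_nil, mul_one, List.map_cons, List.prod_cons, Matrix.cons_val_zero, Matrix.cons_val_one,
          w0, w1, w2, e0, Nat.cast_zero, Nat.cast_one, zero_div, add_zero, zero_sub, pker_neg]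
        rw [show 1 + 2 * γ + 1 / 2 = 3 / 2 + 2 * γ by ring]
        calc _ ≤ pker 0 2 (u 0) * pker 0 2 (u 0 - u 1) * pker 0 (-1 / 2) (u 0 - u 1) * (pker ε (3 / 2 + 2 * γ) (u 1) * pker 0 (1 + 2 * γ) (u 0 - u 1)) :=
              mul_le_mul_right (mul_le_mul_right h1 _) _
          _ = _ := by ring
    _ = ∫⁻ x, ∫⁻ y, pker 0 2 x * (pker 0 (5 / 2 + 2 * γ) (y - x) * pker ε (3 / 2 + 2 * γ) y) :=
        lintegral_fin_two (fun x y => pker 0 2 x * (pker 0 (5 / 2 + 2 * γ) (y - x) * pker ε (3 / 2 + 2 * γ) y)) (by unfold Function.uncurry; fun_prop)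
    _ = ∫⁻ y, ∫⁻ x, pker 0 2 x * (pker 0 (5 / 2 + 2 * γ) (y - x) * pker ε (3 / 2 + 2 * γ) y) :=
        lintegral_lintegral_swap (by unfold Function.uncurry; fun_prop)
    _ ≤ _ := by
        refine (H ε hε).trans_eq ?_
        congr 3; ring

theorem exists_renormConst_B_le (hD : IsEdgeKernel (spaceDeriv K) C c₀) (hD' : Integrable (spaceDeriv K)) (hC : 0 ≤ C) (hC' : C ≤ 1 / 16)
    (hc : 0 ≤ c) (hγ : 0 < γ) (hγ' : γ < 1 / 4) : ∃ b : ℝ, 0 < b ∧ ∀ ε, 0 < ε → IsNoiseKernel (noiseKernel K ρ γ ε) c T (2 + γ) ε →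
      IsCovariance (noiseKernel K ρ γ ε) A (1 + 2 * γ) ε → |renormConst K ρ γ ε Symbol.B| ≤ b * ε ^ (-4 * γ) := by
  have hn : ((2 : ℕ) : ℝ) * C ≤ 1 / 4 := by push_cast; linarith
  have key : Controlled (spaceDeriv K) c T A γ (-4 * γ) ![0, 0] [((1 : Fin 3), (2 : Fin 3)), (1, 2)] :=
    controlled_of_le (by finiteness) (fun ε N hε hN hN' => enorm_diag_le hD hN' hC (by decide) hn [(1, 2), (1, 2)]) (exists_majorant_B_le hγ hγ')
  refine exists_renormConst_le (l := V) (r := V) hD.meas hD' hc hγ.le fourPairs (fun σ hσ => exists_fourPairs hσ)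
    ![.inl (.inl ()), .inr (.inl ())] (by decide) ![0, 0] (![1, 1, 2, 2] : Fin 4 → Fin 3)
    (fun D w => by simp only [pairKer, treeKer, V, Fin.prod_univ_two, mul_one]; rfl)
    (fun w => by change ∀ i : Fin 4, _; intro i; fin_cases i <;> rfl) ?_
  -- The first matching contracts each `V` with itself and vanishes by reflecting a leaf about the
  -- root; the other two give the same diagram.
  exact forall_mem_fourPairs (controlled_of_antisymmetric hD (S := {1}) (p := 0) (by decide)) key key

theorem exists_renormConst_WV_le (hD : IsEdgeKernel (spaceDeriv K) C c₀) (hD' : Integrable (spaceDeriv K)) (hC : 0 ≤ C) (hC' : C ≤ 1 / 16)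
    (hc : 0 ≤ c) (hγ : 0 < γ) (hγ' : γ < 1 / 4) : ∃ b : ℝ, 0 < b ∧ ∀ ε, 0 < ε → IsNoiseKernel (noiseKernel K ρ γ ε) c T (2 + γ) ε →
      IsCovariance (noiseKernel K ρ γ ε) A (1 + 2 * γ) ε → |renormConst K ρ γ ε Symbol.WV| ≤ b * ε ^ (-4 * γ) := by
  have hn : ((2 : ℕ) : ℝ) * C ≤ 1 / 4 := by push_cast; linarith
  have key : Controlled (spaceDeriv K) c T A γ (-4 * γ) ![0, 1] [((0 : Fin 3), (2 : Fin 3)), (1, 2)] :=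
    controlled_of_le (by finiteness) (fun ε N hε hN hN' => enorm_diag_le_of_leaf hD hN' hN hC (by decide) hn (p := 1) (by decide) (by decide))
      (exists_majorant_WV_le hγ hγ')
  refine exists_renormConst_le (l := Xi) (r := W) hD.meas hD' hc hγ.le fourPairs (fun σ hσ => exists_fourPairs hσ)
    ![.inr (.inl ()), .inr (.inr (.inr (.inl ())))] (by decide) ![0, 1] (![0, 1, 2, 2] : Fin 4 → Fin 3)
    (fun D w => by simp only [pairKer, treeKer, W, V, Fin.prod_univ_two, mul_one, one_mul]; rfl)
    (fun w => by change ∀ i : Fin 4, _; intro i; fin_cases i <;> rfl) ?_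
  exact forall_mem_fourPairs (controlled_of_antisymmetric hD (S := {2}) (p := 1) (by decide)) key key

end

end FracKPZ

/-! ### Lower bound for `∂ₓ^γ K'` when `√t ≪ x ≪ 1` -/

namespace FracKPZ
open Set ENNReal

/-- Half of the Gaussian exponent is kept as a heat kernel at time `2t`; the other half is at most
`8t/R²` by `e^{-y} ≤ 1/y`. So the mass outside `[-R, R]` is of order `t/R²`. -/
lemma heatKernel_le_of_far {t R v : ℝ} (ht : 0 < t) (hR : 0 < R) (hv : R ≤ |v|) :
    heatKernel (t, v) ≤ 16 * (t / R ^ 2) * heatKernel (2 * t, v) := by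
  have hv2 : R ^ 2 ≤ v ^ 2 := by rw [← sq_abs v]; exact pow_le_pow_left₀ hR.le hv 2
  have hv0 : 0 < v ^ 2 := lt_of_lt_of_le (by positivity) hv2
  rw [heatKernel, heatKernel, if_pos ht, if_pos (by simpa using ht)]
  simp only
  have h1 : (√(4 * Real.pi * t))⁻¹ ≤ 2 * (√(4 * Real.pi * (2 * t)))⁻¹ := by
    rw [show 4 * Real.pi * (2 * t) = 2 * (4 * Real.pi * t) by ring, Real.sqrt_mul (show (0 : ℝ) ≤ 2 by norm_num), mul_inv, ← mul_assoc]
    refine le_mul_of_one_le_left (by positivity) ?_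
    rw [← div_eq_mul_inv, one_le_div (by positivity)]
    exact Real.sqrt_le_iff.2 ⟨by norm_num, by norm_num⟩
  have h2 : Real.exp (-v ^ 2 / (4 * t)) ≤ 8 * (t / R ^ 2) * Real.exp (-v ^ 2 / (4 * (2 * t))) := by
    rw [show -v ^ 2 / (4 * t) = -(v ^ 2 / (8 * t)) + -v ^ 2 / (4 * (2 * t)) by field_simp; ring, Real.exp_add]
    refine mul_le_mul_of_nonneg_right ?_ (Real.exp_nonneg _)
    have hy : 0 < v ^ 2 / (8 * t) := by positivity
    calc Real.exp (-(v ^ 2 / (8 * t))) ≤ (v ^ 2 / (8 * t))⁻¹ := by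
          rw [Real.exp_neg]
          exact inv_anti₀ hy (by linarith [Real.add_one_le_exp (v ^ 2 / (8 * t))])
      _ = 8 * (t / v ^ 2) := by rw [inv_div]; ring
      _ ≤ _ := by gcongr
  calc _ ≤ (2 * (√(4 * Real.pi * (2 * t)))⁻¹) * (8 * (t / R ^ 2) * Real.exp (-v ^ 2 / (4 * (2 * t)))) := by gcongr
    _ = _ := by ring

lemma abs_farKer_le_rpow {γ R b y : ℝ} (hγ : 0 ≤ γ) (hb : 0 < b) (hy : b ≤ |y|) : |farKer γ R y| ≤ b ^ (-2 - γ) := by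
  have hm : 0 < max |y| R := lt_max_of_lt_left (hb.trans_le hy)
  rw [farKer, abs_mul, abs_of_pos (show 0 < max |y| R ^ (-3 - γ) by positivity)]
  calc |y| * max |y| R ^ (-3 - γ) ≤ max |y| R * max |y| R ^ (-3 - γ) := by gcongr; exact le_max_left _ _
    _ = max |y| R ^ (-2 - γ) := by
      rw [show -2 - γ = 1 + (-3 - γ) by ring, Real.rpow_add hm, Real.rpow_one]
    _ ≤ _ := Real.rpow_le_rpow_of_nonpos hb (hy.trans (le_max_left _ _)) (by linarith)

section
variable {K : ℝ × ℝ → ℝ} {C r γ t R : ℝ}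

lemma integrable_mul_farKer_sub {g : ℝ → ℝ} (hγ : 0 ≤ γ) (hR : 0 < R) (hg : Integrable g) (x : ℝ) :
    Integrable fun v => g v * farKer γ R (x - v) :=
  hg.mul_bdd (c := R ^ (-2 - γ)) ((continuous_farKer hR).comp (by fun_prop)).aestronglyMeasurable
    (ae_of_all _ fun y => abs_farKer_le hγ hR _)

/-- For `t ≪ R²` the heat kernel acts like a unit mass at the origin: on `|v| ≤ R` the argument `2R
- v` lies in `[R, 3R]`, where the far kernel is the exact power. Beyond, the kernel may be negative
but is at most `R^{-2-γ}`. The constant 32 counts the tail twice, once as missing main term and once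
as error. -/
lemma le_integral_heatKernel_mul_farKer (hγ : 0 ≤ γ) (ht : 0 < t) (hR : 0 < R) :
    (3 * R) ^ (-2 - γ) - 32 * (t / R ^ 2) * R ^ (-2 - γ) ≤ ∫ v, heatKernel (t, v) * farKer γ R (2 * R - v) := by
  have e : (3 * R) ^ (-2 - γ) - 32 * (t / R ^ 2) * R ^ (-2 - γ) =
      ∫ v, ((3 * R) ^ (-2 - γ) * heatKernel (t, v) - 32 * (t / R ^ 2) * R ^ (-2 - γ) * heatKernel (2 * t, v)) := by
    rw [integral_sub ((integrable_heatKernel ht).const_mul _) ((integrable_heatKernel (by positivity)).const_mul _),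
      integral_const_mul, integral_const_mul, integral_heatKernel ht, integral_heatKernel (by positivity), mul_one, mul_one]
  rw [e]
  refine integral_mono (((integrable_heatKernel ht).const_mul _).sub ((integrable_heatKernel (by positivity)).const_mul _))
    (integrable_mul_farKer_sub hγ hR (integrable_heatKernel ht) _) fun v => ?_
  have h1 := heatKernel_nonneg (t, v)
  have h2 := heatKernel_nonneg (2 * t, v)
  have hP : 0 < R ^ (-2 - γ) := by positivity
  have hQ : (3 * R) ^ (-2 - γ) ≤ R ^ (-2 - γ) := Real.rpow_le_rpow_of_nonpos hR (by linarith) (by linarith)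
  simp only
  rcases le_total |v| R with hv | hv
  · have hv' := abs_le.1 hv
    rw [farKer_of_le hR (by linarith)]
    have h3 : (3 * R) ^ (-2 - γ) ≤ (2 * R - v) ^ (-2 - γ) :=
      Real.rpow_le_rpow_of_nonpos (by linarith) (by linarith) (by linarith)
    have h4 : 0 ≤ 32 * (t / R ^ 2) * R ^ (-2 - γ) * heatKernel (2 * t, v) := by positivity
    nlinarith
  · have h3 := heatKernel_le_of_far ht hR hv
    have h4 := (abs_le.1 (abs_farKer_le hγ hR (2 * R - v))).1
    have h5 : -(R ^ (-2 - γ)) * heatKernel (t, v) ≤ heatKernel (t, v) * farKer γ R (2 * R - v) := by nlinarith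
    have h6 : 2 * R ^ (-2 - γ) * heatKernel (t, v) ≤ 2 * R ^ (-2 - γ) * (16 * (t / R ^ 2) * heatKernel (2 * t, v)) := by gcongr
    nlinarith

lemma IsTruncatedHeatKernel.exists_iterate_bound_of_far (hK : IsTruncatedHeatKernel K C r) (hC : 0 < C) (k : ℕ) (hk : k ≤ 3) :
    ∃ c : ℝ, 0 < c ∧ ∀ t R y, 0 < t → 0 < R → R ≤ |y| → |spaceDeriv^[k] K (t, y)| ≤ c * (√t * (R ^ (k + 2))⁻¹ + 1) := by
  obtain ⟨c, hc, H⟩ := hK.exists_bound hC k hk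
  refine ⟨Real.exp 64 + c * ((C / 2) ^ (k + 1))⁻¹, by positivity, fun t R y ht hR hy => ?_⟩
  have hp : |y| ≤ parNorm (t, y) := abs_snd_le_parNorm (t, y)
  have h0 : 0 ≤ √t * (R ^ (k + 2))⁻¹ := by positivity
  rcases lt_or_ge (parNorm (t, y)) (C / 2) with h | h
  · rw [hK.iterate_eq_heat k h]
    refine (abs_iterate_spaceDeriv_heat_le ht k hk y).trans ?_
    have h1 : (parNorm (t, y) ^ (k + 2))⁻¹ ≤ (R ^ (k + 2))⁻¹ := by
      have := hy.trans hp
      gcongr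
    have h2 : Real.exp 64 * √t * (parNorm (t, y) ^ (k + 2))⁻¹ ≤ Real.exp 64 * (√t * (R ^ (k + 2))⁻¹) := by
      rw [mul_assoc]; gcongr
    have h3 : 0 ≤ c * ((C / 2) ^ (k + 1))⁻¹ := by positivity
    have h4 := Real.exp_pos 64
    nlinarith
  · have h1 : (parNorm (t, y) ^ (k + 1))⁻¹ ≤ ((C / 2) ^ (k + 1))⁻¹ := by gcongr
    have h2 := (H (t, y)).trans (mul_le_mul_of_nonneg_left h1 hc.le)
    have h3 : 0 ≤ c * ((C / 2) ^ (k + 1))⁻¹ := by positivity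
    have h4 := Real.exp_pos 64
    nlinarith

/-- The truncation differs from the heat kernel only for `|v| > C/4`, because `√t ≤ R ≤ C/16`. There
`|2R - v| ≥ C/8`, so the far kernel is bounded and the two `L¹` norms suffice. -/
lemma IsTruncatedHeatKernel.exists_integral_sub_heat_le (hK : IsTruncatedHeatKernel K C r) (hC : 0 < C) (hγ : 0 ≤ γ) :
    ∃ c : ℝ, 0 < c ∧ ∀ t R, 0 < t → 0 < R → 16 * R ≤ C → √t ≤ R →
      |∫ v, (K (t, v) - heatKernel (t, v)) * farKer γ R (2 * R - v)| ≤ c := by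
  obtain ⟨c, hc, H⟩ := hK.exists_L1_bound hC
  refine ⟨(c + 1) * (C / 8) ^ (-2 - γ), by positivity, fun t R ht hR hRC htR => ?_⟩
  obtain ⟨hi, hb⟩ := H t ht
  have hiH := integrable_heatKernel ht
  calc |∫ v, (K (t, v) - heatKernel (t, v)) * farKer γ R (2 * R - v)|
      ≤ ∫ v, (|K (t, v)| + heatKernel (t, v)) * (C / 8) ^ (-2 - γ) := by
        rw [← Real.norm_eq_abs]
        refine norm_integral_le_of_norm_le ((hi.abs.add hiH).mul_const _) (ae_of_all _ fun v => ?_)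
        rw [Real.norm_eq_abs, abs_mul]
        have hH := heatKernel_nonneg (t, v)
        rcases le_total |v| (C / 4) with hv | hv
        · have : parNorm (t, v) ≤ C / 2 := by rw [parNorm_mk_pos ht]; linarith
          rw [hK.eq_heat _ this, sub_self, abs_zero, zero_mul]
          positivity
        · refine mul_le_mul ((abs_sub _ _).trans_eq (by rw [abs_of_nonneg hH])) (abs_farKer_le_rpow hγ (by positivity) ?_) (abs_nonneg _) (by positivity)
          have h1 : |v| - |2 * R| ≤ |v - 2 * R| := abs_sub_abs_le_abs_sub _ _
          rw [abs_of_pos (by positivity : 0 < 2 * R)] at h1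
          rw [abs_sub_comm]
          linarith
    _ = ((∫ v, |K (t, v)|) + 1) * (C / 8) ^ (-2 - γ) := by
        rw [integral_mul_const, integral_add hi.abs hiH, integral_heatKernel ht]
    _ ≤ _ := by gcongr

/-- The splitting of the singular integral at scale `R` around the point `2R`: the far part sees the
concentrated mass and is of order `R^{-2-γ}`; near `2R` the derivatives of `K` are small since `√t ≪
R`. The constant `1/27` is `3^{-3} ≤ 3^{-2-γ}`. -/
theorem IsTruncatedHeatKernel.exists_le_fracInt (hK : IsTruncatedHeatKernel K C r) (hC : 0 < C) (hγ : 0 < γ) (hγ1 : γ < 1) :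
    ∃ c : ℝ, 0 < c ∧ ∀ t R, 0 < t → 0 < R → R ≤ 1 → 16 * R ≤ C → √t ≤ R →
      R ^ (-2 - γ) * (1 / 27 - c * (√t / R + R)) ≤ fracInt γ (fun x => K (t, x)) (fun x => spaceDeriv K (t, x)) (2 * R) := by
  obtain ⟨c₁, h₁, H₁⟩ := hK.exists_iterate_bound_of_far hC 1 (by norm_num)
  obtain ⟨c₂, h₂, H₂⟩ := hK.exists_iterate_bound_of_far hC 2 (by norm_num)
  obtain ⟨c₃, h₃, H₃⟩ := hK.exists_integral_sub_heat_le hC hγ.le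
  obtain ⟨c₄, h₄, H₄⟩ := hK.exists_L1_bound hC
  have hg1 : 0 < 1 - γ := by linarith
  set a₁ := 2 / (1 - γ) with ha₁
  set a₂ := 2 * (1 + 1 / γ) with ha₂
  have ha₁0 : 0 < a₁ := by positivity
  have ha₂0 : 0 < a₂ := by positivity
  refine ⟨a₁ * c₂ + a₂ * c₁ + c₃ + 32, by positivity, fun t R ht hR hR1 hRC htR => ?_⟩
  set P := R ^ (-2 - γ) with hP'
  have hP : 0 < P := by positivity
  set q := √t / R with hq'
  have hq0 : 0 ≤ q := by positivity
  have hq1 : q ≤ 1 := (div_le_one hR).2 htR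
  have hB := (abs_fracInt_zero_add_le (g := fun y => K (t, 2 * R + y)) (g₁ := fun y => spaceDeriv K (t, 2 * R + y))
    (g₂ := fun y => spaceDeriv^[2] K (t, 2 * R + y)) (M := c₂ * (√t * (R ^ 4)⁻¹ + 1)) hγ hγ1 hR
    (fun y => (hK.hasDerivAt_slice 0 t (2 * R + y) ht.ne').comp_const_add (2 * R) y)
    (fun y => (hK.hasDerivAt_slice 1 t (2 * R + y) ht.ne').comp_const_add (2 * R) y)
    (fun s hs => H₂ t R _ ht hR (by
      have := abs_le.1 hs
      rw [abs_of_pos (by linarith)]; linarith)) ((H₄ t ht).1.comp_add_left (2 * R))).2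
  have e1 : ∫ y in Ioi 0, (2 * y * spaceDeriv K (t, 2 * R + 0) - K (t, 2 * R + y) + K (t, 2 * R + -y)) * y ^ (-2 - γ) =
      fracInt γ (fun x => K (t, x)) (fun x => spaceDeriv K (t, x)) (2 * R) := by
    simp only [fracInt, add_zero, sub_eq_add_neg]
  have e2 : ∫ y, K (t, 2 * R + y) * farKer γ R y = -∫ v, K (t, v) * farKer γ R (2 * R - v) := by
    rw [← integral_add_left_eq_self (fun v => K (t, v) * farKer γ R (2 * R - v)) (2 * R), ← integral_neg]
    refine integral_congr_ae (ae_of_all _ fun y => ?_)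
    simp only [sub_add_cancel_left, farKer_neg, mul_neg, neg_neg]
  have e3 : ∫ v, K (t, v) * farKer γ R (2 * R - v) = (∫ v, heatKernel (t, v) * farKer γ R (2 * R - v)) +
      ∫ v, (K (t, v) - heatKernel (t, v)) * farKer γ R (2 * R - v) := by
    have I : Integrable fun v => (K (t, v) - heatKernel (t, v)) * farKer γ R (2 * R - v) :=
      integrable_mul_farKer_sub hγ.le hR ((H₄ t ht).1.sub (integrable_heatKernel ht)) _
    rw [← integral_add (integrable_mul_farKer_sub hγ.le hR (integrable_heatKernel ht) _) I]
    refine integral_congr_ae (ae_of_all _ fun y => ?_)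
    simp only
    ring
  rw [e1, e2, e3] at hB
  have hmain := le_integral_heatKernel_mul_farKer hγ.le ht hR
  have herr := (abs_le.1 (H₃ t R ht hR hRC htR)).1
  have hB' := (abs_le.1 hB).1
  have hD := H₁ t R (2 * R + 0) ht hR (by rw [add_zero, abs_of_pos (by positivity)]; linarith)
  simp only [Function.iterate_one] at hD
  have r1 : R ^ (1 - γ) = P * R ^ 3 := by
    rw [hP', ← Real.rpow_natCast R 3, ← Real.rpow_add hR]; congr 1; push_cast; ring
  have r2 : R ^ (-γ) = P * R ^ 2 := by
    rw [hP', ← Real.rpow_natCast R 2, ← Real.rpow_add hR]; congr 1; push_cast; ring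
  have r3 : P / 27 ≤ (3 * R) ^ (-2 - γ) := by
    rw [Real.mul_rpow (by norm_num) hR.le, ← hP']
    have : (3 : ℝ) ^ (-3 : ℝ) ≤ 3 ^ (-2 - γ) := Real.rpow_le_rpow_of_exponent_le (by norm_num) (by linarith)
    have h27 : (3 : ℝ) ^ (-3 : ℝ) = 1 / 27 := by
      rw [Real.rpow_neg (by norm_num), show (3 : ℝ) = (3 : ℕ) by norm_num, Real.rpow_natCast]; norm_num
    rw [h27] at this
    nlinarith
  -- The truncation error is only bounded, but `R^{-2-γ} R ≥ 1` for `R ≤ 1`, so it counts as an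
  -- error of relative size `R`.
  have r4 : c₃ ≤ P * (c₃ * R) := by
    have : 1 ≤ P * R := by
      rw [hP', show P * R = R ^ (-1 - γ) by rw [hP']; nth_rewrite 2 [← Real.rpow_one R]; rw [← Real.rpow_add hR]; congr 1; ring]
      exact Real.one_le_rpow_of_pos_of_le_one_of_nonpos hR hR1 (by linarith)
    nlinarith
  have r5 : t / R ^ 2 ≤ q := by
    have : t / R ^ 2 = q ^ 2 := by rw [hq', div_pow, Real.sq_sqrt ht.le]
    rw [this]; nlinarith
  have r6 : R ^ 3 * (√t * (R ^ 4)⁻¹ + 1) ≤ q + R := by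
    have : R ^ 3 * (√t * (R ^ 4)⁻¹ + 1) = q + R ^ 3 := by rw [hq']; field_simp
    rw [this]
    have : R ^ 3 ≤ R := by simpa using pow_le_pow_of_le_one hR.le hR1 (show 1 ≤ 3 by norm_num)
    linarith
  have r7 : R ^ 2 * (√t * (R ^ 3)⁻¹ + 1) ≤ q + R := by
    have : R ^ 2 * (√t * (R ^ 3)⁻¹ + 1) = q + R ^ 2 := by rw [hq']; field_simp
    rw [this]
    have : R ^ 2 ≤ R := by simpa using pow_le_pow_of_le_one hR.le hR1 (show 1 ≤ 2 by norm_num)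
    linarith
  have s1 : a₁ * R ^ (1 - γ) * (c₂ * (√t * (R ^ 4)⁻¹ + 1)) ≤ P * (a₁ * c₂ * (q + R)) := by
    rw [r1, show a₁ * (P * R ^ 3) * (c₂ * (√t * (R ^ 4)⁻¹ + 1)) = P * (a₁ * c₂ * (R ^ 3 * (√t * (R ^ 4)⁻¹ + 1))) by ring]
    gcongr
  have s2 : a₂ * R ^ (-γ) * |spaceDeriv K (t, 2 * R + 0)| ≤ P * (a₂ * c₁ * (q + R)) := by
    rw [r2]
    calc _ ≤ a₂ * (P * R ^ 2) * (c₁ * (√t * (R ^ (1 + 2))⁻¹ + 1)) := by gcongr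
      _ = P * (a₂ * c₁ * (R ^ 2 * (√t * (R ^ 3)⁻¹ + 1))) := by ring
      _ ≤ _ := by gcongr
  have s3 : 32 * (t / R ^ 2) * P ≤ P * (32 * q) := by
    rw [mul_comm P]
    exact mul_le_mul_of_nonneg_right (mul_le_mul_of_nonneg_left r5 (by norm_num)) hP.le
  have s4 : P * (1 / 27 - (a₁ * c₂ + a₂ * c₁ + c₃ + 32) * (q + R)) =
      P / 27 - P * (a₁ * c₂ * (q + R)) - P * (a₂ * c₁ * (q + R)) - P * (c₃ * R) - P * (32 * q) - P * (c₃ * q) - P * (32 * R) := by ring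
  have s5 : 0 ≤ P * (c₃ * q) := by positivity
  have s6 : 0 ≤ P * (32 * R) := by positivity
  rw [s4]
  linarith

end

end FracKPZ

/-! ### Lower bound for the variance of the noise -/

namespace FracKPZ
open Set ENNReal

section
variable {K ρ : ℝ × ℝ → ℝ} {C r γ ε : ℝ}

lemma IsTruncatedHeatKernel.exists_region_zero (hK : IsTruncatedHeatKernel K C r) (hC : 0 < C) {ϱ : ℝ} (hϱ : 0 < ϱ) :
    ∃ X m ε₀ : ℝ, 2 * ϱ ≤ X ∧ 0 < m ∧ 0 < ε₀ ∧ ∀ ε s y, 0 < ε → ε ≤ ε₀ → ϱ ^ 2 * ε ^ 2 ≤ s → s ≤ 4 * ϱ ^ 2 * ε ^ 2 →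
      X * ε / 2 ≤ y → y ≤ 3 * X * ε → m * ε ^ (-2 : ℝ) ≤ -1 * spaceDeriv K (s, y) := by
  refine ⟨2 * ϱ, (√(4 * Real.pi))⁻¹ * (4 * ϱ ^ 2)⁻¹ * (1 / 4 * Real.exp (-9)), C / (32 * ϱ), le_rfl, by positivity, by positivity, ?_⟩
  intro ε s y hε hε0 hs hs' hy hy'
  have hs0 : 0 < s := lt_of_lt_of_le (by positivity) hs
  set q := √s with hq
  have hq0 : 0 < q := Real.sqrt_pos.2 hs0
  have hsq : s = q ^ 2 := (Real.sq_sqrt hs0.le).symm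
  have hq1 : ϱ * ε ≤ q := Real.le_sqrt_of_sq_le (by rw [mul_pow]; exact hs)
  have hq2 : q ≤ 2 * (ϱ * ε) := Real.sqrt_le_iff.2 ⟨by positivity, by rw [mul_pow, mul_pow]; linarith⟩
  have hε1 : ϱ * ε * 32 ≤ C := by
    rw [le_div_iff₀ (by positivity)] at hε0
    linarith
  have hpos : 0 < ϱ * ε := by positivity
  have hy0 : 0 < y := by linarith
  have hpar : parNorm (s, y) < C / 2 := by
    rw [parNorm_mk_pos hs0, abs_of_pos hy0]
    linarith
  have e : spaceDeriv K (s, y) = (√(4 * Real.pi))⁻¹ * q⁻¹ ^ 2 * (-(y / q) / 2 * Real.exp (-(y / q) ^ 2 / 4)) := by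
    have h1 := hK.iterate_eq_heat 1 hpar
    have h2 := iterate_spaceDeriv_heat hq0 1 (by norm_num) y
    rw [← hsq] at h2
    rw [h2] at h1
    exact h1
  have hv1 : 1 / 2 ≤ y / q := by rw [le_div_iff₀ hq0]; linarith
  have hv2 : y / q ≤ 6 := by rw [div_le_iff₀ hq0]; linarith
  rw [e, show -1 * ((√(4 * Real.pi))⁻¹ * q⁻¹ ^ 2 * (-(y / q) / 2 * Real.exp (-(y / q) ^ 2 / 4))) =
    (√(4 * Real.pi))⁻¹ * q⁻¹ ^ 2 * (y / q / 2 * Real.exp (-(y / q) ^ 2 / 4)) by ring]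
  have r1 : ε ^ (-2 : ℝ) = (ε ^ 2)⁻¹ := by rw [Real.rpow_neg hε.le]; norm_cast
  have r2 : (4 * ϱ ^ 2)⁻¹ * (ε ^ 2)⁻¹ ≤ q⁻¹ ^ 2 := by
    rw [← mul_inv, inv_pow]
    exact inv_anti₀ (by positivity) (by rw [← hsq]; exact hs')
  have r3 : Real.exp (-9) ≤ Real.exp (-(y / q) ^ 2 / 4) := Real.exp_le_exp.2 (by nlinarith)
  rw [r1]
  calc _ = (√(4 * Real.pi))⁻¹ * ((4 * ϱ ^ 2)⁻¹ * (ε ^ 2)⁻¹) * (1 / 4 * Real.exp (-9)) := by ring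
    _ ≤ _ := mul_le_mul (mul_le_mul_of_nonneg_left r2 (by positivity))
        (mul_le_mul (by linarith) r3 (Real.exp_nonneg _) (by linarith)) (by positivity) (by positivity)

/-- The region has parabolic scale `ε` but is elongated in space by a large factor `X/ϱ`, so that
`√t ≪ x` there. It is somewhat larger than finally needed, to leave room for a mollifier of radius
`ϱ ε`. -/
lemma IsTruncatedHeatKernel.exists_region_pos (hK : IsTruncatedHeatKernel K C r) (hC : 0 < C) (hγ : 0 < γ) (hγ1 : γ < 1) {ϱ : ℝ} (hϱ : 0 < ϱ) :
    ∃ X m ε₀ : ℝ, 2 * ϱ ≤ X ∧ 0 < m ∧ 0 < ε₀ ∧ ∀ ε s y, 0 < ε → ε ≤ ε₀ → ϱ ^ 2 * ε ^ 2 ≤ s → s ≤ 4 * ϱ ^ 2 * ε ^ 2 →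
      X * ε / 2 ≤ y → y ≤ 3 * X * ε → m * ε ^ (-2 - γ) ≤ fracKernel K γ (s, y) := by
  obtain ⟨c, hc, H⟩ := hK.exists_le_fracInt hC hγ hγ1
  have hF := fracConst_pos hγ hγ1
  set θ := min (min 1 (C / 16)) (1 / (108 * c)) with hθ
  have hθ0 : 0 < θ := by positivity
  have hθ1 : θ ≤ 1 := (min_le_left _ _).trans (min_le_left _ _)
  have hθC : θ ≤ C / 16 := (min_le_left _ _).trans (min_le_right _ _)
  have hθc : c * θ ≤ 1 / 108 := by
    have : θ ≤ 1 / (108 * c) := min_le_right _ _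
    rw [le_div_iff₀ (by positivity)] at this
    linarith
  -- Chosen so that `√s ≤ 2ϱε = θXε/4 ≤ θR` throughout the region, where `y = 2R ≥ Xε/2`.
  set X := 8 * ϱ / θ with hX
  have hX0 : 0 < X := by positivity
  have hXθ : θ * X = 8 * ϱ := by rw [hX]; field_simp
  refine ⟨X, fracConst γ * ((2 * X) ^ (-2 - γ) / 54), θ / (2 * X), by nlinarith, by positivity, by positivity, ?_⟩
  intro ε s y hε hε0 hs hs' hy hy'
  have hs0 : 0 < s := lt_of_lt_of_le (by positivity) hs
  have hXε : 2 * (X * ε) ≤ θ := by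
    rw [le_div_iff₀ (by positivity)] at hε0
    linarith
  have hXε0 : 0 < X * ε := by positivity
  have hsq : √s ≤ 2 * (ϱ * ε) := Real.sqrt_le_iff.2 ⟨by positivity, by rw [mul_pow, mul_pow]; linarith⟩
  obtain ⟨R, rfl⟩ : ∃ R, y = 2 * R := ⟨y / 2, by ring⟩
  have hR0 : 0 < R := by linarith
  have hsR : √s ≤ θ * R := by
    have : θ * (X * ε) = 8 * (ϱ * ε) := by rw [← mul_assoc, hXθ]; ring
    nlinarith
  have hRθ : R ≤ θ := by linarith
  have hfrac := H s R hs0 hR0 (by linarith) (by linarith) (by nlinarith)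
  have hq : √s / R ≤ θ := (div_le_iff₀ hR0).2 hsR
  have h54 : 1 / 54 ≤ 1 / 27 - c * (√s / R + R) := by nlinarith
  have hP : (2 * X) ^ (-2 - γ) * ε ^ (-2 - γ) ≤ R ^ (-2 - γ) := by
    rw [← Real.mul_rpow (by positivity) hε.le]
    exact Real.rpow_le_rpow_of_nonpos hR0 (by linarith) (by linarith)
  rw [fracKernel, if_neg hγ.ne']
  have hR' : 0 < R ^ (-2 - γ) := by positivity
  calc fracConst γ * ((2 * X) ^ (-2 - γ) / 54) * ε ^ (-2 - γ) = fracConst γ * (((2 * X) ^ (-2 - γ) * ε ^ (-2 - γ)) * (1 / 54)) := by ring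
    _ ≤ fracConst γ * (R ^ (-2 - γ) * (1 / 27 - c * (√s / R + R))) := by gcongr
    _ ≤ _ := by gcongr

lemma IsTruncatedHeatKernel.exists_region (hK : IsTruncatedHeatKernel K C r) (hC : 0 < C) (hγ : 0 ≤ γ) (hγ1 : γ < 1) {ϱ : ℝ} (hϱ : 0 < ϱ) :
    ∃ σ X m ε₀ : ℝ, |σ| = 1 ∧ 2 * ϱ ≤ X ∧ 0 < m ∧ 0 < ε₀ ∧ ∀ ε s y, 0 < ε → ε ≤ ε₀ → ϱ ^ 2 * ε ^ 2 ≤ s → s ≤ 4 * ϱ ^ 2 * ε ^ 2 →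
      X * ε / 2 ≤ y → y ≤ 3 * X * ε → m * ε ^ (-2 - γ) ≤ σ * fracKernel K γ (s, y) := by
  rcases hγ.eq_or_lt with rfl | hγ
  · obtain ⟨X, m, ε₀, h1, h2, h3, H⟩ := hK.exists_region_zero hC hϱ
    exact ⟨-1, X, m, ε₀, by simp, h1, h2, h3, by simpa [fracKernel] using H⟩
  · obtain ⟨X, m, ε₀, h1, h2, h3, H⟩ := hK.exists_region_pos hC hγ hγ1 hϱ
    exact ⟨1, X, m, ε₀, by simp, h1, h2, h3, by simpa using H⟩

lemma IsMollifier.integrable_rescale (hρ : IsMollifier ρ) (hε : 0 < ε) : Integrable (rescale ρ ε) :=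
  (hρ.contDiff_rescale ε).continuous.integrable_of_hasCompactSupport (hρ.hasCompactSupport_rescale hε)

lemma IsMollifier.integral_rescale (hρ : IsMollifier ρ) (hε : 0 < ε) : ∫ z, rescale ρ ε z = 1 := by
  have h1 := hρ.integrable_rescale hε
  have h2 : Integrable ρ := hρ.smooth.continuous.integrable_of_hasCompactSupport hρ.compact
  rw [Measure.volume_eq_prod] at h1 ⊢
  rw [integral_prod _ h1]
  have e1 : ∀ t, ∫ x, rescale ρ ε (t, x) = (ε ^ 2)⁻¹ * ∫ x, ρ (t / ε ^ 2, x) := by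
    intro t
    simp only [rescale]
    rw [integral_const_mul, Measure.integral_comp_div (fun x => ρ (t / ε ^ 2, x)) ε, smul_eq_mul, abs_of_pos hε]
    field_simp
  simp only [e1]
  rw [integral_const_mul, Measure.integral_comp_div (fun t => ∫ x, ρ (t, x)) (ε ^ 2), smul_eq_mul, abs_of_pos (by positivity),
    ← mul_assoc, inv_mul_cancel₀ (by positivity), one_mul]
  have := hρ.mass
  rw [Measure.volume_eq_prod] at this h2
  rw [← this, integral_prod _ h2]

/-- Averaging against a nonnegative mollifier of mass one preserves a lower bound of constant sign.
The other periods contribute at most a constant `L`, which is half of the main term for small `ε`,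
as `ε^{-2-γ} ≥ ε^{-1}`. -/
theorem exists_le_abs_noiseKernel (hK : IsTruncatedHeatKernel K C r) (hC : 0 < C) (hρ : IsMollifier ρ) (hγ : 0 ≤ γ) (hγ1 : γ < 1) :
    ∃ ϱ X m ε₀ : ℝ, 0 < ϱ ∧ 0 < X ∧ 0 < m ∧ 0 < ε₀ ∧ ∀ ε t x, 0 < ε → ε ≤ ε₀ → 2 * ϱ ^ 2 * ε ^ 2 ≤ t → t ≤ 3 * ϱ ^ 2 * ε ^ 2 →
      X * ε ≤ x → x ≤ 2 * X * ε → x ≤ 3 / 4 → m * ε ^ (-2 - γ) ≤ |noiseKernel K ρ γ ε (t, x)| := by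
  obtain ⟨M, ϱ, hM, hϱ, Hρ⟩ := hρ.rescale_bound
  obtain ⟨σ, X, m, ε₀, hσ, hX, hm, hε₀, H⟩ := hK.exists_region hC hγ hγ1 hϱ
  obtain ⟨c, hc, Hc⟩ := hK.exists_hasOrder_fracKernel hC hγ hγ1
  obtain ⟨c', hc', Hc'⟩ := exists_mollKernel_size hK hC hρ hγ hγ1
  have htail := tailSum_nonneg
  have hX0 : 0 < X := by linarith
  set L := c' * tailSum with hL
  have hL0 : 0 ≤ L := by positivity
  refine ⟨ϱ, X, m / 2, min (min ε₀ 1) (m / (2 * L + 1)), hϱ, hX0, by positivity, by positivity, ?_⟩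
  intro ε t x hε hε' ht ht' hx hx' hx1
  have hεa : ε ≤ ε₀ := hε'.trans ((min_le_left _ _).trans (min_le_left _ _))
  have hεb : ε ≤ 1 := hε'.trans ((min_le_left _ _).trans (min_le_right _ _))
  have hεc : ε * (2 * L + 1) ≤ m := (le_div_iff₀ (by positivity)).1 (hε'.trans (min_le_right _ _))
  have hx0 : 0 < x := lt_of_lt_of_le (by positivity) hx
  have hmoll : m * ε ^ (-2 - γ) ≤ σ * mollKernel K ρ γ ε (t, x) := by
    have hi := hρ.integrable_pker_mul (measurable_fracKernel hK γ) hc.le (by linarith) (by linarith) Hc.size hε (t, x)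
    have hr : Integrable fun w => rescale ρ ε ((t, x) - w) := (hρ.integrable_rescale hε).comp_sub_left _
    have e : m * ε ^ (-2 - γ) = ∫ w, m * ε ^ (-2 - γ) * rescale ρ ε ((t, x) - w) := by
      rw [integral_const_mul, integral_sub_left_eq_self (rescale ρ ε), hρ.integral_rescale hε, mul_one]
    rw [mollKernel, e, ← integral_const_mul]
    refine integral_mono (hr.const_mul _) (hi.const_mul _) fun w => ?_
    simp only
    rw [← mul_assoc]
    rcases lt_or_ge (ϱ * ε) (parNorm ((t, x) - w)) with h | h
    · rw [(Hρ ε hε _).2.2 h, mul_zero, mul_zero]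
    refine mul_le_mul_of_nonneg_right ?_ (Hρ ε hε _).1
    have h1 := (abs_fst_le_parNorm_sq ((t, x) - w)).trans (pow_le_pow_left₀ (parNorm_nonneg _) h 2)
    have h2 := (abs_snd_le_parNorm ((t, x) - w)).trans h
    rw [mul_pow] at h1
    simp only [Prod.fst_sub, Prod.snd_sub] at h1 h2
    have h1' := abs_le.1 h1
    have h2' := abs_le.1 h2
    have h3 : 2 * (ϱ * ε) ≤ X * ε := by nlinarith
    exact H ε w.1 w.2 hε hεa (by linarith) (by linarith) (by linarith) (by linarith)
  have hN : |noiseKernel K ρ γ ε (t, x) - mollKernel K ρ γ ε (t, x)| ≤ L := by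
    rw [noiseKernel_eq hK hC hρ hε hγ hγ1]
    have := (tsum_sub_le_of_tail (f := fun k : ℤ => mollKernel K ρ γ ε (t, x + k)) (A := c') fun k hk =>
      (Hc' ε hε _).trans (mul_le_mul_of_nonneg_left (rpow_tail_le (by rw [abs_of_pos hx0]; exact hx1) hε (by linarith) (by linarith) hk) hc'.le)).2
    simpa [periodize] using this
  have h4 : m * ε ^ (-2 - γ) ≤ |mollKernel K ρ γ ε (t, x)| := by
    refine hmoll.trans ((le_abs_self _).trans_eq ?_)
    rw [abs_mul, hσ, one_mul]
  have h5 : L ≤ m / 2 * ε ^ (-2 - γ) := by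
    have h6 : ε⁻¹ ≤ ε ^ (-2 - γ) := by
      rw [← Real.rpow_neg_one]
      exact Real.rpow_le_rpow_of_exponent_ge hε hεb (by linarith)
    have h7 : L ≤ m / 2 * ε⁻¹ := by
      rw [← div_eq_mul_inv, le_div_iff₀ hε]
      linarith
    exact h7.trans (by gcongr)
  have h8 := abs_sub_abs_le_abs_sub (mollKernel K ρ γ ε (t, x)) (noiseKernel K ρ γ ε (t, x))
  rw [abs_sub_comm] at hN
  linarith

/-- The integrand is a square, so it suffices to integrate over a set of volume `ϱ² X ε³` on which
it is at least `m² ε^{-4-2γ}`. Oddness moves the argument into the region where the kernel is known.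
-/
theorem exists_le_cov (hK : IsTruncatedHeatKernel K C r) (hC : 0 < C) (hρ : IsMollifier ρ) (hγ : 0 ≤ γ) (hγ1 : γ < 1) {c T : ℝ} (hc : 0 ≤ c) :
    ∃ b ε₀ : ℝ, 0 < b ∧ 0 < ε₀ ∧ ∀ ε, 0 < ε → ε ≤ ε₀ → IsNoiseKernel (noiseKernel K ρ γ ε) c T (2 + γ) ε →
      b * ε ^ (-1 - 2 * γ) ≤ cov (noiseKernel K ρ γ ε) 0 0 := by
  obtain ⟨ϱ, X, m, ε₀, hϱ, hX, hm, hε₀, H⟩ := exists_le_abs_noiseKernel hK hC hρ hγ hγ1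
  refine ⟨m ^ 2 * (ϱ ^ 2 * X), min ε₀ (1 / (4 * X)), by positivity, by positivity, fun ε hε hε' hN => ?_⟩
  have hεa : ε ≤ ε₀ := hε'.trans (min_le_left _ _)
  have hεb : ε * (4 * X) ≤ 1 := (le_div_iff₀ (by positivity)).1 (hε'.trans (min_le_right _ _))
  set N := noiseKernel K ρ γ ε with hN'
  set S : Set (ℝ × ℝ) := Icc (-(3 * ϱ ^ 2 * ε ^ 2)) (-(2 * ϱ ^ 2 * ε ^ 2)) ×ˢ Icc (X * ε) (2 * X * ε) with hS
  have hSm : MeasurableSet S := measurableSet_Icc.prod measurableSet_Icc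
  have hSs : S ⊆ strip := by
    rintro ⟨t, x⟩ ⟨_, hx⟩
    have hx0 : 0 < X * ε := by positivity
    simp only [mem_Icc] at hx
    exact ⟨mem_univ _, by simp only [mem_Ico]; exact ⟨by linarith, by linarith⟩⟩
  have hvol : volume.real S = ϱ ^ 2 * ε ^ 2 * (X * ε) := by
    rw [hS, Measure.volume_eq_prod, measureReal_prod_prod, Real.volume_real_Icc_of_le (by nlinarith [sq_nonneg (ϱ * ε)]),
      Real.volume_real_Icc_of_le (by nlinarith [mul_pos hX hε])]
    ring
  have hvol' : volume S ≠ ⊤ := by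
    rw [hS]
    exact (isCompact_Icc.prod isCompact_Icc).measure_lt_top.ne
  have hi := hN.integrableOn_strip hc (by linarith) hε 0 0
  have hpw : ∀ w ∈ S, (m * ε ^ (-2 - γ)) ^ 2 ≤ N (0 - w) * N (0 - w) := by
    rintro ⟨t, x⟩ ⟨ht, hx⟩
    simp only [mem_Icc] at ht hx
    have hodd : N (0 - (t, x)) = -N (-t, x) := by
      rw [← hN.odd]
      simp
    rw [hodd, neg_mul_neg, ← sq, ← sq_abs (N (-t, x))]
    refine pow_le_pow_left₀ (by positivity) (H ε (-t) x hε hεa (by linarith) (by linarith) hx.1 hx.2 (by linarith)) 2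
  calc m ^ 2 * (ϱ ^ 2 * X) * ε ^ (-1 - 2 * γ) = ∫ _ in S, (m * ε ^ (-2 - γ)) ^ 2 := by
        rw [setIntegral_const, hvol, smul_eq_mul, mul_pow, ← Real.rpow_natCast (ε ^ (-2 - γ)), ← Real.rpow_mul hε.le]
        have : ε ^ (-1 - 2 * γ) = ε ^ 3 * ε ^ ((-2 - γ) * ((2 : ℕ) : ℝ)) := by
          rw [← Real.rpow_natCast ε 3, ← Real.rpow_add hε]
          congr 1; push_cast; ring
        rw [this]; ring
    _ ≤ ∫ w in S, N (0 - w) * N (0 - w) :=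
        setIntegral_mono_on (integrableOn_const hvol') (hi.mono_set hSs) hSm hpw
    _ ≤ cov N 0 0 := setIntegral_mono_set hi (ae_of_all _ fun w => mul_self_nonneg _) hSs.eventuallyLE

lemma renormConst_V {c T p : ℝ} (hD : Measurable (spaceDeriv K)) (hD' : Integrable (spaceDeriv K))
    (hN : IsNoiseKernel (noiseKernel K ρ γ ε) c T p ε) (hc : 0 ≤ c) (hp : 0 ≤ p) (hε : 0 < ε) :
    renormConst K ρ γ ε Symbol.V = cov (noiseKernel K ρ γ ε) 0 0 := by
  have h1 : pairings 2 = {Equiv.swap 0 1} := by decide +kernel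
  have hL : IsPairList (Equiv.swap (0 : Fin 2) 1) [(0, 1)] := by
    intro f
    rw [prod_pairs_eq, Fin.prod_univ_two]
    simp
  have h2 : renormConst K ρ γ ε Symbol.V = contraction (Equiv.swap (0 : Fin 2) 1) (symbolKernel K ρ γ ε Symbol.V 0) := by
    change ∑ σ ∈ pairings 2, _ = _
    rw [h1]
    exact Finset.sum_singleton _ _
  rw [h2]
  refine (contraction_eq_diag (l := .Xi) (r := .Xi) hD hD' hN hc hp hε (n := 0) (fun k => k.elim0) (by decide) (fun k => k.elim0) (fun _ => 0)
    (fun w => by simp [pairKer, treeKer]) (fun w => ?_) (by change _ ∈ pairings 2; rw [h1]; exact Finset.mem_singleton_self _) hL).trans ?_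
  · change ∀ i : Fin 2, _
    intro i
    fin_cases i <;> rfl
  · change ∫ _ : Fin 0 → ℝ × ℝ, 1 * (cov _ 0 0 * 1) = _
    rw [integral_const, volume_pi, Measure.pi_of_empty]
    simp

end

end FracKPZ

/-! ### The theorem -/

open FracKPZ in
theorem mainTheorem7 (K ρ : ℝ × ℝ → ℝ) (C r : ℝ) (hC : 0 < C) (hC' : C ≤ 1 / 16) (hr : 2 < r)
    (hK : IsTruncatedHeatKernel K C r) (hρ : IsMollifier ρ)
    (γ : ℝ) (hγ : 0 ≤ γ) (hγ' : γ < 1 / 4) :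
    ((∃ c : ℝ, 0 < c ∧ ∀ ε : ℝ, 0 < ε → ε ≤ 1 →
        renormConst K ρ γ ε Symbol.V ≤ c * ε ^ (-1 - 2 * γ)) ∧
      (∃ c : ℝ, 0 < c ∧ ∃ ε₀ : ℝ, 0 < ε₀ ∧ ∀ ε : ℝ, 0 < ε → ε ≤ ε₀ →
        c * ε ^ (-1 - 2 * γ) ≤ renormConst K ρ γ ε Symbol.V)) ∧
    (0 < γ → ∃ c : ℝ, 0 < c ∧ ∀ ε : ℝ, 0 < ε → ε ≤ 1 →
      |renormConst K ρ γ ε Symbol.B| ≤ c * ε ^ (-4 * γ) ∧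
      |renormConst K ρ γ ε Symbol.WV| ≤ c * ε ^ (-4 * γ)) ∧
    (1 / 6 ≤ γ → ∀ κ : ℝ, 0 < κ → ∃ c : ℝ, 0 < c ∧ ∀ τ ∈ sixNoise, ∀ ε : ℝ, 0 < ε → ε ≤ 1 →
      |renormConst K ρ γ ε τ| ≤ c * ε ^ (1 - 6 * γ - κ)) := by
  obtain ⟨c, T, hc, -, hN⟩ := exists_isNoiseKernel hK hC hρ hγ (by linarith)
  obtain ⟨A, hA, hcov⟩ := exists_isCovariance (p := 2 + γ) hc.le (by linarith) (by linarith)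
  obtain ⟨c₀, -, hD⟩ := hK.exists_isEdgeKernel hC
  have hD' := hK.integrable_spaceDeriv hC
  have hG : ∀ ε : ℝ, 0 < ε → ε ≤ 1 → IsCovariance (noiseKernel K ρ γ ε) A (1 + 2 * γ) ε := fun ε hε hε1 => by
    have := hcov _ _ ε hε (hN ε hε hε1)
    rwa [show 2 * (2 + γ) - 3 = 1 + 2 * γ by ring] at this
  have hV : ∀ ε : ℝ, 0 < ε → ε ≤ 1 → renormConst K ρ γ ε Symbol.V = cov (noiseKernel K ρ γ ε) 0 0 := fun ε hε hε1 =>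
    renormConst_V hK.measurable_spaceDeriv hD' (hN ε hε hε1) hc.le (by linarith) hε
  refine ⟨⟨⟨A, hA, fun ε hε hε1 => ?_⟩, ?_⟩, fun hγ0 => ?_, fun hγ6 κ hκ => ?_⟩
  -- The upper bound on `C_V` is the size of the covariance at coinciding points, where only the
  -- regularisation remains.
  · have h := (hG ε hε hε1).size 0 0 (by norm_num)
    have e : pker ε (1 + 2 * γ) (0 - 0) = ENNReal.ofReal (ε ^ (-1 - 2 * γ)) := by
      rw [pker, sub_self, parNorm_zero, zero_add, ENNReal.ofReal_rpow_of_pos hε, show -(1 + 2 * γ) = -1 - 2 * γ by ring]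
    rw [e, ← ENNReal.ofReal_mul hA.le, ← ofReal_norm, ENNReal.ofReal_le_ofReal_iff (by positivity)] at h
    rw [hV ε hε hε1]
    exact (le_abs_self _).trans h
  · obtain ⟨b, ε₀, hb, hε₀, H⟩ := exists_le_cov (T := T) hK hC hρ hγ (by linarith) hc.le
    refine ⟨b, hb, min ε₀ 1, by positivity, fun ε hε hε' => ?_⟩
    have hε1 := hε'.trans (min_le_right _ _)
    rw [hV ε hε hε1]
    exact H ε hε (hε'.trans (min_le_left _ _)) (hN ε hε hε1)
  · obtain ⟨b₁, hb₁, H₁⟩ := exists_renormConst_B_le (ρ := ρ) (T := T) (A := A) hD hD' hC.le hC' hc.le hγ0 hγ'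
    obtain ⟨b₂, hb₂, H₂⟩ := exists_renormConst_WV_le (ρ := ρ) (T := T) (A := A) hD hD' hC.le hC' hc.le hγ0 hγ'
    refine ⟨b₁ + b₂, by positivity, fun ε hε hε1 => ⟨?_, ?_⟩⟩
    · refine (H₁ ε hε (hN ε hε hε1) (hG ε hε hε1)).trans ?_
      exact mul_le_mul_of_nonneg_right (by linarith) (by positivity)
    · refine (H₂ ε hε (hN ε hε hε1) (hG ε hε hε1)).trans ?_
      exact mul_le_mul_of_nonneg_right (by linarith) (by positivity)
  -- Each of the three covariances of a diagram costs one power of the auxiliary exponent, hence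
  -- `κ/3`; the cap `1/48` is what the power counting tolerates.
  · have hS : Setting K C c c₀ γ (min (κ / 3) (1 / 48)) :=
      { edge := hD, integrable := hD', C_nonneg := hC.le, C_le := hC', c_nonneg := hc.le, le_γ := hγ6,
        κ_pos := by positivity, κ_le := min_le_right _ _ }
    have hfin : sixNoise.Finite := by simp [sixNoise]
    choose! b hb H using fun τ (hτ : τ ∈ sixNoise) => bound_of_mem_sixNoise (ρ := ρ) (T := T) (A := A) hS hτ
    obtain ⟨B, hB⟩ := (hfin.image b).bddAbove
    refine ⟨max B 1, by positivity, fun τ hτ ε hε hε1 => ?_⟩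
    refine (H τ hτ ε hε (hN ε hε hε1) (hG ε hε hε1)).trans ?_
    refine mul_le_mul ((hB (Set.mem_image_of_mem b hτ)).trans (le_max_left _ _))
      (Real.rpow_le_rpow_of_exponent_ge hε hε1 ?_) (by positivity) (by positivity)
    linarith [min_le_left (κ / 3) (1 / 48)]
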